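/- Fix a chemical potential $\mu>0$. For $\Omega=\mathbb{R}$ or $\Omega=\mathbb{R}_+=(0,\infty)$, a temperature $T>0$ and a coupling constant $v>0$, consider in $L^2_{\mathrm{symm}}(\Omega^2)=\{\psi\in L^2(\Omega^2)\mid \psi(x,y)=\psi(y,x)\}$ the operator $$H_T^\Omega=\frac{-\Delta_x-\Delta_y-2\mu}{\tanh\left(\frac{-\Delta_x-\mu}{2T}\right)+\tanh\left(\frac{-\Delta_y-\mu}{2T}\right)}-v\,\delta(x-y),$$ where $\Delta$ is the Dirichlet Laplacian on $\Omega$ and the first term is defined through functional calculus; $H_T^\Omega$ is the self-adjoint operator associated with the quadratic form of the first term minus $v\int_\Omega|\psi(x,x)|^2\,dx$, where $\psi(x,x)$ denotes the trace of $\psi$ on the diagonal and the domain is the form domain of the first term. Define the critical temperature $$T_c^\Omega(v):=\inf\{T\in(0,\infty)\mid \inf\sigma(H_T^\Omega)\ge 0\}.$$ For all $v>0$, the set on the right-hand side is non-empty for both $\Omega=\mathbb{R}$ and $\Omega=\mathbb{R}_+$, and $T_c^{\mathbb{R}}(v)>0$. Moreover: (i) There is a $\tilde v>0$ such that $T_c^{\mathbb{R}_+}(v)>T_c^{\mathbb{R}}(v)$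 for all $0<v<\tilde v$. (ii) In the weak coupling limit, $$\lim_{v\to 0^+}\frac{T_c^{\mathbb{R}_+}(v)-T_c^{\mathbb{R}}(v)}{T_c^{\mathbb{R}}(v)}=0.$$ (iii) In the strong coupling limit, $$\lim_{v\to\infty}\frac{T_c^{\mathbb{R}_+}(v)-T_c^{\mathbb{R}}(v)}{T_c^{\mathbb{R}}(v)}=0.$$ -/

import Mathlib

open MeasureTheory Filter Topology FourierTransform ComplexConjugate

noncomputable section

namespace BCS

/-- The two samples: the line `ℝ` and the half-line `ℝ₊ = (0, ∞)`. -/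
inductive Sample
  | line
  | halfLine

/-- The subset `Ω` of `ℝ` occupied by the sample. -/
def Sample.toSet : Sample → Set ℝ
  | .line => Set.univ
  | .halfLine => Set.Ioi 0

/-- The two-particle configuration (or momentum) space `ℝ²`, with points `(x, y) = (z 0, z 1)`. -/
abbrev Plane : Type := EuclideanSpace ℝ (Fin 2)

/-- `L²(ℝ²; ℂ)`. -/
abbrev L2Plane : Type := Lp ℂ 2 (volume : Measure Plane)

/-- The set `Ω²` in `ℝ²`. -/
def Sample.square (Ω : Sample) : Set Plane := {z | z 0 ∈ Ω.toSet ∧ z 1 ∈ Ω.toSet}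

/-- The exchange of the two particles, `(x, y) ↦ (y, x)`. -/
def swap : Plane ≃ₗᵢ[ℝ] Plane :=
  LinearIsometryEquiv.piLpCongrLeft 2 ℝ ℝ (Equiv.swap (0 : Fin 2) 1)

/-- The reflection that changes the sign of the `i`-th coordinate. -/
def reflect (i : Fin 2) : Plane ≃ₗᵢ[ℝ] Plane :=
  LinearIsometryEquiv.piLpCongrRight 2
    (fun j => if j = i then LinearIsometryEquiv.neg ℝ else LinearIsometryEquiv.refl ℝ ℝ)

/-- Composition `ψ ↦ ψ ∘ e` of a square-integrable function with a linear isometry of the plane. -/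
def comp (e : Plane ≃ₗᵢ[ℝ] Plane) : L2Plane →ₗ[ℂ] L2Plane :=
  (Lp.compMeasurePreservingₗᵢ ℂ (⇑e) e.measurePreserving).toLinearMap

/-- The Hilbert space `L²_symm(Ω²)`: square-integrable `ψ` with `ψ(x,y) = ψ(y,x)`. A function on
`Ω²` is identified with its extension by zero to `ℝ²`. -/
def Sample.pairSpace (Ω : Sample) : Submodule ℂ L2Plane where
  carrier := {ψ | (∀ᵐ z : Plane, z ∉ Ω.square → ψ z = 0) ∧ comp swap ψ = ψ}
  zero_mem' := by
    refine ⟨?_, map_zero _⟩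
    filter_upwards [Lp.coeFn_zero ℂ 2 (volume : Measure Plane)] with z hz _
    rw [hz, Pi.zero_apply]
  add_mem' := by
    rintro a b ⟨ha, ha'⟩ ⟨hb, hb'⟩
    refine ⟨?_, by rw [map_add, ha', hb']⟩
    filter_upwards [ha, hb, Lp.coeFn_add a b] with z h1 h2 h3 hz
    rw [h3, Pi.add_apply, h1 hz, h2 hz, add_zero]
  smul_mem' := by
    rintro c a ⟨ha, ha'⟩
    refine ⟨?_, by rw [map_smul, ha']⟩
    filter_upwards [ha, Lp.coeFn_smul c a] with z h1 h3 hz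
    rw [h3, Pi.smul_apply, h1 hz, smul_zero]

/-- The extension of a function on `(0,∞)²` to `ℝ²` that is odd in each of the two variables. -/
def oddExtension : L2Plane →ₗ[ℂ] L2Plane :=
  LinearMap.id - comp (reflect 0) - comp (reflect 1) + comp (reflect 0) ∘ₗ comp (reflect 1)

/-- The unitary transform that diagonalizes the two commuting Dirichlet Laplacians `Δ_x`, `Δ_y` on
`L²(Ω²)` simultaneously: with `p = 2π ξ 0` and `q = 2π ξ 1`, the operators `-Δ_x` and `-Δ_y` become
multiplication by `p²` and `q²`. On the line it is the Fourier transform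
`∫ e^{-i(px+qy)} ψ(x,y) dx dy`. On the half-line it is the sine transform
`-2 ∫∫ sin(px) sin(qy) ψ(x,y) dx dy`, that is, half the Fourier transform of the extension of `ψ`
that is odd in both variables. -/
def Sample.spectralTransform : Sample → (L2Plane →ₗ[ℂ] L2Plane)
  | .line => (Lp.fourierTransformₗᵢ Plane ℂ).toLinearEquiv.toLinearMap
  | .halfLine =>
      (1 / 2 : ℂ) • ((Lp.fourierTransformₗᵢ Plane ℂ).toLinearEquiv.toLinearMap ∘ₗ oddExtension)

/-- The kinetic symbol `(p² + q² - 2μ) / (tanh((p²-μ)/2T) + tanh((q²-μ)/2T))`. It is positive; on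
the null set `p² + q² = 2μ`, where the formula reads `0 / 0`, its value plays no role. -/
def kineticSymbol (T μ p q : ℝ) : ℝ :=
  (p ^ 2 + q ^ 2 - 2 * μ) /
    (Real.tanh ((p ^ 2 - μ) / (2 * T)) + Real.tanh ((q ^ 2 - μ) / (2 * T)))

/-- The kinetic symbol as a function of the spectral variable `ξ`, where `(p, q) = 2π ξ`. -/
def kineticMultiplier (T μ : ℝ) (ξ : Plane) : ℝ :=
  kineticSymbol T μ (2 * Real.pi * ξ 0) (2 * Real.pi * ξ 1)

/-- The form domain of the kinetic operator (the first term of `H_T^Ω`, given by functional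
calculus). -/
def Sample.IsInFormDomain (Ω : Sample) (T μ : ℝ) (ψ : Ω.pairSpace) : Prop :=
  Integrable (fun ξ : Plane =>
    kineticMultiplier T μ ξ * ‖(Ω.spectralTransform (ψ : L2Plane) : Plane → ℂ) ξ‖ ^ 2)

/-- The sesquilinear form of the kinetic operator, antilinear in the first argument. -/
def Sample.kineticForm (Ω : Sample) (T μ : ℝ) (φ ψ : Ω.pairSpace) : ℂ :=
  ∫ ξ : Plane, (kineticMultiplier T μ ξ : ℂ) *
    (conj ((Ω.spectralTransform (φ : L2Plane) : Plane → ℂ) ξ) *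
      (Ω.spectralTransform (ψ : L2Plane) : Plane → ℂ) ξ)

/-- `g ∈ L²(Ω)` is the trace of `ψ` on the diagonal of `Ω²`, `g(x) = ψ(x,x)`: the mean of
`|ψ(x,y) - g(x)|²` over the strip `|x - y| < ε`, taken across the strip, tends to zero. -/
def Sample.IsDiagonalTrace (Ω : Sample) (ψ : Ω.pairSpace) (g : ℝ → ℂ) : Prop :=
  MemLp g 2 (volume.restrict Ω.toSet) ∧
    Tendsto (fun ε : ℝ => (1 / (2 * ε)) *
        ∫ z in {z : Plane | z ∈ Ω.square ∧ |z 0 - z 1| < ε},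
          ‖((ψ : L2Plane) : Plane → ℂ) z - g (z 0)‖ ^ 2)
      (𝓝[>] 0) (𝓝 0)

/-- The graph of `H_T^Ω`, the self-adjoint operator in `L²_symm(Ω²)` associated with the quadratic
form "kinetic form minus `v ∫_Ω |ψ(x,x)|² dx`": `ψ` is in the domain of `H_T^Ω` with
`H_T^Ω ψ = η`. -/
def Sample.IsHamiltonian (Ω : Sample) (T μ v : ℝ) (ψ η : Ω.pairSpace) : Prop :=
  Ω.IsInFormDomain T μ ψ ∧ ∃ g : ℝ → ℂ, Ω.IsDiagonalTrace ψ g ∧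
    ∀ φ : Ω.pairSpace, Ω.IsInFormDomain T μ φ →
      ∃ f : ℝ → ℂ, Ω.IsDiagonalTrace φ f ∧
        Ω.kineticForm T μ φ ψ - v * ∫ x in Ω.toSet, conj (f x) * g x = inner ℂ φ η

/-- The spectrum of `H_T^Ω`: the `z ∈ ℂ` for which `H_T^Ω - z` has no bounded inverse `R` on
`L²_symm(Ω²)`. -/
def Sample.spectrum (Ω : Sample) (T μ v : ℝ) : Set ℂ :=
  {z | ¬ ∃ R : Ω.pairSpace →L[ℂ] Ω.pairSpace,
    ∀ ψ χ : Ω.pairSpace, Ω.IsHamiltonian T μ v ψ (χ + z • ψ) ↔ ψ = R χ}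

/-- `inf σ(H_T^Ω)`, as an extended real number. -/
def Sample.infSpectrum (Ω : Sample) (T μ v : ℝ) : EReal :=
  sInf ((fun l : ℝ => (l : EReal)) '' {l : ℝ | (l : ℂ) ∈ Ω.spectrum T μ v})

/-- The temperatures `T ∈ (0, ∞)` with `inf σ(H_T^Ω) ≥ 0`. -/
def Sample.normalTemperatures (Ω : Sample) (μ v : ℝ) : Set ℝ :=
  {T | 0 < T ∧ 0 ≤ Ω.infSpectrum T μ v}

/-- The critical temperature `T_c^Ω(v)`. -/
def Sample.criticalTemperature (Ω : Sample) (μ v : ℝ) : ℝ :=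
  sInf (Ω.normalTemperatures μ v)

end BCS

end

open scoped ENNReal

noncomputable section

namespace BCS

/-! ### Quadratic forms in bounded coordinates and the negative spectrum of their operators. -/

section FormOperator

variable {H : Type*} [NormedAddCommGroup H] [InnerProductSpace ℂ H]

/-! Pass to momentum variables and use the square root of the kinetic symbol as a coordinate: with
`ψ̂ = pairAmp · θ` the form of the Hamiltonian becomes `‖θ‖²` minus the coupling times the squared
norm of the diagonal trace. The trace integrates `pairAmp · θ` over the lines `p + q = η`. It is
infinitesimally bounded (`exists_norm_diagTrace_sq_le`), so a temperature is normal exactly when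
this form is nonnegative (`forall_resolvent_iff_form_nonneg`). Dualizing, as in the Birman-Schwinger
principle, leaves an inequality for functions `g(η)` of the total momentum alone.

On the line the dual operator is multiplication by the row mass `∫ kern p (η - p) dp`. This is
largest at `η = 0`, with value `gapInt`; hence `T` is normal iff `v · gapInt ≤ 4π²`, and the
critical temperature solves this as an equation (`gap_equation`). On the half-line, projecting onto
functions odd in both variables couples `η = p + q` with `η' = p - q`. For even `g` the result is
the Dirichlet form `J(g) = ½ ∬ C(η, η') |g(η) - g(η')|²` with `C = jumpKernel`, whose rows have mass
at most `gapInt`. The theorem is thus a comparison of the supremum of `J(g) / ‖g‖²` over even `g`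
with `gapInt`.

Lower bounds come from trial functions. Indicators of `[-r, r]` with `r → 0` give a quotient tending
to `gapInt`, so the half-line temperature is never smaller. Adding a small negative bump near
`±2√ν`, where `C(0, ·)` has size `1/τ`, gains a term of the same order in `r` as the loss; the gain
wins once `τ · gapInt` is small, which is low temperature. This is (i)
(`exists_even_gapInt_lt_jumpForm`).

For (ii) and (iii) it suffices that, for every `s > 1`, `J` at temperature `sτ` is at most `gapInt`
at temperature `τ`, for `τ` small, respectively large. At low temperature `gapInt` drops by a fixed
amount from `τ` to `sτ`, the rows with `|η| ≥ δ` have a logarithmically divergent deficit, and their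
coupling to small `|η|` is a kernel of Hilbert type, so a weighted Schur test closes
(`exists_jumpForm_le_of_temperature_le`). At high temperature the chemical potential is negligible.
At `ν = 0` the kernel is dominated by a mixture of product kernels, for which the Dirichlet form
costs only one row mass instead of the generic two (`jumpForm_zero_le`). -/

/-- The graph of the operator attached to the form `‖θ‖² - ⟪N θ, θ⟫` in the coordinates
`ψ = S θ`. -/
def FormRel (S N : H →L[ℂ] H) (ψ η : H) : Prop :=
  ∃ θ : H, ψ = S θ ∧ θ - N θ = S η

/-- The shifted quadratic form `‖θ‖² - ⟪N θ, θ⟫ + s ‖S θ‖²`. -/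
def shiftedForm (S N : H →L[ℂ] H) (s : ℝ) (θ : H) : ℝ :=
  ‖θ‖ ^ 2 - (inner ℂ (N θ) θ).re + s * ‖S θ‖ ^ 2

/-- The bounded operator of the shifted form. -/
def shiftedOp (S N : H →L[ℂ] H) (s : ℝ) : H →L[ℂ] H :=
  ContinuousLinearMap.id ℂ H - N + (s : ℂ) • (S ∘L S)

variable {S N : H →L[ℂ] H}

lemma re_inner_shiftedOp (hS : ∀ x y, inner ℂ (S x) y = inner ℂ x (S y)) (s : ℝ) (θ : H) :
    (inner ℂ (shiftedOp S N s θ) θ).re = shiftedForm S N s θ := by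
  have h1 : inner ℂ (S (S θ)) θ = ((‖S θ‖ ^ 2 : ℝ) : ℂ) := by
    rw [hS, inner_self_eq_norm_sq_to_K]; push_cast; rfl
  have h2 : inner ℂ θ θ = ((‖θ‖ ^ 2 : ℝ) : ℂ) := by
    rw [inner_self_eq_norm_sq_to_K]; push_cast; rfl
  simp only [shiftedOp, shiftedForm, add_apply, sub_apply,
    smul_apply, ContinuousLinearMap.comp_apply, ContinuousLinearMap.id_apply,
    inner_add_left, inner_sub_left, inner_smul_left, h1, h2, Complex.add_re, Complex.sub_re,
    Complex.conj_ofReal, ← Complex.ofReal_mul, Complex.ofReal_re]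

lemma shiftedOp_symm (hS : ∀ x y, inner ℂ (S x) y = inner ℂ x (S y))
    (hN : ∀ x y, inner ℂ (N x) y = inner ℂ x (N y)) (s : ℝ) (x y : H) :
    inner ℂ (shiftedOp S N s x) y = inner ℂ x (shiftedOp S N s y) := by
  simp only [shiftedOp, add_apply, sub_apply,
    smul_apply, ContinuousLinearMap.comp_apply, ContinuousLinearMap.id_apply,
    inner_add_left, inner_sub_left, inner_smul_left, inner_add_right, inner_sub_right,
    inner_smul_right, hS, hN, Complex.conj_ofReal]

/-- This converts the resolvent equation of an unbounded operator into an equation for the bounded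
symmetric operator `1 - N - l S²`, to which Lax-Milgram applies. -/
lemma formRel_shift_iff (l : ℝ) (ψ χ : H) :
    FormRel S N ψ (χ + (l : ℂ) • ψ) ↔ ∃ θ, ψ = S θ ∧ shiftedOp S N (-l) θ = S χ := by
  refine exists_congr fun θ => and_congr_right fun h => ?_
  subst h
  simp only [shiftedOp, add_apply, sub_apply,
    smul_apply, ContinuousLinearMap.comp_apply, ContinuousLinearMap.id_apply,
    map_add, map_smul]
  push_cast
  rw [neg_smul, ← sub_eq_add_neg, sub_eq_iff_eq_add, sub_eq_iff_eq_add, sub_eq_iff_eq_add]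

/-- If the form is nonnegative, then every negative number is in the resolvent set. -/
lemma exists_resolvent_of_form_nonneg [CompleteSpace H]
    (hS : ∀ x y, inner ℂ (S x) y = inner ℂ x (S y)) {C : ℝ} (hC : 0 ≤ C)
    (hb : ∀ θ, (inner ℂ (N θ) θ).re ≤ 1 / 2 * ‖θ‖ ^ 2 + C * ‖S θ‖ ^ 2)
    (h : ∀ θ, (inner ℂ (N θ) θ).re ≤ ‖θ‖ ^ 2) {l : ℝ} (hl : l < 0) :
    ∃ R : H →L[ℂ] H, ∀ ψ χ, FormRel S N ψ (χ + (l : ℂ) • ψ) ↔ ψ = R χ := by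
  -- Coercivity comes from averaging the bound `hb` with weight `t` and nonnegativity with weight `1
  -- - t`; this `t` makes `t C ≤ -l`, so the shift absorbs the error term `C ‖S θ‖²`.
  set t : ℝ := -l / (C - l) with ht
  have hCl : 0 < C - l := by linarith
  have ht0 : 0 < t := div_pos (by linarith) hCl
  have ht1 : t ≤ 1 := (div_le_one hCl).2 (by linarith)
  have htC : t * C ≤ -l := by
    rw [ht, div_mul_eq_mul_div, div_le_iff₀ hCl]; nlinarith
  have hform : ∀ θ, ‖θ‖ ^ 2 * (t / 2) ≤ shiftedForm S N (-l) θ := by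
    intro θ
    have h1 := mul_le_mul_of_nonneg_left (hb θ) ht0.le
    have h2 := mul_le_mul_of_nonneg_left (h θ) (sub_nonneg.2 ht1)
    have h3 := mul_le_mul_of_nonneg_right htC (sq_nonneg ‖S θ‖)
    unfold shiftedForm
    nlinarith
  have hunit : IsUnit (shiftedOp S N (-l)) := by
    refine ContinuousLinearMap.isUnit_of_forall_le_norm_inner_map _
      (c := ⟨t / 2, by positivity⟩) (by exact_mod_cast half_pos ht0) fun x => ?_
    refine (hform x).trans ?_
    rw [← re_inner_shiftedOp hS]
    exact Complex.re_le_norm _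
  obtain ⟨X, hX⟩ := hunit
  refine ⟨S ∘L ((X⁻¹ : (H →L[ℂ] H)ˣ) : H →L[ℂ] H) ∘L S, fun ψ χ => ?_⟩
  rw [formRel_shift_iff, ← hX]
  have e1 : ∀ x, (X : H →L[ℂ] H) (((X⁻¹ : (H →L[ℂ] H)ˣ) : H →L[ℂ] H) x) = x := fun x => by
    rw [← mul_apply_eq_comp, X.mul_inv]; rfl
  have e2 : ∀ x, ((X⁻¹ : (H →L[ℂ] H)ˣ) : H →L[ℂ] H) ((X : H →L[ℂ] H) x) = x := fun x => by
    rw [← mul_apply_eq_comp, X.inv_mul]; rfl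
  constructor
  · rintro ⟨θ, rfl, hθ⟩
    simp only [ContinuousLinearMap.comp_apply, ← hθ, e2]
  · rintro rfl
    exact ⟨_, rfl, e1 _⟩

/-- If the form is nonnegative and its resolvent at `-s` exists, then the form is coercive. -/
lemma form_coercive_of_resolvent
    (hS : ∀ x y, inner ℂ (S x) y = inner ℂ x (S y))
    (hN : ∀ x y, inner ℂ (N x) y = inner ℂ x (N y)) {C : ℝ} (hC : 0 ≤ C)
    (hb : ∀ θ, (inner ℂ (N θ) θ).re ≤ 1 / 2 * ‖θ‖ ^ 2 + C * ‖S θ‖ ^ 2)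
    {s : ℝ} (hs : 0 ≤ s) (hpos : ∀ θ, 0 ≤ shiftedForm S N s θ)
    {R : H →L[ℂ] H} (hR : ∀ ψ χ, FormRel S N ψ (χ + ((-s : ℝ) : ℂ) • ψ) ↔ ψ = R χ) :
    ∃ ε : ℝ, 0 < ε ∧ ∀ θ, ε * ‖θ‖ ^ 2 ≤ shiftedForm S N s θ := by
  -- Cauchy-Schwarz for the nonnegative shifted form: pair `θ` with the solution `θ'` of the
  -- resolvent equation with right side `S θ`. The mixed term is exactly `‖S θ‖²`, and the form at
  -- `θ'` is at most `‖R‖ ‖S θ‖²`.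
  have key : ∀ θ, ‖S θ‖ ^ 2 ≤ (‖R‖ + 1) * shiftedForm S N s θ := by
    intro θ
    obtain ⟨θ', h1, h2⟩ := (formRel_shift_iff (-s) _ (S θ)).1 ((hR (R (S θ)) (S θ)).2 rfl)
    rw [neg_neg] at h2
    set t : ℝ := 1 / (‖R‖ + 1) with ht
    have hRp : 0 < ‖R‖ + 1 := by positivity
    have ht0 : 0 < t := by positivity
    have h3 : shiftedForm S N s θ' ≤ ‖R‖ * ‖S θ‖ ^ 2 := by
      rw [← re_inner_shiftedOp hS, h2, hS, ← h1]
      calc _ ≤ ‖inner ℂ (S θ) (R (S θ))‖ := Complex.re_le_norm _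
        _ ≤ ‖S θ‖ * ‖R (S θ)‖ := norm_inner_le_norm _ _
        _ ≤ ‖S θ‖ * (‖R‖ * ‖S θ‖) := by gcongr; exact R.le_opNorm _
        _ = _ := by ring
    have h4 : inner ℂ θ (shiftedOp S N s θ') = ((‖S θ‖ ^ 2 : ℝ) : ℂ) := by
      rw [h2, ← hS, inner_self_eq_norm_sq_to_K]; push_cast; rfl
    have h5 : inner ℂ (shiftedOp S N s θ') θ = ((‖S θ‖ ^ 2 : ℝ) : ℂ) := by
      rw [← inner_conj_symm, h4, Complex.conj_ofReal]
    have h6 := hpos (θ - (t : ℂ) • θ')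
    rw [← re_inner_shiftedOp hS] at h6
    have h7 : (inner ℂ (shiftedOp S N s (θ - (t : ℂ) • θ')) (θ - (t : ℂ) • θ')).re
        = shiftedForm S N s θ - 2 * t * ‖S θ‖ ^ 2 + t ^ 2 * shiftedForm S N s θ' := by
      rw [← re_inner_shiftedOp hS, ← re_inner_shiftedOp hS]
      simp only [map_sub, map_smul, inner_sub_left, inner_sub_right, inner_smul_left,
        inner_smul_right, Complex.conj_ofReal, h5]
      rw [shiftedOp_symm hS hN s θ θ', h4]
      simp only [Complex.sub_re, Complex.re_ofReal_mul, Complex.ofReal_re]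
      ring
    rw [h7] at h6
    have h8 : t * ‖R‖ ≤ 1 := by
      rw [ht, one_div, inv_mul_le_iff₀ hRp]; linarith
    have h9 : t * (‖R‖ + 1) = 1 := by rw [ht]; field_simp
    have h10 : t ^ 2 * shiftedForm S N s θ' ≤ t * ‖S θ‖ ^ 2 := by
      calc _ ≤ t ^ 2 * (‖R‖ * ‖S θ‖ ^ 2) := by gcongr
        _ = t * (t * ‖R‖) * ‖S θ‖ ^ 2 := by ring
        _ ≤ t * 1 * ‖S θ‖ ^ 2 := by gcongr
        _ = _ := by ring
    have h11 : t * ‖S θ‖ ^ 2 ≤ shiftedForm S N s θ := by linarith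
    calc ‖S θ‖ ^ 2 = (‖R‖ + 1) * (t * ‖S θ‖ ^ 2) := by
          rw [← mul_assoc, mul_comm _ t, h9, one_mul]
      _ ≤ _ := by gcongr
  refine ⟨1 / (2 * (1 + C * (‖R‖ + 1))), by positivity, fun θ => ?_⟩
  rw [one_div, inv_mul_le_iff₀ (by positivity)]
  have h1 : 1 / 2 * ‖θ‖ ^ 2 ≤ shiftedForm S N s θ + C * ‖S θ‖ ^ 2 := by
    have := hb θ
    have h2 : 0 ≤ s * ‖S θ‖ ^ 2 := by positivity
    unfold shiftedForm; linarith
  have h2 := mul_le_mul_of_nonneg_left (key θ) hC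
  nlinarith

/-- A form that is infinitesimally bounded with respect to `‖·‖²` is nonnegative if and only if
the operator attached to it has no negative spectrum. -/
theorem forall_resolvent_iff_form_nonneg [CompleteSpace H]
    (hS : ∀ x y, inner ℂ (S x) y = inner ℂ x (S y))
    (hN : ∀ x y, inner ℂ (N x) y = inner ℂ x (N y)) {C : ℝ} (hC : 0 ≤ C)
    (hb : ∀ θ, (inner ℂ (N θ) θ).re ≤ 1 / 2 * ‖θ‖ ^ 2 + C * ‖S θ‖ ^ 2) :
    (∀ l : ℝ, l < 0 → ∃ R : H →L[ℂ] H, ∀ ψ χ, FormRel S N ψ (χ + (l : ℂ) • ψ) ↔ ψ = R χ) ↔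
      ∀ θ, (inner ℂ (N θ) θ).re ≤ ‖θ‖ ^ 2 := by
  refine ⟨fun hres => ?_, fun h l hl => exists_resolvent_of_form_nonneg hS hC hb h hl⟩
  -- The smallest admissible shift is `-inf σ` when the spectrum reaches below zero. If it were
  -- positive, the resolvent there would make the form coercive and a smaller shift would still be
  -- admissible.
  set A : Set ℝ := {s | 0 ≤ s ∧ ∀ θ, 0 ≤ shiftedForm S N s θ} with hA
  have hCA : C ∈ A := ⟨hC, fun θ => by
    have := hb θ
    have h2 : 0 ≤ ‖θ‖ ^ 2 := by positivity
    unfold shiftedForm; linarith⟩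
  have hclosed : IsClosed A := by
    have : A = Set.Ici 0 ∩ ⋂ θ, {s | 0 ≤ shiftedForm S N s θ} := by
      ext s; simp [hA]
    rw [this]
    refine isClosed_Ici.inter (isClosed_iInter fun θ => isClosed_le continuous_const ?_)
    unfold shiftedForm; fun_prop
  have hbdd : BddBelow A := ⟨0, fun s hs => hs.1⟩
  have hmem : sInf A ∈ A := hclosed.csInf_mem ⟨C, hCA⟩ hbdd
  set s := sInf A with hs
  rcases hmem.1.eq_or_lt with h0 | h0
  · intro θ
    have := hmem.2 θ
    rw [← h0] at this
    unfold shiftedForm at this; linarith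
  · exfalso
    obtain ⟨R, hR⟩ := hres (-s) (by linarith)
    obtain ⟨ε, hε, hco⟩ := form_coercive_of_resolvent hS hN hC hb hmem.1 hmem.2 hR
    set d := ε / (‖S‖ ^ 2 + 1) with hd
    have hd0 : 0 < d := by positivity
    have hdS : d * ‖S‖ ^ 2 ≤ ε := by
      rw [hd, div_mul_eq_mul_div, div_le_iff₀ (by positivity)]
      nlinarith
    set s' := max 0 (s - d) with hs'
    have hlt : s' < s := max_lt h0 (by linarith)
    have : s' ∈ A := by
      refine ⟨le_max_left _ _, fun θ => ?_⟩
      have h1 : (s - d) * ‖S θ‖ ^ 2 ≤ s' * ‖S θ‖ ^ 2 := by gcongr; exact le_max_right _ _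
      have h2 : d * ‖S θ‖ ^ 2 ≤ ε * ‖θ‖ ^ 2 := by
        calc d * ‖S θ‖ ^ 2 ≤ d * (‖S‖ * ‖θ‖) ^ 2 := by gcongr; exact S.le_opNorm _
          _ = d * ‖S‖ ^ 2 * ‖θ‖ ^ 2 := by ring
          _ ≤ _ := by gcongr
      have h3 := hco θ
      unfold shiftedForm at h3 ⊢
      linarith
    exact absurd (csInf_le hbdd this) (not_le.2 hlt)

end FormOperator

/-! ### The Fourier transform on L²: isometries, agreement with the integral, Plancherel. -/

section FourierL2

variable {V : Type*} [NormedAddCommGroup V] [InnerProductSpace ℝ V] [FiniteDimensional ℝ V]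
  [MeasurableSpace V] [BorelSpace V]

/-- Composition of a square-integrable function with a linear isometry. -/
def compIso (e : V ≃ₗᵢ[ℝ] V) : Lp ℂ 2 (volume : Measure V) →ₗᵢ[ℂ] Lp ℂ 2 (volume : Measure V) :=
  Lp.compMeasurePreservingₗᵢ ℂ (⇑e) e.measurePreserving

lemma coeFn_compIso (e : V ≃ₗᵢ[ℝ] V) (f : Lp ℂ 2 (volume : Measure V)) :
    compIso e f =ᵐ[volume] f ∘ e :=
  Lp.coeFn_compMeasurePreserving f e.measurePreserving

lemma compIso_toLp (e : V ≃ₗᵢ[ℝ] V) {f : V → ℂ} (hf : MemLp f 2 (volume : Measure V)) :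
    compIso e (hf.toLp f) = (hf.comp_measurePreserving e.measurePreserving).toLp (f ∘ e) :=
  Lp.toLp_compMeasurePreserving hf e.measurePreserving

/-- The Fourier transform on `L²` commutes with linear isometries. -/
theorem fourier_compIso (e : V ≃ₗᵢ[ℝ] V) (f : Lp ℂ 2 (volume : Measure V)) :
    𝓕 (compIso e f) = compIso e (𝓕 f) := by
  apply DenseRange.induction_on
    (p := fun f : Lp ℂ 2 (volume : Measure V) => 𝓕 (compIso e f) = compIso e (𝓕 f))
    (SchwartzMap.denseRange_toLpCLM (p := 2) (F := ℂ) (μ := (volume : Measure V)) ENNReal.ofNat_ne_top) f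
  · exact isClosed_eq ((Lp.fourierTransformₗᵢ V ℂ).continuous.comp (compIso e).continuous)
      ((compIso e).continuous.comp (Lp.fourierTransformₗᵢ V ℂ).continuous)
  intro g
  have h1 : ∀ g : SchwartzMap V ℂ, compIso e (g.toLp 2) =
      (SchwartzMap.compCLMOfContinuousLinearEquiv ℂ e.toContinuousLinearEquiv g).toLp 2 := by
    intro g
    exact compIso_toLp e (g.memLp 2)
  change 𝓕 (compIso e (g.toLp 2)) = compIso e (𝓕 (g.toLp 2))
  rw [h1, SchwartzMap.toLp_fourier_eq, SchwartzMap.toLp_fourier_eq, h1]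
  congr 1
  ext x
  exact Real.fourier_comp_linearIsometry e g x

theorem fourierInv_compIso (e : V ≃ₗᵢ[ℝ] V) (f : Lp ℂ 2 (volume : Measure V)) :
    𝓕⁻ (compIso e f) = compIso e (𝓕⁻ f) := by
  have h : 𝓕 (compIso e (𝓕⁻ f)) = compIso e f := by
    rw [fourier_compIso, FourierTransform.fourier_fourierInv_eq]
  rw [← h]
  exact FourierTransform.fourierInv_fourier_eq _

/-- On `L¹ ∩ L²`, the inverse Fourier transform on `L²` is given by the integral. -/
theorem fourierInv_toLp_ae_eq {h : V → ℂ} (h1 : Integrable h) (h2 : MemLp h 2 volume) :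
    (𝓕⁻ (h2.toLp h) : Lp ℂ 2 (volume : Measure V)) =ᵐ[volume] 𝓕⁻ h := by
  have hcont : Continuous (𝓕⁻ h) := by
    rw [Real.fourierInv_eq_fourier_comp_neg]
    exact VectorFourier.fourierIntegral_continuous Real.continuous_fourierChar
      (by exact continuous_inner) h1.comp_neg
  -- It suffices to compare integrals against test functions. There the inverse transform moves onto
  -- the test function, on one side by its definition for tempered distributions, on the other by
  -- Fubini.
  refine ae_eq_of_integral_contDiff_smul_eq
    ((Lp.memLp _).locallyIntegrable (by norm_num)) hcont.locallyIntegrable fun g hg hgc => ?_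
  set φ : SchwartzMap V ℂ := (hgc.comp_left (g := fun x : ℝ => (x : ℂ)) (by simp)).toSchwartzMap
    (by exact Complex.ofRealCLM.contDiff.comp hg) with hφ
  have hφg : ∀ x, φ x = (g x : ℂ) := fun x => rfl
  have e1 := congrArg (fun T : TemperedDistribution V ℂ => T φ)
    (Lp.fourierInv_toTemperedDistribution_eq (h2.toLp h))
  simp only [Lp.toTemperedDistribution_apply, TemperedDistribution.fourierInv_apply] at e1
  have e2 : ∫ x, (𝓕⁻ φ : SchwartzMap V ℂ) x • (h2.toLp h) x = ∫ x, φ x • 𝓕⁻ h x := by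
    have : ∫ x, (𝓕⁻ φ : SchwartzMap V ℂ) x • (h2.toLp h) x
        = ∫ x, (𝓕⁻ (φ : V → ℂ)) x • h x := by
      refine integral_congr_ae ?_
      filter_upwards [h2.coeFn_toLp] with x hx
      rw [hx, SchwartzMap.fourierInv_coe]
    rw [this]
    have := VectorFourier.integral_fourierIntegral_smul_eq_flip (μ := (volume : Measure V))
      (ν := (volume : Measure V)) (e := Real.fourierChar) (L := -innerₗ V)
      Real.continuous_fourierChar (by
        simp only [LinearMap.neg_apply, innerₗ_apply_apply]; fun_prop) φ.integrable h1
    have ha : ∀ x, VectorFourier.fourierIntegral Real.fourierChar volume (-innerₗ V) (φ : V → ℂ) x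
        = 𝓕⁻ (φ : V → ℂ) x := fun x => by
      simp [VectorFourier.fourierIntegral, Real.fourierInv_eq]
    have hb : ∀ x, VectorFourier.fourierIntegral Real.fourierChar volume (-innerₗ V).flip h x
        = 𝓕⁻ h x := fun x => by
      simp [VectorFourier.fourierIntegral, Real.fourierInv_eq, real_inner_comm]
    simp only [ha, hb] at this
    exact this
  calc ∫ x, g x • (𝓕⁻ (h2.toLp h) : Lp ℂ 2 (volume : Measure V)) x
      = ∫ x, φ x • (𝓕⁻ (h2.toLp h) : Lp ℂ 2 (volume : Measure V)) x := by
        simp only [hφg]; rfl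
    _ = ∫ x, φ x • 𝓕⁻ h x := by rw [← e1, ← e2]
    _ = ∫ x, g x • 𝓕⁻ h x := by simp only [hφg]; rfl

/-- Plancherel's identity on `L¹ ∩ L²`. -/
theorem lintegral_enorm_fourierInv_sq {h : V → ℂ} (h1 : Integrable h) (h2 : MemLp h 2 volume) :
    ∫⁻ x, ‖𝓕⁻ h x‖ₑ ^ 2 = ∫⁻ x, ‖h x‖ₑ ^ 2 := by
  have key : eLpNorm (𝓕⁻ h) 2 volume = eLpNorm h 2 volume := by
    rw [← eLpNorm_congr_ae (fourierInv_toLp_ae_eq h1 h2), ← Lp.enorm_def, 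
      ← eLpNorm_congr_ae h2.coeFn_toLp, ← Lp.enorm_def]
    exact (Lp.fourierTransformₗᵢ V ℂ).symm.enorm_map _
  have h3 : ∀ f : V → ℂ, ∫⁻ x, ‖f x‖ₑ ^ 2 = eLpNorm f 2 volume ^ 2 := fun f => by
    simpa using (eLpNorm_nnreal_pow_eq_lintegral (f := f) (μ := volume) (p := 2) (by simp)).symm
  rw [h3, h3, key]

end FourierL2

/-! ### Scalar inequalities for `(tanh A + tanh B) / (A + B)` and `tanh x / x`. -/

/-- The square of the hyperbolic secant. -/
def sechSq (x : ℝ) : ℝ := (Real.cosh x ^ 2)⁻¹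

lemma sechSq_pos (x : ℝ) : 0 < sechSq x := inv_pos.2 (pow_pos (Real.cosh_pos x) 2)

lemma sechSq_le_sechSq {x y : ℝ} (h : |x| ≤ |y|) : sechSq y ≤ sechSq x := by
  unfold sechSq
  have := Real.cosh_le_cosh.2 h
  have := Real.cosh_pos x
  gcongr

lemma sechSq_le_one (x : ℝ) : sechSq x ≤ 1 :=
  inv_le_one_of_one_le₀ (one_le_pow₀ (Real.one_le_cosh x))

lemma continuous_sechSq : Continuous sechSq :=
  (Real.continuous_cosh.pow 2).inv₀ fun x => (pow_pos (Real.cosh_pos x) 2).ne'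

lemma sechSq_neg (x : ℝ) : sechSq (-x) = sechSq x := by simp [sechSq]

/-- `log cosh` is 1-Lipschitz. All factors `exp (2 ε)` below, in particular the price of changing
the chemical potential, come from here. -/
lemma cosh_le_exp_mul_cosh {x y ε : ℝ} (h : |x - y| ≤ ε) :
    Real.cosh x ≤ Real.exp ε * Real.cosh y := by
  rw [Real.cosh_eq, Real.cosh_eq]
  have h1 : Real.exp x ≤ Real.exp ε * Real.exp y := by
    rw [← Real.exp_add]; exact Real.exp_le_exp.2 (by linarith [le_abs_self (x - y)])
  have h2 : Real.exp (-x) ≤ Real.exp ε * Real.exp (-y) := by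
    rw [← Real.exp_add]; exact Real.exp_le_exp.2 (by linarith [neg_abs_le (x - y)])
  linarith

lemma sechSq_le_exp_mul_sechSq {x y ε : ℝ} (h : |x - y| ≤ ε) :
    sechSq x ≤ Real.exp (2 * ε) * sechSq y := by
  unfold sechSq
  have h1 := cosh_le_exp_mul_cosh (by rwa [abs_sub_comm] at h : |y - x| ≤ ε)
  have hx := Real.cosh_pos x
  have hy := Real.cosh_pos y
  rw [← div_eq_mul_inv, le_div_iff₀ (by positivity), inv_mul_le_iff₀ (by positivity), 
    two_mul, Real.exp_add]
  calc Real.cosh y ^ 2 ≤ (Real.exp ε * Real.cosh x) ^ 2 := by gcongr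
    _ = _ := by ring

lemma hasDerivAt_tanh (x : ℝ) : HasDerivAt Real.tanh (sechSq x) x := by
  have h := (Real.hasDerivAt_sinh x).div (Real.hasDerivAt_cosh x) (Real.cosh_pos x).ne'
  have e : Real.sinh / Real.cosh = Real.tanh := by
    ext y; rw [Real.tanh_eq_sinh_div_cosh]; rfl
  rw [e] at h
  convert! h using 1
  have := Real.cosh_sq x
  unfold sechSq
  rw [inv_eq_one_div]
  congr 1
  nlinarith

/-- The symmetric function `(tanh A + tanh B) / (A + B)`, continued across `A + B = 0`. -/
def pairWeight (A B : ℝ) : ℝ := ∫ t in (0 : ℝ)..1, sechSq (t * A - (1 - t) * B)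

lemma intervalIntegrable_pairWeight (A B a b : ℝ) :
    IntervalIntegrable (fun t : ℝ => sechSq (t * A - (1 - t) * B)) volume a b :=
  Continuous.intervalIntegrable (continuous_sechSq.comp (by fun_prop)) _ _

lemma continuous_pairWeight : Continuous fun z : ℝ × ℝ => pairWeight z.1 z.2 := by
  unfold pairWeight
  apply intervalIntegral.continuous_parametric_intervalIntegral_of_continuous'
  exact continuous_sechSq.comp (by fun_prop)

lemma pairWeight_mono {A B A' B' c : ℝ}
    (h : ∀ t ∈ Set.Icc (0 : ℝ) 1,
      sechSq (t * A - (1 - t) * B) ≤ c * sechSq (t * A' - (1 - t) * B')) :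
    pairWeight A B ≤ c * pairWeight A' B' := by
  unfold pairWeight
  rw [← intervalIntegral.integral_const_mul]
  exact intervalIntegral.integral_mono_on zero_le_one (intervalIntegrable_pairWeight _ _ _ _)
    ((intervalIntegrable_pairWeight _ _ _ _).const_mul _) h

lemma pairWeight_pos (A B : ℝ) : 0 < pairWeight A B :=
  intervalIntegral.intervalIntegral_pos_of_pos (intervalIntegrable_pairWeight _ _ _ _)
    (fun _ => sechSq_pos _) zero_lt_one

lemma pairWeight_zero : pairWeight 0 0 = 1 := by simp [pairWeight, sechSq]

lemma pairWeight_le_one (A B : ℝ) : pairWeight A B ≤ 1 := by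
  have := pairWeight_mono (A := A) (B := B) (A' := 0) (B' := 0) (c := 1) (fun t _ => by
    simpa [sechSq] using sechSq_le_one _)
  simpa [pairWeight_zero] using this

lemma pairWeight_neg_self (A : ℝ) : pairWeight A (-A) = sechSq A := by
  unfold pairWeight
  have : ∀ t : ℝ, t * A - (1 - t) * -A = A := fun t => by ring
  simp only [this, intervalIntegral.integral_const, sub_zero, one_smul]

/-- The path `t ↦ t A - (1 - t) B` runs from `-B` to `A` with speed `A + B`, and `tanh` is odd. The
integral representation removes the `0 / 0` on `A + B = 0` and reduces comparisons of weights to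
pointwise comparisons of `sech²`. -/
lemma add_mul_pairWeight (A B : ℝ) : (A + B) * pairWeight A B = Real.tanh A + Real.tanh B := by
  unfold pairWeight
  rw [← intervalIntegral.integral_const_mul]
  have : ∀ t ∈ Set.uIcc (0 : ℝ) 1, HasDerivAt (fun t : ℝ => Real.tanh (t * A - (1 - t) * B))
      ((A + B) * sechSq (t * A - (1 - t) * B)) t := by
    intro t _
    have h1 : HasDerivAt (fun t : ℝ => t * A - (1 - t) * B) (A + B) t := by
      have := ((hasDerivAt_id t).mul_const A).sub (((hasDerivAt_id t).const_sub 1).mul_const B)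
      convert! this using 1; ring
    have := (hasDerivAt_tanh (t * A - (1 - t) * B)).comp t h1
    convert! this using 1; ring
  rw [intervalIntegral.integral_eq_sub_of_hasDerivAt this
    ((intervalIntegrable_pairWeight _ _ _ _).const_mul _)]
  simp [Real.tanh_neg]

lemma pairWeight_comm (A B : ℝ) : pairWeight A B = pairWeight B A := by
  unfold pairWeight
  have := intervalIntegral.integral_comp_sub_left (a := 0) (b := 1)
    (fun t : ℝ => sechSq (t * A - (1 - t) * B)) 1
  simp only [sub_self, sub_zero] at this
  rw [← this]
  congr 1; ext t
  rw [← sechSq_neg]; congr 1; ring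

lemma pairWeight_le_exp_mul {A B A' B' ε : ℝ} (hA : |A - A'| ≤ ε) (hB : |B - B'| ≤ ε) :
    pairWeight A B ≤ Real.exp (2 * ε) * pairWeight A' B' := by
  refine pairWeight_mono fun t ht => sechSq_le_exp_mul_sechSq ?_
  have e : t * A - (1 - t) * B - (t * A' - (1 - t) * B') = t * (A - A') - (1 - t) * (B - B') := by
    ring
  rw [e]
  calc |t * (A - A') - (1 - t) * (B - B')| ≤ |t * (A - A')| + |(1 - t) * (B - B')| := abs_sub _ _
    _ = t * |A - A'| + (1 - t) * |B - B'| := by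
        rw [abs_mul, abs_mul, abs_of_nonneg ht.1, abs_of_nonneg (sub_nonneg.2 ht.2)]
    _ ≤ t * ε + (1 - t) * ε := by
        have := sub_nonneg.2 ht.2
        have := ht.1
        gcongr
    _ = ε := by ring

lemma pairWeight_le_pairWeight_smul (A B : ℝ) {θ : ℝ} (h0 : 0 ≤ θ) (h1 : θ ≤ 1) :
    pairWeight A B ≤ pairWeight (θ * A) (θ * B) := by
  rw [← one_mul (pairWeight (θ * A) (θ * B))]
  refine pairWeight_mono fun t ht => ?_
  rw [one_mul]
  apply sechSq_le_sechSq
  have e : t * (θ * A) - (1 - t) * (θ * B) = θ * (t * A - (1 - t) * B) := by ring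
  rw [e, abs_mul, abs_of_nonneg h0]
  exact mul_le_of_le_one_left (abs_nonneg _) h1

lemma sechSq_le_pairWeight {A B R : ℝ} (hA : |A| ≤ R) (hB : |B| ≤ R) :
    sechSq R ≤ pairWeight A B := by
  rw [← pairWeight_neg_self, ← one_mul (pairWeight A B)]
  refine pairWeight_mono fun t ht => ?_
  rw [one_mul]
  apply sechSq_le_sechSq
  have e : t * R - (1 - t) * -R = R := by ring
  rw [e, abs_of_nonneg ((abs_nonneg _).trans hA)]
  calc |t * A - (1 - t) * B| ≤ |t * A| + |(1 - t) * B| := abs_sub _ _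
    _ = t * |A| + (1 - t) * |B| := by
        rw [abs_mul, abs_mul, abs_of_nonneg ht.1, abs_of_nonneg (sub_nonneg.2 ht.2)]
    _ ≤ t * R + (1 - t) * R := by
        have := sub_nonneg.2 ht.2
        have := ht.1
        gcongr
    _ = R := by ring

/-- The function `tanh x / x`, continued to `x = 0`. -/
def tanhRatio (x : ℝ) : ℝ := pairWeight x x

lemma continuous_tanhRatio : Continuous tanhRatio := by
  have h : Continuous fun x : ℝ => (x, x) := by fun_prop
  have e : tanhRatio = (fun z : ℝ × ℝ => pairWeight z.1 z.2) ∘ fun x : ℝ => (x, x) := by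
    ext x
    rw [tanhRatio, Function.comp_apply]
  rw [e]
  exact continuous_pairWeight.comp h

lemma tanhRatio_pos (x : ℝ) : 0 < tanhRatio x := pairWeight_pos _ _

lemma tanhRatio_le_one (x : ℝ) : tanhRatio x ≤ 1 := pairWeight_le_one _ _

lemma tanhRatio_zero : tanhRatio 0 = 1 := pairWeight_zero

lemma mul_tanhRatio (x : ℝ) : x * tanhRatio x = Real.tanh x := by
  have := add_mul_pairWeight x x
  unfold tanhRatio; linarith

lemma tanhRatio_le_tanhRatio {x y : ℝ} (h : |x| ≤ |y|) : tanhRatio y ≤ tanhRatio x := by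
  unfold tanhRatio
  rw [← one_mul (pairWeight x x)]
  refine pairWeight_mono fun t ht => ?_
  rw [one_mul]
  apply sechSq_le_sechSq
  have e : ∀ z : ℝ, t * z - (1 - t) * z = (2 * t - 1) * z := fun z => by ring
  rw [e, e, abs_mul, abs_mul]
  gcongr

lemma tanhRatio_neg (x : ℝ) : tanhRatio (-x) = tanhRatio x :=
  le_antisymm (tanhRatio_le_tanhRatio (by simp)) (tanhRatio_le_tanhRatio (by simp))

lemma sechSq_le_tanhRatio (x : ℝ) : sechSq x ≤ tanhRatio x := by
  have := sechSq_le_pairWeight (A := x) (B := x) le_rfl le_rfl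
  rwa [sechSq, Real.cosh_abs, ← sechSq] at this

lemma abs_tanh_le_one (x : ℝ) : |Real.tanh x| ≤ 1 := by
  rw [Real.tanh_eq_sinh_div_cosh, abs_div, abs_of_pos (Real.cosh_pos x),
    div_le_one (Real.cosh_pos x)]
  exact abs_le_of_sq_le_sq (by nlinarith [Real.cosh_sq x]) (Real.cosh_pos x).le

/-- With `f = tanhRatio`, multiplying the claim by `(A + B)²` leaves `(B² - A²)(f A - f B) ≥ 0`,
which holds since `f` decreases in `|x|`. This inequality makes zero total momentum optimal for the
bulk. -/
lemma pairWeight_le_half_add (A B : ℝ) :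
    pairWeight A B ≤ (tanhRatio A + tanhRatio B) / 2 := by
  by_cases h : A + B = 0
  · have hB : B = -A := by linarith
    subst hB
    rw [pairWeight_neg_self, tanhRatio_neg]
    linarith [sechSq_le_tanhRatio A]
  · have h1 := add_mul_pairWeight A B
    rw [← mul_tanhRatio, ← mul_tanhRatio] at h1
    have h2 : 0 ≤ (B ^ 2 - A ^ 2) * (tanhRatio A - tanhRatio B) := by
      rcases le_total |A| |B| with h | h
      · have := tanhRatio_le_tanhRatio h
        have := sq_le_sq.2 h
        exact mul_nonneg (by linarith) (by linarith)
      · have := tanhRatio_le_tanhRatio h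
        have := sq_le_sq.2 h
        exact mul_nonneg_of_nonpos_of_nonpos (by linarith) (by linarith)
    have h3 : 0 < (A + B) ^ 2 := by positivity
    by_contra! hlt
    have h4 : (A + B) ^ 2 * ((tanhRatio A + tanhRatio B) / 2) < (A + B) ^ 2 * pairWeight A B := by
      gcongr
    have h5 : (A + B) ^ 2 * pairWeight A B
        = (A + B) * (A * tanhRatio A + B * tanhRatio B) := by rw [← h1]; ring
    nlinarith

/-- For equal signs this is `|tanh| ≤ 1`. For opposite signs `|t A - (1 - t) B| ≥ t |A|`, so the
weight is at most its value at `(A, 0)`, which times `|A|` is `|tanh A|`; likewise for `B`. -/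
lemma pairWeight_mul_le_two (A B : ℝ) : pairWeight A B * (|A| + |B|) ≤ 2 := by
  rcases le_or_gt 0 (A * B) with h | h
  · have h1 : |A| + |B| = |A + B| := ((abs_add_eq_add_abs_iff A B).2 (by
      rcases mul_nonneg_iff.1 h with h | h <;> tauto)).symm
    rw [h1, ← abs_of_pos (pairWeight_pos A B), ← abs_mul, mul_comm, add_mul_pairWeight]
    calc _ ≤ |Real.tanh A| + |Real.tanh B| := abs_add_le _ _
      _ ≤ 1 + 1 := add_le_add (abs_tanh_le_one _) (abs_tanh_le_one _)
      _ = 2 := by norm_num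
  · have key : ∀ A B : ℝ, A * B < 0 → pairWeight A B * |A| ≤ 1 := by
      intro A B h
      have h1 : pairWeight A B ≤ 1 * pairWeight A 0 := by
        refine pairWeight_mono fun t ht => ?_
        rw [one_mul]
        apply sechSq_le_sechSq
        have h2 : 0 ≤ (t * A) * (-((1 - t) * B)) := by
          have := mul_nonneg ht.1 (sub_nonneg.2 ht.2)
          nlinarith
        have h3 : |t * A + -((1 - t) * B)| = |t * A| + |-((1 - t) * B)| :=
          (abs_add_eq_add_abs_iff _ _).2 (by rcases mul_nonneg_iff.1 h2 with h | h <;> tauto)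
        rw [mul_zero, sub_zero, sub_eq_add_neg, h3]
        linarith [abs_nonneg (-((1 - t) * B))]
      have h4 := add_mul_pairWeight A 0
      calc pairWeight A B * |A| ≤ pairWeight A 0 * |A| := by
            rw [one_mul] at h1; gcongr
        _ = |Real.tanh A| := by
            rw [← abs_of_pos (pairWeight_pos A 0), ← abs_mul, mul_comm]
            simpa using congrArg abs h4
        _ ≤ 1 := abs_tanh_le_one A
    have h1 := key A B h
    have h2 := key B A (by linarith)
    rw [pairWeight_comm] at h2
    linarith

/-- The dependence of the pair weight on `A - B`. -/
lemma pairWeight_mul_cosh (m δ : ℝ) :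
    pairWeight (m + δ) (m - δ) * (Real.cosh (2 * m) + Real.cosh (2 * δ)) =
      tanhRatio m * (Real.cosh (2 * m) + 1) := by
  have h2 : ∀ x, Real.cosh (2 * x) = 2 * Real.cosh x ^ 2 - 1 := fun x => by
    rw [Real.cosh_two_mul]; have := Real.cosh_sq x; linarith
  by_cases h : m = 0
  · subst h
    have := pairWeight_neg_self δ
    rw [zero_add, zero_sub, this, tanhRatio_zero, h2]
    have := Real.cosh_pos δ
    unfold sechSq
    simp only [Real.cosh_zero]
    field_simp
    rw [h2]; ring
  · have h1 := add_mul_pairWeight (m + δ) (m - δ)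
    have hc1 := Real.cosh_pos (m + δ)
    have hc2 := Real.cosh_pos (m - δ)
    have hc := Real.cosh_pos m
    have h3 : Real.cosh (2 * m) + Real.cosh (2 * δ)
        = 2 * (Real.cosh (m + δ) * Real.cosh (m - δ)) := by
      have e1 : 2 * m = (m + δ) + (m - δ) := by ring
      have e2 : 2 * δ = (m + δ) - (m - δ) := by ring
      rw [e1, e2, Real.cosh_add (m + δ), Real.cosh_sub (m + δ)]; ring
    have h4 : Real.sinh (2 * m) = Real.sinh (m + δ) * Real.cosh (m - δ)
        + Real.cosh (m + δ) * Real.sinh (m - δ) := by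
      rw [← Real.sinh_add]; congr 1; ring
    have h5 : m * (tanhRatio m * (Real.cosh (2 * m) + 1)) = Real.sinh (2 * m) := by
      rw [← mul_assoc, mul_tanhRatio, h2, Real.tanh_eq_sinh_div_cosh, Real.sinh_two_mul]
      field_simp; ring
    apply mul_left_cancel₀ h
    rw [h5, h3, h4]
    calc m * (pairWeight (m + δ) (m - δ) * (2 * (Real.cosh (m + δ) * Real.cosh (m - δ))))
        = ((m + δ + (m - δ)) * pairWeight (m + δ) (m - δ)) *
          (Real.cosh (m + δ) * Real.cosh (m - δ)) := by ring
      _ = _ := by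
          rw [h1, Real.tanh_eq_sinh_div_cosh, Real.tanh_eq_sinh_div_cosh]
          field_simp

/-- By `pairWeight_mul_cosh`, at fixed `A + B` the weight decreases in `|A - B|`, so it is largest
on the diagonal. -/
lemma pairWeight_le_tanhRatio_half_add (A B : ℝ) : pairWeight A B ≤ tanhRatio ((A + B) / 2) := by
  have h := pairWeight_mul_cosh ((A + B) / 2) ((A - B) / 2)
  have e1 : (A + B) / 2 + (A - B) / 2 = A := by ring
  have e2 : (A + B) / 2 - (A - B) / 2 = B := by ring
  rw [e1, e2] at h
  have h1 := Real.one_le_cosh (2 * ((A - B) / 2))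
  have h2 := Real.cosh_pos (2 * ((A + B) / 2))
  have h3 := pairWeight_pos A B
  by_contra! hlt
  nlinarith

lemma two_mul_mul_sinh_le {z : ℝ} (hz : 0 ≤ z) :
    2 * z * Real.sinh z ≤ Real.exp (2 * z) - 1 - 2 * z := by
  set φ : ℝ → ℝ := fun z => Real.exp (2 * z) - 1 - 2 * z - 2 * z * Real.sinh z with hφ
  have hder : ∀ z, HasDerivAt φ
      (Real.exp (2 * z) * 2 - 2 - (2 * Real.sinh z + 2 * z * Real.cosh z)) z := by
    intro z
    have h1 : HasDerivAt (fun z : ℝ => 2 * z) 2 z := by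
      simpa using (hasDerivAt_id z).const_mul 2
    exact ((h1.exp.sub_const 1).sub h1).sub (h1.mul (Real.hasDerivAt_sinh z))
  have hmono : MonotoneOn φ (Set.Ici 0) := by
    refine monotoneOn_of_deriv_nonneg (convex_Ici 0)
      (fun z _ => (hder z).continuousAt.continuousWithinAt)
      (fun z _ => (hder z).differentiableAt.differentiableWithinAt) fun z hz => ?_
    rw [interior_Ici, Set.mem_Ioi] at hz
    rw [(hder z).deriv]
    have h1 : z ≤ Real.sinh z := Real.self_le_sinh_iff.2 hz.le
    have h2 : 1 ≤ Real.cosh z := Real.one_le_cosh z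
    have h3 : Real.exp (2 * z) = Real.cosh (2 * z) + Real.sinh (2 * z) :=
      (Real.cosh_add_sinh _).symm
    have h4 : 1 ≤ Real.cosh (2 * z) := Real.one_le_cosh _
    have h5 := Real.sinh_two_mul z
    have h6 : z * Real.cosh z ≤ Real.sinh z * Real.cosh z := by gcongr
    have h7 : Real.sinh z * 1 ≤ Real.sinh z * Real.cosh z := by
      gcongr
    rw [h3, h5]; linarith
  have := hmono (Set.mem_Ici.2 le_rfl) (Set.mem_Ici.2 hz) hz
  simp only [hφ] at this
  norm_num at this
  linarith

lemma tanh_eq_exp (x : ℝ) : Real.tanh x = (Real.exp (2 * x) - 1) / (Real.exp (2 * x) + 1) := by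
  rw [Real.tanh_eq_sinh_div_cosh, Real.sinh_eq, Real.cosh_eq, two_mul, Real.exp_add,
    Real.exp_neg]
  have := Real.exp_pos x
  field_simp

/-- Equivalent to `tanh x / x ≥ 1 / (1 + x)`. -/
lemma one_sub_tanhRatio_le {x : ℝ} (hx : 0 ≤ x) : 1 - tanhRatio x ≤ x * tanhRatio x := by
  rcases hx.eq_or_lt with rfl | hx
  · simp [tanhRatio_zero]
  have h1 := mul_tanhRatio x
  have h2 : tanhRatio x = Real.tanh x / x := by rw [← h1]; field_simp
  have h3 : x ≤ (1 + x) * Real.tanh x := by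
    rw [tanh_eq_exp, ← mul_div_assoc, le_div_iff₀ (by positivity)]
    have := Real.add_one_le_exp (2 * x)
    nlinarith
  rw [h1, h2, sub_le_iff_le_add, ← sub_le_iff_le_add', le_div_iff₀ hx]
  linarith

/-- With `f = tanhRatio` this reads `f(x+y) ≤ f(x) f(y) + (1 - f(x))(1 - f(y)) / (x+y)`. The first
term is a product, and `1/(x+y)` is a Laplace integral of products; this is what yields a mixture of
rank-one kernels. -/
lemma tanhRatio_mul_self_le_one_div_add {x y : ℝ} (hx : 0 ≤ x) (hy : 0 ≤ y) :
    (x + y) * tanhRatio (x + y) ≤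
      (x + y) * (tanhRatio x * tanhRatio y) + (1 - tanhRatio x) * (1 - tanhRatio y) := by
  rcases hx.eq_or_lt with rfl | hx
  · simp [tanhRatio_zero]
  rcases hy.eq_or_lt with rfl | hy
  · simp [tanhRatio_zero]
  have hf : ∀ x : ℝ, 0 < x → tanhRatio x =
      (Real.exp (2 * x) - 1) / ((Real.exp (2 * x) + 1) * x) := fun x hx => by
    have h := mul_tanhRatio x
    rw [tanh_eq_exp] at h
    have := Real.exp_pos (2 * x)
    field_simp at h ⊢
    linarith
  have hE : ∀ x : ℝ, 0 < x →
      x * (Real.exp (2 * x) - 1) ≤ Real.exp x * (Real.exp (2 * x) - 1 - 2 * x) := by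
    intro x hx
    have h := two_mul_mul_sinh_le hx.le
    have h1 : Real.exp (2 * x) - 1 = 2 * Real.sinh x * Real.exp x := by
      rw [Real.sinh_eq, two_mul, Real.exp_add, Real.exp_neg]
      have := Real.exp_pos x
      field_simp
    have h2 := mul_le_mul_of_nonneg_left h (Real.exp_pos x).le
    calc _ = Real.exp x * (2 * x * Real.sinh x) := by rw [h1]; ring
      _ ≤ _ := h2
  rw [mul_tanhRatio, tanh_eq_exp, hf x hx, hf y hy, mul_add, Real.exp_add]
  have a1 := hE x hx
  have a2 := hE y hy
  have b1 : Real.exp (2 * x) = Real.exp x ^ 2 := by rw [two_mul, Real.exp_add, sq]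
  have b2 : Real.exp (2 * y) = Real.exp y ^ 2 := by rw [two_mul, Real.exp_add, sq]
  have c1 : 1 < Real.exp (2 * x) := Real.one_lt_exp_iff.2 (by linarith)
  have c2 : 1 < Real.exp (2 * y) := Real.one_lt_exp_iff.2 (by linarith)
  have s0 := Real.exp_pos x
  have r0 := Real.exp_pos y
  set s := Real.exp x
  set r := Real.exp y
  set E := Real.exp (2 * x)
  set F := Real.exp (2 * y)
  have hE1 : 0 < E - 1 := by linarith
  have hF1 : 0 < F - 1 := by linarith
  have p1 : 0 < E - 1 - 2 * x := pos_of_mul_pos_right (lt_of_lt_of_le (by positivity) a1) s0.le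
  have p2 : 0 < F - 1 - 2 * y := pos_of_mul_pos_right (lt_of_lt_of_le (by positivity) a2) r0.le
  -- After clearing denominators only this remains: the product of the one-variable bounds `hE` for
  -- `x` and `y`, combined with `2 s r ≤ (s r)² + 1`.
  have key : 2 * (x * (E - 1)) * (y * (F - 1)) ≤
      (E - 1 - 2 * x) * (F - 1 - 2 * y) * (E * F + 1) := by
    calc 2 * (x * (E - 1)) * (y * (F - 1))
        ≤ 2 * (s * (E - 1 - 2 * x)) * (r * (F - 1 - 2 * y)) := by gcongr
      _ = (E - 1 - 2 * x) * (F - 1 - 2 * y) * (2 * (s * r)) := by ring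
      _ ≤ _ := by
          have : 2 * (s * r) ≤ E * F + 1 := by rw [b1, b2]; nlinarith [sq_nonneg (s * r - 1)]
          gcongr
  have hE0 : 0 < E := by linarith
  have hF0 : 0 < F := by linarith
  rw [← sub_nonneg]
  have hdiff : (x + y) * ((E - 1) / ((E + 1) * x) * ((F - 1) / ((F + 1) * y))) +
      (1 - (E - 1) / ((E + 1) * x)) * (1 - (F - 1) / ((F + 1) * y)) -
      (E * F - 1) / (E * F + 1) =
      ((E - 1 - 2 * x) * (F - 1 - 2 * y) * (E * F + 1) - 2 * (x * (E - 1)) * (y * (F - 1))) /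
        ((E + 1) * (F + 1) * x * y * (E * F + 1)) := by
    field_simp
    ring
  rw [hdiff]
  exact div_nonneg (by linarith) (by positivity)

lemma tanhRatio_sub_pairWeight (m δ : ℝ) :
    (tanhRatio m - pairWeight (m + δ) (m - δ)) * (Real.cosh (2 * m) + Real.cosh (2 * δ)) =
      tanhRatio m * (2 * Real.sinh δ ^ 2) := by
  rw [sub_mul, pairWeight_mul_cosh, Real.cosh_two_mul δ, Real.cosh_sq δ]
  ring

lemma sinh_sq_le (δ : ℝ) : Real.sinh δ ^ 2 ≤ δ ^ 2 * Real.cosh δ ^ 2 := by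
  have h1 : Real.sinh δ = Real.tanh δ * Real.cosh δ := by
    rw [Real.tanh_eq_sinh_div_cosh]
    have := Real.cosh_pos δ
    field_simp
  rw [h1, ← mul_tanhRatio, mul_pow, mul_pow]
  have h2 := tanhRatio_pos δ
  have h3 := tanhRatio_le_one δ
  have h4 : tanhRatio δ ^ 2 ≤ 1 := pow_le_one₀ h2.le h3
  gcongr
  exact mul_le_of_le_one_right (sq_nonneg _) h4

/-- The loss is quadratic in the asymmetry `δ` because the weight depends on `δ` only through `cosh
(2 δ)`. -/
lemma tanhRatio_sub_pairWeight_le (m δ : ℝ) :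
    tanhRatio m - pairWeight (m + δ) (m - δ) ≤ tanhRatio m * (2 * δ ^ 2) := by
  have h := tanhRatio_sub_pairWeight m δ
  have h1 := sinh_sq_le δ
  have h2 := Real.one_le_cosh (2 * m)
  have h3 := Real.one_le_cosh (2 * δ)
  have h4 : Real.cosh (2 * δ) = 2 * Real.cosh δ ^ 2 - 1 := by
    rw [Real.cosh_two_mul]; have := Real.cosh_sq δ; linarith
  have hf := tanhRatio_pos m
  have h5 : 2 * Real.sinh δ ^ 2 ≤ 2 * δ ^ 2 * (Real.cosh (2 * m) + Real.cosh (2 * δ)) := by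
    have : 0 ≤ δ ^ 2 := sq_nonneg δ
    nlinarith
  have h6 : 0 < Real.cosh (2 * m) + Real.cosh (2 * δ) := by linarith
  rw [← mul_le_mul_iff_left₀ h6, h, mul_assoc]
  gcongr

/-- For `|δ| ≤ |m| / 2` the denominator `cosh (2 m)` beats `cosh² δ ≤ cosh m`. The extra decay makes
the loss integrable at large momentum. -/
lemma tanhRatio_sub_pairWeight_le_div_cosh {m δ : ℝ} (hδ : |δ| ≤ |m| / 2) :
    tanhRatio m - pairWeight (m + δ) (m - δ) ≤ tanhRatio m * (2 * δ ^ 2) / Real.cosh m := by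
  have h := tanhRatio_sub_pairWeight m δ
  have h1 := sinh_sq_le δ
  have h2 := Real.one_le_cosh m
  have h3 := Real.one_le_cosh (2 * δ)
  have h4 : Real.cosh (2 * m) = 2 * Real.cosh m ^ 2 - 1 := by
    rw [Real.cosh_two_mul]; have := Real.cosh_sq m; linarith
  have h5 : Real.cosh m = 2 * Real.cosh (m / 2) ^ 2 - 1 := by
    have e : m = 2 * (m / 2) := by ring
    conv_lhs => rw [e, Real.cosh_two_mul]
    have := Real.cosh_sq (m / 2); linarith
  have h6 : Real.cosh δ ^ 2 ≤ Real.cosh (m / 2) ^ 2 := by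
    have : Real.cosh δ ≤ Real.cosh (m / 2) := by
      rw [Real.cosh_le_cosh, abs_div, abs_two]; exact hδ
    have := Real.cosh_pos δ
    gcongr
  have hf := tanhRatio_pos m
  have h7 : δ ^ 2 * Real.cosh δ ^ 2 ≤ δ ^ 2 * Real.cosh m := by
    have : Real.cosh δ ^ 2 ≤ Real.cosh m := by linarith
    gcongr
  have h8 : 0 < Real.cosh (2 * m) + Real.cosh (2 * δ) := by nlinarith
  rw [le_div_iff₀ (by linarith), ← mul_le_mul_iff_left₀ h8, mul_right_comm, h]
  have h9 : 2 * Real.cosh m ^ 2 ≤ Real.cosh (2 * m) + Real.cosh (2 * δ) := by linarith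
  have h10 : 0 ≤ δ ^ 2 := sq_nonneg δ
  calc tanhRatio m * (2 * Real.sinh δ ^ 2) * Real.cosh m
      ≤ tanhRatio m * (2 * (δ ^ 2 * Real.cosh m)) * Real.cosh m := by
        have := h1.trans h7
        gcongr
    _ = tanhRatio m * δ ^ 2 * (2 * Real.cosh m ^ 2) := by ring
    _ ≤ tanhRatio m * δ ^ 2 * (Real.cosh (2 * m) + Real.cosh (2 * δ)) := by gcongr
    _ ≤ tanhRatio m * (2 * δ ^ 2) * (Real.cosh (2 * m) + Real.cosh (2 * δ)) := by
        gcongr; linarith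

/-! ### The pair kernel, its diagonal values and the gap integral. -/

/-- The inverse of the kinetic symbol in rescaled variables: temperature `τ`, chemical
potential `ν`. -/
def kern (τ ν p q : ℝ) : ℝ := pairWeight ((p ^ 2 - ν) / τ) ((q ^ 2 - ν) / τ) / τ

/-- The diagonal values of `kern`. -/
def gap (τ ν p : ℝ) : ℝ := tanhRatio ((p ^ 2 - ν) / τ) / τ

/-- The integral of `gap`. -/
def gapInt (τ ν : ℝ) : ℝ := ∫ p, gap τ ν p

section Kernel

variable {τ ν : ℝ}

lemma kern_comm (τ ν p q : ℝ) : kern τ ν p q = kern τ ν q p := by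
  unfold kern; rw [pairWeight_comm]

lemma kern_neg_left (τ ν p q : ℝ) : kern τ ν (-p) q = kern τ ν p q := by simp [kern]

lemma kern_neg_right (τ ν p q : ℝ) : kern τ ν p (-q) = kern τ ν p q := by simp [kern]

lemma kern_self (τ ν p : ℝ) : kern τ ν p p = gap τ ν p := rfl

lemma kern_pos (hτ : 0 < τ) (p q : ℝ) : 0 < kern τ ν p q := div_pos (pairWeight_pos _ _) hτ

lemma gap_pos (hτ : 0 < τ) (p : ℝ) : 0 < gap τ ν p := kern_pos hτ p p

lemma kern_le (hτ : 0 < τ) (p q : ℝ) : kern τ ν p q ≤ 1 / τ := by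
  unfold kern; gcongr; exact pairWeight_le_one _ _

lemma gap_le (hτ : 0 < τ) (p : ℝ) : gap τ ν p ≤ 1 / τ := kern_le hτ p p

lemma continuous_kern (τ ν : ℝ) : Continuous fun z : ℝ × ℝ => kern τ ν z.1 z.2 := by
  have h : Continuous fun z : ℝ × ℝ => ((z.1 ^ 2 - ν) / τ, (z.2 ^ 2 - ν) / τ) := by fun_prop
  exact (continuous_pairWeight.comp h).div_const τ

lemma continuous_gap (τ ν : ℝ) : Continuous (gap τ ν) := by
  have h : Continuous fun p : ℝ => (p, p) := by fun_prop
  have := (continuous_kern τ ν).comp h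
  exact this

lemma kern_mul_le (hτ : 0 < τ) (p q : ℝ) :
    kern τ ν p q * (|p ^ 2 - ν| + |q ^ 2 - ν|) ≤ 2 := by
  have h := pairWeight_mul_le_two ((p ^ 2 - ν) / τ) ((q ^ 2 - ν) / τ)
  rw [abs_div, abs_div, abs_of_pos hτ, ← add_div] at h
  unfold kern
  calc _ = pairWeight ((p ^ 2 - ν) / τ) ((q ^ 2 - ν) / τ) * ((|p ^ 2 - ν| + |q ^ 2 - ν|) / τ) := by
        ring
    _ ≤ 2 := h

lemma kern_le_half_add (hτ : 0 < τ) (p q : ℝ) :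
    kern τ ν p q ≤ (gap τ ν p + gap τ ν q) / 2 := by
  unfold kern gap
  rw [← add_div, div_right_comm]
  gcongr
  exact pairWeight_le_half_add _ _

lemma gap_mul_abs_le (hτ : 0 < τ) (p : ℝ) : gap τ ν p * |p ^ 2 - ν| ≤ 1 := by
  have h := kern_mul_le (ν := ν) hτ p p
  rw [kern_self] at h; linarith

/-- The Lorentzian majorant supplies integrability of `gap`, and hence of the kernel along every
line of fixed total momentum. -/
lemma gap_le_div (hτ : 0 < τ) (hν : 0 ≤ ν) (p : ℝ) :
    gap τ ν p ≤ ((1 + ν) / τ + 1) * (1 + p ^ 2)⁻¹ := by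
  rw [← div_eq_mul_inv, le_div_iff₀ (by positivity)]
  have h1 := gap_mul_abs_le (ν := ν) hτ p
  have h2 := gap_le (ν := ν) hτ p
  have h3 := gap_pos (ν := ν) hτ p
  have h4 : p ^ 2 ≤ |p ^ 2 - ν| + ν := by linarith [le_abs_self (p ^ 2 - ν)]
  calc gap τ ν p * (1 + p ^ 2) ≤ gap τ ν p * (1 + (|p ^ 2 - ν| + ν)) := by gcongr
    _ = gap τ ν p * (1 + ν) + gap τ ν p * |p ^ 2 - ν| := by ring
    _ ≤ 1 / τ * (1 + ν) + 1 := by gcongr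
    _ = _ := by ring

lemma integrable_gap (hτ : 0 < τ) (hν : 0 ≤ ν) : Integrable (gap τ ν) := by
  refine (integrable_inv_one_add_sq.const_mul ((1 + ν) / τ + 1)).mono'
    (continuous_gap τ ν).aestronglyMeasurable (ae_of_all _ fun p => ?_)
  rw [Real.norm_of_nonneg (gap_pos hτ p).le]
  exact gap_le_div hτ hν p

lemma integrable_gap_comp_sub (hτ : 0 < τ) (hν : 0 ≤ ν) (η : ℝ) :
    Integrable fun p => gap τ ν (η - p) := (integrable_gap hτ hν).comp_sub_left η

lemma integrable_kern (hτ : 0 < τ) (hν : 0 ≤ ν) (η : ℝ) :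
    Integrable fun p => kern τ ν p (η - p) := by
  refine (((integrable_gap hτ hν).add (integrable_gap_comp_sub hτ hν η)).div_const 2).mono'
    ?_ (ae_of_all _ fun p => ?_)
  · have h : Continuous fun p : ℝ => (p, η - p) := by fun_prop
    exact ((continuous_kern τ ν).comp h).aestronglyMeasurable
  · rw [Real.norm_of_nonneg (kern_pos hτ p _).le]
    exact kern_le_half_add hτ p _

lemma integral_half_gap_add (hτ : 0 < τ) (hν : 0 ≤ ν) (η : ℝ) :
    ∫ p, (gap τ ν p + gap τ ν (η - p)) / 2 = gapInt τ ν := by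
  rw [integral_div, integral_add (integrable_gap hτ hν) (integrable_gap_comp_sub hτ hν η),
    integral_sub_left_eq_self (gap τ ν) volume η, gapInt]
  ring

/-- The arithmetic-mean bound holds pointwise, and both means integrate to `gapInt`. Equality at `η
= 0` is visible from `kern p (-p) = gap p`. -/
lemma integral_kern_le (hτ : 0 < τ) (hν : 0 ≤ ν) (η : ℝ) :
    ∫ p, kern τ ν p (η - p) ≤ gapInt τ ν := by
  rw [← integral_half_gap_add hτ hν η]
  exact integral_mono (integrable_kern hτ hν η)
    (((integrable_gap hτ hν).add (integrable_gap_comp_sub hτ hν η)).div_const 2)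
    fun p => kern_le_half_add hτ p _

lemma gapInt_pos (hτ : 0 < τ) (hν : 0 ≤ ν) : 0 < gapInt τ ν := by
  refine (integral_pos_iff_support_of_nonneg (fun p => (gap_pos hτ p).le)
    (integrable_gap hτ hν)).2 ?_
  have : Function.support (gap τ ν) = Set.univ := by
    ext p; simp [(gap_pos (ν := ν) hτ p).ne']
  simp [this]

/-- Raising the temperature shrinks the arguments of `sech²`. So a change from `τ` to `τ'` reduces
the kernel by at most the factor `τ / τ'`; this one-sided control replaces continuity in the
temperature later on. -/
lemma mul_kern_le_mul_kern {τ' : ℝ} (hτ : 0 < τ) (h : τ ≤ τ') (p q : ℝ) :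
    τ * kern τ ν p q ≤ τ' * kern τ' ν p q := by
  have hτ' : 0 < τ' := hτ.trans_le h
  have h1 := pairWeight_le_pairWeight_smul ((p ^ 2 - ν) / τ) ((q ^ 2 - ν) / τ)
    (θ := τ / τ') (by positivity) ((div_le_one hτ').2 h)
  have e : ∀ x : ℝ, τ / τ' * (x / τ) = x / τ' := fun x => by field_simp
  rw [e, e] at h1
  unfold kern
  rw [mul_div_cancel₀ _ hτ.ne', mul_div_cancel₀ _ hτ'.ne']
  exact h1

lemma monotone_tanh : Monotone Real.tanh :=
  monotone_of_deriv_nonneg (fun x => (hasDerivAt_tanh x).differentiableAt)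
    fun x => by rw [(hasDerivAt_tanh x).deriv]; exact (sechSq_pos x).le

lemma abs_mul_gap (τ ν p : ℝ) :
    |p ^ 2 - ν| * gap τ ν p = Real.tanh (|p ^ 2 - ν| / τ) := by
  rw [← mul_tanhRatio]
  have : tanhRatio (|p ^ 2 - ν| / τ) = tanhRatio ((p ^ 2 - ν) / τ) := by
    rcases abs_choice (p ^ 2 - ν) with h | h
    · rw [h]
    · rw [h, neg_div, tanhRatio_neg]
  rw [this]; unfold gap; ring

/-- Off the Fermi points, `|p² - ν|` times the gap function is `tanh (|p² - ν| / τ)`, which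
decreases in `τ`. -/
lemma gap_anti {τ' : ℝ} (hτ : 0 < τ) (h : τ ≤ τ') (p : ℝ) : gap τ' ν p ≤ gap τ ν p := by
  have hτ' : 0 < τ' := hτ.trans_le h
  by_cases h0 : p ^ 2 - ν = 0
  · unfold gap
    rw [h0, zero_div, zero_div]
    gcongr
    exact (tanhRatio_pos _).le
  · have ha : 0 < |p ^ 2 - ν| := abs_pos.2 h0
    rw [← mul_le_mul_iff_right₀ ha, abs_mul_gap τ ν, abs_mul_gap τ' ν]
    apply monotone_tanh
    gcongr

lemma gapInt_anti {τ' : ℝ} (hτ : 0 < τ) (hν : 0 ≤ ν) (h : τ ≤ τ') : gapInt τ' ν ≤ gapInt τ ν :=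
  integral_mono (integrable_gap (hτ.trans_le h) hν) (integrable_gap hτ hν) fun p => gap_anti hτ h p

lemma mul_gapInt_le_mul_gapInt {τ' : ℝ} (hτ : 0 < τ) (hν : 0 ≤ ν) (h : τ ≤ τ') :
    τ * gapInt τ ν ≤ τ' * gapInt τ' ν := by
  unfold gapInt
  rw [← integral_const_mul, ← integral_const_mul]
  exact integral_mono ((integrable_gap hτ hν).const_mul _)
    ((integrable_gap (hτ.trans_le h) hν).const_mul _) fun p => mul_kern_le_mul_kern hτ h p p

lemma gap_ge (hτ : 0 < τ) (p : ℝ) : (τ + |p ^ 2 - ν|)⁻¹ ≤ gap τ ν p := by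
  have h := one_sub_tanhRatio_le (x := |p ^ 2 - ν| / τ) (by positivity)
  have e : tanhRatio (|p ^ 2 - ν| / τ) = τ * gap τ ν p := by
    have : tanhRatio (|p ^ 2 - ν| / τ) = tanhRatio ((p ^ 2 - ν) / τ) := by
      rcases abs_choice (p ^ 2 - ν) with h | h
      · rw [h]
      · rw [h, neg_div, tanhRatio_neg]
    rw [this]; unfold gap; field_simp
  rw [e] at h
  rw [inv_le_iff_one_le_mul₀ (by positivity)]
  have : |p ^ 2 - ν| / τ * (τ * gap τ ν p) = |p ^ 2 - ν| * gap τ ν p := by field_simp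
  nlinarith

lemma ae_sq_ne (ν : ℝ) : ∀ᵐ p : ℝ, p ^ 2 - ν ≠ 0 := by
  have : {p : ℝ | p ^ 2 - ν = 0} ⊆ {√ν, -√ν} := by
    intro p hp
    have hp : p ^ 2 = ν := by simpa [sub_eq_zero] using hp
    rcases le_total 0 p with h | h
    · left; rw [← hp, Real.sqrt_sq h]
    · right; rw [← hp, Real.sqrt_sq_eq_abs, abs_of_nonpos h, neg_neg]; rfl
  have h0 : volume {p : ℝ | p ^ 2 - ν = 0} = 0 :=
    measure_mono_null this (Set.Finite.measure_zero (Set.toFinite _) _)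
  exact measure_eq_zero_iff_ae_notMem.1 h0

lemma tendsto_gapInt_atTop (hν : 0 ≤ ν) : Tendsto (fun τ => gapInt τ ν) atTop (𝓝 0) := by
  have : (0 : ℝ) = ∫ _ : ℝ, (0 : ℝ) := by simp
  rw [this]
  refine tendsto_integral_filter_of_dominated_convergence (gap 1 ν)
    (Eventually.of_forall fun τ => (continuous_gap τ ν).aestronglyMeasurable) ?_
    (integrable_gap one_pos hν) (ae_of_all _ fun p => ?_)
  · filter_upwards [eventually_ge_atTop 1] with τ hτ
    refine ae_of_all _ fun p => ?_
    rw [Real.norm_of_nonneg (gap_pos (by linarith) p).le]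
    exact gap_anti one_pos hτ p
  · refine tendsto_of_tendsto_of_tendsto_of_le_of_le' tendsto_const_nhds
      (tendsto_inv_atTop_zero (𝕜 := ℝ)) ?_ ?_
    · filter_upwards [eventually_gt_atTop 0] with τ hτ using (gap_pos hτ p).le
    · filter_upwards [eventually_gt_atTop 0] with τ hτ
      simpa using gap_le (ν := ν) hτ p

lemma tendsto_mul_gapInt (hν : 0 ≤ ν) : Tendsto (fun τ => τ * gapInt τ ν) (𝓝[>] 0) (𝓝 0) := by
  have : (0 : ℝ) = ∫ _ : ℝ, (0 : ℝ) := by simp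
  nth_rewrite 3 [this]
  unfold gapInt
  simp_rw [← integral_const_mul]
  refine tendsto_integral_filter_of_dominated_convergence (gap 1 ν)
    (Eventually.of_forall fun τ => ((continuous_gap τ ν).const_mul τ).aestronglyMeasurable) ?_
    (integrable_gap one_pos hν) ?_
  · filter_upwards [Ioo_mem_nhdsGT (zero_lt_one' ℝ)] with τ hτ
    refine ae_of_all _ fun p => ?_
    rw [Real.norm_of_nonneg (mul_pos hτ.1 (gap_pos hτ.1 p)).le]
    have := mul_kern_le_mul_kern (ν := ν) hτ.1 hτ.2.le p p
    simpa [kern_self] using this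
  · filter_upwards [ae_sq_ne ν] with p hp
    have ha : 0 < |p ^ 2 - ν| := abs_pos.2 hp
    have ht : Tendsto (fun τ : ℝ => τ / |p ^ 2 - ν|) (𝓝[>] 0) (𝓝 0) := by
      have : Tendsto (fun τ : ℝ => τ / |p ^ 2 - ν|) (𝓝 0) (𝓝 (0 / |p ^ 2 - ν|)) :=
        (continuous_id.div_const _).tendsto 0
      rw [zero_div] at this
      exact this.mono_left nhdsWithin_le_nhds
    refine tendsto_of_tendsto_of_tendsto_of_le_of_le' tendsto_const_nhds ht ?_ ?_
    · filter_upwards [self_mem_nhdsWithin] with τ hτ using (mul_pos hτ (gap_pos hτ p)).le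
    · filter_upwards [self_mem_nhdsWithin] with τ hτ
      rw [le_div_iff₀ ha, mul_assoc]
      exact mul_le_of_le_one_right (le_of_lt hτ) (gap_mul_abs_le hτ p)

end Kernel

/-! ### The jump kernel in sum and difference variables, and its Dirichlet form. -/

/-- The pair kernel as a function of `η = p + q` and `η' = p - q`. -/
def jumpKernel (τ ν η η' : ℝ) : ℝ := kern τ ν ((η + η') / 2) ((η - η') / 2) / 2

/-- The Dirichlet form with jump kernel `jumpKernel`. -/
def jumpForm (τ ν : ℝ) (g : ℝ → ℂ) : ℝ≥0∞ :=
  2⁻¹ * ∫⁻ η, ∫⁻ η', ENNReal.ofReal (jumpKernel τ ν η η') * ‖g η - g η'‖ₑ ^ 2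

section JumpKernel

variable {τ ν : ℝ}

lemma jumpKernel_pos (hτ : 0 < τ) (η η' : ℝ) : 0 < jumpKernel τ ν η η' :=
  div_pos (kern_pos hτ _ _) two_pos

lemma jumpKernel_comm (τ ν η η' : ℝ) : jumpKernel τ ν η η' = jumpKernel τ ν η' η := by
  unfold jumpKernel
  rw [← kern_neg_right, add_comm, ← neg_div, neg_sub]

lemma jumpKernel_neg_right (τ ν η η' : ℝ) : jumpKernel τ ν η (-η') = jumpKernel τ ν η η' := by
  unfold jumpKernel
  rw [kern_comm, sub_neg_eq_add, ← sub_eq_add_neg]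

lemma jumpKernel_neg_left (τ ν η η' : ℝ) : jumpKernel τ ν (-η) η' = jumpKernel τ ν η η' := by
  rw [jumpKernel_comm, jumpKernel_neg_right, jumpKernel_comm]

lemma continuous_jumpKernel (τ ν : ℝ) : Continuous fun z : ℝ × ℝ => jumpKernel τ ν z.1 z.2 := by
  have h : Continuous fun z : ℝ × ℝ => ((z.1 + z.2) / 2, (z.1 - z.2) / 2) := by fun_prop
  have h2 := (continuous_kern τ ν).comp h
  unfold jumpKernel
  exact h2.div_const 2

lemma continuous_jumpKernel_right (τ ν η : ℝ) : Continuous (jumpKernel τ ν η) := by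
  have h : Continuous fun x : ℝ => (η, x) := by fun_prop
  have h2 := (continuous_jumpKernel τ ν).comp h
  exact h2

lemma measurable_jumpKernel (τ ν : ℝ) :
    Measurable fun z : ℝ × ℝ => ENNReal.ofReal (jumpKernel τ ν z.1 z.2) :=
  (continuous_jumpKernel τ ν).measurable.ennreal_ofReal

lemma jumpKernel_eq_kern (τ ν η p : ℝ) : jumpKernel τ ν η (2 * p - η) = kern τ ν p (η - p) / 2 := by
  unfold jumpKernel
  congr 2 <;> ring

lemma integrable_jumpKernel (hτ : 0 < τ) (hν : 0 ≤ ν) (η : ℝ) :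
    Integrable (jumpKernel τ ν η) := by
  have h := ((integrable_kern hτ hν η).div_const 2)
  simp_rw [← jumpKernel_eq_kern] at h
  have h2 : Integrable (fun x : ℝ => jumpKernel τ ν η (2 * x - η)) := h
  have h3 := (h2.comp_mul_left' (R := 1 / 2) (by norm_num)).comp_add_right η
  refine h3.congr (ae_of_all _ fun x => ?_)
  simp only
  congr 1; ring

/-- For fixed `η`, `η' = 2p - η` has `dη' = 2 dp`; the one half in the definition of `jumpKernel`
cancels this Jacobian. -/
lemma integral_jumpKernel (τ ν η : ℝ) :
    ∫ η', jumpKernel τ ν η η' = ∫ p, kern τ ν p (η - p) := by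
  have h1 : ∫ p, jumpKernel τ ν η (2 * p - η) = 2⁻¹ * ∫ η', jumpKernel τ ν η η' := by
    rw [Measure.integral_comp_mul_left (fun x => jumpKernel τ ν η (x - η)) 2,
      integral_sub_right_eq_self (jumpKernel τ ν η) η]
    simp
  simp_rw [jumpKernel_eq_kern] at h1
  rw [integral_div] at h1
  linarith

lemma integral_jumpKernel_le (hτ : 0 < τ) (hν : 0 ≤ ν) (η : ℝ) :
    ∫ η', jumpKernel τ ν η η' ≤ gapInt τ ν := by
  rw [integral_jumpKernel]; exact integral_kern_le hτ hν η

lemma lintegral_jumpKernel (hτ : 0 < τ) (hν : 0 ≤ ν) (η : ℝ) :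
    ∫⁻ η', ENNReal.ofReal (jumpKernel τ ν η η') =
      ENNReal.ofReal (∫ η', jumpKernel τ ν η η') :=
  (ofReal_integral_eq_lintegral_ofReal (integrable_jumpKernel hτ hν η)
    (ae_of_all _ fun _ => (jumpKernel_pos hτ _ _).le)).symm

lemma measurable_jumpForm_integrand {k : ℝ × ℝ → ℝ≥0∞} (hk : Measurable k) {g : ℝ → ℂ}
    (hg : Measurable g) : Measurable fun z : ℝ × ℝ => k z * ‖g z.1 - g z.2‖ₑ ^ 2 :=
  hk.mul (((hg.comp measurable_fst).sub (hg.comp measurable_snd)).enorm.pow_const 2)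

lemma jumpForm_congr {g g' : ℝ → ℂ} (h : g =ᵐ[volume] g') : jumpForm τ ν g = jumpForm τ ν g' := by
  unfold jumpForm
  congr 1
  refine lintegral_congr_ae ?_
  filter_upwards [h] with η hη
  refine lintegral_congr_ae ?_
  filter_upwards [h] with η' hη'
  rw [hη, hη']

/-- A Dirichlet form for a finite measure is bounded by twice the total mass. -/
lemma lintegral_enorm_sub_sq_le {α : Type*} [MeasurableSpace α] {m : Measure α} [IsFiniteMeasure m]
    {g : α → ℂ} (hg : MemLp g 2 m) :
    2⁻¹ * ∫⁻ x, ∫⁻ y, ‖g x - g y‖ₑ ^ 2 ∂m ∂m ≤ m Set.univ * ∫⁻ x, ‖g x‖ₑ ^ 2 ∂m := by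
  have hint : Integrable g m := hg.integrable (by norm_num)
  have hsq : Integrable (fun x => ‖g x‖ ^ 2) m := hg.integrable_norm_pow (by norm_num)
  set I : ℂ := ∫ x, g x ∂m with hI
  set N : ℝ := ∫ x, ‖g x‖ ^ 2 ∂m with hN
  set M : ℝ := m.real Set.univ with hM
  have hexp : ∀ z w : ℂ, ‖z - w‖ ^ 2 = ‖z‖ ^ 2 - 2 * (z * conj w).re + ‖w‖ ^ 2 := fun z w => by
    rw [← Complex.normSq_eq_norm_sq, ← Complex.normSq_eq_norm_sq, ← Complex.normSq_eq_norm_sq,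
      Complex.normSq_sub]; ring
  have hre : ∀ x, Integrable (fun y => (g x * conj (g y)).re) m := fun x => by
    have h1 : Integrable (fun y => conj (g y)) m := by
      have := (Complex.conjCLE : ℂ →L[ℝ] ℂ).integrable_comp hint
      exact this
    exact (h1.const_mul (g x)).re
  have hconj : Integrable (fun y => conj (g y)) m :=
    (Complex.conjCLE : ℂ →L[ℝ] ℂ).integrable_comp hint
  have hval : ∀ x, Integrable (fun y => ‖g x - g y‖ ^ 2) m ∧
      ∫ y, ‖g x - g y‖ ^ 2 ∂m = M * ‖g x‖ ^ 2 - 2 * (g x * conj I).re + N := by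
    intro x
    have i1 : Integrable (fun y => ‖g x‖ ^ 2 - 2 * (g x * conj (g y)).re) m :=
      (integrable_const _).sub ((hre x).const_mul 2)
    simp_rw [hexp]
    refine ⟨i1.add hsq, ?_⟩
    rw [integral_add i1 hsq, integral_sub (integrable_const _) ((hre x).const_mul 2),
      integral_const, integral_const_mul]
    have h2 : ∫ y, (g x * conj (g y)).re ∂m = (∫ y, g x * conj (g y) ∂m).re :=
      integral_re (hconj.const_mul (g x))
    rw [h2, integral_const_mul, integral_conj]
    rfl
  rw [lintegral_congr (g := fun x => ENNReal.ofReal (M * ‖g x‖ ^ 2 - 2 * (g x * conj I).re + N))]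
  swap
  · intro x
    have e1 : ∀ y, ‖g x - g y‖ₑ ^ 2 = ENNReal.ofReal (‖g x - g y‖ ^ 2) := fun y => by
      rw [← ofReal_norm, ENNReal.ofReal_pow (norm_nonneg _)]
    simp_rw [e1]
    rw [← ofReal_integral_eq_lintegral_ofReal (hval x).1 (ae_of_all _ fun y => by positivity),
      (hval x).2]
  have hre2 : Integrable (fun x => (g x * conj I).re) m := (hint.mul_const (conj I)).re
  have hint2 : Integrable (fun x => M * ‖g x‖ ^ 2 - 2 * (g x * conj I).re + N) m :=
    ((hsq.const_mul M).sub (hre2.const_mul 2)).add (integrable_const _)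
  rw [← ofReal_integral_eq_lintegral_ofReal hint2]
  · have i1 : Integrable (fun x => M * ‖g x‖ ^ 2 - 2 * (g x * conj I).re) m :=
      (hsq.const_mul M).sub (hre2.const_mul 2)
    rw [integral_add i1 (integrable_const _),
      integral_sub (hsq.const_mul M) (hre2.const_mul 2), integral_const_mul, integral_const_mul,
      integral_const]
    have h2 : ∫ x, (g x * conj I).re ∂m = ‖I‖ ^ 2 := by
      have : ∫ x, (g x * conj I).re ∂m = (∫ x, g x * conj I ∂m).re :=
        integral_re (hint.mul_const (conj I))
      rw [this, integral_mul_const, ← hI, Complex.mul_conj, Complex.normSq_eq_norm_sq]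
      exact Complex.ofReal_re _
    rw [h2]
    have h3 : ∫⁻ x, ‖g x‖ₑ ^ 2 ∂m = ENNReal.ofReal N := by
      rw [hN, ofReal_integral_eq_lintegral_ofReal hsq (ae_of_all _ fun _ => by positivity)]
      congr 1; ext x
      rw [← ofReal_norm, ENNReal.ofReal_pow (norm_nonneg _)]
    have h4 : m Set.univ = ENNReal.ofReal M := by
      rw [hM, Measure.real, ENNReal.ofReal_toReal (measure_ne_top _ _)]
    have h5 : (2⁻¹ : ℝ≥0∞) = ENNReal.ofReal (2⁻¹) := by
      rw [ENNReal.ofReal_inv_of_pos two_pos]; simp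
    have hN0 : 0 ≤ N := integral_nonneg fun _ => by positivity
    have hM0 : 0 ≤ M := measureReal_nonneg
    rw [h3, h4, h5, ← ENNReal.ofReal_mul (by norm_num), ← ENNReal.ofReal_mul hM0]
    apply ENNReal.ofReal_le_ofReal
    simp only [smul_eq_mul]
    -- Half of the double integral equals `M N - ‖I‖²`, so only the square of the mean is discarded.
    -- The generic estimate `|a - b|² ≤ 2|a|² + 2|b|²` would cost a factor two.
    nlinarith [sq_nonneg ‖I‖]
  · refine ae_of_all _ fun x => ?_
    show 0 ≤ M * ‖g x‖ ^ 2 - 2 * (g x * conj I).re + N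
    rw [← (hval x).2]
    exact integral_nonneg fun _ => by positivity

/-- A product kernel is the Dirichlet form of the finite measure `w dx`. The bound `w ≤ 1` is there
so that `g` remains square integrable for this measure. -/
lemma lintegral_rank_one_le {w : ℝ → ℝ} (hw : Measurable w)
    (hw1 : ∀ x, w x ≤ 1) (hwi : Integrable w) {g : ℝ → ℂ} (hgm : Measurable g)
    (hg : MemLp g 2 volume) :
    2⁻¹ * ∫⁻ x, ∫⁻ y, ENNReal.ofReal (w x) * ENNReal.ofReal (w y) * ‖g x - g y‖ₑ ^ 2 ≤
      ∫⁻ x, ∫⁻ y, ENNReal.ofReal (w x) * ENNReal.ofReal (w y) * ‖g x‖ₑ ^ 2 := by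
  set W : ℝ → ℝ≥0∞ := fun x => ENNReal.ofReal (w x) with hW
  have hWm : Measurable W := hw.ennreal_ofReal
  set m : Measure ℝ := volume.withDensity W with hm
  have hfin : IsFiniteMeasure m := isFiniteMeasure_withDensity_ofReal hwi.2
  have hle : m ≤ volume := by
    rw [hm]
    conv_rhs => rw [← withDensity_one (μ := (volume : Measure ℝ))]
    exact withDensity_mono (ae_of_all _ fun x => by
      simpa [hW] using hw1 x)
  have key := lintegral_enorm_sub_sq_le (m := m) (hg.mono_measure hle)
  have e1 : ∀ f : ℝ → ℝ≥0∞, Measurable f → ∫⁻ x, f x ∂m = ∫⁻ x, W x * f x := fun f hf => by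
    rw [hm, lintegral_withDensity_eq_lintegral_mul _ hWm hf]; rfl
  have hm2 : Measurable fun z : ℝ × ℝ => ‖g z.1 - g z.2‖ₑ ^ 2 :=
    (((hgm.comp measurable_fst).sub (hgm.comp measurable_snd)).enorm.pow_const 2)
  rw [e1 _ (hm2.lintegral_prod_right' (ν := m)), e1 _ (hgm.enorm.pow_const 2)] at key
  refine le_trans (le_of_eq ?_) (key.trans (le_of_eq ?_))
  · congr 1
    refine lintegral_congr fun x => ?_
    have hx : Measurable fun y => ‖g x - g y‖ₑ ^ 2 :=
      (measurable_const.sub hgm).enorm.pow_const 2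
    show _ = W x * ∫⁻ y, ‖g x - g y‖ₑ ^ 2 ∂m
    have hx2 : Measurable fun y => W y * ‖g x - g y‖ₑ ^ 2 := hWm.mul hx
    rw [e1 _ hx, ← lintegral_const_mul _ hx2]
    refine lintegral_congr fun y => ?_
    simp only [hW, mul_assoc]
  · have e2 : m Set.univ = ∫⁻ x, W x := by
      rw [hm, withDensity_apply _ MeasurableSet.univ, Measure.restrict_univ]
    have hx : Measurable fun x => W x * ‖g x‖ₑ ^ 2 := hWm.mul (hgm.enorm.pow_const 2)
    rw [e2, mul_comm, ← lintegral_mul_const _ hx]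
    refine lintegral_congr fun x => ?_
    rw [← lintegral_const_mul _ hWm]
    refine lintegral_congr fun y => ?_
    simp only [hW]; ring

end JumpKernel

/-! ### High temperature: a majorant of the kernel by product kernels. -/

section HighTemperature

/-- The profile of the majorant of the jump kernel at zero chemical potential. -/
def profile (τ η : ℝ) : ℝ := tanhRatio (η ^ 2 / (4 * τ))

variable {τ ν : ℝ}

lemma continuous_profile (τ : ℝ) : Continuous (profile τ) := by
  have h : Continuous fun η : ℝ => η ^ 2 / (4 * τ) := by fun_prop
  have h2 := continuous_tanhRatio.comp h
  exact h2

lemma profile_pos (τ η : ℝ) : 0 < profile τ η := tanhRatio_pos _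

lemma profile_le_one (τ η : ℝ) : profile τ η ≤ 1 := tanhRatio_le_one _

lemma profile_two_mul (hτ : 0 < τ) (p : ℝ) : profile τ (2 * p) = τ * gap τ 0 p := by
  unfold profile gap
  rw [mul_div_cancel₀ _ hτ.ne']
  congr 1; field_simp; ring

lemma integrable_profile (hτ : 0 < τ) : Integrable (profile τ) := by
  have h : Integrable fun p => profile τ (2 * p) := by
    simp_rw [profile_two_mul hτ]
    exact (integrable_gap hτ le_rfl).const_mul τ
  exact (integrable_comp_mul_left_iff _ two_ne_zero).1 h

lemma integral_profile (hτ : 0 < τ) : ∫ η, profile τ η = 2 * τ * gapInt τ 0 := by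
  have h := Measure.integral_comp_mul_left (profile τ) 2
  simp_rw [profile_two_mul hτ] at h
  rw [integral_const_mul] at h
  unfold gapInt
  simp at h
  linarith

lemma lintegral_exp_neg_mul {s : ℝ} (hs : 0 < s) :
    ∫⁻ t in Set.Ioi (0 : ℝ), ENNReal.ofReal (Real.exp (-(s * t))) = ENNReal.ofReal (1 / s) := by
  have h := integral_exp_mul_Ioi (a := -s) (by linarith) 0
  have hi := integrableOn_exp_mul_Ioi (a := -s) (by linarith) 0
  simp only [neg_mul] at h hi
  rw [← ofReal_integral_eq_lintegral_ofReal hi (ae_of_all _ fun _ => (Real.exp_pos _).le), h]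
  simp

/-- The one-parameter family of functions that generates the second part of the majorant. -/
def profileTail (τ t η : ℝ) : ℝ :=
  (1 - profile τ η) * Real.exp (-(η ^ 2 / (4 * τ) * t))

lemma profileTail_nonneg (τ t η : ℝ) : 0 ≤ profileTail τ t η :=
  mul_nonneg (sub_nonneg.2 (profile_le_one _ _)) (Real.exp_pos _).le

lemma profileTail_le_exp (τ t η : ℝ) :
    profileTail τ t η ≤ Real.exp (-(η ^ 2 / (4 * τ) * t)) :=
  mul_le_of_le_one_left (Real.exp_pos _).le (by linarith [profile_pos τ η])

lemma continuous_profileTail (τ : ℝ) : Continuous fun z : ℝ × ℝ => profileTail τ z.1 z.2 := by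
  unfold profileTail
  have := (continuous_profile τ).comp (continuous_snd (X := ℝ) (Y := ℝ))
  refine (continuous_const.sub this).mul ?_
  fun_prop

/-- At `ν = 0` the mean of the two arguments of the weight is `x + y` with `x = η²/(4τ)` and `y =
η'²/(4τ)`. So the weight is at most `tanhRatio (x + y)`, which splits by
`tanhRatio_mul_self_le_one_div_add` with `1/(x+y) = ∫ exp(-(x+y)t) dt`. -/
lemma jumpKernel_le_majorant (hτ : 0 < τ) (η η' : ℝ) :
    ENNReal.ofReal (jumpKernel τ 0 η η') ≤ ENNReal.ofReal (1 / (2 * τ)) *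
      (ENNReal.ofReal (profile τ η) * ENNReal.ofReal (profile τ η') +
        ∫⁻ t in Set.Ioi (0 : ℝ),
          ENNReal.ofReal (profileTail τ t η) * ENNReal.ofReal (profileTail τ t η')) := by
  set x := η ^ 2 / (4 * τ) with hx
  set y := η' ^ 2 / (4 * τ) with hy
  have hx0 : 0 ≤ x := by positivity
  have hy0 : 0 ≤ y := by positivity
  have h1 : jumpKernel τ 0 η η' ≤ 1 / (2 * τ) * tanhRatio (x + y) := by
    have h := pairWeight_le_tanhRatio_half_add ((((η + η') / 2) ^ 2 - 0) / τ)
      ((((η - η') / 2) ^ 2 - 0) / τ)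
    have e : ((((η + η') / 2) ^ 2 - 0) / τ + (((η - η') / 2) ^ 2 - 0) / τ) / 2 = x + y := by
      rw [hx, hy]; field_simp; ring
    rw [e] at h
    unfold jumpKernel kern
    calc _ ≤ tanhRatio (x + y) / τ / 2 := by gcongr
      _ = _ := by field_simp
  refine (ENNReal.ofReal_le_ofReal h1).trans ?_
  rw [ENNReal.ofReal_mul (by positivity)]
  gcongr
  have hfx : profile τ η = tanhRatio x := rfl
  have hfy : profile τ η' = tanhRatio y := rfl
  rcases (add_nonneg hx0 hy0).eq_or_lt with h0 | h0
  · have hx' : x = 0 := by linarith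
    have hy' : y = 0 := by linarith
    rw [hfx, hfy, hx', hy', add_zero, tanhRatio_zero]
    simp
  · have h2 := tanhRatio_mul_self_le_one_div_add hx0 hy0
    have h3 : tanhRatio (x + y) ≤ tanhRatio x * tanhRatio y +
        (1 - tanhRatio x) * (1 - tanhRatio y) * (1 / (x + y)) := by
      rw [← mul_le_mul_iff_right₀ h0]
      calc _ ≤ _ := h2
        _ = _ := by field_simp
    have hx1 := sub_nonneg.2 (tanhRatio_le_one x)
    have hy1 := sub_nonneg.2 (tanhRatio_le_one y)
    have h4 : ∀ t, ENNReal.ofReal (profileTail τ t η) * ENNReal.ofReal (profileTail τ t η') =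
        ENNReal.ofReal ((1 - tanhRatio x) * (1 - tanhRatio y)) *
          ENNReal.ofReal (Real.exp (-((x + y) * t))) := by
      intro t
      rw [← ENNReal.ofReal_mul (profileTail_nonneg _ _ _),
        ← ENNReal.ofReal_mul (mul_nonneg hx1 hy1)]
      congr 1
      have : Real.exp (-((x + y) * t)) = Real.exp (-(x * t)) * Real.exp (-(y * t)) := by
        rw [← Real.exp_add]; congr 1; ring
      rw [this]
      unfold profileTail
      rw [hfx, hfy]; ring
    simp_rw [h4]
    rw [lintegral_const_mul _ (by fun_prop), lintegral_exp_neg_mul h0,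
      hfx, hfy, ← ENNReal.ofReal_mul (tanhRatio_pos x).le, ← ENNReal.ofReal_mul (mul_nonneg hx1 hy1),
      ← ENNReal.ofReal_add (mul_pos (tanhRatio_pos _) (tanhRatio_pos _)).le
        (mul_nonneg (mul_nonneg hx1 hy1) (by positivity))]
    exact ENNReal.ofReal_le_ofReal h3

/-- Dropping the decay in `η` gives `(1 - f(x))(1 - f(y)) / y ≤ (1 - f(x)) f(y)`, where `f =
tanhRatio` and `x, y` are the rescaled squares. Added to the product part `f(x) f(y)`, this is
`f(y)`: the majorant has the row mass of the original kernel at `η = 0`. -/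
lemma lintegral_profileTail_le (hτ : 0 < τ) (η : ℝ) {η' : ℝ} (hη' : η' ≠ 0) :
    ∫⁻ t in Set.Ioi (0 : ℝ),
      ENNReal.ofReal (profileTail τ t η) * ENNReal.ofReal (profileTail τ t η') ≤
      ENNReal.ofReal (1 - profile τ η) * ENNReal.ofReal (profile τ η') := by
  set y := η' ^ 2 / (4 * τ) with hy
  have hy0 : 0 < y := by positivity
  have hfy : profile τ η' = tanhRatio y := rfl
  have h1 : ∀ t ∈ Set.Ioi (0 : ℝ),
      ENNReal.ofReal (profileTail τ t η) * ENNReal.ofReal (profileTail τ t η') ≤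
      ENNReal.ofReal ((1 - profile τ η) * (1 - profile τ η')) *
        ENNReal.ofReal (Real.exp (-(y * t))) := by
    intro t ht
    rw [← ENNReal.ofReal_mul (profileTail_nonneg _ _ _),
      ← ENNReal.ofReal_mul (mul_nonneg (sub_nonneg.2 (profile_le_one _ _))
        (sub_nonneg.2 (profile_le_one _ _)))]
    apply ENNReal.ofReal_le_ofReal
    have h2 : profileTail τ t η ≤ 1 - profile τ η := by
      refine mul_le_of_le_one_right (sub_nonneg.2 (profile_le_one _ _)) (Real.exp_le_one_iff.2 ?_)
      have : 0 ≤ η ^ 2 / (4 * τ) * t := mul_nonneg (by positivity) (le_of_lt ht)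
      linarith
    calc _ ≤ (1 - profile τ η) * profileTail τ t η' := by
          gcongr; exact profileTail_nonneg _ _ _
      _ = _ := by unfold profileTail; ring
  refine (setLIntegral_mono (by fun_prop) h1).trans ?_
  rw [lintegral_const_mul _ (by fun_prop), lintegral_exp_neg_mul hy0,
    ← ENNReal.ofReal_mul (mul_nonneg (sub_nonneg.2 (profile_le_one _ _))
        (sub_nonneg.2 (profile_le_one _ _))),
    ← ENNReal.ofReal_mul (sub_nonneg.2 (profile_le_one _ _))]
  apply ENNReal.ofReal_le_ofReal
  rw [mul_assoc]
  have h3 : (1 - profile τ η') * (1 / y) ≤ profile τ η' := by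
    rw [mul_one_div, div_le_iff₀ hy0, hfy, mul_comm]
    exact one_sub_tanhRatio_le hy0.le
  have := sub_nonneg.2 (profile_le_one τ η)
  gcongr

lemma integrable_profileTail (hτ : 0 < τ) {t : ℝ} (ht : 0 < t) : Integrable (profileTail τ t) := by
  have hc : Continuous (profileTail τ t) :=
    (continuous_const.sub (continuous_profile τ)).mul (by fun_prop)
  refine (integrable_exp_neg_mul_sq (b := t / (4 * τ)) (by positivity)).mono'
    hc.aestronglyMeasurable (ae_of_all _ fun η => ?_)
  rw [Real.norm_of_nonneg (profileTail_nonneg _ _ _)]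
  refine (profileTail_le_exp _ _ _).trans (le_of_eq ?_)
  congr 1; ring

lemma lintegral_lintegral_lintegral_rotate {m : Measure ℝ} [SFinite m] {A : ℝ × ℝ × ℝ → ℝ≥0∞}
    (hA : Measurable A) :
    ∫⁻ x, ∫⁻ y, ∫⁻ t, A (x, y, t) ∂m = ∫⁻ t, (∫⁻ x, ∫⁻ y, A (x, y, t)) ∂m := by
  have h1 : ∀ x, ∫⁻ y, ∫⁻ t, A (x, y, t) ∂m = ∫⁻ t, (∫⁻ y, A (x, y, t)) ∂m := fun x => by
    have h : Measurable fun z : ℝ × ℝ => A (x, z.1, z.2) := by fun_prop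
    exact lintegral_lintegral_swap h.aemeasurable
  rw [lintegral_congr h1, lintegral_lintegral_swap]
  have h : Measurable fun z : (ℝ × ℝ) × ℝ => A (z.1.1, z.2, z.1.2) := by fun_prop
  exact (h.lintegral_prod_right' (ν := volume)).aemeasurable

lemma lintegral_mul_add_lintegral_mul {m : Measure ℝ} [SFinite m] {P : ℝ → ℝ≥0∞}
    {W F : ℝ → ℝ → ℝ≥0∞} (hP : Measurable P) (hW : Measurable fun z : ℝ × ℝ => W z.1 z.2)
    (hF : Measurable fun z : ℝ × ℝ => F z.1 z.2) :
    ∫⁻ x, ∫⁻ y, (P x * P y + ∫⁻ t, W t x * W t y ∂m) * F x y =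
      (∫⁻ x, ∫⁻ y, P x * P y * F x y) + ∫⁻ t, (∫⁻ x, ∫⁻ y, W t x * W t y * F x y) ∂m := by
  have hA : Measurable fun z : ℝ × ℝ × ℝ => W z.2.2 z.1 * W z.2.2 z.2.1 * F z.1 z.2.1 := by
    have h1 : Measurable fun z : ℝ × ℝ × ℝ => W z.2.2 z.1 :=
      hW.comp (by fun_prop : Measurable fun z : ℝ × ℝ × ℝ => (z.2.2, z.1))
    have h2 : Measurable fun z : ℝ × ℝ × ℝ => W z.2.2 z.2.1 :=
      hW.comp (by fun_prop : Measurable fun z : ℝ × ℝ × ℝ => (z.2.2, z.2.1))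
    have h3 : Measurable fun z : ℝ × ℝ × ℝ => F z.1 z.2.1 :=
      hF.comp (by fun_prop : Measurable fun z : ℝ × ℝ × ℝ => (z.1, z.2.1))
    exact (h1.mul h2).mul h3
  have hPF : Measurable fun z : ℝ × ℝ => P z.1 * P z.2 * F z.1 z.2 :=
    ((hP.comp measurable_fst).mul (hP.comp measurable_snd)).mul hF
  have key := lintegral_lintegral_lintegral_rotate (m := m) hA
  dsimp only at key
  have hPF2 : Measurable fun x => ∫⁻ y, P x * P y * F x y := hPF.lintegral_prod_right'
  rw [← key, ← lintegral_add_left hPF2]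
  refine lintegral_congr fun x => ?_
  have hx : Measurable fun y => P x * P y * F x y := hPF.comp measurable_prodMk_left
  rw [← lintegral_add_left hx]
  refine lintegral_congr fun y => ?_
  have hxy : Measurable fun t => W t x * W t y :=
    (hW.comp measurable_prodMk_right).mul (hW.comp measurable_prodMk_right)
  rw [add_mul, ← lintegral_mul_const _ hxy]

/-- The rank-one inequality is linear in the kernel, so it survives integration over the parameter.
-/
lemma lintegral_mixture_le {m : Measure ℝ} [SFinite m] {p : ℝ → ℝ} {w : ℝ → ℝ → ℝ}
    (hp : Measurable p) (hp1 : ∀ x, p x ≤ 1) (hpi : Integrable p)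
    (hw : Measurable fun z : ℝ × ℝ => w z.1 z.2) (hw1 : ∀ᵐ t ∂m, ∀ x, w t x ≤ 1)
    (hwi : ∀ᵐ t ∂m, Integrable (w t)) {g : ℝ → ℂ} (hgm : Measurable g) (hg : MemLp g 2 volume) :
    2⁻¹ * ∫⁻ x, ∫⁻ y, (ENNReal.ofReal (p x) * ENNReal.ofReal (p y) +
        ∫⁻ t, ENNReal.ofReal (w t x) * ENNReal.ofReal (w t y) ∂m) * ‖g x - g y‖ₑ ^ 2 ≤
      ∫⁻ x, ∫⁻ y, (ENNReal.ofReal (p x) * ENNReal.ofReal (p y) +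
        ∫⁻ t, ENNReal.ofReal (w t x) * ENNReal.ofReal (w t y) ∂m) * ‖g x‖ₑ ^ 2 := by
  have hD : Measurable fun z : ℝ × ℝ => ‖g z.1 - g z.2‖ₑ ^ 2 :=
    ((hgm.comp measurable_fst).sub (hgm.comp measurable_snd)).enorm.pow_const 2
  have hN : Measurable fun z : ℝ × ℝ => ‖g z.1‖ₑ ^ 2 :=
    (hgm.comp measurable_fst).enorm.pow_const 2
  rw [lintegral_mul_add_lintegral_mul (W := fun t x => ENNReal.ofReal (w t x))
      (F := fun x y => ‖g x - g y‖ₑ ^ 2) hp.ennreal_ofReal hw.ennreal_ofReal hD,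
    lintegral_mul_add_lintegral_mul (W := fun t x => ENNReal.ofReal (w t x))
      (F := fun x _ => ‖g x‖ₑ ^ 2) hp.ennreal_ofReal hw.ennreal_ofReal hN,
    mul_add]
  refine add_le_add (lintegral_rank_one_le hp hp1 hpi hgm hg) ?_
  rw [← lintegral_const_mul' _ _ (by simp)]
  refine lintegral_mono_ae ?_
  filter_upwards [hw1, hwi] with t h1 hi
  exact lintegral_rank_one_le (hw.comp measurable_prodMk_left) h1 hi hgm hg

lemma jumpForm_zero_le_mixture (hτ : 0 < τ) {g : ℝ → ℂ} :
    jumpForm τ 0 g ≤ ENNReal.ofReal (1 / (2 * τ)) * (2⁻¹ * ∫⁻ x, ∫⁻ y,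
      (ENNReal.ofReal (profile τ x) * ENNReal.ofReal (profile τ y) + ∫⁻ t in Set.Ioi (0 : ℝ),
        ENNReal.ofReal (profileTail τ t x) * ENNReal.ofReal (profileTail τ t y)) *
          ‖g x - g y‖ₑ ^ 2) := by
  unfold jumpForm
  rw [mul_left_comm, ← lintegral_const_mul' _ _ ENNReal.ofReal_ne_top]
  refine mul_le_mul_right (lintegral_mono fun x => ?_) _
  rw [← lintegral_const_mul' _ _ ENNReal.ofReal_ne_top]
  refine lintegral_mono fun y => ?_
  rw [← mul_assoc]
  exact mul_le_mul_left (jumpKernel_le_majorant hτ x y) _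

/-- Each product kernel costs its row mass only once, and the rows of the majorant have total mass
at most `(2τ)⁻¹ ∫ profile = gapInt`. Hence at zero chemical potential the Dirichlet form never
exceeds the bulk value. -/
lemma jumpForm_zero_le (hτ : 0 < τ) {g : ℝ → ℂ} (hgm : Measurable g) (hg : MemLp g 2 volume) :
    jumpForm τ 0 g ≤ ENNReal.ofReal (gapInt τ 0) * ∫⁻ η, ‖g η‖ₑ ^ 2 := by
  refine (jumpForm_zero_le_mixture hτ).trans ?_
  have hPm : Measurable fun x => ENNReal.ofReal (profile τ x) :=
    (continuous_profile τ).measurable.ennreal_ofReal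
  have h1 : ∀ᵐ t ∂(volume.restrict (Set.Ioi (0 : ℝ))), ∀ x, profileTail τ t x ≤ 1 := by
    filter_upwards [ae_restrict_mem measurableSet_Ioi] with t ht x
    refine (profileTail_le_exp _ _ _).trans (Real.exp_le_one_iff.2 ?_)
    have : 0 ≤ x ^ 2 / (4 * τ) * t := mul_nonneg (by positivity) (le_of_lt ht)
    linarith
  have hi : ∀ᵐ t ∂(volume.restrict (Set.Ioi (0 : ℝ))), Integrable (profileTail τ t) := by
    filter_upwards [ae_restrict_mem measurableSet_Ioi] with t ht using integrable_profileTail hτ ht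
  refine (mul_le_mul_right (lintegral_mixture_le (continuous_profile τ).measurable
    (profile_le_one τ) (integrable_profile hτ) (continuous_profileTail τ).measurable h1 hi hgm hg)
    _).trans ?_
  have h2 : ∫⁻ x, ∫⁻ y, (ENNReal.ofReal (profile τ x) * ENNReal.ofReal (profile τ y) +
        ∫⁻ t in Set.Ioi (0 : ℝ),
          ENNReal.ofReal (profileTail τ t x) * ENNReal.ofReal (profileTail τ t y)) * ‖g x‖ₑ ^ 2 ≤
      ∫⁻ x, ∫⁻ y, ENNReal.ofReal (profile τ y) * ‖g x‖ₑ ^ 2 := by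
    refine lintegral_mono fun x => lintegral_mono_ae ?_
    have h0 : ∀ᵐ y : ℝ, y ≠ 0 := by simp [ae_iff]
    filter_upwards [h0] with y hy
    refine mul_le_mul_left ?_ _
    refine (add_le_add le_rfl (lintegral_profileTail_le hτ x hy)).trans (le_of_eq ?_)
    rw [← add_mul, ← ENNReal.ofReal_add (profile_pos _ _).le (sub_nonneg.2 (profile_le_one _ _))]
    simp
  refine (mul_le_mul_right h2 _).trans (le_of_eq ?_)
  have e : ∫⁻ y, ENNReal.ofReal (profile τ y) = ENNReal.ofReal (2 * τ * gapInt τ 0) := by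
    rw [← integral_profile hτ, ofReal_integral_eq_lintegral_ofReal (integrable_profile hτ)
      (ae_of_all _ fun _ => (profile_pos _ _).le)]
  have e2 : ∀ x, ∫⁻ y, ENNReal.ofReal (profile τ y) * ‖g x‖ₑ ^ 2 =
      ENNReal.ofReal (2 * τ * gapInt τ 0) * ‖g x‖ₑ ^ 2 := fun x => by
    rw [lintegral_mul_const _ hPm, e]
  rw [lintegral_congr e2, lintegral_const_mul _ (hgm.enorm.pow_const 2), ← mul_assoc,
    ← ENNReal.ofReal_mul (by positivity)]
  congr 2
  field_simp

/-- Without chemical potential the problem is scale invariant: substitute `p ↦ s p`. -/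
lemma gapInt_zero_sq_mul (hτ : 0 < τ) {s : ℝ} (hs : 0 < s) :
    gapInt (s ^ 2 * τ) 0 = gapInt τ 0 / s := by
  have h := Measure.integral_comp_mul_left (gap (s ^ 2 * τ) 0) s
  have e : ∀ p, gap (s ^ 2 * τ) 0 (s * p) = gap τ 0 p / s ^ 2 := fun p => by
    unfold gap
    have : ((s * p) ^ 2 - 0) / (s ^ 2 * τ) = (p ^ 2 - 0) / τ := by field_simp; ring
    rw [this]; field_simp
  simp_rw [e] at h
  rw [integral_div, abs_of_pos (inv_pos.2 hs), smul_eq_mul] at h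
  unfold gapInt
  field_simp at h ⊢
  linarith

lemma kern_le_exp_mul_kern_zero (hτ : 0 < τ) (hν : 0 ≤ ν) (p q : ℝ) :
    kern τ ν p q ≤ Real.exp (2 * (ν / τ)) * kern τ 0 p q := by
  unfold kern
  rw [← mul_div_assoc]
  gcongr
  have e : ∀ x : ℝ, |(x - ν) / τ - (x - 0) / τ| ≤ ν / τ := fun x => by
    rw [← sub_div, abs_div, abs_of_pos hτ]; gcongr; simp [abs_of_nonneg hν]
  exact pairWeight_le_exp_mul (e _) (e _)

lemma gap_zero_le_exp_mul_gap (hτ : 0 < τ) (hν : 0 ≤ ν) (p : ℝ) :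
    gap τ 0 p ≤ Real.exp (2 * (ν / τ)) * gap τ ν p := by
  rw [← kern_self, ← kern_self]
  unfold kern
  rw [← mul_div_assoc]
  gcongr
  have e : ∀ x : ℝ, |(x - 0) / τ - (x - ν) / τ| ≤ ν / τ := fun x => by
    rw [← sub_div, abs_div, abs_of_pos hτ]; gcongr; simp [abs_of_nonneg hν]
  exact pairWeight_le_exp_mul (e _) (e _)

lemma jumpForm_le_exp_mul_jumpForm_zero (hτ : 0 < τ) (hν : 0 ≤ ν) (g : ℝ → ℂ) :
    jumpForm τ ν g ≤ ENNReal.ofReal (Real.exp (2 * (ν / τ))) * jumpForm τ 0 g := by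
  unfold jumpForm
  rw [mul_left_comm, ← lintegral_const_mul' _ _ ENNReal.ofReal_ne_top]
  refine mul_le_mul_right (lintegral_mono fun x => ?_) _
  rw [← lintegral_const_mul' _ _ ENNReal.ofReal_ne_top]
  refine lintegral_mono fun y => ?_
  rw [← mul_assoc, ← ENNReal.ofReal_mul (Real.exp_pos _).le]
  refine mul_le_mul_left (ENNReal.ofReal_le_ofReal ?_) _
  unfold jumpKernel
  rw [← mul_div_assoc]
  gcongr
  exact kern_le_exp_mul_kern_zero hτ hν _ _

/-- Removing `ν` from the form at temperature `s² τ` and restoring it in `gapInt` at `τ` costs at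
most `exp (4 ν / τ)`, while scaling at `ν = 0` gains `1 / s`. The lower bound on `τ` makes the cost
at most `s`. -/
lemma jumpForm_le_of_le_temperature (hν : 0 ≤ ν) {s : ℝ} (hs : 1 < s) (hτ : 0 < τ)
    (h : 4 * ν / Real.log s ≤ τ) {g : ℝ → ℂ} (hgm : Measurable g) (hg : MemLp g 2 volume) :
    jumpForm (s ^ 2 * τ) ν g ≤ ENNReal.ofReal (gapInt τ ν) * ∫⁻ η, ‖g η‖ₑ ^ 2 := by
  have hs0 : 0 < s := by linarith
  have hl : 0 < Real.log s := Real.log_pos hs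
  have hτ' : 0 < s ^ 2 * τ := by positivity
  refine (jumpForm_le_exp_mul_jumpForm_zero hτ' hν g).trans ?_
  refine (mul_le_mul_right (jumpForm_zero_le hτ' hgm hg) _).trans ?_
  rw [← mul_assoc, ← ENNReal.ofReal_mul (Real.exp_pos _).le]
  gcongr
  rw [gapInt_zero_sq_mul hτ hs0]
  have h1 : gapInt τ 0 ≤ Real.exp (2 * (ν / τ)) * gapInt τ ν := by
    unfold gapInt
    rw [← integral_const_mul]
    exact integral_mono (integrable_gap hτ le_rfl) ((integrable_gap hτ hν).const_mul _)
      fun p => gap_zero_le_exp_mul_gap hτ hν p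
  have h2 : Real.exp (2 * (ν / (s ^ 2 * τ))) ≤ Real.exp (2 * (ν / τ)) := by
    apply Real.exp_le_exp.2
    have : τ ≤ s ^ 2 * τ := le_mul_of_one_le_left hτ.le (by nlinarith)
    gcongr
  have h3 : Real.exp (2 * (ν / τ)) * Real.exp (2 * (ν / τ)) ≤ s := by
    rw [← Real.exp_add, ← Real.le_log_iff_exp_le hs0]
    rw [div_le_iff₀ hl] at h
    rw [← mul_le_mul_iff_left₀ hτ]
    calc _ = 4 * ν := by field_simp; ring
      _ ≤ _ := by linarith
  have hg0 := gapInt_pos hτ hν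
  calc _ ≤ Real.exp (2 * (ν / τ)) * (Real.exp (2 * (ν / τ)) * gapInt τ ν / s) := by
        gcongr
        exact div_nonneg (gapInt_pos hτ le_rfl).le hs0.le
    _ = (Real.exp (2 * (ν / τ)) * Real.exp (2 * (ν / τ))) * gapInt τ ν / s := by ring
    _ ≤ s * gapInt τ ν / s := by gcongr
    _ = gapInt τ ν := by field_simp

end HighTemperature

/-! ### Low temperature: the Schur test and pointwise kernel bounds. -/

section LowTemperature

variable {τ ν : ℝ}

lemma add_sq_le_weighted {a b t t' : ℝ} (ha : 0 ≤ a) (hb : 0 ≤ b) (ht : 0 ≤ t) (ht' : 0 ≤ t')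
    (h : 1 ≤ t * t') : (a + b) ^ 2 ≤ (1 + t) * a ^ 2 + (1 + t') * b ^ 2 := by
  have h1 : 1 ≤ √t * √t' := by
    rw [← Real.sqrt_mul ht, ← Real.sqrt_one]
    exact Real.sqrt_le_sqrt (by simpa using h)
  have h2 := sq_nonneg (a * √t - b * √t')
  have h3 := Real.sq_sqrt ht
  have h4 := Real.sq_sqrt ht'
  have h5 : a * b * 1 ≤ a * b * (√t * √t') := by gcongr
  nlinarith

/-- The Schur test. -/
lemma lintegral_le_of_schur {K T D : ℝ → ℝ → ℝ≥0∞} {F : ℝ → ℝ≥0∞}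
    (hK : Measurable fun z : ℝ × ℝ => K z.1 z.2) (hT : Measurable fun z : ℝ × ℝ => T z.1 z.2)
    (hF : Measurable F) (hKs : ∀ x y, K x y = K y x)
    (hD : ∀ᵐ x, ∀ᵐ y, D x y ≤ T x y * F x + T y x * F y) {M : ℝ≥0∞}
    (hM : ∀ᵐ x, ∫⁻ y, K x y * T x y ≤ M) :
    2⁻¹ * ∫⁻ x, ∫⁻ y, K x y * D x y ≤ M * ∫⁻ x, F x := by
  have hKT : Measurable fun z : ℝ × ℝ => K z.1 z.2 * T z.1 z.2 := hK.mul hT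
  have hG : Measurable fun z : ℝ × ℝ => K z.1 z.2 * T z.1 z.2 * F z.1 :=
    hKT.mul (hF.comp measurable_fst)
  have h1 : ∫⁻ x, ∫⁻ y, K x y * D x y ≤
      ∫⁻ x, ∫⁻ y, (K x y * T x y * F x + K y x * T y x * F y) := by
    refine lintegral_mono_ae ?_
    filter_upwards [hD] with x hx
    refine lintegral_mono_ae ?_
    filter_upwards [hx] with y hxy
    refine (mul_le_mul_right hxy _).trans (le_of_eq ?_)
    rw [hKs y x]
    ring
  have h2 : ∫⁻ x, ∫⁻ y, (K x y * T x y * F x + K y x * T y x * F y) =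
      2 * ∫⁻ x, ∫⁻ y, K x y * T x y * F x := by
    have e : ∀ x, ∫⁻ y, (K x y * T x y * F x + K y x * T y x * F y) =
        (∫⁻ y, K x y * T x y * F x) + ∫⁻ y, K y x * T y x * F y := fun x =>
      lintegral_add_left (hG.comp measurable_prodMk_left) _
    have hm : Measurable fun x => ∫⁻ y, K x y * T x y * F x := hG.lintegral_prod_right'
    rw [lintegral_congr e, lintegral_add_left hm,
      lintegral_lintegral_swap (f := fun x y => K y x * T y x * F y)
        (hG.comp measurable_swap).aemeasurable, two_mul]
  rw [h2] at h1
  refine (mul_le_mul_right h1 _).trans ?_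
  rw [← mul_assoc, ENNReal.inv_mul_cancel (by simp) (by simp), one_mul, ← lintegral_const_mul _ hF]
  refine lintegral_mono_ae ?_
  filter_upwards [hM] with x hx
  have hKx : Measurable fun y => K x y * T x y := hKT.comp measurable_prodMk_left
  rw [lintegral_mul_const _ hKx]
  gcongr

/-- Weighted AM-GM: `|g x - g y|² ≤ (1 + t x y)|g x|² + (1 + t y x)|g y|²` once `t x y · t y x ≥ 1`.
The form is then bounded by the largest row mass of `C (1 + t)`; the term `1` is unavoidable, and
`t` is to be small where rows are nearly saturated. -/
lemma jumpForm_le_schur {t : ℝ → ℝ → ℝ} (htm : Measurable fun z : ℝ × ℝ => t z.1 z.2)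
    (ht : ∀ x y, 0 ≤ t x y) (htt : ∀ᵐ x, ∀ᵐ y, 1 ≤ t x y * t y x) {M : ℝ≥0∞}
    (hM : ∀ᵐ x, ∫⁻ y, ENNReal.ofReal (jumpKernel τ ν x y) * ENNReal.ofReal (1 + t x y) ≤ M)
    {g : ℝ → ℂ} (hgm : Measurable g) : jumpForm τ ν g ≤ M * ∫⁻ x, ‖g x‖ₑ ^ 2 := by
  have hT : Measurable fun z : ℝ × ℝ => ENNReal.ofReal (1 + t z.1 z.2) :=
    (measurable_const.add htm).ennreal_ofReal
  refine lintegral_le_of_schur (K := fun x y => ENNReal.ofReal (jumpKernel τ ν x y))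
    (T := fun x y => ENNReal.ofReal (1 + t x y)) (measurable_jumpKernel τ ν) hT
    (hgm.enorm.pow_const 2) (fun x y => by rw [jumpKernel_comm]) ?_ hM
  filter_upwards [htt] with x hx
  filter_upwards [hx] with y hxy
  have ha := ht x y
  have hb := ht y x
  rw [← ofReal_norm, ← ofReal_norm, ← ofReal_norm, ← ENNReal.ofReal_pow (norm_nonneg _),
    ← ENNReal.ofReal_pow (norm_nonneg _), ← ENNReal.ofReal_pow (norm_nonneg _),
    ← ENNReal.ofReal_mul (by positivity), ← ENNReal.ofReal_mul (by positivity),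
    ← ENNReal.ofReal_add (by positivity) (by positivity)]
  refine ENNReal.ofReal_le_ofReal (le_trans ?_ (add_sq_le_weighted (norm_nonneg (g x))
    (norm_nonneg (g y)) ha hb hxy))
  gcongr
  exact norm_sub_le _ _

/-- The Hilbert-type kernel with Schur weight. -/
def hilbertWeight (s u : ℝ) : ℝ := √s / (√u * (s + u))

/-- `2 arctan √(u/s)` is an antiderivative. That the value does not depend on `s` is what makes the
square-root weights right for the kernel `1/(s + u)`. -/
lemma lintegral_hilbertWeight {s : ℝ} (hs : 0 < s) :
    ∫⁻ u in Set.Ioi (0 : ℝ), ENNReal.ofReal (hilbertWeight s u) = ENNReal.ofReal Real.pi := by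
  have hd : ∀ u ∈ Set.Ioi (0 : ℝ),
      HasDerivAt (fun u => 2 * Real.arctan (√(u / s))) (hilbertWeight s u) u := by
    intro u hu
    have hu : 0 < u := hu
    have h1 : HasDerivAt (fun u : ℝ => u / s) (1 / s) u := (hasDerivAt_id u).div_const s
    have h2 := ((h1.sqrt (by positivity)).arctan).const_mul 2
    refine h2.congr_deriv ?_
    unfold hilbertWeight
    rw [Real.sq_sqrt (by positivity), Real.sqrt_div hu.le]
    have := Real.sqrt_pos.2 hs
    have := Real.sqrt_pos.2 hu
    field_simp
  have hpos : ∀ u ∈ Set.Ioi (0 : ℝ), 0 ≤ hilbertWeight s u := fun u hu => by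
    have hu : 0 < u := hu
    unfold hilbertWeight; positivity
  have hc : Continuous fun u => 2 * Real.arctan (√(u / s)) := by fun_prop
  have hlim : Tendsto (fun u => 2 * Real.arctan (√(u / s))) atTop (𝓝 Real.pi) := by
    have h1 : Tendsto (fun u : ℝ => √(u / s)) atTop atTop :=
      Real.tendsto_sqrt_atTop.comp (tendsto_id.atTop_div_const hs)
    have h2 := (Real.tendsto_arctan_atTop.mono_right nhdsWithin_le_nhds).comp h1
    have h3 := h2.const_mul 2
    have e : 2 * (Real.pi / 2) = Real.pi := by ring
    rw [e] at h3
    exact h3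
  have hi := integrableOn_Ioi_deriv_of_nonneg hc.continuousWithinAt hd hpos hlim
  have hv := integral_Ioi_of_hasDerivAt_of_nonneg hc.continuousWithinAt hd hpos hlim
  rw [← ofReal_integral_eq_lintegral_ofReal hi, hv]
  · simp
  · filter_upwards [ae_restrict_mem measurableSet_Ioi] with u hu using hpos u hu

lemma lintegral_comp_abs_eq (F : ℝ → ℝ≥0∞) :
    ∫⁻ x, F |x| = 2 * ∫⁻ x in Set.Ioi (0 : ℝ), F x := by
  rw [← lintegral_add_compl (fun x => F |x|) (measurableSet_Ioi (a := (0 : ℝ))), Set.compl_Ioi,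
    two_mul]
  congr 1
  · exact setLIntegral_congr_fun measurableSet_Ioi fun x hx => by rw [abs_of_pos hx]
  · have h := (Measure.measurePreserving_neg (volume : Measure ℝ)).setLIntegral_comp_preimage_emb
      (Homeomorph.neg ℝ).measurableEmbedding (fun x => F |x|) (Set.Iic 0)
    rw [← h]
    have e : (fun x : ℝ => -x) ⁻¹' Set.Iic 0 = Set.Ici 0 := by ext; simp
    have e' : (Neg.neg : ℝ → ℝ) ⁻¹' Set.Iic 0 = Set.Ici 0 := e
    rw [e', setLIntegral_congr Ioi_ae_eq_Ici.symm]
    exact setLIntegral_congr_fun measurableSet_Ioi fun x hx => by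
      simp only [abs_neg, abs_of_pos (show 0 < x from hx)]

/-- The map `x ↦ ||x| - k|` takes each positive value at most four times and has unit slope. -/
lemma lintegral_comp_abs_abs_sub_le (F : ℝ → ℝ≥0∞) (k : ℝ) :
    ∫⁻ x, F |(|x| - k)| ≤ 4 * ∫⁻ x in Set.Ioi (0 : ℝ), F x := by
  rw [lintegral_comp_abs_eq (fun x => F |x - k|)]
  calc _ ≤ 2 * ∫⁻ x, F |x - k| := mul_le_mul_right (setLIntegral_le_lintegral _ _) _
    _ = 2 * ∫⁻ x, F |x| := by rw [lintegral_sub_right_eq_self (fun x => F |x|) k]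
    _ = _ := by rw [lintegral_comp_abs_eq, ← mul_assoc]; norm_num

/-- With `p, q` the half sum and half difference, `x y` is the difference of the energies `p² - ν`
and `q² - ν`; in the next lemma their sum plays the same role. Neither bound depends on the
temperature. -/
lemma jumpKernel_mul_abs_mul_le (hτ : 0 < τ) (x y : ℝ) :
    jumpKernel τ ν x y * |x * y| ≤ 1 := by
  have h := kern_mul_le (ν := ν) hτ ((x + y) / 2) ((x - y) / 2)
  have h1 : |x * y| ≤ |((x + y) / 2) ^ 2 - ν| + |((x - y) / 2) ^ 2 - ν| := by
    have e : x * y = (((x + y) / 2) ^ 2 - ν) - (((x - y) / 2) ^ 2 - ν) := by ring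
    rw [e]; exact abs_sub _ _
  have hk := kern_pos (ν := ν) hτ ((x + y) / 2) ((x - y) / 2)
  unfold jumpKernel
  have := mul_le_mul_of_nonneg_left h1 hk.le
  linarith

lemma jumpKernel_mul_abs_sq_le (hτ : 0 < τ) (x y : ℝ) :
    jumpKernel τ ν x y * (|x ^ 2 + y ^ 2 - 4 * ν| / 2) ≤ 1 := by
  have h := kern_mul_le (ν := ν) hτ ((x + y) / 2) ((x - y) / 2)
  have h1 : |x ^ 2 + y ^ 2 - 4 * ν| / 2 ≤ |((x + y) / 2) ^ 2 - ν| + |((x - y) / 2) ^ 2 - ν| := by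
    have e : |x ^ 2 + y ^ 2 - 4 * ν| / 2 =
        |(((x + y) / 2) ^ 2 - ν) + (((x - y) / 2) ^ 2 - ν)| := by
      rw [show (((x + y) / 2) ^ 2 - ν) + (((x - y) / 2) ^ 2 - ν) = (x ^ 2 + y ^ 2 - 4 * ν) / 2 by
        ring, abs_div, abs_two]
    rw [e]; exact abs_add_le _ _
  have hk := kern_pos (ν := ν) hτ ((x + y) / 2) ((x - y) / 2)
  unfold jumpKernel
  have := mul_le_mul_of_nonneg_left h1 hk.le
  linarith

/-- In units with `2√ν = 1`: in the sector `0 ≤ a ≤ b` the right side vanishes only at `(0, 1)`, and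
does so linearly there. -/
lemma fifth_le_max {a b : ℝ} (ha : 0 ≤ a) (hab : a ≤ b) :
    (a + |b - 1|) / 5 ≤ max (a * b) (|a ^ 2 + b ^ 2 - 1| / 2) := by
  rw [le_max_iff]
  rcases le_total 1 b with hb | hb
  · rw [abs_of_nonneg (by linarith)]
    rcases le_total (b - 1) a with h | h
    · left; nlinarith
    · right
      have : a ^ 2 + b ^ 2 - 1 ≤ |a ^ 2 + b ^ 2 - 1| := le_abs_self _
      nlinarith
  · rw [abs_of_nonpos (by linarith)]
    have h0 : -(a ^ 2 + b ^ 2 - 1) ≤ |a ^ 2 + b ^ 2 - 1| := neg_le_abs _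
    rcases le_total b (1 / 2) with h2 | h2
    · right; nlinarith
    · rcases le_total (2 * (1 - b)) (3 * a) with h | h
      · left; nlinarith
      · right
        have : a ^ 2 ≤ (2 / 3 * (1 - b)) ^ 2 := by gcongr; linarith
        nlinarith

/-- The two energy bounds leave only the singular points `(0, ±2√ν)` in this sector, and there the
kernel is at most of Hilbert type `1 / (|x| + ||y| - 2√ν|)`, uniformly in the temperature. -/
lemma jumpKernel_mul_le_five (hτ : 0 < τ) (hν : 0 < ν) {x y : ℝ} (h : |x| ≤ |y|) :
    jumpKernel τ ν x y * (|x| + |(|y| - 2 * √ν)|) ≤ 5 / (2 * √ν) := by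
  set k := 2 * √ν with hk
  have hk0 : 0 < k := by positivity
  have hk2 : k ^ 2 = 4 * ν := by rw [hk, mul_pow, Real.sq_sqrt hν.le]; norm_num
  have h5 := fifth_le_max (a := |x| / k) (b := |y| / k) (by positivity) (by gcongr)
  have e1 : |x| / k + |(|y| / k - 1)| = (|x| + |(|y| - k)|) / k := by
    have : |y| / k - 1 = (|y| - k) / k := by rw [sub_div, div_self hk0.ne']
    rw [add_div, this, abs_div, abs_of_pos hk0]
  have e2 : |x| / k * (|y| / k) = |x * y| / k ^ 2 := by rw [abs_mul]; ring
  have e3 : |(|x| / k) ^ 2 + (|y| / k) ^ 2 - 1| = |x ^ 2 + y ^ 2 - 4 * ν| / k ^ 2 := by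
    have : (|x| / k) ^ 2 + (|y| / k) ^ 2 - 1 = (x ^ 2 + y ^ 2 - 4 * ν) / k ^ 2 := by
      rw [div_pow, div_pow, sq_abs, sq_abs, ← hk2, sub_div, add_div, div_self (pow_pos hk0 2).ne']
    rw [this, abs_div, abs_of_pos (pow_pos hk0 2)]
  rw [e1, e2, e3] at h5
  have hC := jumpKernel_pos (ν := ν) hτ x y
  have h6 : |x| + |(|y| - k)| ≤ 5 / k * max |x * y| (|x ^ 2 + y ^ 2 - 4 * ν| / 2) := by
    have : max (|x * y| / k ^ 2) (|x ^ 2 + y ^ 2 - 4 * ν| / k ^ 2 / 2) =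
        max |x * y| (|x ^ 2 + y ^ 2 - 4 * ν| / 2) / k ^ 2 := by
      rw [← max_div_div_right (pow_pos hk0 2).le]; congr 1; ring
    rw [this, div_div, div_le_div_iff₀ (by positivity) (by positivity)] at h5
    rw [div_mul_eq_mul_div, le_div_iff₀ hk0]
    rw [← mul_le_mul_iff_left₀ hk0]
    linarith
  have h7 : jumpKernel τ ν x y * max |x * y| (|x ^ 2 + y ^ 2 - 4 * ν| / 2) ≤ 1 := by
    rcases max_choice |x * y| (|x ^ 2 + y ^ 2 - 4 * ν| / 2) with h | h <;> rw [h]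
    · exact jumpKernel_mul_abs_mul_le hτ x y
    · exact jumpKernel_mul_abs_sq_le hτ x y
  calc _ ≤ jumpKernel τ ν x y * (5 / k * max |x * y| (|x ^ 2 + y ^ 2 - 4 * ν| / 2)) := by gcongr
    _ = 5 / k * (jumpKernel τ ν x y * max |x * y| (|x ^ 2 + y ^ 2 - 4 * ν| / 2)) := by ring
    _ ≤ 5 / k * 1 := by gcongr
    _ = _ := mul_one _

lemma jumpKernel_le_of_abs_le (hτ : 0 < τ) (hν : 0 < ν) {x y : ℝ} (hx : x ^ 2 ≤ ν / 2)
    (hy : y ^ 2 ≤ ν / 2) : jumpKernel τ ν x y ≤ 1 / ν := by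
  have h := jumpKernel_mul_abs_sq_le (ν := ν) hτ x y
  have hC := jumpKernel_pos (ν := ν) hτ x y
  rw [le_div_iff₀ hν]
  have : ν ≤ |x ^ 2 + y ^ 2 - 4 * ν| / 2 := by
    have := neg_le_abs (x ^ 2 + y ^ 2 - 4 * ν)
    linarith
  exact (mul_le_mul_of_nonneg_left this hC.le).trans h

/-- Away from both axes the product bound applies for bounded `y` and the sum bound for large `y`.
The Lorentzian majorant is independent of the temperature. -/
lemma jumpKernel_le_of_le_abs (hτ : 0 < τ) (hν : 0 < ν) {δ : ℝ} (hδ : 0 < δ) {x y : ℝ}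
    (hx : δ ≤ |x|) (hy : δ ≤ |y|) :
    jumpKernel τ ν x y ≤ ((1 + 8 * ν) / δ ^ 2 + 4 + 1 / (2 * ν)) * (1 + y ^ 2)⁻¹ := by
  have hC := jumpKernel_pos (ν := ν) hτ x y
  rw [← div_eq_mul_inv, le_div_iff₀ (by positivity)]
  rcases le_total (y ^ 2) (8 * ν) with h | h
  · have h1 := jumpKernel_mul_abs_mul_le (ν := ν) hτ x y
    have h2 : δ ^ 2 ≤ |x * y| := by rw [abs_mul, sq]; gcongr
    have h3 : jumpKernel τ ν x y ≤ 1 / δ ^ 2 := by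
      rw [le_div_iff₀ (by positivity)]
      exact (mul_le_mul_of_nonneg_left h2 hC.le).trans h1
    calc _ ≤ 1 / δ ^ 2 * (1 + 8 * ν) := by gcongr
      _ = (1 + 8 * ν) / δ ^ 2 := by ring
      _ ≤ _ := by
        have : 0 < 1 / (2 * ν) := by positivity
        linarith
  · have h1 := jumpKernel_mul_abs_sq_le (ν := ν) hτ x y
    have h2 : y ^ 2 / 4 ≤ |x ^ 2 + y ^ 2 - 4 * ν| / 2 := by
      have := le_abs_self (x ^ 2 + y ^ 2 - 4 * ν)
      nlinarith [sq_nonneg x]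
    have h3 : jumpKernel τ ν x y * (y ^ 2 / 4) ≤ 1 :=
      (mul_le_mul_of_nonneg_left h2 hC.le).trans h1
    have h4 : jumpKernel τ ν x y ≤ 1 / (2 * ν) := by
      rw [le_div_iff₀ (by positivity)]
      have : 2 * ν ≤ y ^ 2 / 4 := by linarith
      exact (mul_le_mul_of_nonneg_left this hC.le).trans h3
    have : 0 ≤ (1 + 8 * ν) / δ ^ 2 := by positivity
    linarith

end LowTemperature

/-! ### Low temperature: gain of the gap integral, deficit of the outer rows, choice of weights. -/

section LowTemperature

variable {τ ν : ℝ}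

lemma strictMono_tanh : StrictMono Real.tanh :=
  strictMono_of_deriv_pos fun x => by rw [(hasDerivAt_tanh x).deriv]; exact sechSq_pos x

lemma exists_tanhRatio_sub_ge {s : ℝ} (hs : 1 < s) :
    ∃ c : ℝ, 0 < c ∧ ∀ x ∈ Set.Icc (0 : ℝ) 1, c ≤ tanhRatio x - tanhRatio (x / s) / s := by
  have hs0 : 0 < s := by linarith
  have hc : Continuous fun x => tanhRatio x - tanhRatio (x / s) / s := by
    have h : Continuous fun x : ℝ => x / s := by fun_prop
    have h2 := continuous_tanhRatio.comp h
    exact continuous_tanhRatio.sub (h2.div_const s)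
  obtain ⟨x₀, hx₀, hmin⟩ := isCompact_Icc.exists_isMinOn
    (Set.nonempty_Icc.2 (zero_le_one' ℝ)) hc.continuousOn
  refine ⟨_, ?_, fun x hx => hmin hx⟩
  rcases hx₀.1.eq_or_lt with h | h
  · show 0 < tanhRatio x₀ - tanhRatio (x₀ / s) / s
    rw [← h, zero_div, tanhRatio_zero, sub_pos, div_lt_one hs0]
    exact hs
  · have h1 : Real.tanh (x₀ / s) < Real.tanh x₀ := strictMono_tanh (div_lt_self h hs)
    rw [← mul_tanhRatio, ← mul_tanhRatio] at h1
    have h2 : x₀ * (tanhRatio (x₀ / s) / s) < x₀ * tanhRatio x₀ := by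
      calc _ = x₀ / s * tanhRatio (x₀ / s) := by ring
        _ < _ := h1
    have := lt_of_mul_lt_mul_left h2 h.le
    linarith

/-- Within distance of order `τ` of a Fermi point, `gap` drops by at least a constant over `τ` when
the temperature is multiplied by `s`. Height times width is independent of `τ`. -/
lemma exists_gapInt_add_le (hν : 0 < ν) {s : ℝ} (hs : 1 < s) :
    ∃ c : ℝ, 0 < c ∧ ∃ τ₁ : ℝ, 0 < τ₁ ∧ ∀ τ : ℝ, 0 < τ → τ ≤ τ₁ →
      gapInt (s * τ) ν + c ≤ gapInt τ ν := by
  obtain ⟨c, hc, hcx⟩ := exists_tanhRatio_sub_ge hs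
  have hs0 : 0 < s := by linarith
  set k := 2 * √ν with hk
  have hsν : 0 < √ν := Real.sqrt_pos.2 hν
  have hk0 : 0 < k := by positivity
  have hν2 := Real.sq_sqrt hν.le
  -- The window has width `τ/(2k)`; `τ ≤ 2k²` keeps `p + √ν ≤ 2k` on it, hence `0 ≤ p² - ν ≤ τ`.
  refine ⟨c / (2 * k), by positivity, 2 * k ^ 2, by positivity, fun τ hτ hτ1 => ?_⟩
  have hsτ : 0 < s * τ := by positivity
  have hle : τ ≤ s * τ := le_mul_of_one_le_left hτ.le hs.le
  set I : Set ℝ := Set.Icc (√ν) (√ν + τ / (2 * k)) with hI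
  have hd : Integrable fun p => gap τ ν p - gap (s * τ) ν p :=
    (integrable_gap hτ hν.le).sub (integrable_gap hsτ hν.le)
  have h1 : ∀ p ∈ I, c / τ ≤ gap τ ν p - gap (s * τ) ν p := by
    intro p hp
    have hp1 : √ν ≤ p := hp.1
    have hp2 : p - √ν ≤ τ / (2 * k) := by linarith [hp.2]
    have hp3 : p - √ν ≤ k := hp2.trans (by rw [div_le_iff₀ (by positivity)]; nlinarith)
    have hx : p ^ 2 - ν = (p - √ν) * (p + √ν) := by ring_nf; rw [hν2]
    have hx0 : 0 ≤ p ^ 2 - ν := by rw [hx]; exact mul_nonneg (by linarith) (by linarith)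
    have hx1 : p ^ 2 - ν ≤ τ := by
      rw [hx]
      calc _ ≤ τ / (2 * k) * (2 * k) := by
            gcongr
            · linarith
            · linarith
        _ = τ := by field_simp
    have := hcx ((p ^ 2 - ν) / τ) ⟨by positivity, (div_le_one hτ).2 hx1⟩
    unfold gap
    calc c / τ ≤ (tanhRatio ((p ^ 2 - ν) / τ) - tanhRatio ((p ^ 2 - ν) / τ / s) / s) / τ := by
          gcongr
      _ = _ := by rw [sub_div, div_div, div_div, mul_comm τ s]
  have h2 : c / (2 * k) ≤ ∫ p in I, (gap τ ν p - gap (s * τ) ν p) := by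
    have hv : volume.real I = τ / (2 * k) := by
      rw [hI, Real.volume_real_Icc_of_le (by linarith [show 0 < τ / (2 * k) by positivity])]; ring
    calc c / (2 * k) = ∫ _ in I, c / τ := by
          rw [setIntegral_const, hv, smul_eq_mul]; field_simp
      _ ≤ _ := setIntegral_mono_on (integrableOn_const (by simp [hI])) hd.integrableOn
          measurableSet_Icc h1
  have h3 : ∫ p in I, (gap τ ν p - gap (s * τ) ν p) ≤ ∫ p, (gap τ ν p - gap (s * τ) ν p) :=
    setIntegral_le_integral hd (ae_of_all _ fun p => sub_nonneg.2 (gap_anti hτ hle p))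
  rw [integral_sub (integrable_gap hτ hν.le) (integrable_gap hsτ hν.le)] at h3
  unfold gapInt
  linarith

/-- The part of `gapInt` that comes from a neighbourhood of a Fermi point. -/
def fermiGapInt (τ ν δ : ℝ) : ℝ := ∫ p in Set.Icc (-√ν) (-√ν + δ / 2), gap τ ν p

/-- Near the Fermi point `gap` is at least `1/(k u + τ)` with `u` the distance and `k = 2√ν`, so the
integral diverges logarithmically. -/
lemma tendsto_fermiGapInt (hν : 0 < ν) {δ : ℝ} (hδ : 0 < δ) (hδν : δ ≤ 2 * √ν) :
    Tendsto (fun τ => fermiGapInt τ ν δ) (𝓝[>] 0) atTop := by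
  have hsν : 0 < √ν := Real.sqrt_pos.2 hν
  have hν2 := Real.sq_sqrt hν.le
  set k := 2 * √ν with hk
  have hk0 : 0 < k := by positivity
  have hlow : ∀ τ : ℝ, 0 < τ → k⁻¹ * Real.log ((k * (δ / 2) + τ) / τ) ≤ fermiGapInt τ ν δ := by
    intro τ hτ
    have h1 : ∫ u in (0 : ℝ)..(δ / 2), (k * u + τ)⁻¹ =
        k⁻¹ * Real.log ((k * (δ / 2) + τ) / τ) := by
      rw [intervalIntegral.integral_comp_mul_add (fun x => x⁻¹) hk0.ne' τ, mul_zero, zero_add,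
        integral_inv_of_pos hτ (by positivity), smul_eq_mul]
    have h2 : fermiGapInt τ ν δ = ∫ u in (0 : ℝ)..(δ / 2), gap τ ν (u - √ν) := by
      rw [intervalIntegral.integral_comp_sub_right (gap τ ν), zero_sub, fermiGapInt,
        intervalIntegral.integral_of_le (by linarith), integral_Icc_eq_integral_Ioc]
      congr 2; ring_nf
    rw [← h1, h2]
    refine intervalIntegral.integral_mono_on (by positivity) ?_ ?_ fun u hu => ?_
    · refine ContinuousOn.intervalIntegrable_of_Icc (by positivity) ?_
      refine ContinuousOn.inv₀ (by fun_prop) fun u hu => ?_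
      have := hu.1
      positivity
    · exact ((continuous_gap τ ν).comp (by fun_prop : Continuous fun u : ℝ => u - √ν)).intervalIntegrable _ _
    · refine le_trans ?_ (gap_ge hτ (u - √ν))
      have hu0 := hu.1
      have e : (u - √ν) ^ 2 - ν = -(u * (k - u)) := by ring_nf; rw [hν2]; ring
      rw [e, abs_neg, abs_of_nonneg (mul_nonneg hu0 (by linarith [hu.2]))]
      have : u * (k - u) ≤ k * u := by nlinarith
      apply inv_anti₀
      · have := mul_nonneg hu0 (show 0 ≤ k - u by linarith [hu.2])
        linarith
      · linarith
  have hnb : ∀ᶠ τ : ℝ in 𝓝[>] 0, k⁻¹ * Real.log ((k * (δ / 2) + τ) / τ) ≤ fermiGapInt τ ν δ := by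
    filter_upwards [self_mem_nhdsWithin] with τ hτ using hlow τ hτ
  refine tendsto_atTop_mono' _ hnb ?_
  refine Tendsto.const_mul_atTop (inv_pos.2 hk0) (Real.tendsto_log_atTop.comp ?_)
  have h3 : Tendsto (fun τ : ℝ => k * (δ / 2) * τ⁻¹) (𝓝[>] 0) atTop :=
    tendsto_inv_nhdsGT_zero.const_mul_atTop (by positivity)
  refine tendsto_atTop_mono' _ ?_ h3
  filter_upwards [self_mem_nhdsWithin] with τ hτ
  have hτ : 0 < τ := hτ
  rw [add_div, div_self hτ.ne', div_eq_mul_inv _ τ]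
  linarith

lemma fermiGapInt_le_gapInt (hτ : 0 < τ) (hν : 0 ≤ ν) (δ : ℝ) : fermiGapInt τ ν δ ≤ gapInt τ ν :=
  setIntegral_le_integral (integrable_gap hτ hν) (ae_of_all _ fun p => (gap_pos hτ p).le)

lemma tendsto_gapInt_nhdsGT_zero (hν : 0 < ν) : Tendsto (fun τ => gapInt τ ν) (𝓝[>] 0) atTop := by
  have hsν : 0 < √ν := Real.sqrt_pos.2 hν
  refine tendsto_atTop_mono' _ ?_ (tendsto_fermiGapInt hν hsν (by linarith))
  filter_upwards [self_mem_nhdsWithin] with τ hτ using fermiGapInt_le_gapInt hτ hν.le _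

/-- When `p` is near the Fermi point `-√ν` and the total momentum is at least `δ`, the partner `x -
p` stays off the Fermi surface: its energy is at least `δ√ν`. The kernel is then bounded on a window
of length `δ/2`, and half of the divergent mass `fermiGapInt` is missing from the row. -/
lemma integral_jumpKernel_add_le (hτ : 0 < τ) (hν : 0 < ν) {δ : ℝ} (hδ : 0 < δ)
    (hδν : δ ≤ 2 * √ν) {x : ℝ} (hx : δ ≤ |x|) :
    (∫ y, jumpKernel τ ν x y) + (fermiGapInt τ ν δ / 2 - 1 / √ν) ≤ gapInt τ ν := by
  wlog hx0 : 0 ≤ x generalizing x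
  · have := this (x := -x) (by rwa [abs_neg]) (by linarith)
    simpa only [jumpKernel_neg_left] using this
  rw [abs_of_nonneg hx0] at hx
  have hsν : 0 < √ν := Real.sqrt_pos.2 hν
  have hν2 := Real.sq_sqrt hν.le
  set I := Set.Icc (-√ν) (-√ν + δ / 2) with hI
  have hig : Integrable fun p => (gap τ ν p + gap τ ν (x - p)) / 2 :=
    ((integrable_gap hτ hν.le).add (integrable_gap_comp_sub hτ hν.le x)).div_const 2
  have hik := integrable_kern hτ hν.le x
  have hd : Integrable fun p => (gap τ ν p + gap τ ν (x - p)) / 2 - kern τ ν p (x - p) :=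
    hig.sub hik
  have h1 : ∀ p ∈ I, gap τ ν p / 2 - 2 / (δ * √ν) ≤
      (gap τ ν p + gap τ ν (x - p)) / 2 - kern τ ν p (x - p) := by
    intro p hp
    have hp1 : -√ν ≤ p := hp.1
    have hp2 : p ≤ -√ν + δ / 2 := hp.2
    have hq : √ν + δ / 2 ≤ x - p := by linarith
    have hb : δ * √ν ≤ (x - p) ^ 2 - ν := by nlinarith
    have hk : kern τ ν p (x - p) ≤ 2 / (δ * √ν) := by
      rw [le_div_iff₀ (by positivity)]
      refine le_trans ?_ (kern_mul_le (ν := ν) hτ p (x - p))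
      have := kern_pos (ν := ν) hτ p (x - p)
      gcongr
      have := le_abs_self ((x - p) ^ 2 - ν)
      have := abs_nonneg (p ^ 2 - ν)
      linarith
    have := gap_pos (ν := ν) hτ (x - p)
    linarith
  have h2 : fermiGapInt τ ν δ / 2 - 1 / √ν ≤
      ∫ p in I, ((gap τ ν p + gap τ ν (x - p)) / 2 - kern τ ν p (x - p)) := by
    have hgI : IntegrableOn (fun p => gap τ ν p / 2) I :=
      ((integrable_gap hτ hν.le).div_const 2).integrableOn
    have hcI : IntegrableOn (fun _ : ℝ => 2 / (δ * √ν)) I := integrableOn_const (by simp [hI])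
    have hv : volume.real I = δ / 2 := by
      rw [hI, Real.volume_real_Icc_of_le (by linarith)]; ring
    calc _ = ∫ p in I, (gap τ ν p / 2 - 2 / (δ * √ν)) := by
          rw [integral_sub hgI hcI, integral_div, setIntegral_const, hv, smul_eq_mul, fermiGapInt]
          congr 1; field_simp
      _ ≤ _ := setIntegral_mono_on (hgI.sub hcI) hd.integrableOn measurableSet_Icc h1
  have h3 : ∫ p in I, ((gap τ ν p + gap τ ν (x - p)) / 2 - kern τ ν p (x - p)) ≤
      ∫ p, ((gap τ ν p + gap τ ν (x - p)) / 2 - kern τ ν p (x - p)) :=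
    setIntegral_le_integral hd (ae_of_all _ fun p => sub_nonneg.2 (kern_le_half_add hτ _ _))
  rw [integral_sub hig hik] at h3
  have h4 : ∫ p, (gap τ ν p + gap τ ν (x - p)) / 2 = gapInt τ ν := integral_half_gap_add hτ hν.le x
  rw [h4] at h3
  rw [integral_jumpKernel]
  linarith

/-- The weight in the Schur test for the jump form at low temperature. -/
def schurWeight (δ k a x y : ℝ) : ℝ :=
  if |x| < δ then if |y| < δ then 1 else a * (√|x| / √|(|y| - k)|)
  else if |y| < δ then a⁻¹ * (√|(|x| - k)| / √|y|) else 1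

lemma measurable_schurWeight (δ k a : ℝ) :
    Measurable fun z : ℝ × ℝ => schurWeight δ k a z.1 z.2 := by
  unfold schurWeight
  have h1 : MeasurableSet {z : ℝ × ℝ | |z.1| < δ} :=
    measurableSet_lt (by fun_prop) measurable_const
  have h2 : MeasurableSet {z : ℝ × ℝ | |z.2| < δ} :=
    measurableSet_lt (by fun_prop) measurable_const
  refine Measurable.ite h1 (Measurable.ite h2 measurable_const ?_)
    (Measurable.ite h2 ?_ measurable_const)
  · have e1 : Measurable fun z : ℝ × ℝ => √|z.1| := by fun_prop
    have e2 : Measurable fun z : ℝ × ℝ => √|(|z.2| - k)| := by fun_prop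
    exact (e1.div e2).const_mul a
  · have e1 : Measurable fun z : ℝ × ℝ => √|z.2| := by fun_prop
    have e2 : Measurable fun z : ℝ × ℝ => √|(|z.1| - k)| := by fun_prop
    exact (e2.div e1).const_mul _

lemma schurWeight_nonneg {a : ℝ} (ha : 0 < a) (δ k x y : ℝ) : 0 ≤ schurWeight δ k a x y := by
  unfold schurWeight
  split_ifs <;> positivity

lemma ae_ne_zero_and_abs_ne (k : ℝ) : ∀ᵐ x : ℝ, x ≠ 0 ∧ |x| - k ≠ 0 := by
  have : {x : ℝ | ¬ (x ≠ 0 ∧ |x| - k ≠ 0)} ⊆ {0, k, -k} := by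
    intro x hx
    simp only [Set.mem_ofPred_eq, not_and_or, not_not, sub_eq_zero] at hx
    rcases hx with h | h
    · simp [h]
    · rcases abs_choice x with h' | h' <;> rw [h'] at h
      · simp [h]
      · simp [← h]
  exact measure_mono_null this (Set.Finite.measure_zero (Set.toFinite _) _)

/-- The two mixed cases are reciprocal. The excluded points `0, ±k` are where a square root in the
weight vanishes. -/
lemma one_le_schurWeight_mul {a : ℝ} (ha : 0 < a) (δ : ℝ) {k x y : ℝ} (hx : x ≠ 0 ∧ |x| - k ≠ 0)
    (hy : y ≠ 0 ∧ |y| - k ≠ 0) : 1 ≤ schurWeight δ k a x y * schurWeight δ k a y x := by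
  have hx1 : 0 < √|x| := Real.sqrt_pos.2 (abs_pos.2 hx.1)
  have hx2 : 0 < √|(|x| - k)| := Real.sqrt_pos.2 (abs_pos.2 hx.2)
  have hy1 : 0 < √|y| := Real.sqrt_pos.2 (abs_pos.2 hy.1)
  have hy2 : 0 < √|(|y| - k)| := Real.sqrt_pos.2 (abs_pos.2 hy.2)
  unfold schurWeight
  split_ifs
  · norm_num
  · apply le_of_eq; field_simp
  · apply le_of_eq; field_simp
  · norm_num

lemma lintegral_hilbertWeight_abs {s : ℝ} (hs : 0 < s) :
    ∫⁻ y, ENNReal.ofReal (hilbertWeight s |y|) = ENNReal.ofReal (2 * Real.pi) := by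
  rw [lintegral_comp_abs_eq fun u => ENNReal.ofReal (hilbertWeight s u), lintegral_hilbertWeight hs,
    ENNReal.ofReal_mul two_pos.le]
  simp

lemma lintegral_hilbertWeight_abs_sub_le {s : ℝ} (hs : 0 < s) (k : ℝ) :
    ∫⁻ y, ENNReal.ofReal (hilbertWeight s |(|y| - k)|) ≤ ENNReal.ofReal (4 * Real.pi) := by
  refine (lintegral_comp_abs_abs_sub_le (fun u => ENNReal.ofReal (hilbertWeight s u)) k).trans ?_
  rw [lintegral_hilbertWeight hs, ENNReal.ofReal_mul (by norm_num)]
  simp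

lemma hilbertWeight_nonneg {s u : ℝ} (hs : 0 ≤ s) (hu : 0 ≤ u) : 0 ≤ hilbertWeight s u := by
  unfold hilbertWeight; positivity

lemma lintegral_ofReal_mul_hilbertWeight {b : ℝ} (hb : 0 ≤ b) {h : ℝ → ℝ} :
    ∫⁻ y, ENNReal.ofReal (b * h y) = ENNReal.ofReal b * ∫⁻ y, ENNReal.ofReal (h y) := by
  rw [← lintegral_const_mul' _ _ ENNReal.ofReal_ne_top]
  exact lintegral_congr fun y => ENNReal.ofReal_mul hb

/-- Rows near zero may carry nearly the full mass, so the excess must be small: `2δ/ν` from pairs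
with both ends near zero, and a multiple of `a` from the Hilbert kernel. -/
lemma lintegral_schurWeight_le_of_abs_lt (hτ : 0 < τ) (hν : 0 < ν) {δ a : ℝ} (hδ : 0 < δ)
    (ha : 0 < a) (hδν : δ ^ 2 ≤ ν / 2) {x : ℝ} (hx0 : x ≠ 0) (hx : |x| < δ) :
    ∫⁻ y, ENNReal.ofReal (jumpKernel τ ν x y) *
        ENNReal.ofReal (1 + schurWeight δ (2 * √ν) a x y) ≤
      ENNReal.ofReal (gapInt τ ν + (2 * δ / ν + a * (5 / (2 * √ν)) * (4 * Real.pi))) := by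
  set k := 2 * √ν with hk
  have hsν : 0 < √ν := Real.sqrt_pos.2 hν
  have hk0 : 0 < k := by positivity
  have hx1 : 0 < |x| := abs_pos.2 hx0
  set b := a * (5 / k) with hb
  have hb0 : 0 < b := by positivity
  have hpt : ∀ y, jumpKernel τ ν x y * (1 + schurWeight δ k a x y) ≤ jumpKernel τ ν x y +
      ((Set.Ioo (-δ) δ).indicator (fun _ => 1 / ν) y + b * hilbertWeight |x| |(|y| - k)|) := by
    intro y
    rw [mul_one_add]
    refine add_le_add le_rfl ?_
    have hC := jumpKernel_pos (ν := ν) hτ x y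
    have hw := hilbertWeight_nonneg (abs_nonneg x) (abs_nonneg (|y| - k))
    unfold schurWeight
    rw [if_pos hx]
    split_ifs with hy
    · rw [mul_one, Set.indicator_of_mem (show y ∈ Set.Ioo (-δ) δ from abs_lt.1 hy)]
      have : jumpKernel τ ν x y ≤ 1 / ν := by
        refine jumpKernel_le_of_abs_le hτ hν (le_trans ?_ hδν) (le_trans ?_ hδν)
        · rw [← sq_abs]; gcongr
        · rw [← sq_abs]; gcongr
      have := mul_nonneg hb0.le hw
      linarith
    · rw [Set.indicator_of_notMem (fun h : y ∈ Set.Ioo (-δ) δ => hy (abs_lt.2 h)), zero_add]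
      have h5 := jumpKernel_mul_le_five hτ hν (hx.le.trans (not_lt.1 hy))
      rw [← le_div_iff₀ (by positivity)] at h5
      calc _ ≤ 5 / k / (|x| + |(|y| - k)|) * (a * (√|x| / √|(|y| - k)|)) := by gcongr
        _ = b * hilbertWeight |x| |(|y| - k)| := by
          unfold hilbertWeight
          simp only [hb, hk, div_eq_mul_inv, mul_inv]
          ring
  calc _ ≤ ∫⁻ y, (ENNReal.ofReal (jumpKernel τ ν x y) +
      (ENNReal.ofReal ((Set.Ioo (-δ) δ).indicator (fun _ => 1 / ν) y) +
        ENNReal.ofReal (b * hilbertWeight |x| |(|y| - k)|))) := by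
        refine lintegral_mono fun y => ?_
        have hC := jumpKernel_pos (ν := ν) hτ x y
        have hi : 0 ≤ (Set.Ioo (-δ) δ).indicator (fun _ => 1 / ν) y :=
          Set.indicator_nonneg (fun _ _ => by positivity) _
        have hw := mul_nonneg hb0.le (hilbertWeight_nonneg (abs_nonneg x) (abs_nonneg (|y| - k)))
        rw [← ENNReal.ofReal_mul hC.le, ← ENNReal.ofReal_add hi hw,
          ← ENNReal.ofReal_add hC.le (add_nonneg hi hw)]
        exact ENNReal.ofReal_le_ofReal (hpt y)
    _ ≤ ENNReal.ofReal (gapInt τ ν) + (ENNReal.ofReal (2 * δ / ν) +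
          ENNReal.ofReal (b * (4 * Real.pi))) := by
        have hm1 : Measurable fun y => ENNReal.ofReal (jumpKernel τ ν x y) :=
          (continuous_jumpKernel_right τ ν x).measurable.ennreal_ofReal
        have hm2 : Measurable fun y =>
            ENNReal.ofReal ((Set.Ioo (-δ) δ).indicator (fun _ => 1 / ν) y) :=
          (measurable_const.indicator measurableSet_Ioo).ennreal_ofReal
        rw [lintegral_add_left hm1, lintegral_add_left hm2, lintegral_jumpKernel hτ hν.le,
          lintegral_ofReal_mul_hilbertWeight hb0.le]
        refine add_le_add (ENNReal.ofReal_le_ofReal (integral_jumpKernel_le hτ hν.le x))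
          (add_le_add (le_of_eq ?_) ?_)
        · have : ∀ y, ENNReal.ofReal ((Set.Ioo (-δ) δ).indicator (fun _ => 1 / ν) y) =
              (Set.Ioo (-δ) δ).indicator (fun _ => ENNReal.ofReal (1 / ν)) y := fun y => by
            by_cases h : y ∈ Set.Ioo (-δ) δ <;> simp [h]
          simp_rw [this]
          rw [lintegral_indicator_const measurableSet_Ioo, Real.volume_Ioo,
            ← ENNReal.ofReal_mul (by positivity)]
          congr 1; ring
        · rw [ENNReal.ofReal_mul hb0.le]
          exact mul_le_mul_right (lintegral_hilbertWeight_abs_sub_le hx1 k) _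
    _ = _ := by
        have := (gapInt_pos hτ hν.le).le
        rw [← ENNReal.ofReal_add (by positivity) (by positivity),
          ← ENNReal.ofReal_add (by positivity) (by positivity)]

/-- Here the excess involves `a⁻¹` and is large, but it does not depend on the temperature; the
divergent deficit of these rows will absorb it. -/
lemma lintegral_schurWeight_le_of_le_abs (hτ : 0 < τ) (hν : 0 < ν) {δ a : ℝ} (hδ : 0 < δ)
    (ha : 0 < a) {x : ℝ} (hxk : |x| - 2 * √ν ≠ 0) (hx : δ ≤ |x|) :
    ∫⁻ y, ENNReal.ofReal (jumpKernel τ ν x y) *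
        ENNReal.ofReal (1 + schurWeight δ (2 * √ν) a x y) ≤
      ENNReal.ofReal ((∫ y, jumpKernel τ ν x y) +
        (((1 + 8 * ν) / δ ^ 2 + 4 + 1 / (2 * ν)) * Real.pi +
          a⁻¹ * (5 / (2 * √ν)) * (2 * Real.pi))) := by
  set k := 2 * √ν with hk
  have hsν : 0 < √ν := Real.sqrt_pos.2 hν
  have hk0 : 0 < k := by positivity
  have hx1 : 0 < |(|x| - k)| := abs_pos.2 hxk
  set M := (1 + 8 * ν) / δ ^ 2 + 4 + 1 / (2 * ν) with hM
  have hM0 : 0 < M := by positivity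
  set b := a⁻¹ * (5 / k) with hb
  have hb0 : 0 < b := by positivity
  have hpt : ∀ y, jumpKernel τ ν x y * (1 + schurWeight δ k a x y) ≤ jumpKernel τ ν x y +
      (M * (1 + y ^ 2)⁻¹ + b * hilbertWeight |(|x| - k)| |y|) := by
    intro y
    rw [mul_one_add]
    refine add_le_add le_rfl ?_
    have hC := jumpKernel_pos (ν := ν) hτ x y
    have hw := hilbertWeight_nonneg (abs_nonneg (|x| - k)) (abs_nonneg y)
    unfold schurWeight
    rw [if_neg hx.not_gt]
    split_ifs with hy
    · have h5 := jumpKernel_mul_le_five (τ := τ) hτ hν (hy.le.trans hx)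
      rw [jumpKernel_comm, ← hk] at h5
      rw [← le_div_iff₀ (by positivity)] at h5
      have h6 : 0 ≤ M * (1 + y ^ 2)⁻¹ := by positivity
      refine le_trans ?_ (le_add_of_nonneg_left h6)
      calc _ ≤ 5 / k / (|y| + |(|x| - k)|) * (a⁻¹ * (√|(|x| - k)| / √|y|)) := by gcongr
        _ = b * hilbertWeight |(|x| - k)| |y| := by
          unfold hilbertWeight
          rw [hb, add_comm |y|]
          field_simp
    · rw [mul_one]
      have := jumpKernel_le_of_le_abs hτ hν hδ hx (not_lt.1 hy)
      have := mul_nonneg hb0.le hw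
      linarith
  calc _ ≤ ∫⁻ y, (ENNReal.ofReal (jumpKernel τ ν x y) +
      (ENNReal.ofReal (M * (1 + y ^ 2)⁻¹) +
        ENNReal.ofReal (b * hilbertWeight |(|x| - k)| |y|))) := by
        refine lintegral_mono fun y => ?_
        have hC := jumpKernel_pos (ν := ν) hτ x y
        have hi : 0 ≤ M * (1 + y ^ 2)⁻¹ := by positivity
        have hw := mul_nonneg hb0.le (hilbertWeight_nonneg (abs_nonneg (|x| - k)) (abs_nonneg y))
        rw [← ENNReal.ofReal_mul hC.le, ← ENNReal.ofReal_add hi hw,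
          ← ENNReal.ofReal_add hC.le (add_nonneg hi hw)]
        exact ENNReal.ofReal_le_ofReal (hpt y)
    _ = ENNReal.ofReal (∫ y, jumpKernel τ ν x y) + (ENNReal.ofReal (M * Real.pi) +
          ENNReal.ofReal (b * (2 * Real.pi))) := by
        have hm1 : Measurable fun y => ENNReal.ofReal (jumpKernel τ ν x y) :=
          (continuous_jumpKernel_right τ ν x).measurable.ennreal_ofReal
        have hm2 : Measurable fun y : ℝ => ENNReal.ofReal (M * (1 + y ^ 2)⁻¹) := by fun_prop
        rw [lintegral_add_left hm1, lintegral_add_left hm2, lintegral_jumpKernel hτ hν.le,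
          lintegral_ofReal_mul_hilbertWeight hb0.le, lintegral_hilbertWeight_abs hx1,
          ENNReal.ofReal_mul hb0.le]
        congr 2
        rw [← integral_univ_inv_one_add_sq, ← integral_const_mul,
          ofReal_integral_eq_lintegral_ofReal (integrable_inv_one_add_sq.const_mul M)
            (ae_of_all _ fun y => by positivity)]
    _ = _ := by
        have : 0 ≤ ∫ y, jumpKernel τ ν x y := integral_nonneg fun y => (jumpKernel_pos hτ x y).le
        have := Real.pi_pos
        rw [← ENNReal.ofReal_add (by positivity) (by positivity),
          ← ENNReal.ofReal_add (by positivity) (by positivity)]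

/-- First `δ` and `a` are fixed so that rows near zero exceed `gapInt (s τ)` by at most `c`, the
gain from the temperature change; then `τ₀` is made small enough for the outer rows. -/
lemma exists_jumpForm_le_of_temperature_le (hν : 0 < ν) {s : ℝ} (hs : 1 < s) :
    ∃ τ₀ : ℝ, 0 < τ₀ ∧ ∀ τ : ℝ, 0 < τ → τ ≤ τ₀ → ∀ g : ℝ → ℂ, Measurable g →
      jumpForm (s * τ) ν g ≤ ENNReal.ofReal (gapInt τ ν) * ∫⁻ η, ‖g η‖ₑ ^ 2 := by
  obtain ⟨c, hc, τ₁, hτ₁, hgap⟩ := exists_gapInt_add_le hν hs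
  have hs0 : 0 < s := by linarith
  have hsν : 0 < √ν := Real.sqrt_pos.2 hν
  have hν2 := Real.sq_sqrt hν.le
  have hpi := Real.pi_pos
  -- `δ` and `a` each use half of the gain: `2δ/ν ≤ c/2`, and `a · 5/(2√ν) · 4π = c/2`. The bound
  -- `√ν/2` keeps `δ` below the Fermi scale.
  set δ := min (√ν / 2) (c * ν / 4) with hδ
  have hδ0 : 0 < δ := by positivity
  have hδ1 : δ ≤ √ν / 2 := min_le_left _ _
  have hδ2 : δ ≤ c * ν / 4 := min_le_right _ _
  set a := c * (2 * √ν) / (40 * Real.pi) with ha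
  have ha0 : 0 < a := by positivity
  set M := ((1 + 8 * ν) / δ ^ 2 + 4 + 1 / (2 * ν)) * Real.pi +
    a⁻¹ * (5 / (2 * √ν)) * (2 * Real.pi) with hM
  have hlim := tendsto_fermiGapInt hν hδ0 (by linarith)
  obtain ⟨τ₂, hτ₂, hfermi⟩ := mem_nhdsGT_iff_exists_Ioc_subset.1
    (hlim.eventually_ge_atTop (2 * (M + 1 / √ν)))
  have hτ₂ : 0 < τ₂ := hτ₂
  refine ⟨min τ₁ (τ₂ / s), by positivity, fun τ hτ hle g hgm => ?_⟩
  have hsτ : 0 < s * τ := by positivity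
  have h1 := hgap τ hτ (hle.trans (min_le_left _ _))
  have h2 : s * τ ≤ τ₂ := by
    have := hle.trans (min_le_right _ _)
    rw [le_div_iff₀ hs0] at this; linarith
  have h3 : 2 * (M + 1 / √ν) ≤ fermiGapInt (s * τ) ν δ := hfermi ⟨hsτ, h2⟩
  refine jumpForm_le_schur (measurable_schurWeight δ (2 * √ν) a) (schurWeight_nonneg ha0 _ _)
    ?_ ?_ hgm
  · filter_upwards [ae_ne_zero_and_abs_ne (2 * √ν)] with x hx
    filter_upwards [ae_ne_zero_and_abs_ne (2 * √ν)] with y hy using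
      one_le_schurWeight_mul ha0 δ hx hy
  · filter_upwards [ae_ne_zero_and_abs_ne (2 * √ν)] with x hx
    rcases lt_or_ge |x| δ with h | h
    · refine (lintegral_schurWeight_le_of_abs_lt hsτ hν hδ0 ha0 ?_ hx.1 h).trans
        (ENNReal.ofReal_le_ofReal ?_)
      · nlinarith
      · have e1 : 2 * δ / ν ≤ c / 2 := by rw [div_le_iff₀ hν]; linarith
        have e2 : a * (5 / (2 * √ν)) * (4 * Real.pi) = c / 2 := by rw [ha]; field_simp; norm_num
        linarith
    · refine (lintegral_schurWeight_le_of_le_abs hsτ hν hδ0 ha0 hx.2 h).trans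
        (ENNReal.ofReal_le_ofReal ?_)
      have := integral_jumpKernel_add_le hsτ hν hδ0 (by linarith) h
      linarith

end LowTemperature

/-! ### Trial functions: row masses near zero and the lower bound for the Dirichlet form. -/

section TrialFunctions

variable {τ ν : ℝ}

lemma sq_div_four_le_cosh (m : ℝ) : m ^ 2 / 4 ≤ Real.cosh m := by
  rw [← Real.cosh_abs, ← sq_abs, Real.cosh_eq]
  linarith [Real.quadratic_le_exp_of_nonneg (abs_nonneg m), Real.exp_pos (-|m|), abs_nonneg m]

lemma tanhRatio_sub_tanhRatio_le {x y ε : ℝ} (h : |x - y| ≤ ε) :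
    tanhRatio x - tanhRatio y ≤ 2 * ε * tanhRatio x := by
  have h1 : tanhRatio x ≤ Real.exp (2 * ε) * tanhRatio y := pairWeight_le_exp_mul h h
  have h2 := Real.add_one_le_exp (-(2 * ε))
  have h3 : Real.exp (-(2 * ε)) * tanhRatio x ≤ tanhRatio y := by
    rw [Real.exp_neg, inv_mul_le_iff₀ (Real.exp_pos _)]; exact h1
  nlinarith [tanhRatio_pos x]

/-- Centring at `p = s + η/2` turns the arguments of the weight into `m ± sη/τ`, with `m` shifted by
`η²/(4τ)`. By evenness in the asymmetry there is no linear term, so the row mass is stationary at `η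
= 0`. -/
lemma exists_gapInt_sub_le (hτ : 0 < τ) (hν : 0 ≤ ν) :
    ∃ K : ℝ, 0 < K ∧ ∀ η : ℝ, |η| ≤ 1 →
      gapInt τ ν - K * η ^ 2 ≤ ∫ y, jumpKernel τ ν η y := by
  -- For `s² ≥ S` and `|η| ≤ 1` this gives `m ≥ s²/(2τ)` and `|δ| ≤ m/2`, so the bound with `1/cosh
  -- m` applies; for `s² ≤ S` the plain quadratic bound is enough.
  set S := 16 + 2 * ν with hS
  set M := 64 + 2 * S * (1 + S) / τ ^ 2 with hM
  have hS0 : 0 < S := by positivity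
  have hM0 : 0 < M := by positivity
  have hg0 := gapInt_pos hτ hν
  refine ⟨1 / (2 * τ) * gapInt τ ν + M / τ * Real.pi, by positivity, fun η hη => ?_⟩
  have hη2 : η ^ 2 ≤ 1 := by rw [← sq_abs]; exact pow_le_one₀ (abs_nonneg _) hη
  have hpt : ∀ s : ℝ, gap τ ν s - kern τ ν (s + η / 2) (η - (s + η / 2)) ≤
      η ^ 2 * (1 / (2 * τ)) * gap τ ν s + η ^ 2 * (M / τ) * (1 + s ^ 2)⁻¹ := by
    intro s
    set m := (s ^ 2 + η ^ 2 / 4 - ν) / τ with hm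
    set δ := s * η / τ with hδ
    have eA : ((s + η / 2) ^ 2 - ν) / τ = m + δ := by rw [hm, hδ]; ring
    have eB : ((η - (s + η / 2)) ^ 2 - ν) / τ = m - δ := by rw [hm, hδ]; ring
    have h1 : tanhRatio ((s ^ 2 - ν) / τ) - tanhRatio m ≤
        2 * (η ^ 2 / (4 * τ)) * tanhRatio ((s ^ 2 - ν) / τ) := by
      apply tanhRatio_sub_tanhRatio_le
      have e : (s ^ 2 - ν) / τ - m = -(η ^ 2 / (4 * τ)) := by rw [hm]; field_simp; ring
      rw [e, abs_neg, abs_of_nonneg (by positivity)]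
    have hf1 := tanhRatio_le_one m
    have hf0 := tanhRatio_pos m
    have h2 : tanhRatio m - pairWeight (m + δ) (m - δ) ≤ η ^ 2 * M * (1 + s ^ 2)⁻¹ := by
      rw [← div_eq_mul_inv, le_div_iff₀ (by positivity)]
      rcases le_total (s ^ 2) S with hs | hs
      · calc _ ≤ tanhRatio m * (2 * δ ^ 2) * (1 + s ^ 2) := by
              gcongr; exact tanhRatio_sub_pairWeight_le m δ
          _ ≤ 1 * (2 * (S * η ^ 2 / τ ^ 2)) * (1 + S) := by
              have : δ ^ 2 ≤ S * η ^ 2 / τ ^ 2 := by rw [hδ, div_pow, mul_pow]; gcongr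
              gcongr
          _ = η ^ 2 * (2 * S * (1 + S) / τ ^ 2) := by ring
          _ ≤ η ^ 2 * M := by gcongr; rw [hM]; linarith
      · have hs0 : 0 < s ^ 2 := by linarith
        have hsne : s ≠ 0 := fun h => by simp [h] at hs0
        have hs4 : 4 ≤ |s| := by
          rw [← abs_of_nonneg (show (0 : ℝ) ≤ 4 by norm_num)]
          apply sq_le_sq.1
          linarith
        have hm1 : s ^ 2 / (2 * τ) ≤ m := by
          rw [hm, div_le_div_iff₀ (by positivity) hτ]
          nlinarith [sq_nonneg η]
        have hm0 : 0 < m := lt_of_lt_of_le (by positivity) hm1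
        have hδm : |δ| ≤ |m| / 2 := by
          rw [abs_of_pos hm0]
          refine le_trans ?_ (div_le_div_of_nonneg_right hm1 two_pos.le)
          rw [hδ, abs_div, abs_of_pos hτ, div_div, div_le_div_iff₀ hτ (by positivity), abs_mul,
            ← sq_abs s]
          have h3 : |s| * |η| ≤ |s| * 1 := by gcongr
          have h4 : |s| * |η| * 4 ≤ |s| ^ 2 := by nlinarith
          calc |s| * |η| * (2 * τ * 2) = |s| * |η| * 4 * τ := by ring
            _ ≤ _ := by gcongr
        have hc : (s ^ 2 / (2 * τ)) ^ 2 / 4 ≤ Real.cosh m := by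
          refine le_trans ?_ (sq_div_four_le_cosh m)
          gcongr
        have h3 := tanhRatio_sub_pairWeight_le_div_cosh hδm
        calc _ ≤ tanhRatio m * (2 * δ ^ 2) / Real.cosh m * (1 + s ^ 2) := by gcongr
          _ ≤ 1 * (2 * δ ^ 2) / ((s ^ 2 / (2 * τ)) ^ 2 / 4) * (s ^ 2 + s ^ 2) := by
              gcongr
              linarith
          _ = η ^ 2 * 64 := by rw [hδ]; field_simp; ring
          _ ≤ η ^ 2 * M := by
              gcongr; rw [hM]
              have : 0 ≤ 2 * S * (1 + S) / τ ^ 2 := by positivity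
              linarith
    unfold gap kern
    rw [eA, eB]
    calc _ = ((tanhRatio ((s ^ 2 - ν) / τ) - tanhRatio m) +
          (tanhRatio m - pairWeight (m + δ) (m - δ))) / τ := by ring
      _ ≤ (2 * (η ^ 2 / (4 * τ)) * tanhRatio ((s ^ 2 - ν) / τ) +
          η ^ 2 * M * (1 + s ^ 2)⁻¹) / τ := by gcongr
      _ = _ := by ring
  have hk : Integrable fun s => kern τ ν (s + η / 2) (η - (s + η / 2)) :=
    (integrable_kern hτ hν η).comp_add_right (η / 2)
  have h1 := integrable_gap hτ hν
  have h2 : Integrable fun s => η ^ 2 * (1 / (2 * τ)) * gap τ ν s := h1.const_mul _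
  have h3 : Integrable fun s : ℝ => η ^ 2 * (M / τ) * (1 + s ^ 2)⁻¹ :=
    integrable_inv_one_add_sq.const_mul _
  have h4 := integral_mono (h1.sub hk) (h2.add h3) hpt
  have h5 : ∫ s, kern τ ν (s + η / 2) (η - (s + η / 2)) = ∫ y, jumpKernel τ ν η y := by
    rw [integral_jumpKernel, integral_add_right_eq_self (fun p => kern τ ν p (η - p))]
  simp only [Pi.sub_apply, Pi.add_apply] at h4
  rw [integral_sub h1 hk, integral_add h2 h3, integral_const_mul, integral_const_mul, h5,
    integral_univ_inv_one_add_sq] at h4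
  unfold gapInt
  linarith

/-- `W × Wᶜ` and its transpose are disjoint and carry equal mass. -/
lemma lintegral_le_half_of_symm {F : ℝ → ℝ → ℝ≥0∞} (hF : Measurable fun z : ℝ × ℝ => F z.1 z.2)
    (hs : ∀ x y, F x y = F y x) {W : Set ℝ} (hW : MeasurableSet W) :
    ∫⁻ x in W, ∫⁻ y in Wᶜ, F x y ≤ 2⁻¹ * ∫⁻ x, ∫⁻ y, F x y := by
  have hFs : Measurable fun x => ∫⁻ y in Wᶜ, F x y := hF.lintegral_prod_right'
  have h1 : (∫⁻ x in W, ∫⁻ y in Wᶜ, F x y) + ∫⁻ x in Wᶜ, ∫⁻ y in W, F x y ≤ ∫⁻ x, ∫⁻ y, F x y := by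
    rw [← lintegral_add_compl (fun x => ∫⁻ y, F x y) hW]
    exact add_le_add (lintegral_mono fun x => setLIntegral_le_lintegral _ _)
      (lintegral_mono fun x => setLIntegral_le_lintegral _ _)
  have h2 : ∫⁻ x in Wᶜ, ∫⁻ y in W, F x y = ∫⁻ x in W, ∫⁻ y in Wᶜ, F x y := by
    rw [lintegral_lintegral_swap hF.aemeasurable]
    refine lintegral_congr fun x => lintegral_congr fun y => hs _ _
  rw [h2, ← two_mul] at h1
  calc _ = 2⁻¹ * (2 * ∫⁻ x in W, ∫⁻ y in Wᶜ, F x y) := by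
        rw [← mul_assoc, ENNReal.inv_mul_cancel (by simp) (by simp), one_mul]
    _ ≤ _ := by gcongr

/-- The trial functions. -/
def trial (r s : ℝ) (I : Set ℝ) : ℝ → ℂ :=
  fun x => (Set.Icc (-r) r).indicator (fun _ => 1) x - I.indicator (fun _ => (s : ℂ)) x

lemma measurable_trial (r s : ℝ) {I : Set ℝ} (hI : MeasurableSet I) : Measurable (trial r s I) :=
  (measurable_const.indicator measurableSet_Icc).sub (measurable_const.indicator hI)

lemma memLp_trial (r s : ℝ) {I : Set ℝ} (hI : MeasurableSet I) (hIf : volume I ≠ ⊤) :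
    MemLp (trial r s I) 2 volume :=
  (memLp_indicator_const 2 measurableSet_Icc (1 : ℂ) (Or.inr (by simp))).sub
    (memLp_indicator_const 2 hI (s : ℂ) (Or.inr hIf))

lemma trial_neg (r s : ℝ) {I : Set ℝ} (hI : ∀ x, -x ∈ I ↔ x ∈ I) (x : ℝ) :
    trial r s I (-x) = trial r s I x := by
  have h : -x ∈ Set.Icc (-r) r ↔ x ∈ Set.Icc (-r) r := by
    simp only [Set.mem_Icc]; constructor <;> rintro ⟨h1, h2⟩ <;> constructor <;> linarith
  unfold trial
  by_cases h1 : x ∈ Set.Icc (-r) r <;> by_cases h2 : x ∈ I <;>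
    simp [Set.indicator_of_mem, Set.indicator_of_notMem, h, (hI x).2, h1, h2, (hI x), -Set.mem_Icc]

lemma lintegral_trial {r s : ℝ} (hr : 0 ≤ r) {I : Set ℝ} (hI : MeasurableSet I)
    (hIf : volume I ≠ ⊤) (hd : ∀ x ∈ I, r < |x|) :
    ∫⁻ x, ‖trial r s I x‖ₑ ^ 2 = ENNReal.ofReal (2 * r + s ^ 2 * volume.real I) := by
  have h : ∀ x, ‖trial r s I x‖ₑ ^ 2 = (Set.Icc (-r) r).indicator (fun _ => 1) x +
      I.indicator (fun _ => ENNReal.ofReal (s ^ 2)) x := by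
    intro x
    by_cases h1 : x ∈ I
    · have h2 : x ∉ Set.Icc (-r) r := fun h => absurd (abs_le.2 h) (not_le.2 (hd x h1))
      have : ‖(s : ℂ)‖ₑ = ENNReal.ofReal |s| := by
        rw [← ofReal_norm, Complex.norm_real, Real.norm_eq_abs]
      simp only [trial, Set.indicator_of_mem h1, Set.indicator_of_notMem h2, zero_sub, enorm_neg,
        zero_add]
      rw [this, ← ENNReal.ofReal_pow (abs_nonneg _), sq_abs]
    · by_cases h2 : x ∈ Set.Icc (-r) r <;>
        simp [trial, Set.indicator_of_notMem h1, h2, -Set.mem_Icc]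
  simp_rw [h]
  rw [lintegral_add_left (measurable_const.indicator measurableSet_Icc),
    lintegral_indicator_const measurableSet_Icc, lintegral_indicator_const hI, one_mul,
    Real.volume_Icc, ENNReal.ofReal_add (by linarith) (by positivity),
    ENNReal.ofReal_mul (sq_nonneg s), Measure.real, ENNReal.ofReal_toReal hIf]
  congr 2; ring

/-- Only pairs with exactly one end in `[-r, r]` are kept. There the squared jump is `1`, or `(1 +
s)² ≥ 1 + 2s` over `I`. Each kept row has mass `gapInt - K r²` up to the discarded part inside `[-r,
r]`, at most `2r/ν`. -/
lemma jumpForm_trial_ge (hτ : 0 < τ) (hν : 0 < ν) {K : ℝ}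
    (hK : ∀ η : ℝ, |η| ≤ 1 → gapInt τ ν - K * η ^ 2 ≤ ∫ y, jumpKernel τ ν η y) (hK0 : 0 ≤ K)
    {r s c : ℝ} (hr : 0 < r) (hr1 : r ≤ 1) (hrν : r ^ 2 ≤ ν / 2) (hs : 0 ≤ s) (hc : 0 ≤ c)
    {I : Set ℝ} (hI : MeasurableSet I) (hIf : volume I ≠ ⊤) (hd : ∀ x ∈ I, r < |x|)
    (hcI : ∀ x y, |x| ≤ r → y ∈ I → c ≤ jumpKernel τ ν x y) :
    ENNReal.ofReal (2 * r * (gapInt τ ν - K * r ^ 2 - 2 * r / ν + 2 * s * (c * volume.real I))) ≤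
      jumpForm τ ν (trial r s I) := by
  set W := Set.Icc (-r) r with hW
  have hWm : MeasurableSet W := measurableSet_Icc
  have hF := measurable_jumpForm_integrand (measurable_jumpKernel τ ν) (measurable_trial r s hI)
  refine le_trans ?_ (lintegral_le_half_of_symm
    (F := fun x y => ENNReal.ofReal (jumpKernel τ ν x y) * ‖trial r s I x - trial r s I y‖ₑ ^ 2)
    hF (fun x y => by rw [jumpKernel_comm, ← enorm_neg, neg_sub]) hWm)
  have hx : ∀ x ∈ W, ENNReal.ofReal
      (gapInt τ ν - K * r ^ 2 - 2 * r / ν + 2 * s * (c * volume.real I)) ≤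
      ∫⁻ y in Wᶜ, ENNReal.ofReal (jumpKernel τ ν x y) * ‖trial r s I x - trial r s I y‖ₑ ^ 2 := by
    intro x hx
    have hxr : |x| ≤ r := abs_le.2 hx
    have hxI : x ∉ I := fun h => absurd hxr (not_le.2 (hd x h))
    have hint := integrable_jumpKernel (τ := τ) (ν := ν) hτ hν.le x
    have hpos : ∀ y, 0 ≤ jumpKernel τ ν x y := fun y => (jumpKernel_pos hτ x y).le
    have hint2 : IntegrableOn (fun y => I.indicator (fun _ => 2 * s * c) y) Wᶜ :=
      ((integrable_indicator_iff hI).2 (integrableOn_const hIf)).integrableOn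
    have hpt : ∀ y ∈ Wᶜ, ENNReal.ofReal (jumpKernel τ ν x y + I.indicator (fun _ => 2 * s * c) y) ≤
        ENNReal.ofReal (jumpKernel τ ν x y) * ‖trial r s I x - trial r s I y‖ₑ ^ 2 := by
      intro y hy
      have ht : trial r s I x = 1 := by
        simp only [trial, Set.indicator_of_mem (show x ∈ Set.Icc (-r) r from hx),
          Set.indicator_of_notMem hxI, sub_zero]
      rw [ht, ← ofReal_norm, ← ENNReal.ofReal_pow (norm_nonneg _), ← ENNReal.ofReal_mul (hpos y)]
      apply ENNReal.ofReal_le_ofReal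
      have hyW : y ∉ Set.Icc (-r) r := hy
      by_cases hyI : y ∈ I
      · have e : (1 : ℂ) - trial r s I y = ((1 + s : ℝ) : ℂ) := by
          simp [trial, Set.indicator_of_mem hyI, Set.indicator_of_notMem hyW]
        rw [e, Complex.norm_real, Real.norm_of_nonneg (by linarith), Set.indicator_of_mem hyI]
        have := hcI x y hxr hyI
        nlinarith [mul_nonneg (hpos y) (sq_nonneg s), mul_nonneg hs (sub_nonneg.2 this)]
      · have e : (1 : ℂ) - trial r s I y = 1 := by
          simp [trial, Set.indicator_of_notMem hyI, Set.indicator_of_notMem hyW]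
        rw [e, Set.indicator_of_notMem hyI]
        simp
    refine le_trans ?_ (setLIntegral_mono' hWm.compl hpt)
    have hint3 : IntegrableOn (fun y => jumpKernel τ ν x y + I.indicator (fun _ => 2 * s * c) y) Wᶜ :=
      hint.integrableOn.add hint2
    rw [← ofReal_integral_eq_lintegral_ofReal hint3
      (ae_of_all _ fun y => add_nonneg (hpos y)
        (Set.indicator_nonneg (fun _ _ => by positivity) _)),
      integral_add hint.integrableOn hint2]
    apply ENNReal.ofReal_le_ofReal
    have h1 : ∫ y in Wᶜ, I.indicator (fun _ => 2 * s * c) y = 2 * s * (c * volume.real I) := by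
      rw [setIntegral_indicator hI, Set.inter_eq_right.2, setIntegral_const, smul_eq_mul]
      · ring
      · intro y hy hyW
        exact absurd (abs_le.2 hyW) (not_le.2 (hd y hy))
    have h2 : ∫ y in W, jumpKernel τ ν x y ≤ 2 * r / ν := by
      have hv : volume.real W = 2 * r := by
        rw [hW, Real.volume_real_Icc_of_le (by linarith)]; ring
      calc _ ≤ ∫ _ in W, 1 / ν := by
            refine setIntegral_mono_on hint.integrableOn (integrableOn_const (by simp [hW])) hWm
              fun y hy => jumpKernel_le_of_abs_le hτ hν (le_trans ?_ hrν) (le_trans ?_ hrν)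
            · rw [← sq_abs]; gcongr
            · rw [← sq_abs]; gcongr; exact abs_le.2 hy
        _ = _ := by rw [setIntegral_const, hv, smul_eq_mul]; ring
    have h3 := integral_add_compl hWm hint
    have h4 := hK x (hxr.trans hr1)
    have h5 : K * x ^ 2 ≤ K * r ^ 2 := by
      rw [← sq_abs x]; gcongr
    rw [h1]
    linarith
  refine le_trans (le_of_eq ?_) (setLIntegral_mono' hWm hx)
  rw [setLIntegral_const, hW, Real.volume_Icc, ENNReal.ofReal_mul (by linarith), mul_comm]
  congr 2; ring

end TrialFunctions

/-! ### Trial functions: reaching the bulk value, and exceeding it at low temperature. -/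

section TrialFunctions

variable {τ ν : ℝ}

/-- The indicator of a short interval already suffices: its Rayleigh quotient is at least `gapInt -
K r² - 2r/ν`. -/
lemma exists_even_lt_jumpForm (hτ : 0 < τ) (hν : 0 < ν) {c : ℝ} (hc : c < gapInt τ ν) :
    ∃ g : ℝ → ℂ, Measurable g ∧ MemLp g 2 volume ∧ (∀ x, g (-x) = g x) ∧
      ENNReal.ofReal c * ∫⁻ x, ‖g x‖ₑ ^ 2 < jumpForm τ ν g := by
  obtain ⟨K, hK0, hK⟩ := exists_gapInt_sub_le hτ hν.le
  have hG := gapInt_pos hτ hν.le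
  set G := gapInt τ ν with hGdef
  have hcont : Tendsto (fun r : ℝ => G - K * r ^ 2 - 2 * r / ν) (𝓝[>] 0) (𝓝 G) := by
    have h : Continuous fun r : ℝ => G - K * r ^ 2 - 2 * r / ν := by fun_prop
    have h2 := h.tendsto 0
    simp only [ne_eq, OfNat.ofNat_ne_zero, not_false_eq_true, zero_pow, mul_zero, sub_zero,
      zero_div] at h2
    exact h2.mono_left nhdsWithin_le_nhds
  have hν' : 0 < √(ν / 2) := Real.sqrt_pos.2 (by positivity)
  obtain ⟨r, hr1, hr2⟩ := ((hcont.eventually (lt_mem_nhds (max_lt hc hG))).and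
    (Ioo_mem_nhdsGT (lt_min one_pos hν'))).exists
  have hr0 : 0 < r := hr2.1
  have hrν : r ^ 2 ≤ ν / 2 := by
    rw [← Real.sq_sqrt (show 0 ≤ ν / 2 by positivity)]
    have := (hr2.2.trans_le (min_le_right _ _)).le
    gcongr
  refine ⟨trial r 0 ∅, measurable_trial _ _ .empty, memLp_trial _ _ .empty (by simp),
    trial_neg _ _ (by simp), ?_⟩
  rw [lintegral_trial hr0.le .empty (by simp) (by simp)]
  refine lt_of_lt_of_le ?_ (jumpForm_trial_ge hτ hν hK hK0.le hr0
    (hr2.2.trans_le (min_le_left _ _)).le hrν le_rfl le_rfl .empty (by simp) (by simp) (by simp))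
  have h1 : c < G - K * r ^ 2 - 2 * r / ν := (le_max_left _ _).trans_lt hr1
  have h0 : 0 < G - K * r ^ 2 - 2 * r / ν := (le_max_right _ _).trans_lt hr1
  rw [← hGdef, ← ENNReal.ofReal_mul' (by positivity)]
  refine (ENNReal.ofReal_lt_ofReal_iff ?_).2 ?_
  · have := mul_pos hr0 h0
    simp only [mul_zero, zero_mul, add_zero]
    linarith
  · simp only [measureReal_empty, mul_zero, add_zero]
    nlinarith

/-- A neighbourhood of the points `±2√ν`. -/
def shell (τ ν : ℝ) : Set ℝ :=
  Set.Icc (2 * √ν) (2 * √ν + τ / (2 * √ν)) ∪ Set.Icc (-(2 * √ν + τ / (2 * √ν))) (-(2 * √ν))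

lemma measurableSet_shell (τ ν : ℝ) : MeasurableSet (shell τ ν) :=
  measurableSet_Icc.union measurableSet_Icc

lemma neg_mem_shell (x : ℝ) : -x ∈ shell τ ν ↔ x ∈ shell τ ν := by
  unfold shell
  simp only [Set.mem_union, Set.mem_Icc]
  constructor <;> rintro (⟨h1, h2⟩ | ⟨h1, h2⟩)
  · right; constructor <;> linarith
  · left; constructor <;> linarith
  · right; constructor <;> linarith
  · left; constructor <;> linarith

lemma abs_mem_of_mem_shell {y : ℝ} (hν : 0 < ν) (hy : y ∈ shell τ ν) :
    |y| ∈ Set.Icc (2 * √ν) (2 * √ν + τ / (2 * √ν)) := by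
  have hsν : 0 < √ν := Real.sqrt_pos.2 hν
  rcases hy with ⟨h1, h2⟩ | ⟨h1, h2⟩
  · rw [abs_of_nonneg (by linarith)]; exact ⟨h1, h2⟩
  · rw [abs_of_nonpos (by linarith)]; constructor <;> linarith

lemma volume_shell (hτ : 0 < τ) (hν : 0 < ν) :
    volume (shell τ ν) ≠ ⊤ ∧ volume.real (shell τ ν) = τ / √ν := by
  have hsν : 0 < √ν := Real.sqrt_pos.2 hν
  have hd : Disjoint (Set.Icc (2 * √ν) (2 * √ν + τ / (2 * √ν)))
      (Set.Icc (-(2 * √ν + τ / (2 * √ν))) (-(2 * √ν))) := by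
    rw [Set.disjoint_left]
    rintro x ⟨h1, -⟩ ⟨-, h2⟩
    linarith
  have h0 : 0 < τ / (2 * √ν) := by positivity
  unfold shell
  refine ⟨measure_union_ne_top (by simp) (by simp), ?_⟩
  rw [measureReal_union hd measurableSet_Icc (by simp) (by simp),
    Real.volume_real_Icc_of_le (by linarith), Real.volume_real_Icc_of_le (by linarith)]
  field_simp
  ring

/-- For `y` in the shell `y²/4 - ν` lies in `[0, τ]`, and a tiny `x` changes each energy by at most
`τ`. Both arguments of the weight are therefore at most `2` in absolute value. -/
lemma le_jumpKernel_of_mem_shell (hτ : 0 < τ) (hν : 0 < ν) (hτν : τ ≤ 4 * ν) {r : ℝ} (hr : r ≤ 1)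
    (hr2 : r * (1 + (2 * √ν + τ / (2 * √ν))) ≤ τ) {x y : ℝ} (hx : |x| ≤ r)
    (hy : y ∈ shell τ ν) : sechSq 2 / (2 * τ) ≤ jumpKernel τ ν x y := by
  have hsν : 0 < √ν := Real.sqrt_pos.2 hν
  have hν2 := Real.sq_sqrt hν.le
  obtain ⟨h1, h2⟩ := abs_mem_of_mem_shell hν hy
  set k := 2 * √ν with hk
  have hk0 : 0 < k := by positivity
  have hk2 : k ^ 2 = 4 * ν := by rw [hk, mul_pow, hν2]; norm_num
  have hx0 := abs_nonneg x
  have hr0 : 0 ≤ r := hx0.trans hx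
  have hy2 : 0 ≤ y ^ 2 / 4 - ν ∧ y ^ 2 / 4 - ν ≤ τ := by
    rw [← sq_abs y]
    constructor
    · nlinarith
    · have e : (k + τ / k) ^ 2 = k ^ 2 + 2 * τ + τ ^ 2 / k ^ 2 := by field_simp; ring
      have h3 : |y| ^ 2 ≤ (k + τ / k) ^ 2 := by gcongr
      have h4 : τ ^ 2 / k ^ 2 ≤ τ := by
        rw [div_le_iff₀ (by positivity), hk2, sq]; gcongr
      rw [e, hk2] at h3
      rw [hk2] at h4
      linarith
  have hxy : x ^ 2 / 4 + |x * y| / 2 ≤ τ := by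
    rw [abs_mul, ← sq_abs]
    calc |x| ^ 2 / 4 + |x| * |y| / 2 ≤ |x| * 1 + |x| * |y| := by nlinarith [abs_nonneg y]
      _ = |x| * (1 + |y|) := by ring
      _ ≤ r * (1 + (k + τ / k)) := by gcongr
      _ ≤ τ := hr2
  have hp := le_abs_self (x * y)
  have hn := neg_abs_le (x * y)
  have key : sechSq 2 ≤ pairWeight ((((x + y) / 2) ^ 2 - ν) / τ) ((((x - y) / 2) ^ 2 - ν) / τ) := by
    apply sechSq_le_pairWeight
    · rw [abs_div, abs_of_pos hτ, div_le_iff₀ hτ, abs_le]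
      constructor <;> nlinarith [sq_nonneg x]
    · rw [abs_div, abs_of_pos hτ, div_le_iff₀ hτ, abs_le]
      constructor <;> nlinarith [sq_nonneg x]
  unfold jumpKernel kern
  calc _ = sechSq 2 / τ / 2 := by ring
    _ ≤ _ := by gcongr

/-- With amplitude `-s` on the shell, the gain `4 r s c |I| - gapInt s² |I|` is optimized by `s = 2
r c / gapInt`. It becomes a constant times `r² / (τ · gapInt)`, against a loss of at most `6 r²/ν`,
and `τ · gapInt → 0`. -/
lemma exists_even_gapInt_lt_jumpForm (hν : 0 < ν) :
    ∃ τ₀ : ℝ, 0 < τ₀ ∧ ∀ τ : ℝ, 0 < τ → τ ≤ τ₀ →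
      ∃ g : ℝ → ℂ, Measurable g ∧ MemLp g 2 volume ∧ (∀ x, g (-x) = g x) ∧
        ENNReal.ofReal (gapInt τ ν) * ∫⁻ x, ‖g x‖ₑ ^ 2 < jumpForm τ ν g := by
  have hsν : 0 < √ν := Real.sqrt_pos.2 hν
  have hσ : 0 < sechSq 2 := sechSq_pos 2
  set k := 2 * √ν with hk
  have hk0 : 0 < k := by positivity
  have hlim : ∀ᶠ τ in 𝓝[>] 0, τ * gapInt τ ν < sechSq 2 ^ 2 * ν / (3 * k) :=
    (tendsto_mul_gapInt hν.le).eventually (gt_mem_nhds (by positivity))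
  obtain ⟨τ₁, hτ₁, hsmall⟩ := mem_nhdsGT_iff_exists_Ioc_subset.1 hlim
  have hτ₁ : 0 < τ₁ := hτ₁
  refine ⟨min τ₁ (4 * ν), by positivity, fun τ hτ hle => ?_⟩
  have h1 : τ * gapInt τ ν < sechSq 2 ^ 2 * ν / (3 * k) :=
    hsmall ⟨hτ, hle.trans (min_le_left _ _)⟩
  obtain ⟨K, hK0, hK⟩ := exists_gapInt_sub_le hτ hν.le
  have hG := gapInt_pos hτ hν.le
  have hν' : 0 < √(ν / 2) := Real.sqrt_pos.2 (by positivity)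
  -- The bounds in turn: validity of the row-mass expansion, boundedness of the kernel on `[-r,
  -- r]²`, disjointness from the shell, the lower bound of the kernel on the shell, and `K r ≤ 1/ν`
  -- so that the cubic loss is of the same size as the quadratic one.
  obtain ⟨r, hr⟩ : ∃ r : ℝ, r = min (min 1 (√(ν / 2))) (min (√ν)
    (min (τ / (1 + (k + τ / k))) (1 / (ν * K)))) := ⟨_, rfl⟩
  have hr0 : 0 < r := by rw [hr]; positivity
  have hr1 : r ≤ 1 := by rw [hr]; exact (min_le_left _ _).trans (min_le_left _ _)
  have hr2 : r ≤ √(ν / 2) := by rw [hr]; exact (min_le_left _ _).trans (min_le_right _ _)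
  have hr3 : r ≤ √ν := by rw [hr]; exact (min_le_right _ _).trans (min_le_left _ _)
  have hr4 : r ≤ τ / (1 + (k + τ / k)) := by
    rw [hr]; exact (min_le_right _ _).trans ((min_le_right _ _).trans (min_le_left _ _))
  have hr5 : r ≤ 1 / (ν * K) := by
    rw [hr]; exact (min_le_right _ _).trans ((min_le_right _ _).trans (min_le_right _ _))
  have hrν : r ^ 2 ≤ ν / 2 := by
    rw [← Real.sq_sqrt (show 0 ≤ ν / 2 by positivity)]; gcongr
  rw [le_div_iff₀ (by positivity)] at hr4
  obtain ⟨hfin, hvol⟩ := volume_shell hτ hν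
  set c := sechSq 2 / (2 * τ) with hc
  have hc0 : 0 < c := by positivity
  set s := 2 * r * c / gapInt τ ν with hs
  have hs0 : 0 < s := by positivity
  have hd : ∀ x ∈ shell τ ν, r < |x| := fun x hx =>
    lt_of_lt_of_le (by linarith) (abs_mem_of_mem_shell hν hx).1
  refine ⟨trial r s (shell τ ν), measurable_trial _ _ (measurableSet_shell _ _),
    memLp_trial _ _ (measurableSet_shell _ _) hfin, trial_neg _ _ neg_mem_shell, ?_⟩
  rw [lintegral_trial hr0.le (measurableSet_shell _ _) hfin hd]
  refine lt_of_lt_of_le ?_ (jumpForm_trial_ge hτ hν hK hK0.le hr0 hr1 hrν hs0.le hc0.le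
    (measurableSet_shell _ _) hfin hd fun x y hx hy =>
      le_jumpKernel_of_mem_shell hτ hν (hle.trans (min_le_right _ _)) hr1 hr4 hx hy)
  rw [hvol, ← ENNReal.ofReal_mul hG.le]
  have key : gapInt τ ν * (2 * r + s ^ 2 * (τ / √ν)) <
      2 * r * (gapInt τ ν - K * r ^ 2 - 2 * r / ν + 2 * s * (c * (τ / √ν))) := by
    have e1 : 2 * r * (2 * s * (c * (τ / √ν))) - gapInt τ ν * (s ^ 2 * (τ / √ν)) =
        2 * r ^ 2 * (sechSq 2 ^ 2 / (k * (τ * gapInt τ ν))) := by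
      rw [hs, hc, hk]; field_simp; ring
    have e2 : 3 / ν < sechSq 2 ^ 2 / (k * (τ * gapInt τ ν)) := by
      rw [lt_div_iff₀ (by positivity)] at h1
      rw [div_lt_div_iff₀ hν (by positivity)]
      linarith
    have e3 : K * r ≤ 1 / ν := by
      rw [le_div_iff₀ (by positivity)] at hr5 ⊢
      linarith
    have e4 : 0 < r ^ 2 * (sechSq 2 ^ 2 / (k * (τ * gapInt τ ν)) - 3 / ν) :=
      mul_pos (by positivity) (by linarith)
    have e5 : 0 ≤ r ^ 2 * (1 / ν - K * r) := mul_nonneg (by positivity) (by linarith)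
    have e6 : 3 / ν = 3 * (1 / ν) := by ring
    have e7 : 2 * r / ν = 2 * r * (1 / ν) := by ring
    rw [e6] at e4
    rw [e7]
    nlinarith
  refine (ENNReal.ofReal_lt_ofReal_iff ?_).2 key
  refine lt_of_le_of_lt ?_ key
  positivity

/-- Inherited from the kernel: `τ` times the form is nondecreasing in `τ` for each fixed trial
function. -/
lemma mul_jumpForm_le {τ' : ℝ} (hτ : 0 < τ) (h : τ ≤ τ') (g : ℝ → ℂ) :
    ENNReal.ofReal τ * jumpForm τ ν g ≤ ENNReal.ofReal τ' * jumpForm τ' ν g := by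
  have hτ' : 0 < τ' := hτ.trans_le h
  unfold jumpForm
  rw [mul_left_comm, ← lintegral_const_mul' _ _ ENNReal.ofReal_ne_top, mul_left_comm,
    ← lintegral_const_mul' _ _ ENNReal.ofReal_ne_top]
  refine mul_le_mul_right (lintegral_mono fun x => ?_) _
  rw [← lintegral_const_mul' _ _ ENNReal.ofReal_ne_top,
    ← lintegral_const_mul' _ _ ENNReal.ofReal_ne_top]
  refine lintegral_mono fun y => ?_
  rw [← mul_assoc, ← mul_assoc, ← ENNReal.ofReal_mul hτ.le, ← ENNReal.ofReal_mul hτ'.le]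
  refine mul_le_mul_left (ENNReal.ofReal_le_ofReal ?_) _
  unfold jumpKernel
  have := mul_kern_le_mul_kern (ν := ν) hτ h ((x + y) / 2) ((x - y) / 2)
  linarith

/-- The Schur test with unit weight. The factor two is too crude for the limits, but suffices for
finiteness and for existence of normal temperatures. -/
lemma jumpForm_le (hτ : 0 < τ) (hν : 0 ≤ ν) {g : ℝ → ℂ} (hgm : Measurable g) :
    jumpForm τ ν g ≤ ENNReal.ofReal (2 * gapInt τ ν) * ∫⁻ x, ‖g x‖ₑ ^ 2 := by
  refine jumpForm_le_schur (t := fun _ _ => 1) measurable_const (fun _ _ => zero_le_one)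
    (ae_of_all _ fun _ => ae_of_all _ fun _ => by norm_num) (ae_of_all _ fun x => ?_) hgm
  rw [lintegral_mul_const' _ _ ENNReal.ofReal_ne_top, lintegral_jumpKernel hτ hν,
    ← ENNReal.ofReal_mul' (by norm_num)]
  apply ENNReal.ofReal_le_ofReal
  linarith [integral_jumpKernel_le hτ hν x]

end TrialFunctions

/-! ### Measure-preserving coordinates on the plane. -/

section Coordinates

/-- The point of the plane with the given coordinates. -/
def pt (p q : ℝ) : Plane := !₂[p, q]

@[simp] lemma pt_zero (p q : ℝ) : pt p q 0 = p := rfl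

@[simp] lemma pt_one (p q : ℝ) : pt p q 1 = q := rfl

lemma pt_eta (z : Plane) : pt (z 0) (z 1) = z := by
  ext i; fin_cases i <;> rfl

lemma continuous_pt : Continuous fun z : ℝ × ℝ => pt z.1 z.2 := by
  unfold pt; fun_prop

/-- The plane in cartesian coordinates. -/
def ptEquiv : ℝ × ℝ ≃ᵐ Plane :=
  (MeasurableEquiv.finTwoArrow (α := ℝ)).symm.trans (MeasurableEquiv.toLp 2 (Fin 2 → ℝ))

lemma ptEquiv_apply (z : ℝ × ℝ) : ptEquiv z = pt z.1 z.2 := by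
  ext i; fin_cases i <;> rfl

lemma measurePreserving_ptEquiv : MeasurePreserving ptEquiv :=
  (PiLp.volume_preserving_toLp (Fin 2)).comp (volume_preserving_finTwoArrow ℝ).symm

/-- The coordinates "first coordinate and difference" on the plane. -/
def diffEquiv : ℝ × ℝ ≃ᵐ Plane := (MeasurableEquiv.shearAddRight ℝ).trans ptEquiv

lemma diffEquiv_apply (z : ℝ × ℝ) : diffEquiv z = pt z.1 (z.1 + z.2) := by
  change ptEquiv _ = _
  rw [ptEquiv_apply]; rfl

lemma measurePreserving_diffEquiv : MeasurePreserving diffEquiv :=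
  measurePreserving_ptEquiv.comp (measurePreserving_prod_add volume volume)

/-- The coordinates "sum and second coordinate" on the plane. -/
def sumEquiv : ℝ × ℝ ≃ᵐ Plane :=
  (MeasurableEquiv.prodComm.trans ((MeasurableEquiv.shearSubRight ℝ).trans
    MeasurableEquiv.prodComm)).trans ptEquiv

lemma sumEquiv_apply (z : ℝ × ℝ) : sumEquiv z = pt (z.1 - z.2) z.2 := by
  change ptEquiv _ = _
  rw [ptEquiv_apply]; rfl

lemma measurePreserving_sumEquiv : MeasurePreserving sumEquiv := by
  refine measurePreserving_ptEquiv.comp ?_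
  exact measurePreserving_sub_prod volume volume

lemma lintegral_plane_pt {F : Plane → ℝ≥0∞} (hF : Measurable F) :
    ∫⁻ z, F z = ∫⁻ p, ∫⁻ q, F (pt p q) := by
  rw [← measurePreserving_ptEquiv.lintegral_comp hF]
  have h : Measurable fun z => F (ptEquiv z) := hF.comp ptEquiv.measurable
  rw [Measure.volume_eq_prod, lintegral_prod _ h.aemeasurable]
  simp only [ptEquiv_apply]

lemma lintegral_plane_diff {F : Plane → ℝ≥0∞} (hF : Measurable F) :
    ∫⁻ z, F z = ∫⁻ x, ∫⁻ t, F (pt x (x + t)) := by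
  rw [← measurePreserving_diffEquiv.lintegral_comp hF]
  have h : Measurable fun z => F (diffEquiv z) := hF.comp diffEquiv.measurable
  rw [Measure.volume_eq_prod, lintegral_prod _ h.aemeasurable]
  simp only [diffEquiv_apply]

lemma lintegral_plane_sum {F : Plane → ℝ≥0∞} (hF : Measurable F) :
    ∫⁻ z, F z = ∫⁻ η, ∫⁻ q, F (pt (η - q) q) := by
  rw [← measurePreserving_sumEquiv.lintegral_comp hF]
  have h : Measurable fun z => F (sumEquiv z) := hF.comp sumEquiv.measurable
  rw [Measure.volume_eq_prod, lintegral_prod _ h.aemeasurable]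
  simp only [sumEquiv_apply]

lemma quasiMeasurePreserving_sum :
    Measure.QuasiMeasurePreserving (fun z : Plane => z 0 + z 1) volume volume := by
  have h := (Measure.quasiMeasurePreserving_fst (μ := (volume : Measure ℝ))
    (ν := (volume : Measure ℝ))).comp
    (measurePreserving_sumEquiv.symm sumEquiv).quasiMeasurePreserving
  have e : (fun z : Plane => z 0 + z 1) = Prod.fst ∘ sumEquiv.symm := by
    funext z
    have : z = sumEquiv (z 0 + z 1, z 1) := by
      rw [sumEquiv_apply, add_sub_cancel_right, pt_eta]
    conv_rhs => rw [this]
    simp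
  rw [e]
  exact h

lemma quasiMeasurePreserving_fst_coord :
    Measure.QuasiMeasurePreserving (fun z : Plane => z 0) volume volume := by
  have h := (Measure.quasiMeasurePreserving_fst (μ := (volume : Measure ℝ))
    (ν := (volume : Measure ℝ))).comp
    (measurePreserving_ptEquiv.symm ptEquiv).quasiMeasurePreserving
  have e : (fun z : Plane => z 0) = Prod.fst ∘ ptEquiv.symm := by
    funext z
    have : z = ptEquiv (z 0, z 1) := by
      rw [ptEquiv_apply, pt_eta]
    conv_rhs => rw [this]
    simp
  rw [e]
  exact h

lemma ae_swap {p : Plane → Prop} (h : ∀ᵐ z, p z) : ∀ᵐ z, p (swap z) :=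
  swap.measurePreserving.quasiMeasurePreserving.ae h

lemma ae_reflect (i : Fin 2) {p : Plane → Prop} (h : ∀ᵐ z, p z) : ∀ᵐ z, p (reflect i z) :=
  (reflect i).measurePreserving.quasiMeasurePreserving.ae h

@[simp] lemma swap_zero (z : Plane) : swap z 0 = z 1 := rfl

@[simp] lemma swap_one (z : Plane) : swap z 1 = z 0 := rfl

@[simp] lemma reflect_zero_zero (z : Plane) : reflect 0 z 0 = -z 0 := rfl

@[simp] lemma reflect_zero_one (z : Plane) : reflect 0 z 1 = z 1 := rfl

@[simp] lemma reflect_one_zero (z : Plane) : reflect 1 z 0 = z 0 := rfl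

@[simp] lemma reflect_one_one (z : Plane) : reflect 1 z 1 = -z 1 := rfl

end Coordinates

/-! ### Squared L² norms as Lebesgue integrals. -/

section LpTwo

variable {α : Type*} [MeasurableSpace α] {m : Measure α}

lemma memLp_two_iff {f : α → ℂ} :
    MemLp f 2 m ↔ AEStronglyMeasurable f m ∧ ∫⁻ x, ‖f x‖ₑ ^ 2 ∂m < ⊤ := by
  refine and_congr_right fun _ => ?_
  rw [eLpNorm_lt_top_iff_lintegral_rpow_enorm_lt_top (by simp) (by simp)]
  simp

lemma eLpNorm_two_sq (f : α → ℂ) : eLpNorm f 2 m ^ 2 = ∫⁻ x, ‖f x‖ₑ ^ 2 ∂m := by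
  simpa using eLpNorm_nnreal_pow_eq_lintegral (f := f) (μ := m) (p := 2) (by simp)

lemma enorm_sq_eq_lintegral (f : Lp ℂ 2 m) : ‖f‖ₑ ^ 2 = ∫⁻ x, ‖f x‖ₑ ^ 2 ∂m := by
  rw [Lp.enorm_def, eLpNorm_two_sq]

lemma enorm_toLp_sq {f : α → ℂ} (hf : MemLp f 2 m) : ‖hf.toLp f‖ₑ ^ 2 = ∫⁻ x, ‖f x‖ₑ ^ 2 ∂m := by
  rw [Lp.enorm_toLp, eLpNorm_two_sq]

lemma norm_le_of_enorm_sq_le {E F : Type*} [SeminormedAddCommGroup E] [SeminormedAddCommGroup F]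
    {x : E} {y : F} {B : ℝ} (hB : 0 ≤ B)
    (h : ‖x‖ₑ ^ 2 ≤ ENNReal.ofReal B * ‖y‖ₑ ^ 2) : ‖x‖ ^ 2 ≤ B * ‖y‖ ^ 2 := by
  rw [← ofReal_norm, ← ofReal_norm, ← ENNReal.ofReal_pow (norm_nonneg _),
    ← ENNReal.ofReal_pow (norm_nonneg _), ← ENNReal.ofReal_mul hB] at h
  exact (ENNReal.ofReal_le_ofReal_iff (by positivity)).1 h

end LpTwo

/-! ### Multiplication operators and lifts from the total momentum to the plane. -/

section Operators

lemma memLp_mul {m : Plane → ℂ} (hm : Continuous m) {C : ℝ} (hC : ∀ z, ‖m z‖ ≤ C) (f : L2Plane) :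
    MemLp (fun z => m z * f z) 2 volume :=
  MemLp.of_le_mul (c := C) (Lp.memLp f)
    (hm.aestronglyMeasurable.mul (Lp.aestronglyMeasurable f))
    (ae_of_all _ fun z => by rw [norm_mul]; gcongr; exact hC z)

/-- Multiplication by a bounded continuous function on `L²(ℝ²)`. -/
def mulOp (m : Plane → ℂ) (hm : Continuous m) (C : ℝ) (hC : ∀ z, ‖m z‖ ≤ C) :
    L2Plane →L[ℂ] L2Plane :=
  LinearMap.mkContinuous
    { toFun := fun f => (memLp_mul hm hC f).toLp _
      map_add' := fun f g => by
        rw [← MemLp.toLp_add]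
        refine (MemLp.toLp_eq_toLp_iff _ _).2 ?_
        filter_upwards [Lp.coeFn_add f g] with z hz
        rw [hz]; simp only [Pi.add_apply]; ring
      map_smul' := fun c f => by
        rw [RingHom.id_apply, ← MemLp.toLp_const_smul]
        refine (MemLp.toLp_eq_toLp_iff _ _).2 ?_
        filter_upwards [Lp.coeFn_smul c f] with z hz
        rw [hz]; simp only [Pi.smul_apply, smul_eq_mul]; ring }
    C fun f => by
      refine Lp.norm_le_mul_norm_of_ae_le_mul ?_
      filter_upwards [(memLp_mul hm hC f).coeFn_toLp] with z hz
      refine (le_of_eq (congrArg _ hz)).trans ?_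
      rw [norm_mul]; gcongr; exact hC z

lemma coeFn_mulOp {m : Plane → ℂ} (hm : Continuous m) {C : ℝ} (hC : ∀ z, ‖m z‖ ≤ C)
    (f : L2Plane) : mulOp m hm C hC f =ᵐ[volume] fun z => m z * f z :=
  (memLp_mul hm hC f).coeFn_toLp

/-- A weight whose square integrals along the lines `p + q = η` are bounded by `B`. -/
structure IsFiberBounded (w : Plane → ℂ) (B : ℝ) : Prop where
  continuous : Continuous w
  nonneg : 0 ≤ B
  bound : ∀ η, ∫⁻ q, ‖w (pt (η - q) q)‖ₑ ^ 2 ≤ ENNReal.ofReal B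

variable {w : Plane → ℂ} {B : ℝ}

/-- Lifting is weighted by the fibre integral of `‖w‖²` along `p + q = η`, so on the squared norm it
acts as multiplication in `η`; this gives the bulk criterion. -/
lemma lintegral_fiber (hw : Continuous w) {F : ℝ → ℝ≥0∞} (hF : Measurable F) :
    ∫⁻ z, ‖w z‖ₑ ^ 2 * F (z 0 + z 1) =
      ∫⁻ η, (∫⁻ q, ‖w (pt (η - q) q)‖ₑ ^ 2) * F η := by
  have hm : Measurable fun z : Plane => ‖w z‖ₑ ^ 2 * F (z 0 + z 1) := by
    have h1 : Measurable fun z : Plane => ‖w z‖ₑ ^ 2 := hw.measurable.enorm.pow_const 2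
    have h2 : Measurable fun z : Plane => F (z 0 + z 1) :=
      hF.comp (by fun_prop : Measurable fun z : Plane => z 0 + z 1)
    exact h1.mul h2
  rw [lintegral_plane_sum hm]
  refine lintegral_congr fun η => ?_
  simp only [pt_zero, pt_one, sub_add_cancel]
  refine lintegral_mul_const _ ?_
  have h : Continuous fun q => pt (η - q) q :=
    continuous_pt.comp (by fun_prop : Continuous fun q : ℝ => (η - q, q))
  exact (hw.comp h).measurable.enorm.pow_const 2

lemma lintegral_fiber_le (hw : IsFiberBounded w B) {g : ℝ → ℂ} (hg : Measurable g) :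
    ∫⁻ z, ‖w z * g (z 0 + z 1)‖ₑ ^ 2 ≤ ENNReal.ofReal B * ∫⁻ η, ‖g η‖ₑ ^ 2 := by
  simp_rw [enorm_mul, mul_pow]
  have hg2 : Measurable fun η => ‖g η‖ₑ ^ 2 := hg.enorm.pow_const 2
  rw [lintegral_fiber hw.continuous hg2, ← lintegral_const_mul _ hg2]
  exact lintegral_mono fun η => mul_le_mul_left (hw.bound η) _

lemma memLp_fiber (hw : IsFiberBounded w B) (g : Lp ℂ 2 (volume : Measure ℝ)) :
    MemLp (fun z : Plane => w z * g (z 0 + z 1)) 2 volume := by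
  have hs := Lp.stronglyMeasurable g
  refine memLp_two_iff.2 ⟨hw.continuous.aestronglyMeasurable.mul ?_, ?_⟩
  · exact (hs.comp_measurable
      (by fun_prop : Measurable fun z : Plane => z 0 + z 1)).aestronglyMeasurable
  · refine (lintegral_fiber_le hw hs.measurable).trans_lt ?_
    exact ENNReal.mul_lt_top ENNReal.ofReal_lt_top (memLp_two_iff.1 (Lp.memLp g)).2

/-- The operator `g ↦ w(p, q) g(p + q)`. -/
def diagLift (hw : IsFiberBounded w B) : Lp ℂ 2 (volume : Measure ℝ) →L[ℂ] L2Plane :=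
  LinearMap.mkContinuous
    { toFun := fun g => (memLp_fiber hw g).toLp _
      map_add' := fun f g => by
        rw [← MemLp.toLp_add]
        refine (MemLp.toLp_eq_toLp_iff _ _).2 ?_
        filter_upwards [quasiMeasurePreserving_sum.ae (Lp.coeFn_add f g)] with z hz
        rw [hz]; simp only [Pi.add_apply]; ring
      map_smul' := fun c f => by
        rw [RingHom.id_apply, ← MemLp.toLp_const_smul]
        refine (MemLp.toLp_eq_toLp_iff _ _).2 ?_
        filter_upwards [quasiMeasurePreserving_sum.ae (Lp.coeFn_smul c f)] with z hz
        rw [hz]; simp only [Pi.smul_apply, smul_eq_mul]; ring }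
    (√B) fun g => by
      have h : ‖(memLp_fiber hw g).toLp _‖ ^ 2 ≤ B * ‖g‖ ^ 2 := by
        refine norm_le_of_enorm_sq_le hw.nonneg ?_
        rw [enorm_toLp_sq, enorm_sq_eq_lintegral]
        exact lintegral_fiber_le hw (Lp.stronglyMeasurable g).measurable
      refine abs_le_of_sq_le_sq' ?_ (by positivity) |>.2
      rw [mul_pow, Real.sq_sqrt hw.nonneg]
      exact h

lemma coeFn_diagLift (hw : IsFiberBounded w B) (g : Lp ℂ 2 (volume : Measure ℝ)) :
    diagLift hw g =ᵐ[volume] fun z : Plane => w z * g (z 0 + z 1) :=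
  (memLp_fiber hw g).coeFn_toLp

lemma norm_diagLift_sq_le (hw : IsFiberBounded w B) (g : Lp ℂ 2 (volume : Measure ℝ)) :
    ‖diagLift hw g‖ ^ 2 ≤ B * ‖g‖ ^ 2 := by
  refine norm_le_of_enorm_sq_le hw.nonneg ?_
  rw [enorm_sq_eq_lintegral, enorm_sq_eq_lintegral]
  refine le_trans (le_of_eq (lintegral_congr_ae ?_))
    (lintegral_fiber_le hw (Lp.stronglyMeasurable g).measurable)
  filter_upwards [coeFn_diagLift hw g] with z hz
  rw [hz]

lemma norm_diagLift_le (hw : IsFiberBounded w B) : ‖diagLift hw‖ ≤ √B := by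
  refine ContinuousLinearMap.opNorm_le_bound _ (by positivity) fun g => ?_
  refine abs_le_of_sq_le_sq' ?_ (by positivity) |>.2
  rw [mul_pow, Real.sq_sqrt hw.nonneg]
  exact norm_diagLift_sq_le hw g

end Operators

/-! ### Fourier transforms along the antidiagonal and restriction to lines parallel to the diagonal.
-/

section DiagonalFourier

/-- The phase `e^{2πix}`. -/
def phase (x : ℝ) : ℂ := (Real.fourierChar x : ℂ)

lemma norm_phase (x : ℝ) : ‖phase x‖ = 1 := Circle.norm_coe _

lemma phase_add (x y : ℝ) : phase (x + y) = phase x * phase y := by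
  unfold phase; rw [AddChar.map_add_eq_mul]; rfl

lemma continuous_phase : Continuous phase :=
  continuous_subtype_val.comp Real.continuous_fourierChar

lemma norm_phase_sub_one_le (x : ℝ) : ‖phase x - 1‖ ≤ 2 * Real.pi * |x| := by
  unfold phase
  rw [Real.fourierChar_apply]
  have h := Real.norm_exp_I_mul_ofReal_sub_one_le (x := 2 * Real.pi * x)
  rw [mul_comm Complex.I] at h
  refine h.trans (le_of_eq ?_)
  rw [Real.norm_eq_abs, abs_mul, abs_of_pos Real.two_pi_pos]

lemma phase_zero : phase 0 = 1 := by simp [phase]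

variable {u : Plane → ℂ}

/-- The Fourier transform of `u` along the antidiagonal direction. -/
def fiberFourier (u : Plane → ℂ) (t η : ℝ) : ℂ := ∫ q, phase (q * t) * u (pt (η - q) q)

lemma continuous_fiber (hu : Continuous u) : Continuous fun z : ℝ × ℝ => u (pt (z.1 - z.2) z.2) :=
  hu.comp (continuous_pt.comp (by fun_prop : Continuous fun z : ℝ × ℝ => (z.1 - z.2, z.2)))

lemma integrable_fiber (hu : Continuous u) (hc : HasCompactSupport u) :
    Integrable fun z : ℝ × ℝ => u (pt (z.1 - z.2) z.2) := by
  have h := measurePreserving_sumEquiv.integrable_comp_of_integrable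
    (hu.integrable_of_hasCompactSupport hc)
  refine h.congr (ae_of_all _ fun z => ?_)
  simp only [Function.comp_apply, sumEquiv_apply]

lemma exists_support_bound (hc : HasCompactSupport u) :
    ∃ R : ℝ, 0 < R ∧ ∀ p q, u (pt p q) ≠ 0 → |p| ≤ R ∧ |q| ≤ R := by
  obtain ⟨R, hR0, hR⟩ := hc.isCompact.isBounded.exists_pos_norm_le
  refine ⟨R, hR0, fun p q h => ?_⟩
  have h1 := hR (pt p q) (subset_tsupport _ h)
  have h2 : ∀ i, ‖(pt p q) i‖ ≤ ‖pt p q‖ := fun i => PiLp.norm_apply_le _ i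
  exact ⟨(h2 0).trans h1, (h2 1).trans h1⟩

lemma stronglyMeasurable_fiberFourier (hu : Continuous u) (t : ℝ) :
    StronglyMeasurable (fiberFourier u t) := by
  have h : Continuous fun z : ℝ × ℝ => phase (z.2 * t) * u (pt (z.1 - z.2) z.2) :=
    (continuous_phase.comp (by fun_prop : Continuous fun z : ℝ × ℝ => z.2 * t)).mul
      (continuous_fiber hu)
  exact h.stronglyMeasurable.integral_prod_right

lemma exists_fiberFourier_bound (hu : Continuous u) (hc : HasCompactSupport u) :
    ∃ K R : ℝ, 0 ≤ K ∧ ∀ t η, ‖fiberFourier u t η‖ ≤ (Set.Icc (-R) R).indicator (fun _ => K) η := by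
  obtain ⟨R, hR0, hR⟩ := exists_support_bound hc
  obtain ⟨C, hC⟩ := hu.bounded_above_of_compact_support hc
  have hC0 : 0 ≤ C := (norm_nonneg _).trans (hC 0)
  refine ⟨C * (2 * R), 2 * R, by positivity, fun t η => ?_⟩
  have h0 : ∀ q, q ∉ Set.Icc (-R) R → phase (q * t) * u (pt (η - q) q) = 0 := by
    intro q hq
    by_contra h
    exact hq (abs_le.1 (hR _ _ (right_ne_zero_of_mul h)).2)
  by_cases hη : η ∈ Set.Icc (-(2 * R)) (2 * R)
  · rw [Set.indicator_of_mem hη, fiberFourier, ← setIntegral_eq_integral_of_forall_compl_eq_zero h0]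
    have hv : volume.real (Set.Icc (-R) R) = 2 * R := by
      rw [Real.volume_real_Icc_of_le (by linarith)]; ring
    rw [← hv]
    refine norm_setIntegral_le_of_norm_le_const (by simp) fun q _ => ?_
    rw [norm_mul, norm_phase, one_mul]
    exact hC _
  · rw [Set.indicator_of_notMem hη]
    have : fiberFourier u t η = ∫ _ : ℝ, (0 : ℂ) := by
      refine integral_congr_ae (ae_of_all _ fun q => ?_)
      show phase (q * t) * u (pt (η - q) q) = 0
      by_contra h
      have h1 := hR _ _ (right_ne_zero_of_mul h)
      refine hη (abs_le.1 ?_)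
      calc |η| = |(η - q) + q| := by ring_nf
        _ ≤ |η - q| + |q| := abs_add_le _ _
        _ ≤ 2 * R := by linarith [h1.1, h1.2]
    rw [this, integral_zero, norm_zero]

lemma integrable_fiberFourier (hu : Continuous u) (hc : HasCompactSupport u) (t : ℝ) :
    Integrable (fiberFourier u t) := by
  obtain ⟨K, R, -, h⟩ := exists_fiberFourier_bound hu hc
  exact ((integrable_indicator_iff measurableSet_Icc).2 (integrableOn_const (by simp))).mono'
    (stronglyMeasurable_fiberFourier hu t).aestronglyMeasurable (ae_of_all _ (h t))

lemma memLp_fiberFourier (hu : Continuous u) (hc : HasCompactSupport u) (t : ℝ) :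
    MemLp (fiberFourier u t) 2 volume := by
  obtain ⟨K, R, -, h⟩ := exists_fiberFourier_bound hu hc
  refine (memLp_indicator_const 2 (measurableSet_Icc (a := -R) (b := R)) K (Or.inr (by simp))).mono'
    (stronglyMeasurable_fiberFourier hu t).aestronglyMeasurable (ae_of_all _ (h t))

lemma fourierInv_eq_phase {V : Type*} [NormedAddCommGroup V] [InnerProductSpace ℝ V]
    [MeasurableSpace V] [BorelSpace V] [FiniteDimensional ℝ V] (h : V → ℂ) (x : V) :
    𝓕⁻ h x = ∫ v, phase (inner ℝ v x) * h v := by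
  rw [Real.fourierInv_eq]
  rfl

/-- The inverse Fourier transform on a line parallel to the diagonal. -/
lemma fourierInv_pt (hu : Continuous u) (hc : HasCompactSupport u) (x t : ℝ) :
    𝓕⁻ u (pt x (x + t)) = 𝓕⁻ (fiberFourier u t) x := by
  rw [fourierInv_eq_phase, fourierInv_eq_phase,
    ← measurePreserving_sumEquiv.integral_comp sumEquiv.measurableEmbedding]
  have hi : Integrable fun z : ℝ × ℝ =>
      phase (z.1 * x) * (phase (z.2 * t) * u (pt (z.1 - z.2) z.2)) := by
    have hm : Continuous fun z : ℝ × ℝ => phase (z.1 * x) * phase (z.2 * t) :=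
      (continuous_phase.comp (by fun_prop : Continuous fun z : ℝ × ℝ => z.1 * x)).mul
        (continuous_phase.comp (by fun_prop : Continuous fun z : ℝ × ℝ => z.2 * t))
    have := (integrable_fiber hu hc).bdd_mul (c := 1) hm.aestronglyMeasurable
      (ae_of_all _ fun z => by rw [norm_mul, norm_phase, norm_phase, one_mul])
    refine this.congr (ae_of_all _ fun z => ?_)
    simp only; ring
  have e : ∀ z : ℝ × ℝ, phase (inner ℝ (sumEquiv z) (pt x (x + t))) * u (sumEquiv z) =
      phase (z.1 * x) * (phase (z.2 * t) * u (pt (z.1 - z.2) z.2)) := by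
    intro z
    rw [sumEquiv_apply]
    have : inner ℝ (pt (z.1 - z.2) z.2) (pt x (x + t)) = z.1 * x + z.2 * t := by
      rw [PiLp.inner_apply, Fin.sum_univ_two]
      simp only [pt_zero, pt_one, RCLike.inner_apply, conj_trivial]
      ring
    rw [this, phase_add]; ring
  simp_rw [e]
  rw [Measure.volume_eq_prod, integral_prod _ hi]
  refine integral_congr_ae (ae_of_all _ fun η => ?_)
  simp only
  rw [integral_const_mul]
  have : inner ℝ η x = η * x := by simp [mul_comm]
  rw [this]; rfl

lemma lintegral_mul_sq_le {α : Type*} [MeasurableSpace α] {m : Measure α} {f g : α → ℝ≥0∞}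
    (hf : AEMeasurable f m) (hg : AEMeasurable g m) :
    (∫⁻ x, f x * g x ∂m) ^ 2 ≤ (∫⁻ x, f x ^ 2 ∂m) * ∫⁻ x, g x ^ 2 ∂m := by
  have h := ENNReal.lintegral_mul_le_Lp_mul_Lq m Real.HolderConjugate.two_two hf hg
  have h2 := pow_le_pow_left' h 2
  refine h2.trans (le_of_eq ?_)
  rw [mul_pow, ← ENNReal.rpow_natCast, ← ENNReal.rpow_natCast, ← ENNReal.rpow_mul,
    ← ENNReal.rpow_mul]
  norm_num

/-- Cauchy-Schwarz on each fibre against the weight `w`. The constant `c` will be `2` for a bound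
valid for all functions, and proportional to the strip width for functions of bounded support. -/
lemma lintegral_fiberFourier_sub_le {w f : Plane → ℂ} {B : ℝ} (hw : IsFiberBounded w B)
    (hf : Continuous f) (hc : HasCompactSupport f) {t c : ℝ} (hc0 : 0 ≤ c)
    (hphase : ∀ p q, f (pt p q) ≠ 0 → ‖phase (q * t) - 1‖ ≤ c) :
    ∫⁻ η, ‖fiberFourier (fun z => w z * f z) t η - fiberFourier (fun z => w z * f z) 0 η‖ₑ ^ 2 ≤
      ENNReal.ofReal (c ^ 2 * B) * ∫⁻ z, ‖f z‖ₑ ^ 2 := by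
  set u : Plane → ℂ := fun z => w z * f z with hu
  have huc : Continuous u := hw.continuous.mul hf
  have hus : HasCompactSupport u := hc.mul_left
  have hline : ∀ η : ℝ, Continuous fun q => pt (η - q) q := fun η =>
    continuous_pt.comp (by fun_prop : Continuous fun q : ℝ => (η - q, q))
  have hint : ∀ t η, Integrable fun q => phase (q * t) * u (pt (η - q) q) := by
    intro t η
    have h1 : Continuous fun q => phase (q * t) * u (pt (η - q) q) :=
      (continuous_phase.comp (by fun_prop : Continuous fun q : ℝ => q * t)).mul
        (huc.comp (hline η))
    refine h1.integrable_of_hasCompactSupport ?_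
    obtain ⟨R, hR0, hR⟩ := exists_support_bound hus
    refine HasCompactSupport.intro (isCompact_Icc (a := -R) (b := R)) fun q hq => ?_
    by_contra h
    exact hq (abs_le.1 (hR _ _ (right_ne_zero_of_mul h)).2)
  have hpt : ∀ η, ‖fiberFourier u t η - fiberFourier u 0 η‖ₑ ^ 2 ≤
      ENNReal.ofReal (c ^ 2 * B) * ∫⁻ q, ‖f (pt (η - q) q)‖ₑ ^ 2 := by
    intro η
    have h1 : ‖fiberFourier u t η - fiberFourier u 0 η‖ₑ ≤
        ENNReal.ofReal c * ∫⁻ q, ‖w (pt (η - q) q)‖ₑ * ‖f (pt (η - q) q)‖ₑ := by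
      unfold fiberFourier
      rw [← integral_sub (hint t η) (hint 0 η), ← lintegral_const_mul' _ _ ENNReal.ofReal_ne_top]
      refine (enorm_integral_le_lintegral_enorm _).trans (lintegral_mono fun q => ?_)
      rw [mul_zero, phase_zero, ← sub_mul, enorm_mul, hu, enorm_mul]
      by_cases h : f (pt (η - q) q) = 0
      · simp [h]
      · gcongr
        rw [← ofReal_norm]
        exact ENNReal.ofReal_le_ofReal (hphase _ _ h)
    have hfm : Measurable fun q => ‖f (pt (η - q) q)‖ₑ := (hf.comp (hline η)).measurable.enorm
    have hwm : Measurable fun q => ‖w (pt (η - q) q)‖ₑ :=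
      (hw.continuous.comp (hline η)).measurable.enorm
    calc _ ≤ (ENNReal.ofReal c * ∫⁻ q, ‖w (pt (η - q) q)‖ₑ * ‖f (pt (η - q) q)‖ₑ) ^ 2 := by
          gcongr
      _ ≤ ENNReal.ofReal c ^ 2 * (ENNReal.ofReal B * ∫⁻ q, ‖f (pt (η - q) q)‖ₑ ^ 2) := by
          rw [mul_pow]
          gcongr
          refine (lintegral_mul_sq_le hwm.aemeasurable hfm.aemeasurable).trans ?_
          exact mul_le_mul_left (hw.bound η) _
      _ = _ := by
          rw [ENNReal.ofReal_mul (by positivity), ENNReal.ofReal_pow hc0, mul_assoc]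
  refine (lintegral_mono hpt).trans ?_
  rw [lintegral_const_mul' _ _ ENNReal.ofReal_ne_top]
  have hm : Measurable fun z => ‖f z‖ₑ ^ 2 := hf.measurable.enorm.pow_const 2
  rw [lintegral_plane_sum hm]

end DiagonalFourier

/-! ### The trace theorem on the diagonal. -/

section DiagonalTrace

variable {w : Plane → ℂ} {B C : ℝ}

/-- The strip of width `ε` around the diagonal. -/
def strip (ε : ℝ) : Set Plane := {z | |z 0 - z 1| < ε}

lemma measurableSet_strip (ε : ℝ) : MeasurableSet (strip ε) :=
  measurableSet_lt (by fun_prop) measurable_const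

lemma lintegral_strip {F : Plane → ℝ≥0∞} (hF : Measurable F) (ε : ℝ) :
    ∫⁻ z in strip ε, F z = ∫⁻ t in Set.Ioo (-ε) ε, ∫⁻ x, F (pt x (x + t)) := by
  rw [← lintegral_indicator (measurableSet_strip ε), lintegral_plane_diff
    (hF.indicator (measurableSet_strip ε)), lintegral_lintegral_swap,
    ← lintegral_indicator measurableSet_Ioo]
  · refine lintegral_congr fun t => ?_
    have h : ∀ x, (pt x (x + t) ∈ strip ε ↔ t ∈ Set.Ioo (-ε) ε) := fun x => by
      simp only [strip, Set.mem_ofPred_eq, pt_zero, pt_one, Set.mem_Ioo, abs_lt]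
      constructor <;> rintro ⟨h1, h2⟩ <;> constructor <;> linarith
    by_cases ht : t ∈ Set.Ioo (-ε) ε
    · rw [Set.indicator_of_mem ht]
      exact lintegral_congr fun x => Set.indicator_of_mem ((h x).2 ht) _
    · rw [Set.indicator_of_notMem ht]
      rw [lintegral_congr fun x => Set.indicator_of_notMem (fun h' => ht ((h x).1 h')) F]
      simp
  · have hm := (hF.indicator (measurableSet_strip ε)).comp diffEquiv.measurable
    refine hm.aemeasurable.congr (ae_of_all _ fun z => ?_)
    simp only [Function.comp_apply, diffEquiv_apply]
    rfl

lemma lintegral_strip_fst {F : ℝ → ℝ≥0∞} (hF : Measurable F) (ε : ℝ) :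
    ∫⁻ z in strip ε, F (z 0) = ENNReal.ofReal (2 * ε) * ∫⁻ x, F x := by
  have hm : Measurable fun z : Plane => F (z 0) :=
    hF.comp (by fun_prop : Measurable fun z : Plane => z 0)
  rw [lintegral_strip hm]
  simp only [pt_zero]
  rw [setLIntegral_const, Real.volume_Ioo, mul_comm]
  congr 2; ring

lemma memLp_stripPull (ε : ℝ) (g : Lp ℂ 2 (volume : Measure ℝ)) :
    MemLp (fun z : Plane => g (z 0)) 2 (volume.restrict (strip ε)) := by
  have hs := Lp.stronglyMeasurable g
  refine memLp_two_iff.2 ⟨(hs.comp_measurable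
    (by fun_prop : Measurable fun z : Plane => z 0)).aestronglyMeasurable, ?_⟩
  rw [lintegral_strip_fst (hs.measurable.enorm.pow_const 2)]
  exact ENNReal.mul_lt_top ENNReal.ofReal_lt_top (memLp_two_iff.1 (Lp.memLp g)).2

/-- The pull-back `g ↦ g(x)` to the strip. -/
def stripPull (ε : ℝ) :
    Lp ℂ 2 (volume : Measure ℝ) →L[ℂ] Lp ℂ 2 ((volume : Measure Plane).restrict (strip ε)) :=
  LinearMap.mkContinuous
    { toFun := fun g => (memLp_stripPull ε g).toLp _
      map_add' := fun f g => by
        rw [← MemLp.toLp_add]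
        refine (MemLp.toLp_eq_toLp_iff _ _).2 (ae_restrict_of_ae ?_)
        filter_upwards [quasiMeasurePreserving_fst_coord.ae (Lp.coeFn_add f g)] with z hz
        rw [hz]; rfl
      map_smul' := fun c f => by
        rw [RingHom.id_apply, ← MemLp.toLp_const_smul]
        refine (MemLp.toLp_eq_toLp_iff _ _).2 (ae_restrict_of_ae ?_)
        filter_upwards [quasiMeasurePreserving_fst_coord.ae (Lp.coeFn_smul c f)] with z hz
        rw [hz]; rfl }
    (√(max (2 * ε) 0)) fun g => by
      have h : ‖(memLp_stripPull ε g).toLp _‖ ^ 2 ≤ max (2 * ε) 0 * ‖g‖ ^ 2 := by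
        refine norm_le_of_enorm_sq_le (le_max_right _ _) ?_
        rw [enorm_toLp_sq, enorm_sq_eq_lintegral,
          lintegral_strip_fst ((Lp.stronglyMeasurable g).measurable.enorm.pow_const 2)]
        gcongr
        exact le_max_left _ _
      refine abs_le_of_sq_le_sq' ?_ (by positivity) |>.2
      rw [mul_pow, Real.sq_sqrt (le_max_right _ _)]
      exact h

lemma coeFn_stripPull (ε : ℝ) (g : Lp ℂ 2 (volume : Measure ℝ)) :
    stripPull ε g =ᵐ[(volume : Measure Plane).restrict (strip ε)] fun z => g (z 0) :=
  (memLp_stripPull ε g).coeFn_toLp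

/-- The trace on the diagonal of the function with Fourier transform `w θ`, as a function of
`θ`. -/
def diagTrace (hw : IsFiberBounded w B) : L2Plane →L[ℂ] Lp ℂ 2 (volume : Measure ℝ) :=
  ((Lp.fourierTransformₗᵢ ℝ ℂ).symm.toContinuousLinearEquiv : Lp ℂ 2 (volume : Measure ℝ) →L[ℂ] _) ∘L
    ContinuousLinearMap.adjoint (diagLift hw)

lemma diagTrace_apply (hw : IsFiberBounded w B) (θ : L2Plane) :
    diagTrace hw θ = 𝓕⁻ (ContinuousLinearMap.adjoint (diagLift hw) θ) := rfl

/-- The difference, on the strip, between a function and its trace on the diagonal. -/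
def stripDefect (hw : IsFiberBounded w B) (hC : ∀ z, ‖w z‖ ≤ C) (ε : ℝ) :
    L2Plane →L[ℂ] Lp ℂ 2 ((volume : Measure Plane).restrict (strip ε)) :=
  LpToLpRestrictCLM Plane ℂ ℂ volume 2 (strip ε) ∘L
    ((Lp.fourierTransformₗᵢ Plane ℂ).symm.toContinuousLinearEquiv : L2Plane →L[ℂ] L2Plane) ∘L
      mulOp w hw.continuous C hC - stripPull ε ∘L diagTrace hw

lemma coeFn_stripDefect (hw : IsFiberBounded w B) (hC : ∀ z, ‖w z‖ ≤ C) (ε : ℝ) (θ : L2Plane) :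
    stripDefect hw hC ε θ =ᵐ[(volume : Measure Plane).restrict (strip ε)] fun z =>
      (𝓕⁻ (mulOp w hw.continuous C hC θ) : L2Plane) z - diagTrace hw θ (z 0) := by
  filter_upwards [Lp.coeFn_sub (LpToLpRestrictCLM Plane ℂ ℂ volume 2 (strip ε)
      (𝓕⁻ (mulOp w hw.continuous C hC θ) : L2Plane)) (stripPull ε (diagTrace hw θ)),
    LpToLpRestrictCLM_coeFn (p := 2) (μ := volume) ℂ (strip ε)
      (𝓕⁻ (mulOp w hw.continuous C hC θ) : L2Plane),
    coeFn_stripPull ε (diagTrace hw θ)] with z h1 h2 h3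
  rw [← h3, ← h2]
  exact h1

lemma continuous_fourierInv {V : Type*} [NormedAddCommGroup V] [InnerProductSpace ℝ V]
    [MeasurableSpace V] [BorelSpace V] [FiniteDimensional ℝ V] {h : V → ℂ} (hi : Integrable h) :
    Continuous (𝓕⁻ h) := by
  rw [Real.fourierInv_eq_fourier_comp_neg]
  exact VectorFourier.fourierIntegral_continuous Real.continuous_fourierChar
    (by exact continuous_inner) hi.comp_neg

lemma fourierInv_sub {h k : ℝ → ℂ} (hh : Integrable h) (hk : Integrable k) (x : ℝ) :
    𝓕⁻ (fun y => h y - k y) x = 𝓕⁻ h x - 𝓕⁻ k x := by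
  have hp : ∀ {h : ℝ → ℂ}, Integrable h → Integrable fun v : ℝ => phase (inner ℝ v x) * h v := by
    intro h hh
    refine hh.bdd_mul (c := 1) ?_ (ae_of_all _ fun v => (norm_phase _).le)
    exact (continuous_phase.comp (by fun_prop : Continuous fun v : ℝ => inner ℝ v x)).aestronglyMeasurable
  rw [fourierInv_eq_phase, fourierInv_eq_phase, fourierInv_eq_phase, ← integral_sub (hp hh) (hp hk)]
  simp_rw [mul_sub]

/-- Fubini in the coordinates `(p + q, q)`: the adjoint of the lift integrates `w f` along the
fibres, which is the Fourier transform of the restriction to the diagonal. -/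
lemma adjoint_diagLift_toLp (hw : IsFiberBounded w B) (hreal : ∀ z, conj (w z) = w z)
    {f : Plane → ℂ} (hf : Continuous f) (hc : HasCompactSupport f) (hfm : MemLp f 2 volume)
    (hτ : MemLp (fiberFourier (fun z => w z * f z) 0) 2 volume) :
    ContinuousLinearMap.adjoint (diagLift hw) (hfm.toLp f) =
      hτ.toLp (fiberFourier (fun z => w z * f z) 0) := by
  have huc : Continuous fun z => w z * f z := hw.continuous.mul hf
  have hus : HasCompactSupport fun z => w z * f z := hc.mul_left
  refine ext_inner_left ℂ fun g => ?_
  rw [ContinuousLinearMap.adjoint_inner_right, L2.inner_def, L2.inner_def]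
  have hgm := Lp.stronglyMeasurable g
  have h1 : ∫ z, inner ℂ (diagLift hw g z) (hfm.toLp f z) =
      ∫ z : Plane, conj (g (z 0 + z 1)) * (w z * f z) := by
    refine integral_congr_ae ?_
    filter_upwards [coeFn_diagLift hw g, hfm.coeFn_toLp] with z hz hz2
    rw [hz, hz2, RCLike.inner_apply, map_mul, hreal]; ring
  have h2 : ∫ x, inner ℂ (g x) (hτ.toLp _ x) =
      ∫ x, conj (g x) * fiberFourier (fun z => w z * f z) 0 x := by
    refine integral_congr_ae ?_
    filter_upwards [hτ.coeFn_toLp] with z hz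
    rw [hz, RCLike.inner_apply, mul_comm]
  have hint : Integrable fun z : Plane => conj (g (z 0 + z 1)) * (w z * f z) := by
    have h3 : Integrable fun z => inner ℂ (diagLift hw g z) (hfm.toLp f z) :=
      L2.integrable_inner _ _
    refine h3.congr ?_
    filter_upwards [coeFn_diagLift hw g, hfm.coeFn_toLp] with z hz hz2
    rw [hz, hz2, RCLike.inner_apply, map_mul, hreal]; ring
  rw [h1, h2, ← measurePreserving_sumEquiv.integral_comp sumEquiv.measurableEmbedding]
  have hint2 := (measurePreserving_sumEquiv.integrable_comp_emb sumEquiv.measurableEmbedding).2 hint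
  have hint3 : Integrable fun z : ℝ × ℝ =>
      conj (g z.1) * (w (pt (z.1 - z.2) z.2) * f (pt (z.1 - z.2) z.2)) := by
    refine hint2.congr (ae_of_all _ fun z => ?_)
    simp only [Function.comp_apply, sumEquiv_apply, pt_zero, pt_one, sub_add_cancel]
  simp only [sumEquiv_apply, pt_zero, pt_one, sub_add_cancel]
  rw [Measure.volume_eq_prod, integral_prod _ hint3]
  refine integral_congr_ae (ae_of_all _ fun x => ?_)
  simp only
  rw [integral_const_mul]
  unfold fiberFourier
  simp only [mul_zero, phase_zero, one_mul]

/-- On the line `y = x + t` the defect is the inverse Fourier transform in `η` of the difference of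
the fibre transforms at `t` and at `0`. Plancherel on each such line and integration over `|t| < ε`
give the factor `2 ε`. -/
lemma enorm_stripDefect_le (hw : IsFiberBounded w B) (hC : ∀ z, ‖w z‖ ≤ C)
    (hreal : ∀ z, conj (w z) = w z) {f : Plane → ℂ} (hf : Continuous f)
    (hc : HasCompactSupport f) (hfm : MemLp f 2 volume) {ε c : ℝ} (hε : 0 < ε) (hc0 : 0 ≤ c)
    (hphase : ∀ p q t, f (pt p q) ≠ 0 → |t| < ε → ‖phase (q * t) - 1‖ ≤ c) :
    ‖stripDefect hw hC ε (hfm.toLp f)‖ ^ 2 ≤ 2 * ε * (c ^ 2 * B) * ‖hfm.toLp f‖ ^ 2 := by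
  have hB := hw.nonneg
  refine norm_le_of_enorm_sq_le (by positivity) ?_
  rw [enorm_sq_eq_lintegral, enorm_toLp_sq]
  set u : Plane → ℂ := fun z => w z * f z with hu
  have huc : Continuous u := hw.continuous.mul hf
  have hus : HasCompactSupport u := hc.mul_left
  have hui : Integrable u := huc.integrable_of_hasCompactSupport hus
  have hum : MemLp u 2 volume := huc.memLp_of_hasCompactSupport hus
  have hτ0 := memLp_fiberFourier huc hus 0
  have hτi := integrable_fiberFourier huc hus
  have e1 : mulOp w hw.continuous C hC (hfm.toLp f) = hum.toLp u := by
    refine Lp.ext ?_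
    filter_upwards [coeFn_mulOp hw.continuous hC (hfm.toLp f), hfm.coeFn_toLp, hum.coeFn_toLp] with
      z h1 h2 h3
    rw [h1, h2, h3]
  have e2 := fourierInv_toLp_ae_eq hui hum
  have e3 : diagTrace hw (hfm.toLp f) =ᵐ[volume] 𝓕⁻ (fiberFourier u 0) := by
    rw [diagTrace_apply, adjoint_diagLift_toLp hw hreal hf hc hfm hτ0]
    exact fourierInv_toLp_ae_eq (hτi 0) hτ0
  have e4 : ∫⁻ z in strip ε, ‖stripDefect hw hC ε (hfm.toLp f) z‖ₑ ^ 2 =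
      ∫⁻ z in strip ε, ‖𝓕⁻ u z - 𝓕⁻ (fiberFourier u 0) (z 0)‖ₑ ^ 2 := by
    refine lintegral_congr_ae ?_
    filter_upwards [coeFn_stripDefect hw hC ε (hfm.toLp f), ae_restrict_of_ae e2,
      ae_restrict_of_ae (quasiMeasurePreserving_fst_coord.ae e3)] with z h1 h2 h3
    rw [h1, e1, h2, h3]
  have hm : Measurable fun z : Plane => ‖𝓕⁻ u z - 𝓕⁻ (fiberFourier u 0) (z 0)‖ₑ ^ 2 := by
    have h1 := (continuous_fourierInv hui).measurable
    have h2 : Measurable fun z : Plane => 𝓕⁻ (fiberFourier u 0) (z 0) :=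
      (continuous_fourierInv (hτi 0)).measurable.comp
        (by fun_prop : Measurable fun z : Plane => z 0)
    exact (h1.sub h2).enorm.pow_const 2
  rw [e4, lintegral_strip hm]
  calc _ ≤ ∫⁻ _ in Set.Ioo (-ε) ε, ENNReal.ofReal (c ^ 2 * B) * ∫⁻ z, ‖f z‖ₑ ^ 2 := by
        refine setLIntegral_mono' measurableSet_Ioo fun t ht => ?_
        refine le_trans (le_of_eq ?_) (lintegral_fiberFourier_sub_le hw hf hc hc0
          (t := t) fun p q h => hphase p q t h (abs_lt.2 ht))
        have e5 : ∀ x, 𝓕⁻ u (pt x (x + t)) - 𝓕⁻ (fiberFourier u 0) ((pt x (x + t)) 0) =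
            𝓕⁻ (fun η => fiberFourier u t η - fiberFourier u 0 η) x := fun x => by
          rw [fourierInv_pt huc hus, pt_zero, fourierInv_sub (hτi t) (hτi 0)]
        simp_rw [e5]
        exact lintegral_enorm_fourierInv_sq ((hτi t).sub (hτi 0))
          ((memLp_fiberFourier huc hus t).sub hτ0)
    _ = _ := by
        rw [setLIntegral_const, Real.volume_Ioo, mul_right_comm, ← ENNReal.ofReal_mul' (by linarith)]
        congr 2; ring

lemma dense_toLp_compactSupport :
    Dense {θ : L2Plane | ∃ (f : Plane → ℂ) (hf : MemLp f 2 volume), Continuous f ∧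
      HasCompactSupport f ∧ θ = hf.toLp f} := by
  refine Metric.dense_iff.2 fun θ r hr => ?_
  obtain ⟨f, hc, hfe, hf, hfm⟩ := (Lp.memLp θ).exists_hasCompactSupport_eLpNorm_sub_le
    (by simp) (ε := ENNReal.ofReal (r / 2)) (by simpa using hr)
  refine ⟨hfm.toLp f, ?_, f, hfm, hf, hc, rfl⟩
  rw [Metric.mem_ball', dist_eq_norm]
  have h : ‖θ - hfm.toLp f‖ₑ ≤ ENNReal.ofReal (r / 2) := by
    rw [Lp.enorm_def]
    refine le_trans (le_of_eq (eLpNorm_congr_ae ?_)) hfe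
    filter_upwards [Lp.coeFn_sub θ (hfm.toLp f), hfm.coeFn_toLp] with z h1 h2
    rw [h1, Pi.sub_apply, Pi.sub_apply, h2]
  rw [← ofReal_norm, ENNReal.ofReal_le_ofReal_iff (by positivity)] at h
  linarith

/-- With `c = 2` the estimate needs no information on the support, so it extends by density with a
constant proportional to the strip width. -/
lemma norm_stripDefect_le (hw : IsFiberBounded w B) (hC : ∀ z, ‖w z‖ ≤ C)
    (hreal : ∀ z, conj (w z) = w z) {ε : ℝ} (hε : 0 < ε) (θ : L2Plane) :
    ‖stripDefect hw hC ε θ‖ ^ 2 ≤ 2 * ε * (2 ^ 2 * B) * ‖θ‖ ^ 2 := by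
  refine dense_toLp_compactSupport.induction (P := fun θ =>
    ‖stripDefect hw hC ε θ‖ ^ 2 ≤ 2 * ε * (2 ^ 2 * B) * ‖θ‖ ^ 2) ?_ ?_ θ
  · rintro _ ⟨f, hfm, hf, hc, rfl⟩
    refine enorm_stripDefect_le hw hC hreal hf hc hfm hε two_pos.le fun p q t _ _ => ?_
    refine (norm_sub_le _ _).trans ?_
    rw [norm_phase, norm_one]; norm_num
  · exact isClosed_le (by fun_prop) (by fun_prop)

/-- The trace theorem. -/
theorem tendsto_stripDefect (hw : IsFiberBounded w B) (hC : ∀ z, ‖w z‖ ≤ C)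
    (hreal : ∀ z, conj (w z) = w z) (θ : L2Plane) :
    Tendsto (fun ε : ℝ => 1 / (2 * ε) * ‖stripDefect hw hC ε θ‖ ^ 2) (𝓝[>] 0) (𝓝 0) := by
  have hB := hw.nonneg
  rw [Metric.tendsto_nhds]
  intro r hr
  -- `δ` is the error allowed in approximating `θ` by a compactly supported function: after division
  -- by `2 ε` it contributes at most `r/2`, uniformly in `ε`.
  obtain ⟨δ, hδ, hδr⟩ : ∃ δ : ℝ, 0 < δ ∧ 2 * (2 ^ 2 * B) * δ ^ 2 ≤ r / 2 := by
    refine ⟨√(r / (16 * (B + 1))), Real.sqrt_pos.2 (by positivity), ?_⟩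
    rw [Real.sq_sqrt (by positivity), mul_div_assoc', div_le_div_iff₀ (by positivity) two_pos]
    nlinarith
  obtain ⟨θ', ⟨f, hfm, hf, hc, rfl⟩, hθ'⟩ := dense_toLp_compactSupport.exists_dist_lt θ hδ
  rw [dist_eq_norm] at hθ'
  obtain ⟨R, hR0, hR⟩ := exists_support_bound hc
  set K := 2 * ((2 * Real.pi * R) ^ 2 * B) * ‖hfm.toLp f‖ ^ 2 with hK
  have hlim : Tendsto (fun ε : ℝ => K * ε ^ 2) (𝓝[>] 0) (𝓝 0) := by
    have h : Continuous fun ε : ℝ => K * ε ^ 2 := by fun_prop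
    have h2 := h.tendsto 0
    simp only [ne_eq, OfNat.ofNat_ne_zero, not_false_eq_true, zero_pow, mul_zero] at h2
    exact h2.mono_left nhdsWithin_le_nhds
  filter_upwards [self_mem_nhdsWithin, hlim.eventually (gt_mem_nhds (half_pos hr))] with ε hε hεK
  have hε : 0 < ε := hε
  rw [Real.dist_0_eq_abs, abs_of_nonneg (by positivity)]
  have h1 := norm_stripDefect_le hw hC hreal hε (θ - hfm.toLp f)
  have h2 : ‖stripDefect hw hC ε (hfm.toLp f)‖ ^ 2 ≤
      2 * ε * ((2 * Real.pi * R * ε) ^ 2 * B) * ‖hfm.toLp f‖ ^ 2 := by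
    refine enorm_stripDefect_le hw hC hreal hf hc hfm hε (by positivity) fun p q t h ht => ?_
    refine (norm_phase_sub_one_le _).trans ?_
    rw [abs_mul, mul_assoc (2 * Real.pi)]
    have := (hR p q h).2
    gcongr
  have h3 : ‖stripDefect hw hC ε θ‖ ^ 2 ≤ 2 * ‖stripDefect hw hC ε (θ - hfm.toLp f)‖ ^ 2 +
      2 * ‖stripDefect hw hC ε (hfm.toLp f)‖ ^ 2 := by
    have : stripDefect hw hC ε θ =
        stripDefect hw hC ε (θ - hfm.toLp f) + stripDefect hw hC ε (hfm.toLp f) := by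
      rw [← map_add, sub_add_cancel]
    rw [this]
    have h4 := norm_add_le (stripDefect hw hC ε (θ - hfm.toLp f))
      (stripDefect hw hC ε (hfm.toLp f))
    have h5 := pow_le_pow_left₀ (norm_nonneg _) h4 2
    nlinarith [sq_nonneg (‖stripDefect hw hC ε (θ - hfm.toLp f)‖ -
      ‖stripDefect hw hC ε (hfm.toLp f)‖)]
  have h6 : ‖θ - hfm.toLp f‖ ^ 2 ≤ δ ^ 2 := by gcongr
  rw [one_div, inv_mul_lt_iff₀ (by positivity)]
  calc _ ≤ 2 * (2 * ε * (2 ^ 2 * B) * δ ^ 2) +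
        2 * (2 * ε * ((2 * Real.pi * R * ε) ^ 2 * B) * ‖hfm.toLp f‖ ^ 2) := by
        refine h3.trans ?_
        gcongr
        exact h1.trans (by gcongr)
    _ = 2 * ε * (2 * (2 ^ 2 * B) * δ ^ 2 + K * ε ^ 2) := by rw [hK]; ring
    _ < 2 * ε * r := by gcongr; linarith

end DiagonalTrace

/-! ### Unfolding the half-line: odd extension and the symmetric subspaces. -/

section Unfolding

lemma coeFn_comp (e : Plane ≃ₗᵢ[ℝ] Plane) (f : L2Plane) : comp e f =ᵐ[volume] f ∘ e :=
  coeFn_compIso e f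

lemma comp_comp_self {e : Plane ≃ₗᵢ[ℝ] Plane} (he : ∀ z, e (e z) = z) (f : L2Plane) :
    comp e (comp e f) = f := by
  refine Lp.ext ?_
  filter_upwards [coeFn_comp e (comp e f),
    e.measurePreserving.quasiMeasurePreserving.ae (coeFn_comp e f)] with z h1 h2
  rw [h1, Function.comp_apply, h2, Function.comp_apply, he]

lemma reflect_reflect (i : Fin 2) (z : Plane) : reflect i (reflect i z) = z := by
  ext j; fin_cases i <;> fin_cases j <;> simp

lemma reflect_comm (z : Plane) : reflect 0 (reflect 1 z) = reflect 1 (reflect 0 z) := by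
  ext j; fin_cases j <;> simp

/-- The subspace of `L²(ℝ²)` of functions with the symmetries of the sample: invariance under
exchange and, on the half-line, oddness in each variable. -/
def Sample.symmSpace : Sample → Submodule ℂ L2Plane
  | .line => LinearMap.eqLocus (comp swap) LinearMap.id
  | .halfLine => LinearMap.eqLocus (comp swap) LinearMap.id ⊓
      (LinearMap.eqLocus (comp (reflect 0)) (-LinearMap.id) ⊓
        LinearMap.eqLocus (comp (reflect 1)) (-LinearMap.id))

lemma mem_symmSpace_line {f : L2Plane} : f ∈ Sample.line.symmSpace ↔ comp swap f = f := Iff.rfl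

lemma mem_symmSpace_halfLine {f : L2Plane} : f ∈ Sample.halfLine.symmSpace ↔
    comp swap f = f ∧ comp (reflect 0) f = -f ∧ comp (reflect 1) f = -f := Iff.rfl

lemma isClosed_symmSpace (Ω : Sample) : IsClosed (Ω.symmSpace : Set L2Plane) := by
  have h : ∀ e, Continuous (comp e) := fun e => (compIso e).continuous
  cases Ω
  · exact isClosed_eq (h swap) continuous_id
  · exact (isClosed_eq (h swap) continuous_id).inter
      ((isClosed_eq (h (reflect 0)) continuous_id.neg).inter
        (isClosed_eq (h (reflect 1)) continuous_id.neg))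

lemma mem_symmSpace_iff_ae (Ω : Sample) (f : L2Plane) : f ∈ Ω.symmSpace ↔
    (∀ᵐ z, f (swap z) = f z) ∧
      (Ω = .halfLine → (∀ᵐ z, f (reflect 0 z) = -f z) ∧ ∀ᵐ z, f (reflect 1 z) = -f z) := by
  have h1 : comp swap f = f ↔ ∀ᵐ z, f (swap z) = f z := by
    rw [Lp.ext_iff]
    refine ⟨fun h => ?_, fun h => ?_⟩ <;>
      filter_upwards [h, coeFn_comp swap f] with z hz hz2
    · rw [← hz, hz2]; rfl
    · rw [hz2, ← hz]; rfl
  have h2 : ∀ i, comp (reflect i) f = -f ↔ ∀ᵐ z, f (reflect i z) = -f z := by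
    intro i
    rw [Lp.ext_iff]
    refine ⟨fun h => ?_, fun h => ?_⟩ <;>
      filter_upwards [h, coeFn_comp (reflect i) f, Lp.coeFn_neg f] with z hz hz2 hz3
    · rw [hz3, hz2] at hz; exact hz
    · rw [hz3, hz2]; exact hz
  cases Ω
  · simp [mem_symmSpace_line, h1]
  · rw [mem_symmSpace_halfLine, h1, h2, h2]; simp

lemma comp_fourier (e : Plane ≃ₗᵢ[ℝ] Plane) (f : L2Plane) : comp e (𝓕 f) = 𝓕 (comp e f) :=
  (fourier_compIso e f).symm

lemma comp_fourierInv (e : Plane ≃ₗᵢ[ℝ] Plane) (f : L2Plane) : comp e (𝓕⁻ f) = 𝓕⁻ (comp e f) :=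
  (fourierInv_compIso e f).symm

lemma fourier_neg_plane (f : L2Plane) : 𝓕 (-f) = -𝓕 f :=
  map_neg (Lp.fourierTransformₗᵢ Plane ℂ) f

lemma fourierInv_neg_plane (f : L2Plane) : 𝓕⁻ (-f) = -𝓕⁻ f :=
  map_neg (Lp.fourierTransformₗᵢ Plane ℂ).symm f

lemma fourier_mem_symmSpace {Ω : Sample} {f : L2Plane} (hf : f ∈ Ω.symmSpace) :
    𝓕 f ∈ Ω.symmSpace := by
  cases Ω
  · rw [mem_symmSpace_line] at *
    rw [comp_fourier, hf]
  · rw [mem_symmSpace_halfLine] at *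
    simp only [comp_fourier, hf.1, hf.2.1, hf.2.2, fourier_neg_plane, and_self]

lemma fourierInv_mem_symmSpace {Ω : Sample} {f : L2Plane} (hf : f ∈ Ω.symmSpace) :
    𝓕⁻ f ∈ Ω.symmSpace := by
  cases Ω
  · rw [mem_symmSpace_line] at *
    rw [comp_fourierInv, hf]
  · rw [mem_symmSpace_halfLine] at *
    simp only [comp_fourierInv, hf.1, hf.2.1, hf.2.2, fourierInv_neg_plane, and_self]

lemma coeFn_oddExtension (f : L2Plane) : oddExtension f =ᵐ[volume] fun z =>
    f z - f (reflect 0 z) - f (reflect 1 z) + f (reflect 0 (reflect 1 z)) := by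
  have e : oddExtension f =
      f - comp (reflect 0) f - comp (reflect 1) f + comp (reflect 0) (comp (reflect 1) f) := rfl
  rw [e]
  filter_upwards [Lp.coeFn_add (f - comp (reflect 0) f - comp (reflect 1) f)
      (comp (reflect 0) (comp (reflect 1) f)),
    Lp.coeFn_sub (f - comp (reflect 0) f) (comp (reflect 1) f),
    Lp.coeFn_sub f (comp (reflect 0) f), coeFn_comp (reflect 0) f, coeFn_comp (reflect 1) f,
    coeFn_comp (reflect 0) (comp (reflect 1) f), ae_reflect 0 (coeFn_comp (reflect 1) f)]
    with z h1 h2 h3 h4 h5 h6 h7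
  rw [h1, Pi.add_apply, h2, Pi.sub_apply, h3, Pi.sub_apply, h4, h5, h6, Function.comp_apply,
    Function.comp_apply, Function.comp_apply, h7, Function.comp_apply, reflect_comm]

lemma oddExtension_mem_symmSpace {f : L2Plane} (hf : comp swap f = f) :
    oddExtension f ∈ Sample.halfLine.symmSpace := by
  rw [mem_symmSpace_iff_ae]
  have hs : ∀ᵐ z, f (swap z) = f z := ((mem_symmSpace_iff_ae .line f).1 hf).1
  have ho := coeFn_oddExtension f
  have hsw0 : ∀ z, swap (reflect 0 z) = reflect 1 (swap z) := fun z => by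
    ext j; fin_cases j <;> simp
  have hsw1 : ∀ z, swap (reflect 1 z) = reflect 0 (swap z) := fun z => by
    ext j; fin_cases j <;> simp
  refine ⟨?_, fun _ => ⟨?_, ?_⟩⟩
  · filter_upwards [ho, ae_swap ho, hs, ae_reflect 0 hs, ae_reflect 1 hs,
      ae_reflect 1 (ae_reflect 0 hs)] with z h1 h2 h3 h4 h5 h6
    rw [hsw0] at h4 h6
    rw [hsw1] at h5 h6
    rw [h1, h2, h3, h4, h5, reflect_comm, h6]
    ring
  · filter_upwards [ho, ae_reflect 0 ho] with z h1 h2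
    rw [h1, h2, reflect_reflect, ← reflect_comm, reflect_reflect]; ring
  · filter_upwards [ho, ae_reflect 1 ho] with z h1 h2
    rw [h1, h2, reflect_reflect]; ring

lemma lintegral_comp_isometry (e : Plane ≃ₗᵢ[ℝ] Plane) (F : Plane → ℝ≥0∞) :
    ∫⁻ z, F (e z) = ∫⁻ z, F z :=
  e.measurePreserving.lintegral_comp_emb e.toHomeomorph.measurableEmbedding F

lemma measurableSet_square (Ω : Sample) : MeasurableSet Ω.square := by
  have h : MeasurableSet Ω.toSet := by
    cases Ω
    · exact .univ
    · exact measurableSet_Ioi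
  have h1 : MeasurableSet {z : Plane | z 0 ∈ Ω.toSet} :=
    (by fun_prop : Measurable fun z : Plane => z 0) h
  have h2 : MeasurableSet {z : Plane | z 1 ∈ Ω.toSet} :=
    (by fun_prop : Measurable fun z : Plane => z 1) h
  exact h1.inter h2

lemma mem_square_halfLine {z : Plane} : z ∈ Sample.halfLine.square ↔ 0 < z 0 ∧ 0 < z 1 := Iff.rfl

lemma ae_coord_ne_zero : ∀ᵐ z : Plane, z 0 ≠ 0 ∧ z 1 ≠ 0 := by
  have h0 : ∀ᵐ x : ℝ, x ≠ 0 := by simp [ae_iff]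
  have h1 := quasiMeasurePreserving_fst_coord.ae h0
  filter_upwards [h1, ae_swap h1] with z hz1 hz2
  exact ⟨hz1, hz2⟩

/-- The four reflected copies of a function supported in the open quadrant have disjoint supports,
so there are no cross terms. -/
lemma enorm_oddExtension_sq {ψ : L2Plane}
    (hψ : ∀ᵐ z : Plane, z ∉ Sample.halfLine.square → ψ z = 0) :
    ‖oddExtension ψ‖ₑ ^ 2 = 4 * ‖ψ‖ₑ ^ 2 := by
  have hm : Measurable fun z => ‖ψ z‖ₑ ^ 2 :=
    (Lp.stronglyMeasurable ψ).measurable.enorm.pow_const 2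
  have hr : ∀ i, Measurable fun z : Plane => reflect i z := fun i =>
    (reflect i).continuous.measurable
  rw [enorm_sq_eq_lintegral, enorm_sq_eq_lintegral]
  have key : ∫⁻ z, ‖oddExtension ψ z‖ₑ ^ 2 = ∫⁻ z, (‖ψ z‖ₑ ^ 2 + ‖ψ (reflect 0 z)‖ₑ ^ 2 +
      ‖ψ (reflect 1 z)‖ₑ ^ 2 + ‖ψ (reflect 0 (reflect 1 z))‖ₑ ^ 2) := by
    refine lintegral_congr_ae ?_
    filter_upwards [coeFn_oddExtension ψ, hψ, ae_reflect 0 hψ, ae_reflect 1 hψ,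
      ae_reflect 1 (ae_reflect 0 hψ)] with z h h0 h1 h2 h3
    rw [h]
    simp only [mem_square_halfLine, reflect_zero_zero, reflect_zero_one, reflect_one_zero,
      reflect_one_one] at h0 h1 h2 h3
    by_cases hz0 : 0 < z 0 <;> by_cases hz1 : 0 < z 1
    · rw [h1 (by intro h; linarith [h.1]), h2 (by intro h; linarith [h.2]),
        h3 (by intro h; linarith [h.1])]
      simp
    · rw [h0 (by intro h; linarith [h.2]), h1 (by intro h; linarith [h.1]),
        h3 (by intro h; linarith [h.1])]
      simp
    · rw [h0 (by intro h; linarith [h.1]), h2 (by intro h; linarith [h.2]),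
        h3 (by intro h; linarith [h.2])]
      simp
    · rw [h0 (by intro h; linarith [h.1]), h1 (by intro h; linarith [h.2]),
        h2 (by intro h; linarith [h.1])]
      simp
  have hm0 : Measurable fun z => ‖ψ (reflect 0 z)‖ₑ ^ 2 := hm.comp (hr 0)
  have hm1 : Measurable fun z => ‖ψ (reflect 1 z)‖ₑ ^ 2 := hm.comp (hr 1)
  have i1 : ∫⁻ z, ‖ψ (reflect 0 (reflect 1 z))‖ₑ ^ 2 = ∫⁻ z, ‖ψ z‖ₑ ^ 2 :=
    (lintegral_comp_isometry (reflect 1) fun z => ‖ψ (reflect 0 z)‖ₑ ^ 2).trans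
      (lintegral_comp_isometry (reflect 0) fun z => ‖ψ z‖ₑ ^ 2)
  have hs1 : Measurable fun z => ‖ψ z‖ₑ ^ 2 + ‖ψ (reflect 0 z)‖ₑ ^ 2 := hm.add hm0
  have hs2 : Measurable fun z => ‖ψ z‖ₑ ^ 2 + ‖ψ (reflect 0 z)‖ₑ ^ 2 + ‖ψ (reflect 1 z)‖ₑ ^ 2 :=
    hs1.add hm1
  rw [key, lintegral_add_left hs2, lintegral_add_left hs1,
    lintegral_add_left hm, i1, lintegral_comp_isometry (reflect 0) fun z => ‖ψ z‖ₑ ^ 2,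
    lintegral_comp_isometry (reflect 1) fun z => ‖ψ z‖ₑ ^ 2]
  ring

/-- The unitary embedding of the pair space into `L²(ℝ²)`: the inclusion on the line, and half the
odd extension on the half-line. -/
def Sample.unfoldMap : (Ω : Sample) → Ω.pairSpace →ₗ[ℂ] L2Plane
  | .line => Sample.line.pairSpace.subtype
  | .halfLine => (1 / 2 : ℂ) • (oddExtension ∘ₗ Sample.halfLine.pairSpace.subtype)

/-- The factor by which a function differs from its unfolding. -/
def Sample.foldFactor : Sample → ℝ
  | .line => 1
  | .halfLine => 2

lemma Sample.foldFactor_pos (Ω : Sample) : 0 < Ω.foldFactor := by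
  cases Ω <;> simp [Sample.foldFactor]

/-- The sine transform becomes an ordinary Fourier transform on the subspace of functions odd in
both variables; both samples can then be treated alike. -/
lemma spectralTransform_eq (Ω : Sample) (ψ : Ω.pairSpace) :
    Ω.spectralTransform (ψ : L2Plane) = 𝓕 (Ω.unfoldMap ψ) := by
  cases Ω
  · rfl
  · exact (map_smul (Lp.fourierTransformₗᵢ Plane ℂ) (1 / 2 : ℂ) (oddExtension (ψ : L2Plane))).symm

lemma norm_unfoldMap (Ω : Sample) (ψ : Ω.pairSpace) : ‖Ω.unfoldMap ψ‖ = ‖ψ‖ := by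
  cases Ω
  · rfl
  · have h := enorm_oddExtension_sq (ψ := (ψ : L2Plane)) ψ.2.1
    have h2 : ‖oddExtension (ψ : L2Plane)‖ ^ 2 = (2 * ‖ψ‖) ^ 2 := by
      have := congrArg ENNReal.toReal h
      rw [ENNReal.toReal_pow, ENNReal.toReal_mul, ENNReal.toReal_pow, toReal_enorm,
        toReal_enorm] at this
      rw [this, mul_pow, Submodule.coe_norm]; norm_num
    have h3 := (pow_left_inj₀ (norm_nonneg _) (by positivity) two_ne_zero).1 h2
    show ‖(1 / 2 : ℂ) • oddExtension (ψ : L2Plane)‖ = _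
    rw [norm_smul, h3]
    norm_num
    ring

lemma unfoldMap_mem (Ω : Sample) (ψ : Ω.pairSpace) : Ω.unfoldMap ψ ∈ Ω.symmSpace := by
  cases Ω
  · exact ψ.2.2
  · exact Submodule.smul_mem _ _ (oddExtension_mem_symmSpace ψ.2.2)

lemma eq_foldFactor_mul_unfoldMap (Ω : Sample) (ψ : Ω.pairSpace) :
    ∀ᵐ z, z ∈ Ω.square → (ψ : L2Plane) z = Ω.foldFactor * Ω.unfoldMap ψ z := by
  cases Ω
  · refine ae_of_all _ fun z _ => ?_
    simp [Sample.foldFactor, Sample.unfoldMap]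
  · have hψ := ψ.2.1
    have e : Sample.halfLine.unfoldMap ψ = (1 / 2 : ℂ) • oddExtension (ψ : L2Plane) := rfl
    rw [e]
    filter_upwards [coeFn_oddExtension (ψ : L2Plane),
      Lp.coeFn_smul (1 / 2 : ℂ) (oddExtension (ψ : L2Plane)), ae_reflect 0 hψ, ae_reflect 1 hψ,
      ae_reflect 1 (ae_reflect 0 hψ)] with z h hs h1 h2 h3 hz
    simp only [mem_square_halfLine, reflect_zero_zero, reflect_zero_one, reflect_one_zero,
      reflect_one_one] at hz h1 h2 h3
    rw [hs, Pi.smul_apply, h, h1 (by intro h; linarith [h.1, hz.1]),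
      h2 (by intro h; linarith [h.2, hz.2]), h3 (by intro h; linarith [h.1, hz.1])]
    simp [Sample.foldFactor]

/-- The preimage on the half-line is twice the restriction to the quadrant; the odd symmetries
recover the other quadrants, and the axes are null. -/
lemma unfoldMap_surjective (Ω : Sample) {f : L2Plane} (hf : f ∈ Ω.symmSpace) :
    ∃ ψ : Ω.pairSpace, Ω.unfoldMap ψ = f := by
  cases Ω
  · exact ⟨⟨f, ae_of_all _ fun z hz => absurd ⟨trivial, trivial⟩ hz, hf⟩, rfl⟩
  · obtain ⟨hs, ho⟩ := (mem_symmSpace_iff_ae _ _).1 hf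
    obtain ⟨ho0, ho1⟩ := ho rfl
    have hm : MemLp (Sample.halfLine.square.indicator fun z => 2 * f z) 2 volume :=
      ((Lp.memLp f).const_mul 2).indicator (measurableSet_square _)
    have hc := hm.coeFn_toLp
    set ψ : L2Plane := hm.toLp _ with hψ
    have h1 : ∀ᵐ z : Plane, z ∉ Sample.halfLine.square → ψ z = 0 := by
      filter_upwards [hc] with z hz hz2
      rw [hz, Set.indicator_of_notMem hz2]
    have h2 : comp swap ψ = ψ := by
      have : ψ ∈ Sample.line.symmSpace := by
        refine (mem_symmSpace_iff_ae _ _).2 ⟨?_, by simp⟩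
        filter_upwards [hc, ae_swap hc, hs] with z hz1 hz2 hz3
        rw [hz1, hz2]
        by_cases h : z ∈ Sample.halfLine.square
        · have h' : swap z ∈ Sample.halfLine.square := ⟨h.2, h.1⟩
          rw [Set.indicator_of_mem h, Set.indicator_of_mem h', hz3]
        · rw [Set.indicator_of_notMem h, Set.indicator_of_notMem]
          exact fun h' => h ⟨h'.2, h'.1⟩
      exact this
    refine ⟨⟨ψ, h1, h2⟩, ?_⟩
    have e : Sample.halfLine.unfoldMap ⟨ψ, h1, h2⟩ = (1 / 2 : ℂ) • oddExtension ψ := rfl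
    rw [e]
    refine Lp.ext ?_
    filter_upwards [coeFn_oddExtension ψ, Lp.coeFn_smul (1 / 2 : ℂ) (oddExtension ψ), hc,
      ae_reflect 0 hc, ae_reflect 1 hc, ae_reflect 1 (ae_reflect 0 hc), ho0, ho1,
      ae_reflect 1 ho0, ae_coord_ne_zero] with z h hsm c c0 c1 c01 o0 o1 o01 hne
    rw [hsm, Pi.smul_apply, h, c, c0, c1, c01]
    simp only [Set.indicator, mem_square_halfLine, reflect_zero_zero, reflect_zero_one,
      reflect_one_zero, reflect_one_one, o0, o1, o01]
    rcases lt_or_gt_of_ne hne.1 with a | a <;> rcases lt_or_gt_of_ne hne.2 with b | b <;>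
      simp [a, b, a.not_gt, b.not_gt]

/-- The spectral transform as a unitary onto the functions with the symmetries of the sample. -/
def Sample.unitary (Ω : Sample) : Ω.pairSpace ≃ₗᵢ[ℂ] Ω.symmSpace :=
  LinearIsometryEquiv.ofSurjective
    { toFun := fun ψ => ⟨𝓕 (Ω.unfoldMap ψ), fourier_mem_symmSpace (unfoldMap_mem Ω ψ)⟩
      map_add' := fun ψ φ => Subtype.ext (by
        change 𝓕 (Ω.unfoldMap (ψ + φ)) = 𝓕 (Ω.unfoldMap ψ) + 𝓕 (Ω.unfoldMap φ)
        rw [map_add]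
        exact map_add (Lp.fourierTransformₗᵢ Plane ℂ) _ _)
      map_smul' := fun c ψ => Subtype.ext (by
        change 𝓕 (Ω.unfoldMap (c • ψ)) = c • 𝓕 (Ω.unfoldMap ψ)
        rw [map_smul]
        exact map_smul (Lp.fourierTransformₗᵢ Plane ℂ) _ _)
      norm_map' := fun ψ => by
        refine Eq.trans ?_ (norm_unfoldMap Ω ψ)
        exact (Lp.fourierTransformₗᵢ Plane ℂ).norm_map _ }
    (by
      rintro ⟨f, hf⟩
      obtain ⟨ψ, hψ⟩ := unfoldMap_surjective Ω (fourierInv_mem_symmSpace hf)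
      refine ⟨ψ, Subtype.ext ?_⟩
      change 𝓕 (Ω.unfoldMap ψ) = f
      rw [hψ, FourierTransform.fourier_fourierInv_eq])

lemma coe_unitary (Ω : Sample) (ψ : Ω.pairSpace) :
    (Ω.unitary ψ : L2Plane) = Ω.spectralTransform (ψ : L2Plane) :=
  (spectralTransform_eq Ω ψ).symm

lemma coe_unitary_eq_fourier (Ω : Sample) (ψ : Ω.pairSpace) :
    (Ω.unitary ψ : L2Plane) = 𝓕 (Ω.unfoldMap ψ) := rfl

instance (Ω : Sample) : CompleteSpace Ω.symmSpace :=
  (isClosed_symmSpace Ω).completeSpace_coe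

end Unfolding

/-! ### Existence and uniqueness of diagonal traces. -/

section Traces

variable {w : Plane → ℂ} {B C : ℝ}

lemma measurableSet_toSet (Ω : Sample) : MeasurableSet Ω.toSet := by
  cases Ω
  · exact .univ
  · exact measurableSet_Ioi

lemma measurableSet_square_inter_strip (Ω : Sample) (ε : ℝ) :
    MeasurableSet {z : Plane | z ∈ Ω.square ∧ |z 0 - z 1| < ε} :=
  (measurableSet_square Ω).inter (measurableSet_strip ε)

lemma square_inter_strip_subset (Ω : Sample) (ε : ℝ) :
    {z : Plane | z ∈ Ω.square ∧ |z 0 - z 1| < ε} ⊆ strip ε := fun _ hz => hz.2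

lemma integrable_norm_sq {α : Type*} [MeasurableSpace α] {m : Measure α} {f : α → ℂ}
    (hf : MemLp f 2 m) : Integrable (fun x => ‖f x‖ ^ 2) m := hf.norm.integrable_sq

lemma ofReal_integral_norm_sq {α : Type*} [MeasurableSpace α] {m : Measure α} {f : α → ℂ}
    (hf : MemLp f 2 m) : ENNReal.ofReal (∫ x, ‖f x‖ ^ 2 ∂m) = ∫⁻ x, ‖f x‖ₑ ^ 2 ∂m := by
  rw [ofReal_integral_eq_lintegral_ofReal (integrable_norm_sq hf)
    (ae_of_all _ fun x => by positivity)]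
  refine lintegral_congr fun x => ?_
  rw [ENNReal.ofReal_pow (norm_nonneg _), ofReal_norm]

lemma integral_norm_sq_eq {α : Type*} [MeasurableSpace α] {m : Measure α} (f : Lp ℂ 2 m) :
    ∫ x, ‖f x‖ ^ 2 ∂m = ‖f‖ ^ 2 := by
  have h := ofReal_integral_norm_sq (Lp.memLp f)
  rw [← enorm_sq_eq_lintegral, ← ofReal_norm, ← ENNReal.ofReal_pow (norm_nonneg _)] at h
  exact (ENNReal.ofReal_eq_ofReal_iff (integral_nonneg fun x => by positivity)
    (by positivity)).1 h

/-- Existence of traces on the diagonal. -/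
lemma isDiagonalTrace_diagTrace (Ω : Sample) (hw : IsFiberBounded w B) (hC : ∀ z, ‖w z‖ ≤ C)
    (hreal : ∀ z, conj (w z) = w z) {ψ : Ω.pairSpace} {θ : L2Plane} {c : ℂ}
    (h : ∀ᵐ z, z ∈ Ω.square →
      (ψ : L2Plane) z = c * (𝓕⁻ (mulOp w hw.continuous C hC θ) : L2Plane) z) :
    Ω.IsDiagonalTrace ψ fun x => c * diagTrace hw θ x := by
  refine ⟨((Lp.memLp (diagTrace hw θ)).const_mul c).restrict _, ?_⟩
  have hlim := (tendsto_stripDefect hw hC hreal θ).const_mul (‖c‖ ^ 2)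
  rw [mul_zero] at hlim
  refine squeeze_zero' ?_ ?_ hlim
  · filter_upwards [self_mem_nhdsWithin] with ε hε
    have hε : 0 < ε := hε
    exact mul_nonneg (by positivity) (integral_nonneg fun z => by positivity)
  · filter_upwards [self_mem_nhdsWithin] with ε hε
    have hε : 0 < ε := hε
    rw [mul_left_comm]
    refine mul_le_mul_of_nonneg_left ?_ (by positivity)
    rw [← integral_norm_sq_eq, ← integral_const_mul]
    have hi := (integrable_norm_sq (Lp.memLp (stripDefect hw hC ε θ))).const_mul (‖c‖ ^ 2)
    refine le_trans (le_of_eq ?_) (setIntegral_mono_set hi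
      (ae_of_all _ fun z => by simp only [Pi.zero_apply]; positivity)
      (square_inter_strip_subset Ω ε).eventuallyLE)
    refine setIntegral_congr_ae (measurableSet_square_inter_strip Ω ε) ?_
    have hd := (ae_restrict_iff' (measurableSet_strip ε)).1 (coeFn_stripDefect hw hC ε θ)
    filter_upwards [h, hd] with z h1 h2 hz
    rw [h1 hz.1, h2 hz.2, ← mul_sub, norm_mul, mul_pow]

lemma exists_extension_of_memLp (Ω : Sample) {g : ℝ → ℂ}
    (hg : MemLp g 2 (volume.restrict Ω.toSet)) : ∃ G : Lp ℂ 2 (volume : Measure ℝ),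
      (∀ᵐ x, x ∈ Ω.toSet → G x = g x) ∧ ∀ᵐ x, x ∉ Ω.toSet → G x = 0 := by
  have h := (memLp_indicator_iff_restrict (measurableSet_toSet Ω)).2 hg
  refine ⟨h.toLp _, ?_, ?_⟩ <;> filter_upwards [h.coeFn_toLp] with x hx hx2
  · rw [hx, Set.indicator_of_mem hx2]
  · rw [hx, Set.indicator_of_notMem hx2]

/-- Only the side `y > x` of the diagonal is certain to lie in the quadrant when `x > 0`, which is
why the factor is `ε` and not `2 ε`. -/
lemma le_lintegral_square_inter_strip (Ω : Sample) {F : ℝ → ℝ≥0∞} (hF : Measurable F) (ε : ℝ) :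
    ENNReal.ofReal ε * ∫⁻ x in Ω.toSet, F x ≤
      ∫⁻ z in {z : Plane | z ∈ Ω.square ∧ |z 0 - z 1| < ε}, F (z 0) := by
  have hm : Measurable fun z : Plane => F (z 0) :=
    hF.comp (by fun_prop : Measurable fun z : Plane => z 0)
  have hQ := measurableSet_square_inter_strip Ω ε
  rw [← lintegral_indicator hQ, lintegral_plane_diff (hm.indicator hQ),
    ← lintegral_const_mul _ hF, ← lintegral_indicator (measurableSet_toSet Ω)]
  refine lintegral_mono fun x => ?_
  by_cases hx : x ∈ Ω.toSet
  · rw [Set.indicator_of_mem hx]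
    have e : ENNReal.ofReal ε * F x = ∫⁻ t, (Set.Ioo 0 ε).indicator (fun _ => F x) t := by
      rw [lintegral_indicator measurableSet_Ioo, setLIntegral_const, Real.volume_Ioo, sub_zero,
        mul_comm]
    rw [e]
    refine lintegral_mono fun t => ?_
    by_cases ht : t ∈ Set.Ioo 0 ε
    · rw [Set.indicator_of_mem ht, Set.indicator_of_mem]
      · simp
      · refine ⟨⟨hx, ?_⟩, ?_⟩
        · cases Ω
          · trivial
          · exact add_pos hx ht.1
        · simp only [pt_zero, pt_one, sub_add_cancel_left, abs_neg]
          rw [abs_of_pos ht.1]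
          exact ht.2
    · rw [Set.indicator_of_notMem ht]; exact zero_le
  · rw [Set.indicator_of_notMem hx]; exact zero_le

/-- Uniqueness of traces on the diagonal. -/
lemma ae_eq_of_isDiagonalTrace (Ω : Sample) {ψ : Ω.pairSpace} {f g : ℝ → ℂ}
    (hf : Ω.IsDiagonalTrace ψ f) (hg : Ω.IsDiagonalTrace ψ g) :
    f =ᵐ[volume.restrict Ω.toSet] g := by
  obtain ⟨F, hF1, hF2⟩ := exists_extension_of_memLp Ω hf.1
  obtain ⟨G, hG1, hG2⟩ := exists_extension_of_memLp Ω hg.1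
  set Q : ℝ → Set Plane := fun ε => {z : Plane | z ∈ Ω.square ∧ |z 0 - z 1| < ε} with hQ
  have hQm : ∀ ε, MeasurableSet (Q ε) := measurableSet_square_inter_strip Ω
  have hcongr : ∀ {k : ℝ → ℂ} {K : Lp ℂ 2 (volume : Measure ℝ)} (_ : ∀ᵐ x, x ∈ Ω.toSet → K x = k x)
      (ε : ℝ), ∫ z in Q ε, ‖(ψ : L2Plane) z - k (z 0)‖ ^ 2 =
        ∫ z in Q ε, ‖(ψ : L2Plane) z - K (z 0)‖ ^ 2 := by
    intro k K hK ε
    refine setIntegral_congr_ae (hQm ε) ?_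
    filter_upwards [quasiMeasurePreserving_fst_coord.ae hK] with z hz hzQ
    rw [hz hzQ.1.1]
  have hmem : ∀ (K : Lp ℂ 2 (volume : Measure ℝ)) (ε : ℝ),
      MemLp (fun z : Plane => (ψ : L2Plane) z - K (z 0)) 2 (volume.restrict (Q ε)) := fun K ε =>
    ((Lp.memLp (ψ : L2Plane)).restrict _).sub ((memLp_stripPull ε K).mono_measure
      (Measure.restrict_mono (square_inter_strip_subset Ω ε) le_rfl))
  have hsub := Lp.coeFn_sub F G
  -- Compare both traces with `ψ` on the strip: `‖F - G‖² ≤ 2‖ψ - F‖² + 2‖ψ - G‖²` pointwise, while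
  -- the left side integrates to at least `ε` times its norm on the line.
  have hbound : ∀ ε : ℝ, 0 < ε → ‖F - G‖ ^ 2 ≤
      4 * ((1 / (2 * ε)) * ∫ z in Q ε, ‖(ψ : L2Plane) z - f (z 0)‖ ^ 2) +
        4 * ((1 / (2 * ε)) * ∫ z in Q ε, ‖(ψ : L2Plane) z - g (z 0)‖ ^ 2) := by
    intro ε hε
    rw [hcongr hF1, hcongr hG1]
    have h1 := le_lintegral_square_inter_strip Ω
      ((Lp.stronglyMeasurable (F - G)).measurable.enorm.pow_const 2) ε
    have h2 : ∫⁻ x in Ω.toSet, ‖(F - G) x‖ₑ ^ 2 = ‖F - G‖ₑ ^ 2 := by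
      rw [enorm_sq_eq_lintegral, ← lintegral_indicator (measurableSet_toSet Ω)]
      refine lintegral_congr_ae ?_
      filter_upwards [hsub, hF2, hG2] with x h hf hg
      by_cases hx : x ∈ Ω.toSet
      · rw [Set.indicator_of_mem hx]
      · rw [Set.indicator_of_notMem hx, h, Pi.sub_apply, hf hx, hg hx]; simp
    have hd : MemLp (fun z : Plane => (F - G) (z 0)) 2 (volume.restrict (Q ε)) :=
      (memLp_stripPull ε (F - G)).mono_measure
        (Measure.restrict_mono (square_inter_strip_subset Ω ε) le_rfl)
    rw [h2, ← ofReal_integral_norm_sq hd, ← ofReal_norm, ← ENNReal.ofReal_pow (norm_nonneg _),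
      ← ENNReal.ofReal_mul hε.le, ENNReal.ofReal_le_ofReal_iff
        (integral_nonneg fun z => by positivity)] at h1
    have i1 := (integrable_norm_sq (hmem F ε)).const_mul 2
    have i2 := (integrable_norm_sq (hmem G ε)).const_mul 2
    have h3 : ∫ z in Q ε, ‖(F - G) (z 0)‖ ^ 2 ≤
        ∫ z in Q ε, (2 * ‖(ψ : L2Plane) z - F (z 0)‖ ^ 2 + 2 * ‖(ψ : L2Plane) z - G (z 0)‖ ^ 2) := by
      refine integral_mono_ae (integrable_norm_sq hd) (i1.add i2) (ae_restrict_of_ae ?_)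
      filter_upwards [quasiMeasurePreserving_fst_coord.ae hsub] with z hz
      rw [hz, Pi.sub_apply]
      have h4 : F (z 0) - G (z 0) = ((ψ : L2Plane) z - G (z 0)) - ((ψ : L2Plane) z - F (z 0)) := by
        ring
      rw [h4]
      have h5 := pow_le_pow_left₀ (norm_nonneg _)
        (norm_sub_le ((ψ : L2Plane) z - G (z 0)) ((ψ : L2Plane) z - F (z 0))) 2
      nlinarith [sq_nonneg (‖(ψ : L2Plane) z - G (z 0)‖ - ‖(ψ : L2Plane) z - F (z 0)‖)]
    rw [integral_add i1 i2, integral_const_mul, integral_const_mul] at h3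
    have h6 := h1.trans h3
    rw [← mul_le_mul_iff_right₀ hε]
    refine h6.trans (le_of_eq ?_)
    field_simp
    ring
  have hlim := (hf.2.const_mul 4).add (hg.2.const_mul 4)
  simp only [mul_zero, add_zero] at hlim
  have h0 : ‖F - G‖ ^ 2 ≤ 0 := ge_of_tendsto hlim (by
    filter_upwards [self_mem_nhdsWithin] with ε hε using hbound ε hε)
  have hFG : F = G := by
    rw [← sub_eq_zero, ← norm_eq_zero]
    exact pow_eq_zero_iff two_ne_zero |>.1 (le_antisymm h0 (by positivity))
  subst hFG
  refine (ae_restrict_iff' (measurableSet_toSet Ω)).2 ?_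
  filter_upwards [hF1, hG1] with x h1 h2 hx
  rw [← h1 hx, h2 hx]

end Traces

/-! ### The pair amplitude and the infinitesimal bound for the trace. -/

section PairAmplitude

variable {τ ν : ℝ}

/-- A majorant of the form `h p + h q` has the same integral, twice that of `h`, on every fibre. -/
lemma isFiberBounded_of_le {a : Plane → ℝ} (ha : Continuous a) {h : ℝ → ℝ} (hi : Integrable h)
    (h0 : ∀ x, 0 ≤ h x) (hle : ∀ p q, a (pt p q) ^ 2 ≤ h p + h q) :
    IsFiberBounded (fun z => (a z : ℂ)) (2 * ∫ x, h x) := by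
  refine ⟨Complex.continuous_ofReal.comp ha, mul_nonneg two_pos.le (integral_nonneg h0),
    fun η => ?_⟩
  have hi' : Integrable fun q => h (η - q) := hi.comp_sub_left η
  have e : 2 * ∫ x, h x = ∫ q, (h (η - q) + h q) := by
    rw [integral_add hi' hi, integral_sub_left_eq_self, two_mul]
  have hs : Integrable fun q => h (η - q) + h q := hi'.add hi
  rw [e, ofReal_integral_eq_lintegral_ofReal hs
    (ae_of_all _ fun q => add_nonneg (h0 _) (h0 _))]
  refine lintegral_mono fun q => ?_
  rw [← ofReal_norm, Complex.norm_real, ← ENNReal.ofReal_pow (norm_nonneg _), Real.norm_eq_abs,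
    sq_abs]
  exact ENNReal.ofReal_le_ofReal (hle _ _)

/-- The inverse square root of the kinetic multiplier, in rescaled units. -/
def pairAmp (τ ν : ℝ) (z : Plane) : ℝ := √(kern τ ν (z 0) (z 1)) / (2 * Real.pi)

lemma pairAmp_sq (hτ : 0 < τ) (z : Plane) :
    pairAmp τ ν z ^ 2 = kern τ ν (z 0) (z 1) / (4 * Real.pi ^ 2) := by
  rw [pairAmp, div_pow, Real.sq_sqrt (kern_pos hτ _ _).le, mul_pow]; norm_num

lemma continuous_pairAmp (τ ν : ℝ) : Continuous (pairAmp τ ν) := by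
  have h : Continuous fun z : Plane => (z 0, z 1) := by fun_prop
  have h2 := (continuous_kern τ ν).comp h
  exact h2.sqrt.div_const _

lemma pairAmp_pos (hτ : 0 < τ) (z : Plane) : 0 < pairAmp τ ν z :=
  div_pos (Real.sqrt_pos.2 (kern_pos hτ _ _)) (by positivity)

lemma pairAmp_le (hτ : 0 < τ) (z : Plane) : pairAmp τ ν z ≤ √(1 / τ) / (2 * Real.pi) := by
  unfold pairAmp
  gcongr
  exact kern_le hτ _ _

lemma pairAmp_swap (z : Plane) : pairAmp τ ν (swap z) = pairAmp τ ν z := by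
  simp only [pairAmp, swap_zero, swap_one, kern_comm τ ν (z 1)]

lemma pairAmp_reflect_zero (z : Plane) : pairAmp τ ν (reflect 0 z) = pairAmp τ ν z := by
  simp only [pairAmp, reflect_zero_zero, reflect_zero_one, kern_neg_left]

lemma pairAmp_reflect_one (z : Plane) : pairAmp τ ν (reflect 1 z) = pairAmp τ ν z := by
  simp only [pairAmp, reflect_one_zero, reflect_one_one, kern_neg_right]

lemma pairAmp_sq_le (hτ : 0 < τ) (p q : ℝ) : pairAmp τ ν (pt p q) ^ 2 ≤
    gap τ ν p / (8 * Real.pi ^ 2) + gap τ ν q / (8 * Real.pi ^ 2) := by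
  rw [pairAmp_sq hτ, pt_zero, pt_one, ← add_div, div_le_div_iff₀ (by positivity) (by positivity)]
  have h := kern_le_half_add (ν := ν) hτ p q
  nlinarith [sq_nonneg Real.pi]

lemma isFiberBounded_pairAmp (hτ : 0 < τ) (hν : 0 ≤ ν) :
    IsFiberBounded (fun z => (pairAmp τ ν z : ℂ)) (gapInt τ ν / (4 * Real.pi ^ 2)) := by
  have h := isFiberBounded_of_le (continuous_pairAmp τ ν)
    ((integrable_gap hτ hν).div_const (8 * Real.pi ^ 2))
    (fun x => div_nonneg (gap_pos hτ x).le (by positivity)) (pairAmp_sq_le hτ)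
  have e : 2 * ∫ x, gap τ ν x / (8 * Real.pi ^ 2) = gapInt τ ν / (4 * Real.pi ^ 2) := by
    rw [integral_div, gapInt]; field_simp; ring
  rwa [e] at h

lemma norm_pairAmp_le (hτ : 0 < τ) (z : Plane) :
    ‖(pairAmp τ ν z : ℂ)‖ ≤ √(1 / τ) / (2 * Real.pi) := by
  rw [Complex.norm_real, Real.norm_of_nonneg (pairAmp_pos hτ z).le]
  exact pairAmp_le hτ z

/-- The truncation of the amplitude at large values. -/
def truncAmp (τ ν ε : ℝ) (z : Plane) : ℝ := ε * pairAmp τ ν z / (ε + pairAmp τ ν z ^ 2)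

lemma continuous_truncAmp {ε : ℝ} (hε : 0 < ε) : Continuous (truncAmp τ ν ε) := by
  have h := continuous_pairAmp τ ν
  exact (h.const_mul ε).div (by fun_prop) fun z => by positivity

lemma truncAmp_sq_le {ε : ℝ} (hε : 0 < ε) (z : Plane) :
    truncAmp τ ν ε z ^ 2 ≤ min (pairAmp τ ν z ^ 2) ε := by
  unfold truncAmp
  set a := pairAmp τ ν z
  rw [div_pow]
  refine le_min ?_ ?_
  · rw [div_le_iff₀ (by positivity), mul_pow, mul_comm]
    gcongr
    nlinarith [sq_nonneg a]
  · rw [div_le_iff₀ (by positivity)]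
    nlinarith [sq_nonneg a, mul_nonneg hε.le (sq_nonneg a), sq_nonneg (a ^ 2), mul_nonneg (mul_nonneg hε.le hε.le) (sq_nonneg a), pow_pos hε 3, mul_nonneg hε.le (sq_nonneg (a ^ 2))]

/-- `min (a + b) ε ≤ min a ε + min b ε` lets the truncation act separately on the two one-particle
majorants, so the fibre bound tends to zero with `ε` by dominated convergence. -/
lemma isFiberBounded_truncAmp (hτ : 0 < τ) (hν : 0 ≤ ν) {ε : ℝ} (hε : 0 < ε) :
    IsFiberBounded (fun z => (truncAmp τ ν ε z : ℂ))
      (2 * ∫ x, min (gap τ ν x / (8 * Real.pi ^ 2)) ε) := by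
  have hg : ∀ x, 0 ≤ gap τ ν x / (8 * Real.pi ^ 2) := fun x =>
    div_nonneg (gap_pos hτ x).le (by positivity)
  refine isFiberBounded_of_le (continuous_truncAmp hε) ?_ (fun x => le_min (hg x) hε.le)
    fun p q => ?_
  · refine ((integrable_gap hτ hν).div_const (8 * Real.pi ^ 2)).mono'
      (((continuous_gap τ ν).div_const _).min continuous_const).aestronglyMeasurable
      (ae_of_all _ fun x => ?_)
    rw [Real.norm_of_nonneg (le_min (hg x) hε.le)]
    exact min_le_left _ _
  · refine (truncAmp_sq_le hε _).trans ?_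
    refine (min_le_min_right ε (pairAmp_sq_le hτ p q)).trans ?_
    have h1 := hg p
    have h2 := hg q
    rcases min_cases (gap τ ν p / (8 * Real.pi ^ 2)) ε with ⟨a, _⟩ | ⟨a, _⟩ <;>
    rcases min_cases (gap τ ν q / (8 * Real.pi ^ 2)) ε with ⟨b, _⟩ | ⟨b, _⟩ <;>
    rw [a, b]
    · exact min_le_left _ _
    · exact (min_le_right _ _).trans (by linarith)
    · exact (min_le_right _ _).trans (by linarith)
    · exact (min_le_right _ _).trans (by linarith)

lemma tendsto_integral_min_gap (hτ : 0 < τ) (hν : 0 ≤ ν) :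
    Tendsto (fun ε => 2 * ∫ x, min (gap τ ν x / (8 * Real.pi ^ 2)) ε) (𝓝[>] 0) (𝓝 0) := by
  have hg : ∀ x, 0 ≤ gap τ ν x / (8 * Real.pi ^ 2) := fun x =>
    div_nonneg (gap_pos hτ x).le (by positivity)
  have h : Tendsto (fun ε => ∫ x, min (gap τ ν x / (8 * Real.pi ^ 2)) ε) (𝓝[>] 0)
      (𝓝 (∫ _ : ℝ, (0 : ℝ))) := by
    refine tendsto_integral_filter_of_dominated_convergence
      (fun x => gap τ ν x / (8 * Real.pi ^ 2)) ?_ ?_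
      ((integrable_gap hτ hν).div_const (8 * Real.pi ^ 2)) ?_
    · exact Eventually.of_forall fun ε =>
        (((continuous_gap τ ν).div_const _).min continuous_const).aestronglyMeasurable
    · filter_upwards [self_mem_nhdsWithin] with ε hε
      refine ae_of_all _ fun x => ?_
      rw [Real.norm_of_nonneg (le_min (hg x) (le_of_lt hε))]
      exact min_le_left _ _
    · refine ae_of_all _ fun x => ?_
      have h : Continuous fun ε : ℝ => min (gap τ ν x / (8 * Real.pi ^ 2)) ε := by fun_prop
      have h2 := h.tendsto 0
      rw [min_eq_right (hg x)] at h2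
      exact h2.mono_left nhdsWithin_le_nhds
  rw [integral_zero] at h
  simpa using h.const_mul 2

/-- The trace on the diagonal is infinitesimally small with respect to the kinetic form. -/
lemma exists_norm_diagTrace_sq_le (hτ : 0 < τ) (hν : 0 ≤ ν) {δ : ℝ} (hδ : 0 < δ) :
    ∃ K : ℝ, 0 ≤ K ∧ ∀ θ : L2Plane, ‖diagTrace (isFiberBounded_pairAmp hτ hν) θ‖ ^ 2 ≤
      δ * ‖θ‖ ^ 2 + K * ‖mulOp _ (isFiberBounded_pairAmp hτ hν).continuous _
        (norm_pairAmp_le hτ) θ‖ ^ 2 := by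
  have hw := isFiberBounded_pairAmp hτ hν
  obtain ⟨ε, hε1, hε⟩ := (((tendsto_integral_min_gap hτ hν).eventually
    (gt_mem_nhds (by positivity : (0 : ℝ) < δ / 2))).and self_mem_nhdsWithin).exists
  have hε : 0 < ε := hε
  have hw1 := isFiberBounded_truncAmp hτ hν hε
  set B1 := 2 * ∫ x, min (gap τ ν x / (8 * Real.pi ^ 2)) ε with hB1
  set B := gapInt τ ν / (4 * Real.pi ^ 2) with hB
  have hB0 : 0 ≤ B := hw.nonneg
  have ha := continuous_pairAmp τ ν
  set m : Plane → ℂ := fun z => ((pairAmp τ ν z / (ε + pairAmp τ ν z ^ 2) : ℝ) : ℂ) with hm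
  have hmc : Continuous m :=
    Complex.continuous_ofReal.comp (ha.div (by fun_prop) fun z => by positivity)
  have hmb : ∀ z, ‖m z‖ ≤ 1 / √ε := by
    intro z
    have hp := pairAmp_pos (ν := ν) hτ z
    rw [hm, Complex.norm_real, Real.norm_of_nonneg (by positivity),
      div_le_div_iff₀ (by positivity) (Real.sqrt_pos.2 hε)]
    have h1 := Real.sq_sqrt hε.le
    have h2 := Real.sqrt_pos.2 hε
    nlinarith [sq_nonneg (√ε - pairAmp τ ν z)]
  set M := mulOp _ hw.continuous _ (norm_pairAmp_le hτ) with hM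
  -- With `w` the amplitude, `w = ε w/(ε + w²) + w · (w/(ε + w²)) · w`. The first part has a small
  -- fibre bound; the second sees `θ` only through `w θ`, which is the transform of `ψ`.
  have hadj : ∀ θ, ContinuousLinearMap.adjoint (diagLift hw) θ =
      ContinuousLinearMap.adjoint (diagLift hw1) θ +
        ContinuousLinearMap.adjoint (diagLift hw) (mulOp m hmc _ hmb (M θ)) := by
    intro θ
    refine ext_inner_left ℂ fun g => ?_
    rw [inner_add_right, ContinuousLinearMap.adjoint_inner_right,
      ContinuousLinearMap.adjoint_inner_right, ContinuousLinearMap.adjoint_inner_right,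
      L2.inner_def, L2.inner_def, L2.inner_def,
      ← integral_add (L2.integrable_inner _ _) (L2.integrable_inner _ _)]
    refine integral_congr_ae ?_
    filter_upwards [coeFn_diagLift hw g, coeFn_diagLift hw1 g, coeFn_mulOp hmc hmb (M θ),
      coeFn_mulOp hw.continuous (norm_pairAmp_le hτ) θ] with z h1 h2 h3 h4
    rw [h1, h2, h3, h4]
    simp only [RCLike.inner_apply, map_mul, Complex.conj_ofReal, hm, truncAmp]
    have hne : (ε : ℂ) + (pairAmp τ ν z : ℂ) ^ 2 ≠ 0 := by
      have : (0 : ℝ) < ε + pairAmp τ ν z ^ 2 := by positivity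
      exact_mod_cast this.ne'
    push_cast
    field_simp
  refine ⟨2 * (B * (1 / √ε) ^ 2), by positivity, fun θ => ?_⟩
  have hn : ‖diagTrace hw θ‖ = ‖ContinuousLinearMap.adjoint (diagLift hw) θ‖ :=
    (Lp.fourierTransformₗᵢ ℝ ℂ).symm.norm_map _
  have h1 : ‖ContinuousLinearMap.adjoint (diagLift hw1) θ‖ ≤ √B1 * ‖θ‖ := by
    refine (ContinuousLinearMap.le_opNorm _ _).trans ?_
    rw [LinearIsometryEquiv.norm_map]
    gcongr
    exact norm_diagLift_le hw1
  have h2 : ‖ContinuousLinearMap.adjoint (diagLift hw) (mulOp m hmc _ hmb (M θ))‖ ≤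
      √B * (1 / √ε * ‖M θ‖) := by
    refine (ContinuousLinearMap.le_opNorm _ _).trans ?_
    rw [LinearIsometryEquiv.norm_map]
    gcongr
    · exact norm_diagLift_le hw
    · refine Lp.norm_le_mul_norm_of_ae_le_mul ?_
      filter_upwards [coeFn_mulOp hmc hmb (M θ)] with z hz
      rw [hz, norm_mul]
      gcongr
      exact hmb z
  rw [hn, hadj]
  have h3 := norm_add_le (ContinuousLinearMap.adjoint (diagLift hw1) θ)
    (ContinuousLinearMap.adjoint (diagLift hw) (mulOp m hmc _ hmb (M θ)))
  have h4 := h3.trans (add_le_add h1 h2)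
  have h5 := pow_le_pow_left₀ (norm_nonneg _) h4 2
  have e1 : (√B1 * ‖θ‖) ^ 2 = B1 * ‖θ‖ ^ 2 := by rw [mul_pow, Real.sq_sqrt hw1.nonneg]
  have e2 : (√B * (1 / √ε * ‖M θ‖)) ^ 2 = B * (1 / √ε) ^ 2 * ‖M θ‖ ^ 2 := by
    rw [mul_pow, mul_pow, Real.sq_sqrt hB0, mul_assoc]
  have h6 : B1 * ‖θ‖ ^ 2 ≤ δ / 2 * ‖θ‖ ^ 2 := by gcongr
  nlinarith [sq_nonneg (√B1 * ‖θ‖ - √B * (1 / √ε * ‖M θ‖))]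

end PairAmplitude

/-! ### The Hamiltonian in the spectral representation: kinetic form and trace. -/

section Reduction

variable {τ ν : ℝ}

/-- Multiplication by the pair amplitude. -/
def ampOp (hτ : 0 < τ) (ν : ℝ) : L2Plane →L[ℂ] L2Plane :=
  mulOp (fun z => (pairAmp τ ν z : ℂ)) (Complex.continuous_ofReal.comp (continuous_pairAmp τ ν))
    (√(1 / τ) / (2 * Real.pi)) (norm_pairAmp_le hτ)

lemma coeFn_ampOp (hτ : 0 < τ) (f : L2Plane) :
    ampOp hτ ν f =ᵐ[volume] fun z => (pairAmp τ ν z : ℂ) * f z :=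
  coeFn_mulOp _ _ f

lemma ampOp_mem (hτ : 0 < τ) {Ω : Sample} {f : L2Plane} (hf : f ∈ Ω.symmSpace) :
    ampOp hτ ν f ∈ Ω.symmSpace := by
  obtain ⟨h1, h2⟩ := (mem_symmSpace_iff_ae Ω f).1 hf
  have h := coeFn_ampOp (ν := ν) hτ f
  refine (mem_symmSpace_iff_ae Ω _).2 ⟨?_, fun hΩ => ⟨?_, ?_⟩⟩
  · filter_upwards [h, ae_swap h, h1] with z a b c
    rw [a, b, c, pairAmp_swap]
  · filter_upwards [h, ae_reflect 0 h, (h2 hΩ).1] with z a b c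
    rw [a, b, c, pairAmp_reflect_zero, mul_neg]
  · filter_upwards [h, ae_reflect 1 h, (h2 hΩ).2] with z a b c
    rw [a, b, c, pairAmp_reflect_one, mul_neg]

lemma ampOp_symm (hτ : 0 < τ) (f g : L2Plane) :
    inner ℂ (ampOp hτ ν f) g = inner ℂ f (ampOp hτ ν g) := by
  rw [L2.inner_def, L2.inner_def]
  refine integral_congr_ae ?_
  filter_upwards [coeFn_ampOp (ν := ν) hτ f, coeFn_ampOp (ν := ν) hτ g] with z h1 h2
  rw [h1, h2, RCLike.inner_apply, RCLike.inner_apply, map_mul, Complex.conj_ofReal]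
  ring

/-- Multiplication by the pair amplitude on the functions with the symmetries of the sample. -/
def Sample.ampMap (Ω : Sample) (hτ : 0 < τ) (ν : ℝ) : Ω.symmSpace →L[ℂ] Ω.symmSpace :=
  (ampOp hτ ν ∘L Ω.symmSpace.subtypeL).codRestrict _ fun f => ampOp_mem hτ f.2

lemma coe_ampMap (Ω : Sample) (hτ : 0 < τ) (f : Ω.symmSpace) :
    (Ω.ampMap hτ ν f : L2Plane) = ampOp hτ ν f := rfl

lemma ampMap_symm (Ω : Sample) (hτ : 0 < τ) (f g : Ω.symmSpace) :
    inner ℂ (Ω.ampMap hτ ν f) g = inner ℂ f (Ω.ampMap hτ ν g) :=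
  ampOp_symm hτ _ _

/-- The trace on the diagonal, as an operator on the functions with the symmetries of the
sample. -/
def Sample.traceMap (Ω : Sample) (hτ : 0 < τ) (hν : 0 ≤ ν) :
    Ω.symmSpace →L[ℂ] Lp ℂ 2 (volume : Measure ℝ) :=
  diagTrace (isFiberBounded_pairAmp hτ hν) ∘L Ω.symmSpace.subtypeL

lemma traceMap_apply (Ω : Sample) (hτ : 0 < τ) (hν : 0 ≤ ν) (f : Ω.symmSpace) :
    Ω.traceMap hτ hν f = diagTrace (isFiberBounded_pairAmp hτ hν) f := rfl

/-- The coupling operator. -/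
def Sample.couplingMap (Ω : Sample) (hτ : 0 < τ) (hν : 0 ≤ ν) (v : ℝ) :
    Ω.symmSpace →L[ℂ] Ω.symmSpace :=
  ((v * Ω.foldFactor : ℝ) : ℂ) •
    (ContinuousLinearMap.adjoint (Ω.traceMap hτ hν) ∘L Ω.traceMap hτ hν)

lemma inner_couplingMap (Ω : Sample) (hτ : 0 < τ) (hν : 0 ≤ ν) (v : ℝ) (f g : Ω.symmSpace) :
    inner ℂ f (Ω.couplingMap hτ hν v g) =
      ((v * Ω.foldFactor : ℝ) : ℂ) * inner ℂ (Ω.traceMap hτ hν f) (Ω.traceMap hτ hν g) := by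
  refine (inner_smul_right f (ContinuousLinearMap.adjoint (Ω.traceMap hτ hν)
    (Ω.traceMap hτ hν g)) _).trans ?_
  rw [ContinuousLinearMap.adjoint_inner_right]

lemma inner_couplingMap_left (Ω : Sample) (hτ : 0 < τ) (hν : 0 ≤ ν) (v : ℝ) (f g : Ω.symmSpace) :
    inner ℂ (Ω.couplingMap hτ hν v f) g =
      ((v * Ω.foldFactor : ℝ) : ℂ) * inner ℂ (Ω.traceMap hτ hν f) (Ω.traceMap hτ hν g) := by
  refine (inner_smul_left (ContinuousLinearMap.adjoint (Ω.traceMap hτ hν)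
    (Ω.traceMap hτ hν f)) g _).trans ?_
  rw [ContinuousLinearMap.adjoint_inner_left, Complex.conj_ofReal]

lemma re_inner_couplingMap (Ω : Sample) (hτ : 0 < τ) (hν : 0 ≤ ν) (v : ℝ) (f : Ω.symmSpace) :
    (inner ℂ (Ω.couplingMap hτ hν v f) f).re =
      v * Ω.foldFactor * ‖Ω.traceMap hτ hν f‖ ^ 2 := by
  have h : inner ℂ (Ω.traceMap hτ hν f) (Ω.traceMap hτ hν f) =
      ((‖Ω.traceMap hτ hν f‖ ^ 2 : ℝ) : ℂ) := by
    rw [inner_self_eq_norm_sq_to_K]; push_cast; rfl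
  rw [inner_couplingMap_left, h, ← Complex.ofReal_mul, Complex.ofReal_re]

/-- The substitution `p = 2π ξ` turns `T, μ` into `τ = T/(2π²)`, `ν = μ/(4π²)` and leaves the factor
`4π²` contained in `pairAmp`. -/
lemma ae_kineticMultiplier_mul (T μ : ℝ) (hT : 0 < T) : ∀ᵐ z : Plane,
    kineticMultiplier T μ z *
      pairAmp (T / (2 * Real.pi ^ 2)) (μ / (4 * Real.pi ^ 2)) z ^ 2 = 1 := by
  set τ := T / (2 * Real.pi ^ 2) with hτ
  set ν := μ / (4 * Real.pi ^ 2) with hν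
  have hτ0 : 0 < τ := by positivity
  have hpi := Real.pi_pos
  -- On the circle where numerator and denominator both vanish the symbol is a junk value; each of
  -- its vertical sections is finite, so it is null.
  have hne : ∀ᵐ z : Plane, z 0 ^ 2 + z 1 ^ 2 ≠ 2 * ν := by
    have hm : Measurable fun z : Plane => z 0 ^ 2 + z 1 ^ 2 := by fun_prop
    have hset : MeasurableSet {z : Plane | z 0 ^ 2 + z 1 ^ 2 = 2 * ν} := hm (measurableSet_singleton _)
    rw [ae_iff]
    simp only [ne_eq, not_not]
    rw [← lintegral_indicator_one hset, lintegral_plane_pt (measurable_one.indicator hset)]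
    have : ∀ p : ℝ, ∫⁻ q, {z : Plane | z 0 ^ 2 + z 1 ^ 2 = 2 * ν}.indicator 1 (pt p q) = (0 : ℝ≥0∞) := by
      intro p
      refine (lintegral_congr_ae ?_).trans lintegral_zero
      filter_upwards [ae_sq_ne (2 * ν - p ^ 2)] with q hq
      rw [Set.indicator_of_notMem]
      · intro h
        have h : p ^ 2 + q ^ 2 = 2 * ν := h
        exact hq (by linarith)
    simp [this]
  filter_upwards [hne] with z hz
  rw [pairAmp_sq hτ0, kineticMultiplier, kineticSymbol, kern]
  set a := z 0
  set b := z 1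
  have hA : ((2 * Real.pi * a) ^ 2 - μ) / (2 * T) = (a ^ 2 - ν) / τ := by
    rw [hτ, hν]; field_simp; ring
  have hB : ((2 * Real.pi * b) ^ 2 - μ) / (2 * T) = (b ^ 2 - ν) / τ := by
    rw [hτ, hν]; field_simp; ring
  rw [hA, hB, ← add_mul_pairWeight]
  have hw := pairWeight_pos ((a ^ 2 - ν) / τ) ((b ^ 2 - ν) / τ)
  have hne' : a ^ 2 + b ^ 2 - 2 * ν ≠ 0 := sub_ne_zero.2 hz
  have e1 : (2 * Real.pi * a) ^ 2 + (2 * Real.pi * b) ^ 2 - 2 * μ =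
      4 * Real.pi ^ 2 * (a ^ 2 + b ^ 2 - 2 * ν) := by rw [hν]; field_simp; ring
  have e2 : (a ^ 2 - ν) / τ + (b ^ 2 - ν) / τ = (a ^ 2 + b ^ 2 - 2 * ν) / τ := by ring
  rw [e1, e2]
  set s := a ^ 2 + b ^ 2 - 2 * ν
  field_simp

section Form

variable {T μ : ℝ}

/-- A finite kinetic energy says that the transform divided by the amplitude is square integrable;
the symmetries of the amplitude keep the quotient in the symmetric subspace. -/
lemma isInFormDomain_iff (Ω : Sample) (hT : 0 < T)
    (hτ : 0 < T / (2 * Real.pi ^ 2)) (ψ : Ω.pairSpace) :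
    Ω.IsInFormDomain T μ ψ ↔
      ∃ θ : Ω.symmSpace, Ω.unitary ψ = Ω.ampMap hτ (μ / (4 * Real.pi ^ 2)) θ := by
  set ν := μ / (4 * Real.pi ^ 2) with hν
  set τ := T / (2 * Real.pi ^ 2) with hτd
  have hK := ae_kineticMultiplier_mul T μ hT
  rw [← hτd, ← hν] at hK
  rw [Sample.IsInFormDomain, ← coe_unitary]
  constructor
  · intro h
    set f : L2Plane := ((Ω.unitary ψ : Ω.symmSpace) : L2Plane) with hf
    have hfm : f ∈ Ω.symmSpace := (Ω.unitary ψ).2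
    have hinv : Continuous fun z => ((pairAmp τ ν z)⁻¹ : ℝ) :=
      (continuous_pairAmp τ ν).inv₀ fun z => (pairAmp_pos hτ z).ne'
    have hm : AEStronglyMeasurable (fun z => (((pairAmp τ ν z)⁻¹ : ℝ) : ℂ) * f z) volume :=
      (Complex.continuous_ofReal.comp hinv).aestronglyMeasurable.mul (Lp.aestronglyMeasurable f)
    have hL : MemLp (fun z => (((pairAmp τ ν z)⁻¹ : ℝ) : ℂ) * f z) 2 volume := by
      refine (memLp_two_iff_integrable_sq_norm hm).2 (h.congr ?_)
      filter_upwards [hK] with z hz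
      have hp := pairAmp_pos (ν := ν) hτ z
      rw [norm_mul, Complex.norm_real, Real.norm_of_nonneg (by positivity), mul_pow, inv_pow,
        eq_inv_of_mul_eq_one_left hz]
    have hc := hL.coeFn_toLp
    have hmem : hL.toLp _ ∈ Ω.symmSpace := by
      obtain ⟨h1, h2⟩ := (mem_symmSpace_iff_ae Ω f).1 hfm
      refine (mem_symmSpace_iff_ae Ω _).2 ⟨?_, fun hΩ => ⟨?_, ?_⟩⟩
      · filter_upwards [hc, ae_swap hc, h1] with z a b c
        rw [a, b, c, pairAmp_swap]
      · filter_upwards [hc, ae_reflect 0 hc, (h2 hΩ).1] with z a b c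
        rw [a, b, c, pairAmp_reflect_zero, mul_neg]
      · filter_upwards [hc, ae_reflect 1 hc, (h2 hΩ).2] with z a b c
        rw [a, b, c, pairAmp_reflect_one, mul_neg]
    refine ⟨⟨_, hmem⟩, Subtype.ext (Lp.ext ?_)⟩
    rw [coe_ampMap, ← hf]
    filter_upwards [coeFn_ampOp (ν := ν) hτ (hL.toLp _), hc] with z h1 h2
    have hp := (pairAmp_pos (ν := ν) hτ z).ne'
    rw [h1, h2, ← mul_assoc, ← Complex.ofReal_mul, mul_inv_cancel₀ hp, Complex.ofReal_one, one_mul]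
  · rintro ⟨θ, hθ⟩
    rw [hθ, coe_ampMap]
    refine (integrable_norm_sq (Lp.memLp (θ : L2Plane))).congr ?_
    filter_upwards [coeFn_ampOp (ν := ν) hτ (θ : L2Plane), hK] with z h1 h2
    have hp := pairAmp_pos (ν := ν) hτ z
    rw [h1, norm_mul, Complex.norm_real, Real.norm_of_nonneg hp.le, mul_pow, ← mul_assoc, h2,
      one_mul]

lemma kineticForm_eq (Ω : Sample) (hT : 0 < T) (hτ : 0 < T / (2 * Real.pi ^ 2))
    {φ ψ : Ω.pairSpace} {χ θ : Ω.symmSpace}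
    (hφ : Ω.unitary φ = Ω.ampMap hτ (μ / (4 * Real.pi ^ 2)) χ)
    (hψ : Ω.unitary ψ = Ω.ampMap hτ (μ / (4 * Real.pi ^ 2)) θ) :
    Ω.kineticForm T μ φ ψ = inner ℂ χ θ := by
  rw [Sample.kineticForm, ← coe_unitary, ← coe_unitary, hφ, hψ, coe_ampMap, coe_ampMap]
  change _ = inner ℂ (χ : L2Plane) (θ : L2Plane)
  rw [L2.inner_def]
  refine integral_congr_ae ?_
  filter_upwards [coeFn_ampOp (ν := μ / (4 * Real.pi ^ 2)) hτ (χ : L2Plane),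
    coeFn_ampOp (ν := μ / (4 * Real.pi ^ 2)) hτ (θ : L2Plane),
    ae_kineticMultiplier_mul T μ hT] with z h1 h2 h3
  rw [h1, h2, RCLike.inner_apply, map_mul, Complex.conj_ofReal]
  have h3' := congrArg (fun x : ℝ => (x : ℂ)) h3
  simp only [Complex.ofReal_mul, Complex.ofReal_pow, Complex.ofReal_one] at h3'
  linear_combination (conj ((χ : L2Plane) z) * (θ : L2Plane) z) * h3'

/-- On the sample, `ψ` is `foldFactor` times its unfolding, so its trace is this multiple of the
trace on the whole plane. -/
lemma isDiagonalTrace_traceMap (Ω : Sample) (hτ : 0 < τ) (hν : 0 ≤ ν) {ψ : Ω.pairSpace}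
    {θ : Ω.symmSpace} (hψ : Ω.unitary ψ = Ω.ampMap hτ ν θ) :
    Ω.IsDiagonalTrace ψ fun x => Ω.foldFactor * Ω.traceMap hτ hν θ x := by
  refine isDiagonalTrace_diagTrace Ω (isFiberBounded_pairAmp hτ hν) (norm_pairAmp_le hτ)
    (fun z => Complex.conj_ofReal _) ?_
  have h : Ω.unfoldMap ψ = 𝓕⁻ (ampOp hτ ν θ) := by
    rw [← coe_ampMap, ← hψ, coe_unitary_eq_fourier, FourierTransform.fourierInv_fourier_eq]
  filter_upwards [eq_foldFactor_mul_unfoldMap Ω ψ] with z hz hzs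
  rw [hz hzs, h]
  rfl

end Form

end Reduction

/-! ### From the graph of the Hamiltonian to nonnegativity of the form. -/

section Hamiltonian

variable {τ ν : ℝ}

lemma ae_neg {p : ℝ → Prop} (h : ∀ᵐ x, p x) : ∀ᵐ x : ℝ, p (-x) :=
  (Measure.measurePreserving_neg (volume : Measure ℝ)).quasiMeasurePreserving.ae h

/-- The reflection `g ↦ g(-·)` on `L²(ℝ)`. -/
def reflectLine : Lp ℂ 2 (volume : Measure ℝ) →ₗᵢ[ℂ] Lp ℂ 2 (volume : Measure ℝ) :=
  compIso (LinearIsometryEquiv.neg ℝ)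

lemma coeFn_reflectLine (g : Lp ℂ 2 (volume : Measure ℝ)) :
    reflectLine g =ᵐ[volume] fun x => g (-x) :=
  coeFn_compIso (LinearIsometryEquiv.neg ℝ) g

lemma inner_reflectLine (f g : Lp ℂ 2 (volume : Measure ℝ)) :
    inner ℂ (reflectLine f) g = inner ℂ f (reflectLine g) := by
  rw [L2.inner_def, L2.inner_def, ← integral_neg_eq_self]
  refine integral_congr_ae ?_
  filter_upwards [ae_neg (coeFn_reflectLine f), coeFn_reflectLine g] with x h1 h2
  rw [h1, h2, neg_neg]

lemma inner_comp_reflect (i : Fin 2) (f g : L2Plane) :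
    inner ℂ (comp (reflect i) f) g = inner ℂ f (comp (reflect i) g) := by
  have h : comp (reflect i) (comp (reflect i) g) = g := comp_comp_self (reflect_reflect i) g
  conv_lhs => rw [← h]
  exact (Lp.compMeasurePreservingₗᵢ ℂ (⇑(reflect i)) (reflect i).measurePreserving).inner_map_map
    f (comp (reflect i) g)

lemma diagLift_reflectLine (hτ : 0 < τ) (hν : 0 ≤ ν) (g : Lp ℂ 2 (volume : Measure ℝ)) :
    diagLift (isFiberBounded_pairAmp hτ hν) (reflectLine g) =
      comp (reflect 0) (comp (reflect 1) (diagLift (isFiberBounded_pairAmp hτ hν) g)) := by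
  refine Lp.ext ?_
  have h := coeFn_diagLift (isFiberBounded_pairAmp hτ hν) g
  filter_upwards [coeFn_diagLift (isFiberBounded_pairAmp hτ hν) (reflectLine g),
    quasiMeasurePreserving_sum.ae (coeFn_reflectLine g),
    coeFn_comp (reflect 0) (comp (reflect 1) (diagLift (isFiberBounded_pairAmp hτ hν) g)),
    ae_reflect 0 (coeFn_comp (reflect 1) (diagLift (isFiberBounded_pairAmp hτ hν) g)),
    ae_reflect 0 (ae_reflect 1 h)] with z h1 h2 h3 h4 h5
  rw [h1, h2, h3, Function.comp_apply, h4, Function.comp_apply, h5]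
  simp only [pairAmp_reflect_zero, pairAmp_reflect_one, reflect_one_zero, reflect_one_one,
    reflect_zero_zero, reflect_zero_one]
  rw [neg_add]

/-- A function odd in each variable is even under reflection of both, and this joint reflection acts
on the diagonal as `x ↦ -x`. -/
lemma traceMap_halfLine_even (hτ : 0 < τ) (hν : 0 ≤ ν) (θ : Sample.halfLine.symmSpace) :
    ∀ᵐ x, Sample.halfLine.traceMap hτ hν θ (-x) = Sample.halfLine.traceMap hτ hν θ x := by
  have hθ := mem_symmSpace_halfLine.1 θ.2
  have h1 : reflectLine (ContinuousLinearMap.adjoint (diagLift (isFiberBounded_pairAmp hτ hν))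
      (θ : L2Plane)) =
      ContinuousLinearMap.adjoint (diagLift (isFiberBounded_pairAmp hτ hν)) (θ : L2Plane) := by
    refine ext_inner_left ℂ fun g => ?_
    rw [← inner_reflectLine, ContinuousLinearMap.adjoint_inner_right,
      ContinuousLinearMap.adjoint_inner_right, diagLift_reflectLine hτ hν, inner_comp_reflect,
      inner_comp_reflect, hθ.2.1, map_neg, hθ.2.2, neg_neg]
  have h2 : reflectLine (Sample.halfLine.traceMap hτ hν θ) =
      Sample.halfLine.traceMap hτ hν θ := by
    rw [traceMap_apply, diagTrace_apply]
    refine (fourierInv_compIso _ _).symm.trans ?_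
    exact congrArg _ h1
  filter_upwards [coeFn_reflectLine (Sample.halfLine.traceMap hτ hν θ)] with x hx
  rw [← hx, h2]

/-- On the half-line each trace carries the factor `2`, and evenness makes the integral over `(0,
∞)` half of the full one: `2 · 2 / 2 = 2`. -/
lemma integral_trace_mul_trace (Ω : Sample) (hτ : 0 < τ) (hν : 0 ≤ ν) (χ θ : Ω.symmSpace) :
    ∫ x in Ω.toSet, conj (Ω.foldFactor * Ω.traceMap hτ hν χ x) *
        (Ω.foldFactor * Ω.traceMap hτ hν θ x) =
      Ω.foldFactor * inner ℂ (Ω.traceMap hτ hν χ) (Ω.traceMap hτ hν θ) := by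
  rw [L2.inner_def]
  cases Ω
  · rw [Sample.toSet, Measure.restrict_univ]
    simp only [Sample.foldFactor, Complex.ofReal_one, one_mul, RCLike.inner_apply]
    refine integral_congr_ae (ae_of_all _ fun x => mul_comm _ _)
  · set f := Sample.halfLine.traceMap hτ hν χ with hf
    set g := Sample.halfLine.traceMap hτ hν θ with hg
    have hi : Integrable fun x => inner ℂ (f x) (g x) := L2.integrable_inner f g
    have hfe := traceMap_halfLine_even hτ hν χ
    have hge := traceMap_halfLine_even hτ hν θ
    have h1 : ∫ x in Set.Iic (0 : ℝ), inner ℂ (f x) (g x) =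
        ∫ x in Set.Ioi (0 : ℝ), inner ℂ (f x) (g x) := by
      have := integral_comp_neg_Ioi (0 : ℝ) fun x => inner ℂ (f x) (g x)
      rw [neg_zero] at this
      rw [← this]
      refine setIntegral_congr_ae measurableSet_Ioi ?_
      filter_upwards [hfe, hge] with x h1 h2 _
      rw [h1, h2]
    have h2 := integral_add_compl (measurableSet_Ioi (a := (0 : ℝ))) hi
    rw [Set.compl_Ioi, h1] at h2
    rw [← h2, ← two_mul]
    have h3 : ∀ x, conj ((Sample.halfLine.foldFactor : ℂ) * f x) *
        ((Sample.halfLine.foldFactor : ℂ) * g x) = 4 * inner ℂ (f x) (g x) := fun x => by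
      simp only [Sample.foldFactor, map_mul, Complex.conj_ofReal, RCLike.inner_apply]
      push_cast; ring
    simp_rw [h3]
    rw [integral_const_mul]
    simp only [Sample.foldFactor, Sample.toSet]
    push_cast; ring

variable {T μ : ℝ}

/-- The Hamiltonian in the spectral representation. -/
lemma isHamiltonian_iff_formRel (Ω : Sample) (hT : 0 < T) (hμ : 0 ≤ μ / (4 * Real.pi ^ 2))
    (hτ : 0 < T / (2 * Real.pi ^ 2)) (v : ℝ) (ψ η : Ω.pairSpace) :
    Ω.IsHamiltonian T μ v ψ η ↔
      FormRel (Ω.ampMap hτ (μ / (4 * Real.pi ^ 2))) (Ω.couplingMap hτ hμ v)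
        (Ω.unitary ψ) (Ω.unitary η) := by
  have hinner : ∀ (φ : Ω.pairSpace) (χ : Ω.symmSpace),
      Ω.unitary φ = Ω.ampMap hτ (μ / (4 * Real.pi ^ 2)) χ →
      inner ℂ φ η = inner ℂ χ (Ω.ampMap hτ (μ / (4 * Real.pi ^ 2)) (Ω.unitary η)) := by
    intro φ χ h
    rw [← ampMap_symm, ← h, LinearIsometryEquiv.inner_map_map]
  constructor
  · rintro ⟨hD, g, hg, h⟩
    obtain ⟨θ, hθ⟩ := (isInFormDomain_iff Ω hT hτ ψ).1 hD
    refine ⟨θ, hθ, ext_inner_left ℂ fun χ => ?_⟩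
    set φ := Ω.unitary.symm (Ω.ampMap hτ (μ / (4 * Real.pi ^ 2)) χ) with hφ
    have hφ' : Ω.unitary φ = Ω.ampMap hτ (μ / (4 * Real.pi ^ 2)) χ := by
      rw [hφ, LinearIsometryEquiv.apply_symm_apply]
    obtain ⟨f, hf, hfg⟩ := h φ ((isInFormDomain_iff Ω hT hτ φ).2 ⟨χ, hφ'⟩)
    rw [hinner φ χ hφ', kineticForm_eq Ω hT hτ hφ' hθ] at hfg
    rw [inner_sub_right, inner_couplingMap, ← hfg]
    -- The traces given by the definition of the graph are unspecified; uniqueness allows replacing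
    -- them by those of `traceMap`.
    have e : ∫ x in Ω.toSet, conj (f x) * g x =
        Ω.foldFactor * inner ℂ (Ω.traceMap hτ hμ χ) (Ω.traceMap hτ hμ θ) := by
      rw [← integral_trace_mul_trace]
      refine integral_congr_ae ?_
      filter_upwards [ae_eq_of_isDiagonalTrace Ω hf (isDiagonalTrace_traceMap Ω hτ hμ hφ'),
        ae_eq_of_isDiagonalTrace Ω hg (isDiagonalTrace_traceMap Ω hτ hμ hθ)] with x h1 h2
      rw [h1, h2]
    rw [e]
    push_cast; ring
  · rintro ⟨θ, hθ, h⟩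
    refine ⟨(isInFormDomain_iff Ω hT hτ ψ).2 ⟨θ, hθ⟩, _,
      isDiagonalTrace_traceMap Ω hτ hμ hθ, fun φ hφ => ?_⟩
    obtain ⟨χ, hχ⟩ := (isInFormDomain_iff Ω hT hτ φ).1 hφ
    refine ⟨_, isDiagonalTrace_traceMap Ω hτ hμ hχ, ?_⟩
    rw [hinner φ χ hχ, kineticForm_eq Ω hT hτ hχ hθ, ← h, inner_sub_right, inner_couplingMap,
      integral_trace_mul_trace]
    push_cast; ring

lemma zero_le_infSpectrum_iff (Ω : Sample) (T μ v : ℝ) :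
    0 ≤ Ω.infSpectrum T μ v ↔ ∀ l : ℝ, l < 0 → ∃ R : Ω.pairSpace →L[ℂ] Ω.pairSpace,
      ∀ ψ χ : Ω.pairSpace, Ω.IsHamiltonian T μ v ψ (χ + (l : ℂ) • ψ) ↔ ψ = R χ := by
  rw [Sample.infSpectrum, le_sInf_iff]
  constructor
  · intro h l hl
    by_contra hR
    exact absurd (h _ ⟨l, hR, rfl⟩) (not_le.2 (show (l : EReal) < 0 by exact_mod_cast hl))
  · rintro h _ ⟨l, hl, rfl⟩
    by_contra hl0
    have hl1 : (l : EReal) < 0 := not_le.1 hl0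
    exact hl (h l (by exact_mod_cast hl1))

/-- The relative bound `1/2` is reached for every coupling strength because the trace bound is
infinitesimal; this is the hypothesis of the abstract form criterion. -/
lemma formBound_couplingMap (Ω : Sample) (hτ : 0 < τ) (hν : 0 ≤ ν) {v : ℝ} (hv : 0 < v) :
    ∃ K : ℝ, 0 ≤ K ∧ ∀ θ : Ω.symmSpace, (inner ℂ (Ω.couplingMap hτ hν v θ) θ).re ≤
      1 / 2 * ‖θ‖ ^ 2 + K * ‖Ω.ampMap hτ ν θ‖ ^ 2 := by
  have hc : 0 < v * Ω.foldFactor := mul_pos hv Ω.foldFactor_pos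
  obtain ⟨K, hK, h⟩ := exists_norm_diagTrace_sq_le hτ hν
    (by positivity : 0 < 1 / 2 / (v * Ω.foldFactor))
  refine ⟨v * Ω.foldFactor * K, by positivity, fun θ => ?_⟩
  rw [re_inner_couplingMap]
  have h1 := mul_le_mul_of_nonneg_left (h (θ : L2Plane)) hc.le
  refine h1.trans (le_of_eq ?_)
  rw [mul_add, ← mul_assoc, mul_div_cancel₀ _ hc.ne', ← mul_assoc]
  rfl

/-- The resolvents of the Hamiltonian at negative energies exist if and only if the quadratic form
is nonnegative. -/
lemma mem_normalTemperatures_iff (Ω : Sample) (hT : 0 < T) (hμ : 0 ≤ μ / (4 * Real.pi ^ 2))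
    (hτ : 0 < T / (2 * Real.pi ^ 2)) {v : ℝ} (hv : 0 < v) :
    T ∈ Ω.normalTemperatures μ v ↔
      ∀ θ : Ω.symmSpace, v * Ω.foldFactor * ‖Ω.traceMap hτ hμ θ‖ ^ 2 ≤ ‖θ‖ ^ 2 := by
  obtain ⟨K, hK, hb⟩ := formBound_couplingMap Ω hτ hμ hv
  have key := forall_resolvent_iff_form_nonneg (ampMap_symm Ω hτ)
    (fun f g => by rw [inner_couplingMap, inner_couplingMap_left]) hK hb
  simp only [re_inner_couplingMap] at key
  rw [← key]
  change 0 < T ∧ 0 ≤ Ω.infSpectrum T μ v ↔ _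
  rw [and_iff_right hT, zero_le_infSpectrum_iff]
  refine forall₂_congr fun l _ => ⟨?_, ?_⟩
  · rintro ⟨R, hR⟩
    refine ⟨(Ω.unitary : Ω.pairSpace →L[ℂ] Ω.symmSpace) ∘L R ∘L
      (Ω.unitary.symm : Ω.symmSpace →L[ℂ] Ω.pairSpace), fun ψ χ => ?_⟩
    have h := hR (Ω.unitary.symm ψ) (Ω.unitary.symm χ)
    rw [isHamiltonian_iff_formRel Ω hT hμ hτ, map_add, map_smul,
      LinearIsometryEquiv.apply_symm_apply, LinearIsometryEquiv.apply_symm_apply] at h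
    rw [h]
    exact LinearIsometryEquiv.symm_apply_eq _
  · rintro ⟨R, hR⟩
    refine ⟨(Ω.unitary.symm : Ω.symmSpace →L[ℂ] Ω.pairSpace) ∘L R ∘L
      (Ω.unitary : Ω.pairSpace →L[ℂ] Ω.symmSpace), fun ψ χ => ?_⟩
    rw [isHamiltonian_iff_formRel Ω hT hμ hτ, map_add, map_smul, hR]
    exact LinearIsometryEquiv.eq_symm_apply _ |>.symm

end Hamiltonian

/-! ### Birman-Schwinger criteria for normal temperatures. -/

section Criteria

/-- An operator and its adjoint have equal norm; this transfers the inequality from the pair space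
to functions of the total momentum. -/
lemma norm_adjoint_sq_le {H K : Type*} [NormedAddCommGroup H] [InnerProductSpace ℂ H]
    [CompleteSpace H] [NormedAddCommGroup K] [InnerProductSpace ℂ K] [CompleteSpace K]
    (A : H →L[ℂ] K) {c : ℝ} (hc : 0 ≤ c) (h : ∀ x, c * ‖A x‖ ^ 2 ≤ ‖x‖ ^ 2) (y : K) :
    c * ‖ContinuousLinearMap.adjoint A y‖ ^ 2 ≤ ‖y‖ ^ 2 := by
  set x := ContinuousLinearMap.adjoint A y with hx
  have h1 : ‖x‖ ^ 2 ≤ ‖A x‖ * ‖y‖ := by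
    have e : inner ℂ x x = inner ℂ (A x) y := by
      conv_lhs => rw [hx, ContinuousLinearMap.adjoint_inner_right]
    have e2 := inner_self_eq_norm_sq_to_K (𝕜 := ℂ) x
    have e3 := norm_inner_le_norm (𝕜 := ℂ) (A x) y
    rw [← e, e2] at e3
    simpa using e3
  have h2 := h x
  rcases (sq_nonneg ‖x‖).eq_or_lt with h0 | h0
  · rw [← h0, mul_zero]; positivity
  · have h3 : c * (‖x‖ ^ 2) ^ 2 ≤ ‖x‖ ^ 2 * ‖y‖ ^ 2 := by
      calc c * (‖x‖ ^ 2) ^ 2 ≤ c * (‖A x‖ * ‖y‖) ^ 2 := by gcongr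
        _ = c * ‖A x‖ ^ 2 * ‖y‖ ^ 2 := by ring
        _ ≤ _ := by gcongr
    refine le_of_mul_le_mul_left ?_ h0
    linarith

/-- The adjoint of the inclusion is the orthogonal projection, so it is determined by inner products
with the subspace. -/
lemma norm_adjoint_subtypeL {Ω : Sample} {f f' : L2Plane} (hf' : f' ∈ Ω.symmSpace)
    (h : ∀ θ ∈ Ω.symmSpace, inner ℂ θ f = inner ℂ θ f') :
    ‖ContinuousLinearMap.adjoint Ω.symmSpace.subtypeL f‖ = ‖f'‖ := by
  have e : ContinuousLinearMap.adjoint Ω.symmSpace.subtypeL f = ⟨f', hf'⟩ := by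
    refine ext_inner_left ℂ fun θ => ?_
    rw [ContinuousLinearMap.adjoint_inner_right]
    exact h θ θ.2
  rw [e]; rfl

variable {T μ : ℝ}

lemma norm_traceMap (Ω : Sample) {τ ν : ℝ} (hτ : 0 < τ) (hν : 0 ≤ ν) (θ : Ω.symmSpace) :
    ‖Ω.traceMap hτ hν θ‖ = ‖(ContinuousLinearMap.adjoint
      (diagLift (isFiberBounded_pairAmp hτ hν)) ∘L Ω.symmSpace.subtypeL) θ‖ :=
  (Lp.fourierTransformₗᵢ ℝ ℂ).symm.norm_map _

/-- Birman-Schwinger: the trace operator is replaced by its adjoint, lift followed by projection,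
whose domain consists of functions of one variable. -/
lemma mem_normalTemperatures_iff_lift (Ω : Sample) (hT : 0 < T) (hμ : 0 ≤ μ / (4 * Real.pi ^ 2))
    (hτ : 0 < T / (2 * Real.pi ^ 2)) {v : ℝ} (hv : 0 < v) :
    T ∈ Ω.normalTemperatures μ v ↔ ∀ g : Lp ℂ 2 (volume : Measure ℝ),
      v * Ω.foldFactor * ‖ContinuousLinearMap.adjoint Ω.symmSpace.subtypeL
        (diagLift (isFiberBounded_pairAmp hτ hμ) g)‖ ^ 2 ≤ ‖g‖ ^ 2 := by
  rw [mem_normalTemperatures_iff Ω hT hμ hτ hv]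
  have hc : 0 ≤ v * Ω.foldFactor := (mul_pos hv Ω.foldFactor_pos).le
  simp only [norm_traceMap]
  set J := diagLift (isFiberBounded_pairAmp hτ hμ)
  have e : ContinuousLinearMap.adjoint (ContinuousLinearMap.adjoint J ∘L Ω.symmSpace.subtypeL) =
      ContinuousLinearMap.adjoint Ω.symmSpace.subtypeL ∘L J := by
    rw [ContinuousLinearMap.adjoint_comp, ContinuousLinearMap.adjoint_adjoint]
  constructor
  · intro h g
    have := norm_adjoint_sq_le _ hc h g
    rwa [e] at this
  · intro h θ
    have := norm_adjoint_sq_le (ContinuousLinearMap.adjoint Ω.symmSpace.subtypeL ∘L J) hc h θ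
    rwa [← e, ContinuousLinearMap.adjoint_adjoint] at this

variable {τ ν : ℝ}

lemma diagLift_mem_symmSpace_line (hτ : 0 < τ) (hν : 0 ≤ ν) (g : Lp ℂ 2 (volume : Measure ℝ)) :
    diagLift (isFiberBounded_pairAmp hτ hν) g ∈ Sample.line.symmSpace := by
  have h := coeFn_diagLift (isFiberBounded_pairAmp hτ hν) g
  refine (mem_symmSpace_iff_ae _ _).2 ⟨?_, by simp⟩
  filter_upwards [h, ae_swap h] with z h1 h2
  rw [h1, h2, pairAmp_swap, swap_zero, swap_one, add_comm]

lemma enorm_pairAmp_sq (hτ : 0 < τ) (z : Plane) :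
    ‖(pairAmp τ ν z : ℂ)‖ₑ ^ 2 = ENNReal.ofReal (kern τ ν (z 0) (z 1) / (4 * Real.pi ^ 2)) := by
  rw [← pairAmp_sq hτ, ← ofReal_norm, Complex.norm_real, ← ENNReal.ofReal_pow (norm_nonneg _),
    Real.norm_eq_abs, sq_abs]

lemma lintegral_fiber_pairAmp (hτ : 0 < τ) (hν : 0 ≤ ν) (η : ℝ) :
    ∫⁻ q, ‖(pairAmp τ ν (pt (η - q) q) : ℂ)‖ₑ ^ 2 =
      ENNReal.ofReal ((∫ y, jumpKernel τ ν η y) / (4 * Real.pi ^ 2)) := by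
  simp_rw [enorm_pairAmp_sq hτ, pt_zero, pt_one, kern_comm τ ν (η - _)]
  rw [integral_jumpKernel, ← integral_div, ofReal_integral_eq_lintegral_ofReal
    ((integrable_kern hτ hν η).div_const _)
    (ae_of_all _ fun q => div_nonneg (kern_pos hτ _ _).le (by positivity))]

/-- Indicators of short intervals around `η = 0`, where the row mass is continuous enough and
attains `gapInt`; the supremum is thus exactly the bulk constant. -/
lemma exists_lt_norm_diagLift_sq (hτ : 0 < τ) (hν : 0 ≤ ν) {c : ℝ} (hc0 : 0 ≤ c)
    (hc : c < gapInt τ ν) : ∃ g : Lp ℂ 2 (volume : Measure ℝ), g ≠ 0 ∧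
      c / (4 * Real.pi ^ 2) * ‖g‖ ^ 2 ≤ ‖diagLift (isFiberBounded_pairAmp hτ hν) g‖ ^ 2 := by
  obtain ⟨K, hK0, hK⟩ := exists_gapInt_sub_le hτ hν
  have hcont : Tendsto (fun r : ℝ => gapInt τ ν - K * r ^ 2) (𝓝[>] 0) (𝓝 (gapInt τ ν)) := by
    have h : Continuous fun r : ℝ => gapInt τ ν - K * r ^ 2 := by fun_prop
    have h2 := h.tendsto 0
    simp only [ne_eq, OfNat.ofNat_ne_zero, not_false_eq_true, zero_pow, mul_zero, sub_zero] at h2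
    exact h2.mono_left nhdsWithin_le_nhds
  obtain ⟨r, hr1, hr0, hr2⟩ := ((hcont.eventually (lt_mem_nhds hc)).and
    (Ioo_mem_nhdsGT one_pos)).exists
  have hm : MemLp ((Set.Icc (-r) r).indicator fun _ => (1 : ℂ)) 2 (volume : Measure ℝ) :=
    memLp_indicator_const 2 measurableSet_Icc 1 (Or.inr (by simp))
  have hg := hm.coeFn_toLp
  refine ⟨hm.toLp _, ?_, ?_⟩
  · intro h0
    have h1 := enorm_toLp_sq hm
    rw [h0] at h1
    have h2 : ∀ x : ℝ, ‖(Set.Icc (-r) r).indicator (fun _ => (1 : ℂ)) x‖ₑ ^ 2 =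
        (Set.Icc (-r) r).indicator (1 : ℝ → ℝ≥0∞) x := fun x => by
      by_cases hx : x ∈ Set.Icc (-r) r
      · rw [Set.indicator_of_mem hx, Set.indicator_of_mem hx]; simp
      · rw [Set.indicator_of_notMem hx, Set.indicator_of_notMem hx]; simp
    simp_rw [h2] at h1
    rw [lintegral_indicator_one measurableSet_Icc, Real.volume_Icc] at h1
    have : ENNReal.ofReal (r - -r) = 0 := by rw [← h1]; simp
    rw [ENNReal.ofReal_eq_zero] at this
    linarith
  · set g := hm.toLp _ with hgd
    suffices h : ENNReal.ofReal (c / (4 * Real.pi ^ 2)) * ‖g‖ₑ ^ 2 ≤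
        ‖diagLift (isFiberBounded_pairAmp hτ hν) g‖ₑ ^ 2 by
      rw [← ofReal_norm, ← ofReal_norm, ← ENNReal.ofReal_pow (norm_nonneg _),
        ← ENNReal.ofReal_pow (norm_nonneg _), ← ENNReal.ofReal_mul (by positivity)] at h
      exact (ENNReal.ofReal_le_ofReal_iff (by positivity)).1 h
    rw [enorm_sq_eq_lintegral, enorm_sq_eq_lintegral]
    have hgm : Measurable fun x => ‖g x‖ₑ ^ 2 :=
      (Lp.stronglyMeasurable g).measurable.enorm.pow_const 2
    have e : ∫⁻ z, ‖diagLift (isFiberBounded_pairAmp hτ hν) g z‖ₑ ^ 2 =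
        ∫⁻ η, ENNReal.ofReal ((∫ y, jumpKernel τ ν η y) / (4 * Real.pi ^ 2)) * ‖g η‖ₑ ^ 2 := by
      simp_rw [← lintegral_fiber_pairAmp hτ hν]
      rw [← lintegral_fiber (isFiberBounded_pairAmp hτ hν).continuous hgm]
      refine lintegral_congr_ae ?_
      filter_upwards [coeFn_diagLift (isFiberBounded_pairAmp hτ hν) g] with z hz
      rw [hz, enorm_mul, mul_pow]
    rw [e, ← lintegral_const_mul _ hgm]
    refine lintegral_mono_ae ?_
    filter_upwards [hg] with η hη
    by_cases hx : η ∈ Set.Icc (-r) r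
    · gcongr
      have h1 : |η| ≤ r := abs_le.2 hx
      have h2 := hK η (h1.trans hr2.le)
      have h3 : η ^ 2 ≤ r ^ 2 := sq_le_sq' (by linarith [hx.1]) hx.2
      nlinarith
    · rw [hη, Set.indicator_of_notMem hx]; simp

/-- The bulk system is normal if and only if the gap integral is at most the inverse coupling. -/
theorem mem_normalTemperatures_line_iff (hT : 0 < T) (hμ : 0 < μ) {v : ℝ} (hv : 0 < v) :
    T ∈ Sample.line.normalTemperatures μ v ↔
      v / (4 * Real.pi ^ 2) * gapInt (T / (2 * Real.pi ^ 2)) (μ / (4 * Real.pi ^ 2)) ≤ 1 := by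
  have hν : 0 ≤ μ / (4 * Real.pi ^ 2) := by positivity
  have hτ : 0 < T / (2 * Real.pi ^ 2) := by positivity
  rw [mem_normalTemperatures_iff_lift Sample.line hT hν hτ hv]
  set τ := T / (2 * Real.pi ^ 2)
  set ν := μ / (4 * Real.pi ^ 2)
  have hp : ∀ g, ‖ContinuousLinearMap.adjoint Sample.line.symmSpace.subtypeL
      (diagLift (isFiberBounded_pairAmp hτ hν) g)‖ =
        ‖diagLift (isFiberBounded_pairAmp hτ hν) g‖ := fun g =>
    norm_adjoint_subtypeL (diagLift_mem_symmSpace_line hτ hν g) fun _ _ => rfl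
  simp only [hp, Sample.foldFactor, mul_one]
  constructor
  · intro h
    by_contra! hlt
    have hpi : 0 < 4 * Real.pi ^ 2 := by positivity
    have h1 : 4 * Real.pi ^ 2 / v < gapInt τ ν := by
      rw [div_lt_iff₀ hv]
      rw [div_mul_eq_mul_div, lt_div_iff₀ hpi] at hlt
      linarith
    obtain ⟨c, hc1, hc2⟩ := exists_between h1
    have hc0 : 0 < c := lt_trans (by positivity) hc1
    obtain ⟨g, hg0, hg⟩ := exists_lt_norm_diagLift_sq hτ hν hc0.le hc2
    have h2 := h g
    have hg1 : 0 < ‖g‖ ^ 2 := by have := norm_pos_iff.2 hg0; positivity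
    have h3 : v * (c / (4 * Real.pi ^ 2)) ≤ 1 := by
      refine le_of_mul_le_mul_right ?_ hg1
      rw [one_mul, mul_assoc]
      exact (mul_le_mul_of_nonneg_left hg hv.le).trans h2
    rw [div_lt_iff₀ hv] at hc1
    rw [mul_div_assoc', div_le_one hpi] at h3
    linarith
  · intro h g
    calc v * ‖diagLift (isFiberBounded_pairAmp hτ hν) g‖ ^ 2
        ≤ v * (gapInt τ ν / (4 * Real.pi ^ 2) * ‖g‖ ^ 2) := by
          gcongr; exact norm_diagLift_sq_le _ g
      _ = v / (4 * Real.pi ^ 2) * gapInt τ ν * ‖g‖ ^ 2 := by ring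
      _ ≤ 1 * ‖g‖ ^ 2 := by gcongr
      _ = _ := one_mul _

lemma lintegral_comp_sub_two_mul {H : ℝ → ℝ≥0∞} (hH : Measurable H) (η : ℝ) :
    2 * ∫⁻ q, H (η - 2 * q) = ∫⁻ x, H x := by
  have hs : ∫⁻ x, H x = ∫⁻ x, H (η - x) := (lintegral_sub_left_eq_self H η).symm
  have hm : Measurable fun x => H (η - x) := hH.comp (by fun_prop)
  rw [hs]
  conv_rhs => rw [← Real.smul_map_volume_mul_left (two_ne_zero (α := ℝ))]
  rw [lintegral_smul_measure, lintegral_map hm (by fun_prop)]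
  simp

/-- The Jacobian of `(p, q) ↦ (p + q, p - q)` is two in absolute value. -/
lemma two_mul_lintegral_sum_diff {G : ℝ × ℝ → ℝ≥0∞} (hG : Measurable G) :
    2 * ∫⁻ z : Plane, G (z 0 + z 1, z 0 - z 1) = ∫⁻ η, ∫⁻ η', G (η, η') := by
  have hm : Measurable fun z : Plane => G (z 0 + z 1, z 0 - z 1) :=
    hG.comp (by fun_prop : Measurable fun z : Plane => (z 0 + z 1, z 0 - z 1))
  rw [lintegral_plane_sum hm, ← lintegral_const_mul' _ _ (by simp)]
  refine lintegral_congr fun η => ?_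
  have hη : Measurable fun η' => G (η, η') := hG.comp (by fun_prop)
  rw [← lintegral_comp_sub_two_mul hη η]
  congr 1
  refine lintegral_congr fun q => ?_
  simp only [pt_zero, pt_one, sub_add_cancel]
  congr 2
  ring

/-- The projected lift equals `½ pairAmp · (h(p+q) - h(p-q))` with `h` the even part of `g`, because
the amplitude is invariant under reflections. Its squared norm in the variables `p ± q` is a
Dirichlet form; the factor `2` on the left is `foldFactor`. -/
lemma two_mul_enorm_oddExtension_diagLift_sq (hτ : 0 < τ) (hν : 0 ≤ ν)
    (g : Lp ℂ 2 (volume : Measure ℝ)) :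
    2 * ‖(1 / 4 : ℂ) • oddExtension (diagLift (isFiberBounded_pairAmp hτ hν) g)‖ₑ ^ 2 =
      ENNReal.ofReal (1 / (4 * Real.pi ^ 2)) *
        jumpForm τ ν fun x => (g x + g (-x)) / 2 := by
  set f := diagLift (isFiberBounded_pairAmp hτ hν) g with hf
  set h : ℝ → ℂ := fun x => (g x + g (-x)) / 2 with hh
  have hgm : Measurable g := (Lp.stronglyMeasurable g).measurable
  have hhm : Measurable h := (hgm.add (hgm.comp measurable_neg)).div_const 2
  have hc := coeFn_diagLift (isFiberBounded_pairAmp hτ hν) g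
  set G : ℝ × ℝ → ℝ≥0∞ := fun y => ENNReal.ofReal (1 / (8 * Real.pi ^ 2)) *
    (ENNReal.ofReal (jumpKernel τ ν y.1 y.2) * ‖h y.1 - h y.2‖ₑ ^ 2) with hG
  have hGm0 : Measurable fun y : ℝ × ℝ =>
      ENNReal.ofReal (jumpKernel τ ν y.1 y.2) * ‖h y.1 - h y.2‖ₑ ^ 2 := by
    have h1 : Measurable fun y : ℝ × ℝ => ENNReal.ofReal (jumpKernel τ ν y.1 y.2) :=
      (continuous_jumpKernel τ ν).measurable.ennreal_ofReal
    have h2 : Measurable fun y : ℝ × ℝ => h y.1 - h y.2 :=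
      (hhm.comp measurable_fst).sub (hhm.comp measurable_snd)
    exact h1.mul (h2.enorm.pow_const 2)
  have hGm : Measurable G := hGm0.const_mul _
  have hpt : ∀ᵐ z, ‖((1 / 4 : ℂ) • oddExtension f : L2Plane) z‖ₑ ^ 2 =
      G (z 0 + z 1, z 0 - z 1) := by
    filter_upwards [Lp.coeFn_smul (1 / 4 : ℂ) (oddExtension f), coeFn_oddExtension f, hc,
      ae_reflect 0 hc, ae_reflect 1 hc, ae_reflect 1 (ae_reflect 0 hc)] with z h1 h2 h3 h4 h5 h6
    have e : (1 / 4 : ℂ) * (pairAmp τ ν z * g (z 0 + z 1) - pairAmp τ ν z * g (-z 0 + z 1) -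
        pairAmp τ ν z * g (z 0 + -z 1) + pairAmp τ ν z * g (-z 0 + -z 1)) =
        ((1 / 2 : ℝ) : ℂ) * (pairAmp τ ν z * (h (z 0 + z 1) - h (z 0 - z 1))) := by
      simp only [hh, neg_add, sub_eq_add_neg, neg_neg]
      push_cast; ring
    rw [h1, Pi.smul_apply, smul_eq_mul, h2, h3, h4, h5, h6]
    simp only [pairAmp_reflect_zero, pairAmp_reflect_one, reflect_one_zero, reflect_one_one,
      reflect_zero_zero, reflect_zero_one]
    rw [e, enorm_mul, enorm_mul, mul_pow, mul_pow, enorm_pairAmp_sq hτ, ← ofReal_norm,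
      Complex.norm_real, ← ENNReal.ofReal_pow (norm_nonneg _), ← mul_assoc,
      ← ENNReal.ofReal_mul (by positivity), hG]
    simp only
    rw [← mul_assoc, ← ENNReal.ofReal_mul (by positivity)]
    congr 2
    have e1 : (z 0 + z 1 + (z 0 - z 1)) / 2 = z 0 := by ring
    have e2 : (z 0 + z 1 - (z 0 - z 1)) / 2 = z 1 := by ring
    rw [jumpKernel, e1, e2, Real.norm_of_nonneg (by norm_num)]
    field_simp
    ring
  rw [enorm_sq_eq_lintegral, lintegral_congr_ae hpt, two_mul_lintegral_sum_diff hGm, jumpForm, hG]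
  simp only
  have hin : ∀ η, ∫⁻ η', ENNReal.ofReal (1 / (8 * Real.pi ^ 2)) *
      (ENNReal.ofReal (jumpKernel τ ν η η') * ‖h η - h η'‖ₑ ^ 2) =
      ENNReal.ofReal (1 / (8 * Real.pi ^ 2)) *
        ∫⁻ η', ENNReal.ofReal (jumpKernel τ ν η η') * ‖h η - h η'‖ₑ ^ 2 := fun η =>
    lintegral_const_mul' _ _ ENNReal.ofReal_ne_top
  simp_rw [hin]
  rw [lintegral_const_mul' _ _ ENNReal.ofReal_ne_top, ← mul_assoc]
  congr 1
  have e2 : (2⁻¹ : ℝ≥0∞) = ENNReal.ofReal (2⁻¹) := by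
    rw [ENNReal.ofReal_inv_of_pos two_pos]; simp
  rw [e2, ← ENNReal.ofReal_mul (by positivity)]
  congr 1
  field_simp
  norm_num

/-- The half-line system is normal if and only if the jump form is bounded by the inverse
coupling on even functions. -/
theorem mem_normalTemperatures_halfLine_iff (hT : 0 < T) (hμ : 0 < μ) {v : ℝ} (hv : 0 < v) :
    T ∈ Sample.halfLine.normalTemperatures μ v ↔ ∀ g : Lp ℂ 2 (volume : Measure ℝ),
      ENNReal.ofReal (v / (4 * Real.pi ^ 2)) *
        (jumpForm (T / (2 * Real.pi ^ 2)) (μ / (4 * Real.pi ^ 2)) fun x => (g x + g (-x)) / 2) ≤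
          ‖g‖ₑ ^ 2 := by
  have hν : 0 ≤ μ / (4 * Real.pi ^ 2) := by positivity
  have hτ : 0 < T / (2 * Real.pi ^ 2) := by positivity
  rw [mem_normalTemperatures_iff_lift Sample.halfLine hT hν hτ hv]
  refine forall_congr' fun g => ?_
  set τ := T / (2 * Real.pi ^ 2)
  set ν := μ / (4 * Real.pi ^ 2)
  set f := diagLift (isFiberBounded_pairAmp hτ hν) g with hf
  have hsw : comp swap f = f := diagLift_mem_symmSpace_line hτ hν g
  -- On exchange-symmetric functions the projection onto the doubly odd subspace is the signed
  -- average over four reflections, a quarter of `oddExtension`.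
  have hp : ‖ContinuousLinearMap.adjoint Sample.halfLine.symmSpace.subtypeL f‖ =
      ‖(1 / 4 : ℂ) • oddExtension f‖ := by
    refine norm_adjoint_subtypeL (Submodule.smul_mem _ _ (oddExtension_mem_symmSpace hsw))
      fun θ hθ => ?_
    obtain ⟨_, h0, h1⟩ := mem_symmSpace_halfLine.1 hθ
    have e : oddExtension f =
        f - comp (reflect 0) f - comp (reflect 1) f + comp (reflect 0) (comp (reflect 1) f) := rfl
    rw [e, inner_smul_right, inner_add_right, inner_sub_right, inner_sub_right,
      ← inner_comp_reflect, ← inner_comp_reflect, ← inner_comp_reflect, ← inner_comp_reflect,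
      h0, h1, map_neg, h1]
    simp only [inner_neg_left, neg_neg]
    ring
  rw [hp]
  have e1 : ENNReal.ofReal (v / (4 * Real.pi ^ 2)) = ENNReal.ofReal v *
      ENNReal.ofReal (1 / (4 * Real.pi ^ 2)) := by
    rw [← ENNReal.ofReal_mul hv.le, mul_one_div]
  have e2 : ENNReal.ofReal v * (2 * ‖(1 / 4 : ℂ) • oddExtension f‖ₑ ^ 2) =
      ENNReal.ofReal (v * 2 * ‖(1 / 4 : ℂ) • oddExtension f‖ ^ 2) := by
    rw [ENNReal.ofReal_mul (by positivity), ENNReal.ofReal_mul hv.le,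
      ENNReal.ofReal_pow (norm_nonneg _), ofReal_norm, mul_assoc]
    simp
  rw [e1, mul_assoc (ENNReal.ofReal v), ← two_mul_enorm_oddExtension_diagLift_sq hτ hν g, ← hf, e2, ← ofReal_norm,
    ← ENNReal.ofReal_pow (norm_nonneg _), ENNReal.ofReal_le_ofReal_iff (by positivity)]
  rfl

/-- The even part of `g` has no larger norm, so an estimate on all functions implies the criterion,
whose right side contains `g` itself. -/
lemma mem_normalTemperatures_halfLine_of_le (hT : 0 < T) (hμ : 0 < μ) {v : ℝ} (hv : 0 < v)
    (h : ∀ g : ℝ → ℂ, Measurable g → MemLp g 2 volume → ENNReal.ofReal (v / (4 * Real.pi ^ 2)) *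
      jumpForm (T / (2 * Real.pi ^ 2)) (μ / (4 * Real.pi ^ 2)) g ≤ ∫⁻ x, ‖g x‖ₑ ^ 2) :
    T ∈ Sample.halfLine.normalTemperatures μ v := by
  rw [mem_normalTemperatures_halfLine_iff hT hμ hv]
  intro g
  set k : Lp ℂ 2 (volume : Measure ℝ) := (1 / 2 : ℂ) • (g + reflectLine g) with hk
  have hc : k =ᵐ[volume] fun x => (g x + g (-x)) / 2 := by
    filter_upwards [Lp.coeFn_smul (1 / 2 : ℂ) (g + reflectLine g), Lp.coeFn_add g (reflectLine g),
      coeFn_reflectLine g] with x h1 h2 h3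
    rw [h1, Pi.smul_apply, h2, Pi.add_apply, h3, smul_eq_mul]; ring
  rw [← jumpForm_congr hc]
  refine (h k (Lp.stronglyMeasurable k).measurable (Lp.memLp k)).trans ?_
  rw [← enorm_sq_eq_lintegral]
  have hn : ‖k‖ ≤ ‖g‖ := by
    rw [hk, norm_smul]
    have := norm_add_le g (reflectLine g)
    rw [LinearIsometry.norm_map] at this
    norm_num
    linarith
  have : ‖k‖ₑ ≤ ‖g‖ₑ := enorm_le_iff_norm_le.2 hn
  gcongr

lemma le_of_mem_normalTemperatures_halfLine (hT : 0 < T) (hμ : 0 < μ) {v : ℝ} (hv : 0 < v)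
    (h : T ∈ Sample.halfLine.normalTemperatures μ v) {g : ℝ → ℂ} (hg : MemLp g 2 volume)
    (he : ∀ x, g (-x) = g x) : ENNReal.ofReal (v / (4 * Real.pi ^ 2)) *
      jumpForm (T / (2 * Real.pi ^ 2)) (μ / (4 * Real.pi ^ 2)) g ≤ ∫⁻ x, ‖g x‖ₑ ^ 2 := by
  have h1 := (mem_normalTemperatures_halfLine_iff hT hμ hv).1 h (hg.toLp g)
  rw [enorm_toLp_sq] at h1
  have hc : (fun x => (hg.toLp g x + hg.toLp g (-x)) / 2) =ᵐ[volume] g := by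
    filter_upwards [hg.coeFn_toLp, ae_neg hg.coeFn_toLp] with x h1 h2
    rw [h1, h2, he]; ring
  rwa [jumpForm_congr hc] at h1

end Criteria

/-! ### Gap equation, comparison of the critical temperatures, and their limits. -/

section CriticalTemperature

variable {μ v : ℝ}

lemma normalTemperatures_line_nonempty (hμ : 0 < μ) (hv : 0 < v) :
    (Sample.line.normalTemperatures μ v).Nonempty := by
  have hν : 0 ≤ μ / (4 * Real.pi ^ 2) := by positivity
  have hlim := (tendsto_gapInt_atTop hν).const_mul (v / (4 * Real.pi ^ 2))
  rw [mul_zero] at hlim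
  obtain ⟨τ, h1, hτ⟩ := ((hlim.eventually (gt_mem_nhds one_pos)).and (eventually_gt_atTop 0)).exists
  have e : τ * (2 * Real.pi ^ 2) / (2 * Real.pi ^ 2) = τ := by field_simp
  refine ⟨τ * (2 * Real.pi ^ 2), ?_⟩
  rw [mem_normalTemperatures_line_iff (by positivity) hμ hv, e]
  exact h1.le

lemma bddBelow_normalTemperatures (Ω : Sample) (μ v : ℝ) : BddBelow (Ω.normalTemperatures μ v) :=
  ⟨0, fun _ h => h.1.le⟩

/-- `gapInt` decreases in the temperature, so the normal temperatures of the bulk form an upper set.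
-/
lemma mem_line_of_gt_criticalTemperature (hμ : 0 < μ) (hv : 0 < v) {T : ℝ}
    (hT : Sample.line.criticalTemperature μ v < T) : T ∈ Sample.line.normalTemperatures μ v := by
  obtain ⟨T', hT', hlt⟩ := exists_lt_of_csInf_lt (normalTemperatures_line_nonempty hμ hv) hT
  have h0 := hT'.1
  have h1 := (mem_normalTemperatures_line_iff h0 hμ hv).1 hT'
  refine (mem_normalTemperatures_line_iff (h0.trans hlt) hμ hv).2 (le_trans ?_ h1)
  gcongr
  exact gapInt_anti (by positivity) (by positivity) (by gcongr)

lemma criticalTemperature_line_pos (hμ : 0 < μ) (hv : 0 < v) :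
    0 < Sample.line.criticalTemperature μ v := by
  have hν : 0 < μ / (4 * Real.pi ^ 2) := by positivity
  obtain ⟨τ, h1, hτ⟩ := (((tendsto_gapInt_nhdsGT_zero hν).eventually
    (eventually_gt_atTop (4 * Real.pi ^ 2 / v))).and self_mem_nhdsWithin).exists
  have hτ : 0 < τ := hτ
  refine lt_of_lt_of_le (by positivity : 0 < τ * (2 * Real.pi ^ 2)) ?_
  by_contra! hlt
  have h2 := (mem_normalTemperatures_line_iff (by positivity) hμ hv).1
    (mem_line_of_gt_criticalTemperature hμ hv hlt)
  have e : τ * (2 * Real.pi ^ 2) / (2 * Real.pi ^ 2) = τ := by field_simp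
  rw [e, div_mul_eq_mul_div, div_le_one (by positivity)] at h2
  rw [div_lt_iff₀ hv] at h1
  linarith

/-- The gap equation at the bulk critical temperature. -/
lemma gap_equation (hμ : 0 < μ) (hv : 0 < v) :
    v / (4 * Real.pi ^ 2) * gapInt (Sample.line.criticalTemperature μ v / (2 * Real.pi ^ 2))
      (μ / (4 * Real.pi ^ 2)) = 1 := by
  have hν : 0 ≤ μ / (4 * Real.pi ^ 2) := by positivity
  have hT := criticalTemperature_line_pos hμ hv
  set T := Sample.line.criticalTemperature μ v with hTdef
  set ν := μ / (4 * Real.pi ^ 2)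
  set c := v / (4 * Real.pi ^ 2) with hc
  have hc0 : 0 < c := by positivity
  set G := gapInt (T / (2 * Real.pi ^ 2)) ν with hG
  have hlim : Tendsto (fun x : ℝ => x) (𝓝 T) (𝓝 T) := tendsto_id
  -- Continuity of `gapInt` is replaced by monotonicity of temperature times `gapInt`: normal `S >
  -- T` give `T c G ≤ S`, non-normal `S < T` give `S ≤ T c G`, and both let `S → T`.
  have h1 : T * (c * G) ≤ T := by
    refine ge_of_tendsto (hlim.mono_left nhdsWithin_le_nhds : Tendsto _ (𝓝[>] T) _) ?_
    filter_upwards [self_mem_nhdsWithin] with S hS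
    have hS : T < S := hS
    have hS0 : 0 < S := hT.trans hS
    have h2 := (mem_normalTemperatures_line_iff hS0 hμ hv).1
      (mem_line_of_gt_criticalTemperature hμ hv hS)
    have h3 := mul_gapInt_le_mul_gapInt (τ := T / (2 * Real.pi ^ 2)) (τ' := S / (2 * Real.pi ^ 2))
      (by positivity) hν (by gcongr)
    rw [div_mul_eq_mul_div, div_mul_eq_mul_div, div_le_div_iff_of_pos_right (by positivity)] at h3
    calc T * (c * G) = c * (T * G) := by ring
      _ ≤ c * (S * gapInt (S / (2 * Real.pi ^ 2)) ν) := by gcongr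
      _ = S * (c * gapInt (S / (2 * Real.pi ^ 2)) ν) := by ring
      _ ≤ S * 1 := by gcongr
      _ = S := mul_one S
  have h2 : T ≤ T * (c * G) := by
    refine le_of_tendsto (hlim.mono_left nhdsWithin_le_nhds : Tendsto _ (𝓝[<] T) _) ?_
    filter_upwards [Ioo_mem_nhdsLT hT] with S hS
    have hS0 : 0 < S := hS.1
    have h2 : 1 < c * gapInt (S / (2 * Real.pi ^ 2)) ν := by
      by_contra! h
      have := csInf_le (bddBelow_normalTemperatures .line μ v)
        ((mem_normalTemperatures_line_iff hS0 hμ hv).2 h)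
      exact absurd hS.2 (not_lt.2 this)
    have h3 := mul_gapInt_le_mul_gapInt (τ := S / (2 * Real.pi ^ 2)) (τ' := T / (2 * Real.pi ^ 2))
      (by positivity) hν (by have := hS.2.le; gcongr)
    rw [div_mul_eq_mul_div, div_mul_eq_mul_div, div_le_div_iff_of_pos_right (by positivity)] at h3
    calc S = S * 1 := (mul_one S).symm
      _ ≤ S * (c * gapInt (S / (2 * Real.pi ^ 2)) ν) := by gcongr
      _ = c * (S * gapInt (S / (2 * Real.pi ^ 2)) ν) := by ring
      _ ≤ c * (T * G) := by gcongr
      _ = _ := by ring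
  have h3 : T * (c * G) = T * 1 := by rw [mul_one]; exact le_antisymm h1 h2
  exact mul_left_cancel₀ hT.ne' h3

/-- If the bulk is unstable, then `gapInt` exceeds the inverse coupling, and a concentrated even
trial function destabilizes the half-line as well. -/
lemma normalTemperatures_halfLine_subset (hμ : 0 < μ) (hv : 0 < v) :
    Sample.halfLine.normalTemperatures μ v ⊆ Sample.line.normalTemperatures μ v := by
  intro T hT
  have hT0 := hT.1
  refine (mem_normalTemperatures_line_iff hT0 hμ hv).2 ?_
  by_contra! hlt
  have hτ : 0 < T / (2 * Real.pi ^ 2) := by positivity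
  have h1 : 4 * Real.pi ^ 2 / v < gapInt (T / (2 * Real.pi ^ 2)) (μ / (4 * Real.pi ^ 2)) := by
    rw [div_lt_iff₀ hv]
    rw [div_mul_eq_mul_div, lt_div_iff₀ (by positivity)] at hlt
    linarith
  obtain ⟨g, _, hg, he, hlt⟩ := exists_even_lt_jumpForm hτ (by positivity) h1
  have h2 := le_of_mem_normalTemperatures_halfLine hT0 hμ hv hT hg he
  refine absurd h2 (not_le.2 ?_)
  have hv' : 0 < v / (4 * Real.pi ^ 2) := by positivity
  have h3 := ENNReal.mul_lt_mul_right (ENNReal.ofReal_pos.2 hv').ne' ENNReal.ofReal_ne_top hlt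
  refine lt_of_eq_of_lt ?_ h3
  rw [← mul_assoc, ← ENNReal.ofReal_mul hv'.le]
  have : v / (4 * Real.pi ^ 2) * (4 * Real.pi ^ 2 / v) = 1 := by field_simp
  rw [this]; simp

lemma mem_halfLine_of_jumpForm_le {T c : ℝ} (hT : 0 < T) (hμ : 0 < μ) (hv : 0 < v)
    (hc : v / (4 * Real.pi ^ 2) * c ≤ 1)
    (h : ∀ g : ℝ → ℂ, Measurable g → MemLp g 2 volume →
      jumpForm (T / (2 * Real.pi ^ 2)) (μ / (4 * Real.pi ^ 2)) g ≤
        ENNReal.ofReal c * ∫⁻ x, ‖g x‖ₑ ^ 2) :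
    T ∈ Sample.halfLine.normalTemperatures μ v := by
  refine mem_normalTemperatures_halfLine_of_le hT hμ hv fun g hgm hg => ?_
  have hv' : 0 < v / (4 * Real.pi ^ 2) := by positivity
  calc _ ≤ ENNReal.ofReal (v / (4 * Real.pi ^ 2)) *
        (ENNReal.ofReal c * ∫⁻ x, ‖g x‖ₑ ^ 2) := by gcongr; exact h g hgm hg
    _ = ENNReal.ofReal (v / (4 * Real.pi ^ 2) * c) * ∫⁻ x, ‖g x‖ₑ ^ 2 := by
        rw [← mul_assoc, ← ENNReal.ofReal_mul hv'.le]
    _ ≤ ENNReal.ofReal 1 * ∫⁻ x, ‖g x‖ₑ ^ 2 := by gcongr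
    _ = _ := by simp

/-- The crude bound by twice the gap integral suffices, since `gapInt` tends to zero at high
temperature. -/
lemma normalTemperatures_halfLine_nonempty (hμ : 0 < μ) (hv : 0 < v) :
    (Sample.halfLine.normalTemperatures μ v).Nonempty := by
  have hν : 0 ≤ μ / (4 * Real.pi ^ 2) := by positivity
  have hlim := (tendsto_gapInt_atTop hν).const_mul (v / (4 * Real.pi ^ 2) * 2)
  rw [mul_zero] at hlim
  obtain ⟨τ, h1, hτ⟩ := ((hlim.eventually (gt_mem_nhds one_pos)).and (eventually_gt_atTop 0)).exists
  have e : τ * (2 * Real.pi ^ 2) / (2 * Real.pi ^ 2) = τ := by field_simp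
  refine ⟨τ * (2 * Real.pi ^ 2), mem_halfLine_of_jumpForm_le (by positivity) hμ hv
    (c := 2 * gapInt τ (μ / (4 * Real.pi ^ 2))) (by linarith) fun g hgm _ => ?_⟩
  rw [e]
  exact jumpForm_le hτ hν hgm

lemma criticalTemperature_line_le_halfLine (hμ : 0 < μ) (hv : 0 < v) :
    Sample.line.criticalTemperature μ v ≤ Sample.halfLine.criticalTemperature μ v :=
  csInf_le_csInf (bddBelow_normalTemperatures _ _ _) (normalTemperatures_halfLine_nonempty hμ hv)
    (normalTemperatures_halfLine_subset hμ hv)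

/-- The bulk critical temperature tends to zero in the weak coupling limit. -/
lemma tendsto_criticalTemperature_line_zero (hμ : 0 < μ) :
    Tendsto (Sample.line.criticalTemperature μ) (𝓝[>] 0) (𝓝[>] 0) := by
  refine tendsto_nhdsWithin_iff.2 ⟨?_, ?_⟩
  · refine Metric.tendsto_nhds.2 fun T hT => ?_
    have hlim : Tendsto (fun v : ℝ => v / (4 * Real.pi ^ 2) *
        gapInt (T / 2 / (2 * Real.pi ^ 2)) (μ / (4 * Real.pi ^ 2))) (𝓝[>] 0) (𝓝 0) := by
      have h : Continuous fun v : ℝ => v / (4 * Real.pi ^ 2) *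
        gapInt (T / 2 / (2 * Real.pi ^ 2)) (μ / (4 * Real.pi ^ 2)) := by fun_prop
      have h2 := h.tendsto 0
      rw [zero_div, zero_mul] at h2
      exact h2.mono_left nhdsWithin_le_nhds
    filter_upwards [hlim.eventually (gt_mem_nhds one_pos), self_mem_nhdsWithin] with v h1 hv
    have hv : 0 < v := hv
    rw [Real.dist_0_eq_abs, abs_of_pos (criticalTemperature_line_pos hμ hv)]
    have h2 := csInf_le (bddBelow_normalTemperatures .line μ v)
      ((mem_normalTemperatures_line_iff (half_pos hT) hμ hv).2 h1.le)
    exact lt_of_le_of_lt h2 (half_lt_self hT)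
  · filter_upwards [self_mem_nhdsWithin] with v hv using criticalTemperature_line_pos hμ hv

/-- The bulk critical temperature tends to infinity in the strong coupling limit. -/
lemma tendsto_criticalTemperature_line_atTop (hμ : 0 < μ) :
    Tendsto (Sample.line.criticalTemperature μ) atTop atTop := by
  refine tendsto_atTop.2 fun b => ?_
  set T := max b 1 with hTd
  have hT : 0 < T := lt_of_lt_of_le one_pos (le_max_right _ _)
  have hG : 0 < gapInt (T / (2 * Real.pi ^ 2)) (μ / (4 * Real.pi ^ 2)) :=
    gapInt_pos (by positivity) (by positivity)
  set G := gapInt (T / (2 * Real.pi ^ 2)) (μ / (4 * Real.pi ^ 2))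
  filter_upwards [eventually_gt_atTop (4 * Real.pi ^ 2 / G)] with v hv
  have hv0 : 0 < v := lt_trans (by positivity) hv
  refine (le_max_left b 1).trans ?_
  by_contra! hlt
  have h2 := (mem_normalTemperatures_line_iff hT hμ hv0).1
    (mem_line_of_gt_criticalTemperature hμ hv0 hlt)
  rw [div_mul_eq_mul_div, div_le_one (by positivity)] at h2
  rw [div_lt_iff₀ hG] at hv
  linarith

/-- The shift is nonnegative, so its relative size vanishes as soon as every multiple `s > 1` of the
bulk critical temperature is eventually normal for the half-line. -/
lemma tendsto_relative_shift {l : Filter ℝ} (hl : ∀ᶠ v in l, 0 < v) (hμ : 0 < μ)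
    (h : ∀ s : ℝ, 1 < s → ∀ᶠ v in l, s * Sample.line.criticalTemperature μ v ∈
      Sample.halfLine.normalTemperatures μ v) :
    Tendsto (fun v : ℝ =>
        (Sample.halfLine.criticalTemperature μ v - Sample.line.criticalTemperature μ v) /
          Sample.line.criticalTemperature μ v) l (𝓝 0) := by
  refine Metric.tendsto_nhds.2 fun ε hε => ?_
  filter_upwards [hl, h (1 + ε / 2) (by linarith)] with v hv h1
  have hT := criticalTemperature_line_pos hμ hv
  have h2 := criticalTemperature_line_le_halfLine hμ hv
  have h3 := csInf_le (bddBelow_normalTemperatures .halfLine μ v) h1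
  change Sample.halfLine.criticalTemperature μ v ≤ _ at h3
  rw [Real.dist_0_eq_abs, abs_of_nonneg (div_nonneg (sub_nonneg.2 h2) hT.le), div_lt_iff₀ hT]
  nlinarith

theorem tendsto_relative_shift_weak (hμ : 0 < μ) :
    Tendsto (fun v : ℝ =>
        (Sample.halfLine.criticalTemperature μ v - Sample.line.criticalTemperature μ v) /
          Sample.line.criticalTemperature μ v) (𝓝[>] 0) (𝓝 0) := by
  refine tendsto_relative_shift self_mem_nhdsWithin hμ fun s hs => ?_
  obtain ⟨τ₀, hτ₀, h⟩ := exists_jumpForm_le_of_temperature_le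
    (by positivity : 0 < μ / (4 * Real.pi ^ 2)) hs
  filter_upwards [self_mem_nhdsWithin, (tendsto_criticalTemperature_line_zero hμ).eventually
    (Ioo_mem_nhdsGT (by positivity : 0 < τ₀ * (2 * Real.pi ^ 2)))] with v hv h1
  have hv : 0 < v := hv
  have hT := h1.1
  refine mem_halfLine_of_jumpForm_le (by positivity) hμ hv (gap_equation hμ hv).le fun g hgm _ => ?_
  rw [mul_div_assoc]
  exact h _ (by positivity) ((div_le_iff₀ (by positivity)).2 h1.2.le) g hgm

theorem tendsto_relative_shift_strong (hμ : 0 < μ) :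
    Tendsto (fun v : ℝ =>
        (Sample.halfLine.criticalTemperature μ v - Sample.line.criticalTemperature μ v) /
          Sample.line.criticalTemperature μ v) atTop (𝓝 0) := by
  refine tendsto_relative_shift (eventually_gt_atTop 0) hμ fun s hs => ?_
  have hs0 : 0 < s := one_pos.trans hs
  -- The high-temperature estimate compares `τ` with `s² τ`; it is applied with `√s`.
  have hr : 1 < √s := by rwa [Real.lt_sqrt zero_le_one, one_pow]
  filter_upwards [eventually_gt_atTop 0, (tendsto_criticalTemperature_line_atTop hμ).eventually
    (eventually_ge_atTop (4 * (μ / (4 * Real.pi ^ 2)) / Real.log (√s) * (2 * Real.pi ^ 2)))]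
    with v hv h1
  have hT := criticalTemperature_line_pos hμ hv
  refine mem_halfLine_of_jumpForm_le (by positivity) hμ hv (gap_equation hμ hv).le
    fun g hgm hg => ?_
  have h2 := jumpForm_le_of_le_temperature (by positivity) hr (by positivity :
    0 < Sample.line.criticalTemperature μ v / (2 * Real.pi ^ 2))
    ((le_div_iff₀ (by positivity)).2 h1) hgm hg
  rwa [Real.sq_sqrt hs0.le, ← mul_div_assoc] at h2

/-- A strict excess at the bulk critical temperature persists quantitatively: temperature times the
form is nondecreasing, so every normal temperature of the half-line is at least `T · c j / n`. Here
`c j / n > 1` is the excess ratio, and the infimum inherits the bound. -/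
lemma lt_criticalTemperature_halfLine (hμ : 0 < μ) (hv : 0 < v) {g : ℝ → ℂ} (hgm : Measurable g)
    (hg : MemLp g 2 volume) (he : ∀ x, g (-x) = g x)
    (h : ENNReal.ofReal (gapInt (Sample.line.criticalTemperature μ v / (2 * Real.pi ^ 2))
        (μ / (4 * Real.pi ^ 2))) * ∫⁻ x, ‖g x‖ₑ ^ 2 <
      jumpForm (Sample.line.criticalTemperature μ v / (2 * Real.pi ^ 2)) (μ / (4 * Real.pi ^ 2)) g) :
    Sample.line.criticalTemperature μ v < Sample.halfLine.criticalTemperature μ v := by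
  have hT := criticalTemperature_line_pos hμ hv
  have hgap := gap_equation hμ hv
  set T := Sample.line.criticalTemperature μ v with hTd
  set ν := μ / (4 * Real.pi ^ 2) with hν
  have hν0 : 0 < ν := by positivity
  set c := v / (4 * Real.pi ^ 2) with hc
  have hc0 : 0 < c := by positivity
  have hτ : 0 < T / (2 * Real.pi ^ 2) := by positivity
  set G := gapInt (T / (2 * Real.pi ^ 2)) ν with hG
  have hG0 : 0 < G := gapInt_pos hτ hν0.le
  have hN : ∫⁻ x, ‖g x‖ₑ ^ 2 < ⊤ := (memLp_two_iff.1 hg).2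
  set N := ∫⁻ x, ‖g x‖ₑ ^ 2 with hNd
  have hJle := jumpForm_le hτ hν0.le hgm
  have hJ : jumpForm (T / (2 * Real.pi ^ 2)) ν g < ⊤ :=
    hJle.trans_lt (ENNReal.mul_lt_top ENNReal.ofReal_lt_top hN)
  have hN0 : N ≠ 0 := by
    intro h0
    rw [← hNd, h0, mul_zero] at hJle
    rw [h0, mul_zero] at h
    exact absurd h (not_lt.2 hJle)
  set J := jumpForm (T / (2 * Real.pi ^ 2)) ν g with hJd
  obtain ⟨n, hn⟩ : ∃ n, n = N.toReal := ⟨_, rfl⟩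
  obtain ⟨j, hj⟩ : ∃ j, j = J.toReal := ⟨_, rfl⟩
  have hn0 : 0 < n := by rw [hn]; exact ENNReal.toReal_pos hN0 hN.ne
  have hNn : N = ENNReal.ofReal n := by rw [hn, ENNReal.ofReal_toReal hN.ne]
  have hJj : J = ENNReal.ofReal j := by rw [hj, ENNReal.ofReal_toReal hJ.ne]
  have hj0 : 0 ≤ j := by rw [hj]; exact ENNReal.toReal_nonneg
  rw [hNn, hJj, ← ENNReal.ofReal_mul hG0.le, ENNReal.ofReal_lt_ofReal_iff_of_nonneg
    (by positivity)] at h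
  have h1 : n < c * j := by
    calc n = c * G * n := by rw [hgap, one_mul]
      _ = c * (G * n) := by ring
      _ < c * j := by gcongr
  have h2 : T < T * (c * j / n) := by
    rw [lt_mul_iff_one_lt_right hT, one_lt_div hn0]; exact h1
  refine h2.trans_le (le_csInf (normalTemperatures_halfLine_nonempty hμ hv) fun S hS => ?_)
  have hTS : T ≤ S := csInf_le (bddBelow_normalTemperatures .line μ v)
    (normalTemperatures_halfLine_subset hμ hv hS)
  have hS0 := hS.1
  have h3 := mul_jumpForm_le (ν := ν) hτ (τ' := S / (2 * Real.pi ^ 2)) (by gcongr) g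
  have h4 := le_of_mem_normalTemperatures_halfLine hS0 hμ hv hS hg he
  rw [← hNd, hNn] at h4
  rw [← hJd, hJj] at h3
  have h5 : ENNReal.ofReal (c * (T / (2 * Real.pi ^ 2) * j)) ≤
      ENNReal.ofReal (S / (2 * Real.pi ^ 2) * n) := by
    calc _ = ENNReal.ofReal c * (ENNReal.ofReal (T / (2 * Real.pi ^ 2)) * ENNReal.ofReal j) := by
          rw [ENNReal.ofReal_mul hc0.le, ENNReal.ofReal_mul hτ.le]
      _ ≤ ENNReal.ofReal c * (ENNReal.ofReal (S / (2 * Real.pi ^ 2)) *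
          jumpForm (S / (2 * Real.pi ^ 2)) ν g) := by gcongr
      _ = ENNReal.ofReal (S / (2 * Real.pi ^ 2)) * (ENNReal.ofReal c *
          jumpForm (S / (2 * Real.pi ^ 2)) ν g) := by ring
      _ ≤ ENNReal.ofReal (S / (2 * Real.pi ^ 2)) * ENNReal.ofReal n := by gcongr
      _ = _ := by rw [ENNReal.ofReal_mul (by positivity)]
  rw [ENNReal.ofReal_le_ofReal_iff (by positivity)] at h5
  rw [mul_div_assoc', div_le_iff₀ hn0]
  have hpi : 0 < 2 * Real.pi ^ 2 := by positivity
  have e1 : c * (T / (2 * Real.pi ^ 2) * j) = T * (c * j) / (2 * Real.pi ^ 2) := by ring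
  have e2 : S / (2 * Real.pi ^ 2) * n = S * n / (2 * Real.pi ^ 2) := by ring
  rw [e1, e2, div_le_div_iff_of_pos_right hpi] at h5
  exact h5

theorem exists_forall_criticalTemperature_lt (hμ : 0 < μ) : ∃ v₀ : ℝ, 0 < v₀ ∧
    ∀ v : ℝ, 0 < v → v < v₀ →
      Sample.line.criticalTemperature μ v < Sample.halfLine.criticalTemperature μ v := by
  obtain ⟨τ₀, hτ₀, h⟩ := exists_even_gapInt_lt_jumpForm
    (by positivity : 0 < μ / (4 * Real.pi ^ 2))
  have hev := (tendsto_criticalTemperature_line_zero hμ).eventually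
    (Ioo_mem_nhdsGT (by positivity : 0 < τ₀ * (2 * Real.pi ^ 2)))
  obtain ⟨v₀, hv₀, hsub⟩ := mem_nhdsGT_iff_exists_Ioo_subset.1 hev
  refine ⟨v₀, hv₀, fun v hv hlt => ?_⟩
  have h1 := hsub ⟨hv, hlt⟩
  have hT : 0 < Sample.line.criticalTemperature μ v := h1.1
  obtain ⟨g, hgm, hg, he, hJ⟩ := h (Sample.line.criticalTemperature μ v / (2 * Real.pi ^ 2))
    (by positivity) ((div_le_iff₀ (by positivity)).2 h1.2.le)
  exact lt_criticalTemperature_halfLine hμ hv hgm hg he hJ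

end CriticalTemperature

end BCS

end

theorem theorem1 (μ : ℝ) (hμ : 0 < μ) :
    -- the critical temperatures are finite, and the bulk one is positive
    (∀ v : ℝ, 0 < v →
      (BCS.Sample.line.normalTemperatures μ v).Nonempty ∧
      (BCS.Sample.halfLine.normalTemperatures μ v).Nonempty ∧
      0 < BCS.Sample.line.criticalTemperature μ v) ∧
    -- (i)
    (∃ v₀ : ℝ, 0 < v₀ ∧ ∀ v : ℝ, 0 < v → v < v₀ →
      BCS.Sample.line.criticalTemperature μ v < BCS.Sample.halfLine.criticalTemperature μ v) ∧
    -- (ii)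
    Tendsto (fun v : ℝ =>
        (BCS.Sample.halfLine.criticalTemperature μ v - BCS.Sample.line.criticalTemperature μ v) /
          BCS.Sample.line.criticalTemperature μ v)
      (𝓝[>] 0) (𝓝 0) ∧
    -- (iii)
    Tendsto (fun v : ℝ =>
        (BCS.Sample.halfLine.criticalTemperature μ v - BCS.Sample.line.criticalTemperature μ v) /
          BCS.Sample.line.criticalTemperature μ v)
      atTop (𝓝 0) := by
  refine ⟨fun v hv => ⟨BCS.normalTemperatures_line_nonempty hμ hv,
    BCS.normalTemperatures_halfLine_nonempty hμ hv, BCS.criticalTemperature_line_pos hμ hv⟩,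
    BCS.exists_forall_criticalTemperature_lt hμ, BCS.tendsto_relative_shift_weak hμ,
    BCS.tendsto_relative_shift_strong hμ⟩
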